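/- **Online Generalized Scheduling.** There are $m$ machines and $n$ jobs, and each job can be scheduled on each machine in at most $r$ ways ($m,n,r\ge 1$). Given in advance are $m,n,r$, a monotone norm $\|\cdot\|_i$ on $\mathbb{R}^{nr}$ for every machine $i\in[m]$, and a monotone aggregation function $f:\mathbb{R}_{\ge 0}^m\to\mathbb{R}_{\ge 0}$ (monotone means nondecreasing on the nonnegative orthant). The jobs arrive one at a time. When job $j$ arrives, the loads $p_{ijk}\in[0,\infty]$ for all $i\in[m]$, $k\in[r]$ are revealed, where $p_{ijk}=\infty$ means that $j$ cannot be scheduled on machine $i$ in way $k$, and the algorithm must immediately and irrevocably schedule $j$ on exactly one machine in exactly one way. With $x_{ijk}\in\{0,1\}$ indicating whether $j$ is scheduled on $i$ in way $k$, the goal is to minimize $f(\Lambda(x))$, where $\Lambda_i(x)=\|(x_{ijk}p_{ijk})_{j,k}\|_i$ (the cost is $\infty$ if some job is scheduled in an unavailable way). A randomized online algorithm is $c$-competitive if on every fixed instance its expected cost is at most $c$ times the minimum cost over all offline allocations. **Theorem.** There is an absolute constant $C>0$ such that the following holds for all $m,n,r,L\ge 1$. Let $S_1,\dots,S_L\subseteq[m]$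 be pairwise disjoint, let $\|\cdot\|'$ be a norm on $\mathbb{R}^L$ and $\|\cdot\|'_\ell$ a norm on $\mathbb{R}^{S_\ell}$ for every $\ell\in[L]$, and let the aggregation function be $$f(y)=\big\|\big(\|y_{S_1}\|'_1,\dots,\|y_{S_L}\|'_L\big)\big\|',$$ assumed monotone on $\mathbb{R}^m_{\ge 0}$, where $y_S$ is the restriction of $y$ to the coordinates in $S$. Suppose that all norms involved ($\|\cdot\|'$, every $\|\cdot\|'_\ell$, and every monotone machine norm $\|\cdot\|_i$) are symmetric, i.e. invariant under permutations of the coordinates. Then there is a randomized online algorithm for Online Generalized Scheduling with aggregation function $f$ and machine norms $\|\cdot\|_1,\dots,\|\cdot\|_m$ that is $$C\,(1+\log m)^2\,(1+\log L)^2\,(1+\log n)\text{-competitive}.$$ In particular, for $m,L,n\ge 2$ it is $O(\log^2 m\cdot\log^2 L\cdot\log n)$-competitive. -/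

import Mathlib

open scoped ENNReal

namespace GenSched

/-- A symmetric norm on `ℝ^ι`: a seminorm that vanishes only at `0` and is invariant under
permutations of the coordinates. -/
structure IsSymmetricNorm {ι : Type*} (N : Seminorm ℝ (ι → ℝ)) : Prop where
  definite : ∀ x, N x = 0 → x = 0
  symmetric : ∀ (σ : Equiv.Perm ι) (x : ι → ℝ), N (x ∘ σ) = N x

/-- The nested norm `‖y‖ = ‖(‖y_{S_1}‖'_1, …, ‖y_{S_L}‖'_L)‖'`. -/
def nestedNorm {m L : ℕ} (S : Fin L → Finset (Fin m)) (outer : Seminorm ℝ (Fin L → ℝ))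
    (inner : (ℓ : Fin L) → Seminorm ℝ (S ℓ → ℝ)) (y : Fin m → ℝ) : ℝ :=
  outer fun ℓ => inner ℓ fun i => y i

/-- What a job reveals on arrival: the load `p i k` it incurs on machine `i` when it is scheduled
in way `k`. The value `∞` means that this way of scheduling is not available. -/
abbrev Job (m r : ℕ) : Type := Fin m → Fin r → ℝ≥0∞

/-- An input: the sequence of the `n` jobs in the order of their arrival. -/
abbrev Instance (m n r : ℕ) : Type := Fin n → Job m r

/-- An allocation of all jobs: each job goes to exactly one machine, in exactly one way. -/
abbrev Allocation (m n r : ℕ) : Type := Fin n → Fin m × Fin r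

/-- The load `Λ_i(x) = ‖(x_{ijk} p_{ijk})_{jk}‖_i` of machine `i`. -/
noncomputable def load {m n r : ℕ} (N : Fin m → Seminorm ℝ (Fin n × Fin r → ℝ))
    (p : Instance m n r) (x : Allocation m n r) (i : Fin m) : ℝ :=
  N i fun jk => if x jk.1 = (i, jk.2) then (p jk.1 i jk.2).toReal else 0

open Classical in
/-- The cost `f(Λ(x))` of an allocation; it is `∞` if some job is scheduled in an unavailable
way. -/
noncomputable def cost {m n r : ℕ} (f : (Fin m → ℝ) → ℝ)
    (N : Fin m → Seminorm ℝ (Fin n × Fin r → ℝ)) (p : Instance m n r)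
    (x : Allocation m n r) : ℝ≥0∞ :=
  if ∀ j, p j (x j).1 (x j).2 ≠ ∞ then ENNReal.ofReal (f (load N p x)) else ∞

/-- The offline optimum (`∞` if there is no feasible allocation). -/
noncomputable def opt {m n r : ℕ} (f : (Fin m → ℝ) → ℝ)
    (N : Fin m → Seminorm ℝ (Fin n × Fin r → ℝ)) (p : Instance m n r) : ℝ≥0∞ :=
  ⨅ x : Allocation m n r, cost f N p x

/-- A randomized online algorithm: a random seed, drawn before the first job arrives, and a rule
that irrevocably schedules each job on the basis of the seed and of the jobs that have arrived up
to and including it. -/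
structure OnlineAlgorithm (m n r : ℕ) where
  Seed : Type
  law : PMF Seed
  schedule : Seed → Instance m n r → Allocation m n r
  online : ∀ (ω : Seed) (p q : Instance m n r) (t : Fin n),
    (∀ j ≤ t, p j = q j) → schedule ω p t = schedule ω q t

/-- The expected cost of a randomized online algorithm on a fixed instance. -/
noncomputable def OnlineAlgorithm.expectedCost {m n r : ℕ} (A : OnlineAlgorithm m n r)
    (f : (Fin m → ℝ) → ℝ) (N : Fin m → Seminorm ℝ (Fin n × Fin r → ℝ))
    (p : Instance m n r) : ℝ≥0∞ :=
  ∑' ω, A.law ω * cost f N p (A.schedule ω p)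

/-- `A` is `c`-competitive for the aggregation function `f` and the machine norms `N`. -/
def OnlineAlgorithm.IsCompetitive {m n r : ℕ} (A : OnlineAlgorithm m n r)
    (f : (Fin m → ℝ) → ℝ) (N : Fin m → Seminorm ℝ (Fin n × Fin r → ℝ)) (c : ℝ) : Prop :=
  ∀ p : Instance m n r, A.expectedCost f N p ≤ ENNReal.ofReal c * opt f N p

end GenSched

/-! Normalise every norm to be one on unit vectors and scale the optimum to about one. A symmetric
monotone norm is then controlled by its capacities: `cap N s` is the largest number of equal entries
`2 ^ (-(s + 1))` of total norm at most one. A vector in the unit ball has at most `cap N s` entries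
of dyadic level `s`, so the sum of `1 / cap` over its entries is at most the number of levels
(`sum_inv_cap_lev_le`). Conversely, bounds on the maximum and on the sum of the entries bound the
norm (`seminorm_le_prof`). Let `a`, `Am`, `An` be the binary logarithms, rounded up, of the number
of nonempty groups, of `m` and of `n`.

Scheduling thus becomes a nested covering problem. A group opened at level `b` costs `C = 1 / cap`
of the outer norm. A slot, that is a machine with a level inside such a group, costs `c = 1 / cap`
of the inner norm within the budget of that group. A job has relative load `1 / cap` of the machine
norm on a slot. A schedule of cost at most one meets the budgets `a + 1` for the groups, `Am + 1`
for the slots of each group and `An + 1` for the jobs on each slot (`offline_spec`).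

Fractional solution. Group values `v` and slot values `z` grow multiplicatively. A job raises its
price by increments `ε` until the slots that it can afford cover it, and then multiplies the value
of each slot that it uses by one plus its load. The potential `T = ∑ C (B v + ∑ c z)`, with `B` of
order `(Am + 1) ^ 2`, grows by a constant times the price, while the sum of the prices is charged to
the offline solution: either the price of the offline slot has not been reached, or the logarithm of
its slot value or of its group value grows (`micro_progress`). This gives an inequality with a small
multiple of `T` on its right-hand side, hence `T ≤ 70 B (a + 1) ^ 2` (`T_bound`). So `∑ C v = O((a +
1) ^ 2)`, and within every group `∑ c z ≤ B v` (`process_spec`).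

Rounding. Values change with time, so random decisions are attached to tokens, which record a slot
together with the dyadic classes of its `v` and `z`. A token receives bounded total load, since that
load itself multiplies `z`; and the weights of the tokens of one slot or group form geometric series
(`toks_ok`). There are about `log (An + 1)` independent bundles. In bundle `r` tokens open at `64 *
2 ^ r` times their fractional value, and a job goes to the first bundle in which one of its tokens
is open. It reaches bundle `r` with probability at most `exp (-8 (2 ^ r - 1))`. Higher rates are
thus paid for by far fewer jobs: by Cauchy condensation the total over the bundles remains linear in
`An + 1` (`sum_thinLoad_le`). A job missed by all bundles goes to its cheapest machine; this has
probability at most `1 / n` and cost at most one.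

Cost of the rounding. The same saving recurs at all three norms. Summing over levels `s` and
thinning exponents `k < K` the normalised norms of `cap N s / 2 ^ k + 1` ones gives `O(K + A)`
instead of `O(K * A)` (`level_double_sum_le`). In a group it is applied to the number of open tokens
of smaller class in the same slot (`xval_le_rank`), and gives expected value `O((Am + 1) ^ 2 (An +
1))` times the truncated group value (`bernE_xval_nTok_le`). A Chernoff argument shows that the
value of a group in a band exceeds `O((a + 1) (Am + 1) ^ 2 (An + 1))` only by an amount of
expectation of order `2 ^ (-a)` times the other factors, so that the overflow can be summed over all
groups (`bernE_excess_lump_le`). At the outer norm the thinning is by the bands of group values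
above one (`bernE_out_le`). The result is `(a + 1) ^ 2 (Am + 1) ^ 2 (An + 1)`.

The optimum is not known in advance. Jobs are split into phases by the binary scale of the optimum
of the prefix; the scales of the phases form a geometric sum (`bernE_agg_sched_le`). Finally, the
given problem reduces to the normalised one: each machine uses the cheapest way because its norm is
symmetric, and jobs that fit on machines outside all groups cost nothing (`copt_le`,
`cost_lift_le`). -/

set_option linter.unusedSectionVars false

namespace GenSched

/-! ### Independent bits: expectations and a tail bound -/

section Bernoulli

variable {β : Type*} [Fintype β] [DecidableEq β]

/-- Probability of the outcome `ω` of independent bits that are `true` with probabilities `p`. -/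
noncomputable def bernW (p : β → ℝ) (ω : β → Bool) : ℝ := ∏ i, if ω i then p i else 1 - p i

/-- Expectation over independent bits that are `true` with probabilities `p`. -/
noncomputable def bernE (p : β → ℝ) (F : (β → Bool) → ℝ) : ℝ := ∑ ω, bernW p ω * F ω

theorem bernW_nonneg {p : β → ℝ} (hp : ∀ i, 0 ≤ p i ∧ p i ≤ 1) (ω : β → Bool) :
    0 ≤ bernW p ω := by
  refine Finset.prod_nonneg fun i _ => ?_
  have := hp i
  split_ifs <;> linarith

theorem bernE_prod_single (p : β → ℝ) (f : β → Bool → ℝ) :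
    bernE p (fun ω => ∏ i, f i (ω i)) = ∏ i, (p i * f i true + (1 - p i) * f i false) := by
  have h : ∀ i, p i * f i true + (1 - p i) * f i false
      = ∑ b : Bool, (if b then p i else 1 - p i) * f i b := by
    intro i; simp
  simp only [h, bernE, bernW]
  rw [Finset.prod_univ_sum]
  simp only [Fintype.piFinset_univ, Finset.prod_mul_distrib]

theorem bernE_const (p : β → ℝ) (c : ℝ) : bernE p (fun _ => c) = c := by
  have := bernE_prod_single p (fun _ _ => 1)
  simp only [bernE, Finset.prod_const_one, mul_one] at this
  simp only [bernE, ← Finset.sum_mul, this]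
  simp

theorem bernE_add (p : β → ℝ) (F G : (β → Bool) → ℝ) :
    bernE p (fun ω => F ω + G ω) = bernE p F + bernE p G := by
  simp only [bernE, mul_add, Finset.sum_add_distrib]

theorem bernE_const_mul (p : β → ℝ) (c : ℝ) (F : (β → Bool) → ℝ) :
    bernE p (fun ω => c * F ω) = c * bernE p F := by
  simp only [bernE, Finset.mul_sum]
  exact Finset.sum_congr rfl fun _ _ => by ring

theorem bernE_sum {κ : Type*} (p : β → ℝ) (s : Finset κ) (F : κ → (β → Bool) → ℝ) :
    bernE p (fun ω => ∑ k ∈ s, F k ω) = ∑ k ∈ s, bernE p (F k) := by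
  simp only [bernE, Finset.mul_sum]
  exact Finset.sum_comm

theorem bernE_mono {p : β → ℝ} (hp : ∀ i, 0 ≤ p i ∧ p i ≤ 1) {F G : (β → Bool) → ℝ}
    (h : ∀ ω, F ω ≤ G ω) : bernE p F ≤ bernE p G :=
  Finset.sum_le_sum fun ω _ => mul_le_mul_of_nonneg_left (h ω) (bernW_nonneg hp ω)

theorem bernE_nonneg {p : β → ℝ} (hp : ∀ i, 0 ≤ p i ∧ p i ≤ 1) {F : (β → Bool) → ℝ}
    (h : ∀ ω, 0 ≤ F ω) : 0 ≤ bernE p F :=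
  Finset.sum_nonneg fun ω _ => mul_nonneg (bernW_nonneg hp ω) (h ω)

/-- Independence. Splitting the coordinates along `A` factorises the weight; the values filled in by
`ω₀` are immaterial because of the dependence hypotheses. -/
theorem bernE_mul_of_dependsOn (p : β → ℝ) {F G : (β → Bool) → ℝ} {A : Set β}
    (hF : DependsOn F A) (hG : DependsOn G Aᶜ) :
    bernE p (fun ω => F ω * G ω) = bernE p F * bernE p G := by
  classical
  let e := Equiv.piEquivPiSubtypeProd (fun i => i ∈ A) (fun _ : β => Bool)
  let ω₀ : β → Bool := fun _ => false
  let F' : ({i // i ∈ A} → Bool) → ℝ := fun a => F (e.symm (a, fun i => ω₀ i))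
  let G' : ({i // i ∉ A} → Bool) → ℝ := fun b => G (e.symm (fun i => ω₀ i, b))
  let w₁ : ({i // i ∈ A} → Bool) → ℝ := fun a => bernW (fun i : {i // i ∈ A} => p i) a
  let w₂ : ({i // i ∉ A} → Bool) → ℝ := fun b => bernW (fun i : {i // i ∉ A} => p i) b
  have hFe : ∀ a b, F (e.symm (a, b)) = F' a := fun a b => hF fun i hi => by
    simp [e, Equiv.piEquivPiSubtypeProd, hi]
  have hGe : ∀ a b, G (e.symm (a, b)) = G' b := fun a b => hG fun i hi => by
    have hi' : i ∉ A := hi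
    simp [e, Equiv.piEquivPiSubtypeProd, hi']
  have hw : ∀ a b, bernW p (e.symm (a, b)) = w₁ a * w₂ b := by
    intro a b
    simp only [bernW, w₁, w₂]
    rw [← Fintype.prod_subtype_mul_prod_subtype (fun i => i ∈ A)]
    congr 1
    · refine Finset.prod_congr rfl fun i _ => ?_
      simp [e, Equiv.piEquivPiSubtypeProd, i.2]
    · refine Finset.prod_congr rfl fun i _ => ?_
      simp [e, Equiv.piEquivPiSubtypeProd, i.2]
  have hsum : ∀ K : (β → Bool) → ℝ, bernE p K = ∑ a, ∑ b, w₁ a * w₂ b * K (e.symm (a, b)) := by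
    intro K
    rw [bernE, ← e.symm.sum_comp, Fintype.sum_prod_type]
    simp only [hw]
  have h1 : ∑ a, w₁ a = 1 := by
    simpa [bernE] using bernE_const (fun i : {i // i ∈ A} => p i) 1
  have h2 : ∑ b, w₂ b = 1 := by
    simpa [bernE] using bernE_const (fun i : {i // i ∉ A} => p i) 1
  have e1 : bernE p F = ∑ a, w₁ a * F' a := by
    rw [hsum]
    refine Finset.sum_congr rfl fun a _ => ?_
    simp only [hFe]
    rw [← Finset.sum_mul, ← Finset.mul_sum, h2, mul_one]
  have e2 : bernE p G = ∑ b, w₂ b * G' b := by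
    rw [hsum, Finset.sum_comm]
    refine Finset.sum_congr rfl fun b _ => ?_
    simp only [hGe]
    rw [← Finset.sum_mul, ← Finset.sum_mul, h1, one_mul]
  rw [hsum, e1, e2, Finset.sum_mul_sum]
  refine Finset.sum_congr rfl fun a _ => Finset.sum_congr rfl fun b _ => ?_
  rw [hFe, hGe]; ring

theorem bernE_prod_of_blocks {κ : Type*} [DecidableEq κ] (p : β → ℝ) (π : β → κ) (s : Finset κ)
    (F : κ → (β → Bool) → ℝ) (hF : ∀ k ∈ s, DependsOn (F k) (π ⁻¹' {k})) :
    bernE p (fun ω => ∏ k ∈ s, F k ω) = ∏ k ∈ s, bernE p (F k) := by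
  induction s using Finset.induction_on with
  | empty => simp [bernE_const]
  | insert k s hk ih =>
    simp only [Finset.prod_insert hk]
    rw [bernE_mul_of_dependsOn p (A := π ⁻¹' {k}) (hF k (by simp)) (G := fun ω => ∏ k ∈ s, F k ω),
      ih fun k hk => hF k (by simp [hk])]
    intro x y hxy
    refine Finset.prod_congr rfl fun k' hk' => hF k' (by simp [hk']) fun i hi => hxy i ?_
    have : π i = k' := hi
    simp only [Set.mem_compl_iff, Set.mem_preimage, Set.mem_singleton_iff]
    rintro h
    exact hk (by rw [← h, this]; exact hk')

/-- Real indicator of a bit. -/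
def bit (b : Bool) : ℝ := if b then 1 else 0

theorem bit_nonneg (b : Bool) : 0 ≤ bit b := by unfold bit; split_ifs <;> norm_num
theorem bit_le_one (b : Bool) : bit b ≤ 1 := by unfold bit; split_ifs <;> norm_num

theorem bernE_single (p : β → ℝ) (i : β) (f : Bool → ℝ) :
    bernE p (fun ω => f (ω i)) = p i * f true + (1 - p i) * f false := by
  have := bernE_prod_single p (fun k b => if k = i then f b else 1)
  simp only [Finset.prod_ite_eq', Finset.mem_univ, if_true] at this
  rw [this, Finset.prod_eq_single i]
  · simp
  · intro k _ hk; simp [hk]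
  · simp

theorem bernE_bit (p : β → ℝ) (i : β) : bernE p (fun ω => bit (ω i)) = p i := by
  rw [bernE_single p i bit]; simp [bit]

/-- Expected excess of a sum of independent bits with weights in `[0,1]` over four times an upper
bound on its mean. -/
theorem bernE_excess_le {p : β → ℝ} (hp : ∀ i, 0 ≤ p i ∧ p i ≤ 1) (c : β → ℝ)
    (hc : ∀ i, 0 ≤ c i ∧ c i ≤ 1) {M : ℝ} (hM : ∑ i, p i * c i ≤ M) :
    bernE p (fun ω => max 0 (∑ i, bit (ω i) * c i - 4 * M)) ≤ Real.exp (-(2 * M)) := by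
  -- Chernoff bound with exponent one: `max 0 x ≤ exp x`, and `exp c ≤ 1 + 2 c` on `[0, 1]` bounds
  -- the moment generating function by `exp (2 M)`. The threshold `4 M` leaves `exp (-2 M)`.
  have h1 : ∀ ω : β → Bool, max 0 (∑ i, bit (ω i) * c i - 4 * M)
      ≤ Real.exp (-(4 * M)) * ∏ i, Real.exp (bit (ω i) * c i) := by
    intro ω
    rw [← Real.exp_sum, ← Real.exp_add]
    refine max_le (Real.exp_pos _).le ?_
    have := Real.add_one_le_exp (-(4 * M) + ∑ i, bit (ω i) * c i)
    linarith
  refine (bernE_mono hp h1).trans ?_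
  rw [bernE_const_mul, bernE_prod_single p (fun i b => Real.exp (bit b * c i))]
  have h2 : ∏ i, (p i * Real.exp (bit true * c i) + (1 - p i) * Real.exp (bit false * c i))
      ≤ ∏ i, Real.exp (2 * (p i * c i)) := by
    refine Finset.prod_le_prod (fun i _ => ?_) fun i _ => ?_
    · have := hp i
      have := Real.exp_pos (bit true * c i)
      have := Real.exp_pos (bit false * c i)
      have : 0 ≤ 1 - p i := by linarith [(hp i).2]
      have := (hp i).1
      positivity
    · obtain ⟨c0, c1⟩ := hc i
      have he : Real.exp (c i) ≤ 1 + 2 * c i := by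
        have := Real.exp_bound' c0 c1 (n := 2) (by norm_num)
        simp [Finset.sum_range_succ] at this
        nlinarith
      have h3 := Real.add_one_le_exp (2 * (p i * c i))
      have h4 := mul_le_mul_of_nonneg_left he (hp i).1
      simp only [bit, if_true, one_mul, zero_mul, Real.exp_zero, Bool.false_eq_true, if_false]
      linarith
  calc _ ≤ Real.exp (-(4 * M)) * ∏ i, Real.exp (2 * (p i * c i)) := by gcongr
    _ = Real.exp (-(4 * M) + 2 * ∑ i, p i * c i) := by
      rw [← Real.exp_sum, ← Real.exp_add, Finset.mul_sum]
    _ ≤ _ := Real.exp_le_exp.mpr (by linarith)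

end Bernoulli

/-! ### Symmetric norms through their values on indicator vectors -/

section Profile

variable {ι : Type*} [Fintype ι] [DecidableEq ι]

/-- Symmetric monotone seminorms that take the value `1` at the unit vectors. -/
structure SymMono (N : Seminorm ℝ (ι → ℝ)) : Prop where
  symm : ∀ (σ : Equiv.Perm ι) (x : ι → ℝ), N (x ∘ σ) = N x
  mono : MonotoneOn N (Set.Ici 0)
  unit : ∀ i, N (Pi.single i 1) = 1

/-- Indicator vector of a finset. -/
def indVec (A : Finset ι) : ι → ℝ := fun i => if i ∈ A then 1 else 0

/-- The largest norm of an indicator vector with at most `t` ones. -/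
noncomputable def prof (N : Seminorm ℝ (ι → ℝ)) (t : ℕ) : ℝ :=
  (Finset.univ.filter fun A : Finset ι => A.card ≤ t).sup' ⟨∅, by simp⟩ fun A => N (indVec A)

omit [Fintype ι] in
theorem indVec_nonneg (A : Finset ι) : 0 ≤ indVec A := fun i => by
  unfold indVec; split_ifs <;> norm_num

theorem le_prof (N : Seminorm ℝ (ι → ℝ)) {A : Finset ι} {t : ℕ} (h : A.card ≤ t) :
    N (indVec A) ≤ prof N t :=
  Finset.le_sup' (fun A => N (indVec A)) (by simpa using h)

theorem exists_prof_eq (N : Seminorm ℝ (ι → ℝ)) (t : ℕ) :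
    ∃ A : Finset ι, A.card ≤ t ∧ prof N t = N (indVec A) := by
  obtain ⟨A, hA, h⟩ := Finset.exists_mem_eq_sup'
    (s := Finset.univ.filter fun A : Finset ι => A.card ≤ t) ⟨∅, by simp⟩ (fun A => N (indVec A))
  exact ⟨A, by simpa using hA, h⟩

theorem prof_nonneg (N : Seminorm ℝ (ι → ℝ)) (t : ℕ) : 0 ≤ prof N t := by
  obtain ⟨A, _, h⟩ := exists_prof_eq N t
  rw [h]; exact apply_nonneg _ _

theorem prof_mono (N : Seminorm ℝ (ι → ℝ)) {s t : ℕ} (h : s ≤ t) : prof N s ≤ prof N t := by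
  obtain ⟨A, hA, e⟩ := exists_prof_eq N s
  rw [e]; exact le_prof N (hA.trans h)

theorem prof_add_le (N : Seminorm ℝ (ι → ℝ)) (s t : ℕ) :
    prof N (s + t) ≤ prof N s + prof N t := by
  obtain ⟨A, hA, e⟩ := exists_prof_eq N (s + t)
  obtain ⟨B, hBA, hB⟩ := Finset.exists_subset_card_eq (Nat.min_le_left A.card s)
  have h1 : indVec A = indVec B + indVec (A \ B) := by
    funext i
    simp only [indVec, Pi.add_apply, Finset.mem_sdiff]
    by_cases h : i ∈ B
    · simp [h, hBA h]
    · simp [h]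
  have h2 : (A \ B).card ≤ t := by
    rw [Finset.card_sdiff_of_subset hBA, hB]; omega
  rw [e, h1]
  exact (map_add_le_add N _ _).trans
    (add_le_add (le_prof N (by rw [hB]; exact min_le_right _ _)) (le_prof N h2))

theorem prof_zero (N : Seminorm ℝ (ι → ℝ)) : prof N 0 = 0 := by
  obtain ⟨A, hA, e⟩ := exists_prof_eq N 0
  have : A = ∅ := by simpa using hA
  rw [e, this]
  have : indVec (∅ : Finset ι) = 0 := by funext i; simp [indVec]
  rw [this, map_zero]

theorem prof_mul_le (N : Seminorm ℝ (ι → ℝ)) (k t : ℕ) : prof N (k * t) ≤ k * prof N t := by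
  induction k with
  | zero => simp [prof_zero]
  | succ k ih =>
    rw [Nat.succ_mul]
    push_cast
    linarith [prof_add_le N (k * t) t]

theorem prof_le_of_pos (N : Seminorm ℝ (ι → ℝ)) (c : ℕ) {t : ℕ} (ht : 1 ≤ t) :
    prof N c ≤ (1 + c / t) * prof N t := by
  have h1 : c ≤ (c / t + 1) * t := by
    have := Nat.div_add_mod c t
    have := Nat.mod_lt c (by omega : t > 0)
    nlinarith
  refine (prof_mono N h1).trans ((prof_mul_le N _ _).trans ?_)
  refine mul_le_mul_of_nonneg_right ?_ (prof_nonneg N t)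
  push_cast
  linarith [@Nat.cast_div_le ℝ _ _ _ c t]

theorem SymMono.prof_one [Nonempty ι] {N : Seminorm ℝ (ι → ℝ)} (hN : SymMono N) :
    prof N 1 = 1 := by
  have hs : ∀ i : ι, indVec {i} = Pi.single i 1 := by
    intro i; funext k; simp [indVec, Pi.single_apply]
  apply le_antisymm
  · obtain ⟨A, hA, e⟩ := exists_prof_eq N 1
    rw [e]
    rcases A.eq_empty_or_nonempty with rfl | hne
    · have : indVec (∅ : Finset ι) = 0 := by funext i; simp [indVec]
      rw [this, map_zero]; norm_num
    · obtain ⟨i, rfl⟩ := Finset.card_eq_one.mp (le_antisymm hA hne.card_pos)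
      rw [hs, hN.unit]
  · obtain ⟨i⟩ := ‹Nonempty ι›
    rw [← hN.unit i, ← hs]
    exact le_prof N (by simp)

theorem SymMono.prof_le [Nonempty ι] {N : Seminorm ℝ (ι → ℝ)} (hN : SymMono N) (t : ℕ) :
    prof N t ≤ t := by
  have := prof_mul_le N t 1
  rwa [hN.prof_one, mul_one, mul_one] at this

/-- The maximiser in `prof` has at most as many ones as `A`; a permutation moves it into `A`, and
monotonicity concludes. -/
theorem SymMono.apply_indVec {N : Seminorm ℝ (ι → ℝ)} (hN : SymMono N) (A : Finset ι) :
    N (indVec A) = prof N A.card := by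
  refine le_antisymm (le_prof N le_rfl) ?_
  obtain ⟨B, hB, e⟩ := exists_prof_eq N A.card
  obtain ⟨A', hA', hc⟩ := Finset.exists_subset_card_eq hB
  have eq : {x // x ∈ B} ≃ {x // x ∈ A'} := Finset.equivOfCardEq hc.symm
  let σ : Equiv.Perm ι := eq.extendSubtype
  have h1 : indVec B = indVec A' ∘ σ := by
    funext i
    simp only [indVec, Function.comp]
    by_cases h : i ∈ B
    · have := eq.extendSubtype_mem i h
      simp [h, σ, this]
    · have := eq.extendSubtype_not_mem i h
      simp [h, σ, this]
  rw [e, h1, hN.symm]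
  refine hN.mono (indVec_nonneg _) (indVec_nonneg _) fun i => ?_
  simp only [indVec]
  by_cases h : i ∈ A'
  · simp [h, hA' h]
  · simp only [h, if_false]; split_ifs <;> norm_num

/-- A vector with entries in `[0, D]` compared with the profile at `t`. -/
theorem seminorm_le_prof (N : Seminorm ℝ (ι → ℝ)) {t : ℕ} (ht : 1 ≤ t) {D : ℝ} {y : ι → ℝ}
    (hD : 0 ≤ D) (h0 : ∀ i, 0 ≤ y i) (hy : ∀ i, y i ≤ D) :
    N y ≤ prof N t * (D + (∑ i, y i) / t) := by
  -- Layer-cake induction on the support: subtract the smallest positive entry times the indicator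
  -- of the support. Each layer of `c` ones costs at most `(1 + c / t) * prof N t` per unit of
  -- height; the heights add up to at most `D` and the areas to the sum of the entries.
  have main : ∀ (k : ℕ) (y : ι → ℝ) (D : ℝ), (Finset.univ.filter fun i => 0 < y i).card ≤ k →
      0 ≤ D → (∀ i, 0 ≤ y i) → (∀ i, y i ≤ D) → N y ≤ prof N t * (D + (∑ i, y i) / t) := by
    intro k
    induction k with
    | zero =>
      intro y D hk hD h0 hy
      have hz : y = 0 := by
        funext i
        have : i ∉ Finset.univ.filter fun i => 0 < y i := by
          rw [Finset.card_eq_zero.mp (Nat.le_zero.mp hk)]; simp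
        simp only [Finset.mem_filter, Finset.mem_univ, true_and, not_lt] at this
        exact le_antisymm this (h0 i)
      subst hz
      simp only [map_zero, Pi.zero_apply, Finset.sum_const_zero, zero_div, add_zero]
      exact mul_nonneg (prof_nonneg N t) hD
    | succ k ih =>
      intro y D hk hD h0 hy
      set S := Finset.univ.filter fun i => 0 < y i with hS
      rcases S.eq_empty_or_nonempty with he | hne
      · exact ih y D (by rw [← hS, he]; simp) hD h0 hy
      obtain ⟨i₀, hi₀, hmin⟩ := Finset.exists_min_image S y hne
      have hm : 0 < y i₀ := by simpa [hS] using hi₀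
      set m := y i₀ with hmdef
      let y' : ι → ℝ := fun i => y i - m * indVec S i
      have hy'0 : ∀ i, 0 ≤ y' i := by
        intro i
        by_cases h : i ∈ S
        · simp [y', indVec, h, hmin i h]
        · simp [y', indVec, h, h0 i]
      have hy'D : ∀ i, y' i ≤ D - m := by
        intro i
        by_cases h : i ∈ S
        · simp [y', indVec, h, hy i]
        · have h3 : y i ≤ 0 := by simpa [hS] using h
          have := hy i₀
          simp [y', indVec, h]; linarith
      have hsub : (Finset.univ.filter fun i => 0 < y' i) ⊂ S := by
        refine Finset.ssubset_iff_subset_ne.mpr ⟨fun i hi => ?_, fun heq => ?_⟩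
        · simp only [Finset.mem_filter, Finset.mem_univ, true_and] at hi
          by_contra h
          have h3 : y i ≤ 0 := by simpa [hS] using h
          simp [y', indVec, h] at hi; linarith
        · have : i₀ ∈ Finset.univ.filter fun i => 0 < y' i := by rw [heq]; exact hi₀
          simp [y', indVec, hi₀, ← hmdef] at this
      have hih := ih y' (D - m) (by have := Finset.card_lt_card hsub; omega)
        (by linarith [hy i₀]) hy'0 hy'D
      have hdec : y = m • indVec S + y' := by
        funext i; simp [y']
      have hsum : ∑ i, y' i = ∑ i, y i - m * S.card := by
        simp only [y', Finset.sum_sub_distrib, ← Finset.mul_sum]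
        simp [indVec]
      have h1 : N y ≤ m * prof N S.card + N y' := by
        conv_lhs => rw [hdec]
        refine (map_add_le_add N _ _).trans ?_
        rw [map_smul_eq_mul, Real.norm_of_nonneg hm.le]
        gcongr
        exact le_prof N le_rfl
      have h2 := mul_le_mul_of_nonneg_left (prof_le_of_pos N S.card ht) hm.le
      rw [hsum] at hih
      have : prof N t * (D + (∑ i, y i) / t)
          = m * ((1 + (S.card : ℝ) / t) * prof N t)
            + prof N t * (D - m + (∑ i, y i - m * S.card) / t) := by ring
      linarith
  exact main _ y D le_rfl hD h0 hy

/-! ### Dyadic levels, capacities and thinning -/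

/-- Largest number of ones with norm at most `2 ^ (s + 1)`. -/
noncomputable def cap (N : Seminorm ℝ (ι → ℝ)) (s : ℕ) : ℕ :=
  open Classical in Nat.findGreatest (fun t => prof N t ≤ 2 ^ (s + 1)) (Fintype.card ι)

theorem cap_le_card (N : Seminorm ℝ (ι → ℝ)) (s : ℕ) : cap N s ≤ Fintype.card ι := by
  unfold cap; exact Nat.findGreatest_le _

theorem prof_cap_le (N : Seminorm ℝ (ι → ℝ)) (s : ℕ) : prof N (cap N s) ≤ 2 ^ (s + 1) := by
  classical
  unfold cap
  exact Nat.findGreatest_spec (P := fun t => prof N t ≤ 2 ^ (s + 1)) (m := 0) (Nat.zero_le _)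
    (by rw [prof_zero]; positivity)

theorem le_cap (N : Seminorm ℝ (ι → ℝ)) {s t : ℕ} (ht : t ≤ Fintype.card ι)
    (h : prof N t ≤ 2 ^ (s + 1)) : t ≤ cap N s := by
  unfold cap; exact Nat.le_findGreatest ht h

theorem SymMono.one_le_cap [Nonempty ι] {N : Seminorm ℝ (ι → ℝ)} (hN : SymMono N) (s : ℕ) :
    1 ≤ cap N s :=
  le_cap N Fintype.card_pos (by rw [hN.prof_one]; exact one_le_pow₀ (by norm_num))

/-- The dyadic level of a number in `[0, 1]`, truncated at `A`. -/
noncomputable def lev (A : ℕ) (x : ℝ) : ℕ :=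
  open Classical in Nat.findGreatest (fun s => x ≤ (1 / 2) ^ s) A

theorem lev_le (A : ℕ) (x : ℝ) : lev A x ≤ A := by
  unfold lev; exact Nat.findGreatest_le _

theorem le_of_lev {A : ℕ} {x : ℝ} (hx : x ≤ 1) : x ≤ (1 / 2) ^ lev A x := by
  classical
  unfold lev
  exact Nat.findGreatest_spec (P := fun s => x ≤ (1 / 2 : ℝ) ^ s) (m := 0) (Nat.zero_le _)
    (by simpa using hx)

theorem lt_of_lev_lt {A : ℕ} {x : ℝ} (h : lev A x < A) : (1 / 2) ^ (lev A x + 1) < x := by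
  classical
  by_contra hc
  have := Nat.le_findGreatest (P := fun s => x ≤ (1 / 2 : ℝ) ^ s) (Nat.succ_le_of_lt h)
    (not_lt.mp hc)
  unfold lev at this h
  omega

theorem SymMono.le_of_apply_le {N : Seminorm ℝ (ι → ℝ)} (hN : SymMono N) {y : ι → ℝ}
    (h0 : ∀ i, 0 ≤ y i) (i : ι) : y i ≤ N y := by
  have h1 : N (y i • Pi.single i 1) ≤ N y := by
    refine hN.mono ?_ h0 ?_
    · intro k; by_cases h : k = i
      · subst h; simp [h0 k]
      · simp [h]
    · intro k; by_cases h : k = i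
      · subst h; simp
      · simp [h, h0 k]
  rwa [map_smul_eq_mul, hN.unit, mul_one, Real.norm_of_nonneg (h0 i)] at h1

/-- The last level `A` collects all small entries, for which no lower bound is available. Its
capacity must therefore be no restriction. -/
theorem SymMono.cap_eq_card [Nonempty ι] {N : Seminorm ℝ (ι → ℝ)} (hN : SymMono N) {A : ℕ}
    (hA : Fintype.card ι ≤ 2 ^ A) : cap N A = Fintype.card ι := by
  refine le_antisymm (cap_le_card N A) (le_cap N le_rfl ((hN.prof_le _).trans ?_))
  have : (Fintype.card ι : ℝ) ≤ 2 ^ A := by exact_mod_cast hA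
  rw [pow_succ]; nlinarith [pow_pos (two_pos : (0 : ℝ) < 2) A]

/-- Entries of a level `s < A` exceed `2 ^ (-(s + 1))`, so `y` dominates a multiple of the indicator
of `T`, whose norm is then at most `2 ^ (s + 1)`. -/
theorem SymMono.card_lev_le [Nonempty ι] {N : Seminorm ℝ (ι → ℝ)} (hN : SymMono N) {A : ℕ}
    (hA : Fintype.card ι ≤ 2 ^ A) {y : ι → ℝ} (h0 : ∀ i, 0 ≤ y i) (hy : N y ≤ 1) (s : ℕ)
    (T : Finset ι) (hT : ∀ i ∈ T, lev A (y i) = s) : T.card ≤ cap N s := by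
  rcases T.eq_empty_or_nonempty with rfl | ⟨i₀, hi₀⟩
  · simp
  have hs : s ≤ A := by rw [← hT i₀ hi₀]; exact lev_le _ _
  rcases hs.eq_or_lt with rfl | hlt
  · rw [hN.cap_eq_card hA]; exact T.card_le_univ
  refine le_cap N T.card_le_univ ?_
  have h1 : N ((1 / 2 : ℝ) ^ (s + 1) • indVec T) ≤ N y := by
    refine hN.mono ?_ h0 fun i => ?_
    · exact smul_nonneg (by positivity) (indVec_nonneg T)
    · by_cases h : i ∈ T
      · have h2 := hT i h
        have := lt_of_lev_lt (A := A) (x := y i) (by omega)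
        rw [h2] at this
        simpa [indVec, h] using this.le
      · simpa [indVec, h] using h0 i
  rw [map_smul_eq_mul, hN.apply_indVec, Real.norm_of_nonneg (by positivity)] at h1
  have h3 := h1.trans hy
  rw [one_div, inv_pow, inv_mul_le_iff₀ (by positivity), mul_one] at h3
  exact h3

theorem sum_half_pow_Ico_le (a b : ℕ) : ∑ s ∈ Finset.Ico a b, (1 / 2 : ℝ) ^ s ≤ 2 * (1 / 2) ^ a := by
  rcases le_total a b with h | h
  · have : ∑ s ∈ Finset.Ico a b, (1 / 2 : ℝ) ^ s = 2 * (1 / 2) ^ a - 2 * (1 / 2) ^ b := by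
      induction b, h using Nat.le_induction with
      | base => simp
      | succ b hb ih => rw [Finset.sum_Ico_succ_top hb, ih, pow_succ]; ring
    rw [this]
    have : (0 : ℝ) ≤ (1 / 2) ^ b := by positivity
    linarith
  · rw [Finset.Ico_eq_empty (by omega)]; simp

/-- A geometric series governed by its first term, the smallest `s` with `x ≤ 2 ^ (s + 1)`. -/
theorem sum_half_pow_filter_le (A : ℕ) {x : ℝ} (hx : 0 ≤ x) :
    ∑ s ∈ (Finset.range (A + 1)).filter (fun s => x ≤ 2 ^ (s + 1)), (1 / 2 : ℝ) ^ s * x ≤ 4 := by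
  set F := (Finset.range (A + 1)).filter (fun s => x ≤ 2 ^ (s + 1)) with hF
  rcases F.eq_empty_or_nonempty with h | h
  · rw [h]; simp
  obtain ⟨s₀, hs₀, hmin⟩ := Finset.exists_min_image F id h
  have hsub : F ⊆ Finset.Ico s₀ (A + 1) := fun s hs => by
    have h1 := hmin s hs
    have h2 := (Finset.mem_filter.mp hs).1
    simp only [Finset.mem_range] at h2
    simp only [id] at h1
    simp [h1, h2]
  have hx' : x ≤ 2 ^ (s₀ + 1) := (Finset.mem_filter.mp hs₀).2
  rw [← Finset.sum_mul]
  calc (∑ s ∈ F, (1 / 2 : ℝ) ^ s) * x ≤ (2 * (1 / 2) ^ s₀) * 2 ^ (s₀ + 1) := by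
        gcongr
        exact (Finset.sum_le_sum_of_subset_of_nonneg hsub fun _ _ _ => by positivity).trans
          (sum_half_pow_Ico_le _ _)
    _ = 4 * ((1 / 2) * 2) ^ s₀ := by rw [mul_pow]; ring
    _ = 4 := by norm_num

theorem SymMono.level_term_le [Nonempty ι] {N : Seminorm ℝ (ι → ℝ)} (hN : SymMono N) (s k : ℕ) :
    (1 / 2 : ℝ) ^ s * prof N (cap N s / 2 ^ k + 1) ≤ 3 := by
  have h1 : prof N (cap N s / 2 ^ k + 1) ≤ 2 ^ (s + 1) + 1 := by
    refine (prof_add_le N _ _).trans (add_le_add ?_ hN.prof_one.le)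
    exact (prof_mono N (Nat.div_le_self _ _)).trans (prof_cap_le N s)
  calc (1 / 2 : ℝ) ^ s * prof N (cap N s / 2 ^ k + 1) ≤ (1 / 2) ^ s * (2 ^ (s + 1) + 1) := by gcongr
    _ = 2 * ((1 / 2) * 2) ^ s + (1 / 2) ^ s := by rw [mul_pow]; ring
    _ ≤ 2 * 1 + 1 := by
      gcongr
      · norm_num
      · exact pow_le_one₀ (by norm_num) (by norm_num)
    _ = 3 := by norm_num

/-- Every term is at most `3`, but the sum is only of order `K + A`. The thinned capacities run
through dyadic sizes `2 ^ h`, and each size occurs only at levels with `prof N (2 ^ h) ≤ 2 ^ (s +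
1)`, where its contributions decay geometrically in `s`. This estimate saves a logarithm at each of
the three norms. -/
theorem SymMono.level_double_sum_le [Nonempty ι] {N : Seminorm ℝ (ι → ℝ)} (hN : SymMono N) {A : ℕ}
    (hA : Fintype.card ι ≤ 2 ^ A) (K : ℕ) :
    ∑ s ∈ Finset.range (A + 1), ∑ k ∈ Finset.range K,
      (1 / 2 : ℝ) ^ s * prof N (cap N s / 2 ^ k + 1) ≤ 2 * K + 8 * (A + 1) := by
  have h1 : ∀ s ∈ Finset.range (A + 1), ∑ k ∈ Finset.range K,
      (1 / 2 : ℝ) ^ s * prof N (cap N s / 2 ^ k + 1) ≤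
      (1 / 2 : ℝ) ^ s * K + ∑ h ∈ Finset.range (A + 1),
        (if prof N (2 ^ h) ≤ 2 ^ (s + 1) then 2 * ((1 / 2 : ℝ) ^ s * prof N (2 ^ h)) else 0) := by
    intro s _
    set c := cap N s with hc
    have hc1 : c ≠ 0 := by have := hN.one_le_cap s; omega
    set h := Nat.log 2 c with hh
    have hle : 2 ^ h ≤ c := Nat.pow_log_le_self 2 hc1
    have hlt : c < 2 ^ (h + 1) := Nat.lt_pow_succ_log_self (by norm_num) c
    have hhA : h ≤ A := by
      by_contra hcon
      have h3 : 2 ^ (A + 1) ≤ 2 ^ h := Nat.pow_le_pow_right (by norm_num) (by omega)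
      have h4 := cap_le_card N s
      have : 0 < 2 ^ A := by positivity
      rw [pow_succ] at h3
      omega
    -- For `k > h` the quotient vanishes and only the added one survives; it gives the summand `(1 /
    -- 2) ^ s`, which makes up the `2 * K` of the bound.
    have hterm : ∀ k, (1 / 2 : ℝ) ^ s * prof N (c / 2 ^ k + 1) ≤ (1 / 2 : ℝ) ^ s
        + if k ≤ h then 2 * ((1 / 2 : ℝ) ^ s * prof N (2 ^ (h - k))) else 0 := by
      intro k
      by_cases hk : k ≤ h
      · rw [if_pos hk]
        have h5 : c / 2 ^ k + 1 ≤ 2 * 2 ^ (h - k) := by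
          have : c / 2 ^ k < 2 * 2 ^ (h - k) := by
            rw [Nat.div_lt_iff_lt_mul (by positivity)]
            calc c < 2 ^ (h + 1) := hlt
              _ = 2 * 2 ^ (h - k) * 2 ^ k := by
                rw [mul_assoc, ← pow_add, Nat.sub_add_cancel hk, pow_succ]; ring
          omega
        have h6 := (prof_mono N h5).trans (prof_mul_le N 2 _)
        have h7 : (0 : ℝ) < (1 / 2 : ℝ) ^ s := by positivity
        push_cast at h6
        nlinarith
      · rw [if_neg hk, add_zero]
        have h5 : c / 2 ^ k = 0 := Nat.div_eq_of_lt
          (hlt.trans_le (Nat.pow_le_pow_right (by norm_num) (by omega)))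
        rw [h5, zero_add, hN.prof_one, mul_one]
    calc _ ≤ ∑ k ∈ Finset.range K, ((1 / 2 : ℝ) ^ s
        + if k ≤ h then 2 * ((1 / 2 : ℝ) ^ s * prof N (2 ^ (h - k))) else 0) :=
          Finset.sum_le_sum fun k _ => hterm k
      _ = (1 / 2 : ℝ) ^ s * K + ∑ k ∈ (Finset.range K).filter (· ≤ h),
          2 * ((1 / 2 : ℝ) ^ s * prof N (2 ^ (h - k))) := by
        rw [Finset.sum_add_distrib, Finset.sum_filter]; simp [mul_comm]
      _ ≤ (1 / 2 : ℝ) ^ s * K + ∑ k ∈ Finset.range (h + 1),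
          2 * ((1 / 2 : ℝ) ^ s * prof N (2 ^ (h - k))) := by
        refine add_le_add le_rfl
          (Finset.sum_le_sum_of_subset_of_nonneg (fun k hk => ?_) fun k _ _ => ?_)
        · simp only [Finset.mem_filter] at hk; simp; omega
        · have := prof_nonneg N (2 ^ (h - k)); positivity
      _ = (1 / 2 : ℝ) ^ s * K + ∑ k ∈ Finset.range (h + 1),
          2 * ((1 / 2 : ℝ) ^ s * prof N (2 ^ k)) := by
        congr 1
        rw [← Finset.sum_range_reflect]
        refine Finset.sum_congr rfl fun k hk => ?_
        simp only [Finset.mem_range] at hk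
        congr 4; omega
      _ ≤ _ := by
        rw [← Finset.sum_filter]
        gcongr 1
        refine Finset.sum_le_sum_of_subset_of_nonneg (fun k hk => ?_) fun k _ _ => ?_
        · simp only [Finset.mem_range] at hk
          simp only [Finset.mem_filter, Finset.mem_range]
          refine ⟨by omega, ?_⟩
          refine (prof_mono N ?_).trans (prof_cap_le N s)
          exact (Nat.pow_le_pow_right (by norm_num) (by omega)).trans hle
        · have := prof_nonneg N (2 ^ k); positivity
  refine (Finset.sum_le_sum h1).trans ?_
  rw [Finset.sum_add_distrib, Finset.sum_comm (s := Finset.range (A + 1)), ← Finset.sum_mul]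
  have h2 : ∑ s ∈ Finset.range (A + 1), (1 / 2 : ℝ) ^ s ≤ 2 := by
    have := sum_half_pow_Ico_le 0 (A + 1)
    rw [Finset.range_eq_Ico]
    simpa using this
  have h3 : ∀ h ∈ Finset.range (A + 1), ∑ s ∈ Finset.range (A + 1),
      (if prof N (2 ^ h) ≤ 2 ^ (s + 1) then 2 * ((1 / 2 : ℝ) ^ s * prof N (2 ^ h)) else 0) ≤ 8 := by
    intro h _
    rw [← Finset.sum_filter, ← Finset.mul_sum]
    linarith [sum_half_pow_filter_le A (prof_nonneg N (2 ^ h))]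
  have h4 := Finset.sum_le_sum h3
  have h5 : (0 : ℝ) ≤ K := by positivity
  simp only [Finset.sum_const, Finset.card_range, nsmul_eq_mul] at h4
  push_cast at h4
  nlinarith

/-- Cauchy condensation: each dyadic block of `a` is at least its length times its last term. -/
theorem sum_pow_two_mul_le_of_antitone {a : ℕ → ℝ} (ha : Antitone a) (h0 : ∀ k, 0 ≤ a k) (R : ℕ) :
    ∑ r ∈ Finset.range R, 2 ^ r * a (2 ^ r - 1) ≤ 3 * ∑ k ∈ Finset.range (2 ^ R), a k := by
  have key : ∀ R, ∑ r ∈ Finset.range (R + 1), 2 ^ r * a (2 ^ r - 1)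
      ≤ a 0 + 2 * ∑ k ∈ Finset.range (2 ^ R), a k := by
    intro R
    induction R with
    | zero => simp; linarith [h0 0]
    | succ R ih =>
      rw [Finset.sum_range_succ]
      have h1 : ∑ k ∈ Finset.range (2 ^ (R + 1)), a k
          = ∑ k ∈ Finset.range (2 ^ R), a k + ∑ k ∈ Finset.Ico (2 ^ R) (2 ^ (R + 1)), a k := by
        exact (Finset.sum_range_add_sum_Ico _
          (Nat.pow_le_pow_right (by norm_num) (by omega))).symm
      have h2 : 2 ^ R * a (2 ^ (R + 1) - 1) ≤ ∑ k ∈ Finset.Ico (2 ^ R) (2 ^ (R + 1)), a k := by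
        have := Finset.card_nsmul_le_sum (Finset.Ico (2 ^ R) (2 ^ (R + 1))) a
          (a (2 ^ (R + 1) - 1)) fun k hk => ha (by simp only [Finset.mem_Ico] at hk; omega)
        rw [Nat.card_Ico, nsmul_eq_mul] at this
        have e : 2 ^ (R + 1) - 2 ^ R = 2 ^ R := by rw [pow_succ]; omega
        rw [e] at this
        push_cast at this
        exact this
      rw [h1, pow_succ (2 : ℝ) R]
      linarith
  have hpos : ∀ R, a 0 ≤ ∑ k ∈ Finset.range (2 ^ R), a k := fun R =>
    Finset.single_le_sum (f := a) (fun k _ => h0 k) (by simp)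
  have h1 := key R
  rw [Finset.sum_range_succ] at h1
  have h2 := hpos R
  have h3 : 0 ≤ 2 ^ R * a (2 ^ R - 1) := mul_nonneg (by positivity) (h0 _)
  linarith

/-- Load bound of a job class thinned by the factor `2 ^ k`. -/
noncomputable def thinLoad (N : Seminorm ℝ (ι → ℝ)) (A k : ℕ) : ℝ :=
  ∑ s ∈ Finset.range (A + 1), (1 / 2 : ℝ) ^ s * prof N (cap N s / 2 ^ k + 1)

theorem thinLoad_nonneg (N : Seminorm ℝ (ι → ℝ)) (A k : ℕ) : 0 ≤ thinLoad N A k :=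
  Finset.sum_nonneg fun s _ => mul_nonneg (by positivity) (prof_nonneg N _)

theorem thinLoad_antitone (N : Seminorm ℝ (ι → ℝ)) (A : ℕ) : Antitone (thinLoad N A) := by
  intro k l h
  refine Finset.sum_le_sum fun s _ => mul_le_mul_of_nonneg_left (prof_mono N ?_) (by positivity)
  have : cap N s / 2 ^ l ≤ cap N s / 2 ^ k :=
    Nat.div_le_div_left (Nat.pow_le_pow_right (by norm_num) h) (by positivity)
  omega

/-- Bundle `r` of the rounding opens tokens `2 ^ r` times as often but is compared with jobs thinned
by `2 ^ (2 ^ r - 1)`. Condensation turns the sum over the bundles into the sum over all thinning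
exponents, so that the number of bundles costs nothing extra. -/
theorem SymMono.sum_thinLoad_le [Nonempty ι] {N : Seminorm ℝ (ι → ℝ)} (hN : SymMono N) {A : ℕ}
    (hA : Fintype.card ι ≤ 2 ^ A) {R : ℕ} (hR : 2 ^ R ≤ 2 * (A + 1)) :
    ∑ r ∈ Finset.range R, 2 ^ r * thinLoad N A (2 ^ r - 1) ≤ 36 * (A + 1) := by
  refine (sum_pow_two_mul_le_of_antitone (thinLoad_antitone N A) (thinLoad_nonneg N A) R).trans ?_
  have h1 := hN.level_double_sum_le hA (2 ^ R)
  rw [Finset.sum_comm] at h1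
  have h2 : ((2 ^ R : ℕ) : ℝ) ≤ ((2 * (A + 1) : ℕ) : ℝ) := by exact_mod_cast hR
  push_cast at h1 h2
  simp only [thinLoad]
  linarith

end Profile

/-! ### The multiplicative weights process for nested covering -/

theorem exists_subset_sum_mem_Icc {α : Type*} [DecidableEq α] (f : α → ℝ) (A : Finset α)
    (h1 : ∀ x ∈ A, f x ≤ 1) (hA : 1 ≤ ∑ x ∈ A, f x) :
    ∃ U ⊆ A, 1 ≤ ∑ x ∈ U, f x ∧ ∑ x ∈ U, f x ≤ 2 := by
  induction A using Finset.induction_on with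
  | empty => simp at hA; linarith
  | insert x A hx ih =>
    by_cases h : 1 ≤ ∑ x ∈ A, f x
    · obtain ⟨U, hU, h2⟩ := ih (fun y hy => h1 y (by simp [hy])) h
      exact ⟨U, hU.trans (Finset.subset_insert _ _), h2⟩
    · refine ⟨_, subset_rfl, hA, ?_⟩
      rw [Finset.sum_insert hx]
      linarith [h1 x (by simp)]

/-- Parameters of the multiplicative weights process: groups `γ`, slots `υ`, their costs, initial
values, the load bound `B`, the value cap `V` and the price increment `ε`. -/
structure Mwu (γ υ : Type) where
  par : υ → γ
  C : γ → ℝ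
  c : υ → ℝ
  v0 : ℝ
  z0 : ℝ
  B : ℝ
  V : ℝ
  ε : ℝ

/-- State of the multiplicative weights process: group values, slot values, and the number of price
increments of the current job. -/
structure MState (γ υ : Type) where
  v : γ → ℝ
  z : υ → ℝ
  k : ℕ

/-- A job of the multiplicative weights process: allowed slots and relative loads. -/
structure MJob (υ : Type) where
  al : Finset υ
  lam : υ → ℝ

namespace Mwu

variable {γ υ : Type} [Fintype γ] [Fintype υ] [DecidableEq γ] [DecidableEq υ]

/-- Price of a slot for a job. -/
noncomputable def price (P : Mwu γ υ) (J : MJob υ) (s : MState γ υ) (u : υ) : ℝ :=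
  P.C (P.par u) * P.c u * J.lam u * max 1 (s.z u / s.v (P.par u)) * max 1 (s.v (P.par u))

open Classical in
/-- Slots that the job can afford at the next price. -/
noncomputable def act (P : Mwu γ υ) (J : MJob υ) (s : MState γ υ) : Finset υ :=
  J.al.filter fun u => P.price J s u ≤ P.ε * (s.k + 1)

/-- Fraction to which a slot is open, relative to its group. -/
noncomputable def frac (P : Mwu γ υ) (s : MState γ υ) (u : υ) : ℝ :=
  min 1 (s.z u / s.v (P.par u))

/-- Total fraction of a set of slots within a group. -/
noncomputable def gsum (P : Mwu γ υ) (s : MState γ υ) (A : Finset υ) (g : γ) : ℝ :=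
  ∑ u ∈ A with P.par u = g, P.frac s u

/-- Coverage that a group provides by a set of slots. -/
noncomputable def gcov (P : Mwu γ υ) (s : MState γ υ) (A : Finset υ) (g : γ) : ℝ :=
  min 1 (s.v g) * min 1 (P.gsum s A g)

/-- The slots in `A` cover a job. -/
def Cov (P : Mwu γ υ) (s : MState γ υ) (A : Finset υ) : Prop := 1 ≤ ∑ g, P.gcov s A g

/-- Weight of the slot values of a group. -/
noncomputable def Q (P : Mwu γ υ) (z : υ → ℝ) (g : γ) : ℝ := ∑ u with P.par u = g, P.c u * z u

/-- Raise group values so that they dominate the weights of their slots, up to the cap. -/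
noncomputable def raise (P : Mwu γ υ) (v : γ → ℝ) (z : υ → ℝ) (g : γ) : ℝ :=
  min P.V (max (v g) (P.Q z g / P.B))

open Classical in
/-- Group values after a price increment, before the domination step. -/
noncomputable def microV (P : Mwu γ υ) (s : MState γ υ) (A : Finset υ) (g : γ) : ℝ :=
  if 1 ≤ P.gsum s A g then s.v g * (1 + P.ε / (P.C g * P.B)) else s.v g

open Classical in
/-- Slot values after a price increment. -/
noncomputable def microZ (P : Mwu γ υ) (s : MState γ υ) (A : Finset υ) (u : υ) : ℝ :=
  if u ∈ A ∧ P.gsum s A (P.par u) < 1 then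
    s.z u * (1 + P.ε / (P.C (P.par u) * P.c u * max 1 (s.v (P.par u)))) else s.z u

open Classical in
/-- One price increment. -/
noncomputable def micro (P : Mwu γ υ) (J : MJob υ) (s : MState γ υ) : MState γ υ :=
  if P.Cov s (P.act J s) then s else
    ⟨P.raise (P.microV s (P.act J s)) (P.microZ s (P.act J s)), P.microZ s (P.act J s), s.k + 1⟩

/-- A selection of slots that covers the job without waste. -/
def IsSel (P : Mwu γ υ) (s : MState γ υ) (A U : Finset υ) : Prop :=
  U ⊆ A ∧ (∀ g, P.gsum s U g ≤ 2 * min 1 (P.gsum s U g)) ∧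
    1 ≤ ∑ g, P.gcov s U g ∧ ∑ g, P.gcov s U g ≤ 2

open Classical in
/-- The slots used by a job. -/
noncomputable def used (P : Mwu γ υ) (J : MJob υ) (s : MState γ υ) : Finset υ :=
  if h : ∃ U, P.IsSel s (P.act J s) U then h.choose else ∅

/-- Slot values after the job is charged to the slots it uses. -/
noncomputable def loadZ (P : Mwu γ υ) (J : MJob υ) (s : MState γ υ) (u : υ) : ℝ :=
  if u ∈ P.used J s then s.z u * (1 + J.lam u) else s.z u

/-- Charge the job to the slots it uses. -/
noncomputable def charge (P : Mwu γ υ) (J : MJob υ) (s : MState γ υ) : MState γ υ :=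
  ⟨P.raise s.v (P.loadZ J s), P.loadZ J s, 0⟩

/-- One step of the process: every job goes through `N` price increments and a charge. -/
noncomputable def step (P : Mwu γ υ) (N : ℕ) (J : ℕ → MJob υ) (τ : ℕ) (s : MState γ υ) :
    MState γ υ :=
  if τ % (N + 1) = N then P.charge (J (τ / (N + 1))) s else P.micro (J (τ / (N + 1))) s

/-- The sequence of states. -/
noncomputable def tr (P : Mwu γ υ) (N : ℕ) (J : ℕ → MJob υ) : ℕ → MState γ υ
  | 0 => ⟨fun _ => P.v0, fun _ => P.z0, 0⟩
  | τ + 1 => P.step N J τ (tr P N J τ)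

/-- Standing assumptions on the parameters. -/
structure Good (P : Mwu γ υ) (a Am n : ℕ) : Prop where
  ham : a ≤ Am
  v0_eq : P.v0 = (1 / 2) ^ a
  z0_eq : P.z0 = (1 / 2) ^ (a + Am)
  B_eq : P.B = 960 * ((Am : ℝ) + 1) ^ 2
  V_eq : P.V = 2 ^ (3 * a + 7)
  ε_pos : 0 < P.ε
  nε : n * P.ε ≤ 1
  C_ge : ∀ g, (1 / 2) ^ a ≤ P.C g
  c_pos : ∀ u, 0 < P.c u
  ε_le_C : ∀ g, P.ε ≤ P.C g
  ε_le : ∀ u, P.ε ≤ P.C (P.par u) * P.c u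
  sum_C : (∑ g, P.C g) * P.v0 ≤ a + 1
  sum_c : ∀ g, P.Q (fun _ => P.z0) g ≤ (Am + 1) * P.v0

namespace Good
variable {P : Mwu γ υ} {a Am n : ℕ}

omit [DecidableEq υ] in
theorem C_pos (h : P.Good a Am n) (g : γ) : 0 < P.C g :=
  lt_of_lt_of_le (by positivity) (h.C_ge g)
omit [DecidableEq υ] in
theorem v0_pos (h : P.Good a Am n) : 0 < P.v0 := by rw [h.v0_eq]; positivity
omit [DecidableEq υ] in
theorem z0_pos (h : P.Good a Am n) : 0 < P.z0 := by rw [h.z0_eq]; positivity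
omit [DecidableEq υ] in
theorem B_ge (h : P.Good a Am n) : 960 ≤ P.B := by
  rw [h.B_eq]
  have : (0 : ℝ) ≤ Am := by positivity
  nlinarith
omit [DecidableEq υ] in
theorem B_pos (h : P.Good a Am n) : 0 < P.B := by linarith [h.B_ge]
omit [DecidableEq υ] in
theorem V_ge (h : P.Good a Am n) : 2 ≤ P.V := by
  rw [h.V_eq]
  calc (2 : ℝ) = 2 ^ 1 := by norm_num
    _ ≤ _ := pow_le_pow_right₀ (by norm_num) (by omega)
omit [DecidableEq υ] in
theorem V_pos (h : P.Good a Am n) : 0 < P.V := by linarith [h.V_ge]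
omit [DecidableEq υ] in
theorem v0_le_one (h : P.Good a Am n) : P.v0 ≤ 1 := by
  rw [h.v0_eq]; exact pow_le_one₀ (by norm_num) (by norm_num)

end Good

/-- Invariants of the states. -/
structure Inv (P : Mwu γ υ) (s : MState γ υ) : Prop where
  v0_le : ∀ g, P.v0 ≤ s.v g
  le_V : ∀ g, s.v g ≤ P.V
  z0_le : ∀ u, P.z0 ≤ s.z u
  Q_le : ∀ g, s.v g < P.V → P.Q s.z g ≤ P.B * s.v g

/-- Cost of a state. -/
noncomputable def T (P : Mwu γ υ) (s : MState γ υ) : ℝ := ∑ g, P.C g * (P.B * s.v g + P.Q s.z g)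

/-! ### Change of the potential in a single step -/

section Steps
variable {P : Mwu γ υ} {a Am n : ℕ} {s : MState γ υ} {J : MJob υ}

omit [Fintype γ] in
theorem Q_mono (hc : ∀ u, 0 < P.c u) {z z' : υ → ℝ} (h : ∀ u, z u ≤ z' u) (g : γ) :
    P.Q z g ≤ P.Q z' g :=
  Finset.sum_le_sum fun u _ => mul_le_mul_of_nonneg_left (h u) (hc u).le

theorem Inv.of_raise (h : P.Good a Am n) (hs : P.Inv s) {v' : γ → ℝ} {z' : υ → ℝ} {k : ℕ}
    (hv : ∀ g, s.v g ≤ v' g) (hz : ∀ u, s.z u ≤ z' u) : P.Inv ⟨P.raise v' z', z', k⟩ ∧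
      ∀ g, s.v g ≤ P.raise v' z' g := by
  have h1 : ∀ g, s.v g ≤ P.raise v' z' g := fun g =>
    le_min (hs.le_V g) ((hv g).trans (le_max_left _ _))
  refine ⟨⟨fun g => (hs.v0_le g).trans (h1 g), fun g => min_le_left _ _,
    fun u => (hs.z0_le u).trans (hz u), fun g hg => ?_⟩, h1⟩
  have h2 : P.raise v' z' g < P.V := hg
  unfold raise at h2
  have h3 : max (v' g) (P.Q z' g / P.B) < P.V := by
    by_contra hc
    rw [min_eq_left (not_lt.mp hc)] at h2
    exact lt_irrefl _ h2
  show P.Q z' g ≤ P.B * P.raise v' z' g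
  unfold raise
  rw [min_eq_right h3.le]
  have := le_max_right (v' g) (P.Q z' g / P.B)
  rw [div_le_iff₀ h.B_pos] at this
  linarith

/-- Below the cap the invariant gives `Q ≤ B v` before the step, so restoring domination raises `B
v` by at most the growth of `Q`. This is the factor `2` on the slot part. At the cap `v` does not
move. -/
theorem T_raise_le (h : P.Good a Am n) (hs : P.Inv s) {v' : γ → ℝ} {z' : υ → ℝ} {k : ℕ}
    (hv : ∀ g, s.v g ≤ v' g) (hz : ∀ u, s.z u ≤ z' u) :
    P.T ⟨P.raise v' z', z', k⟩ ≤ P.T s +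
      ∑ g, (P.C g * P.B * (v' g - s.v g) + 2 * (P.C g * (P.Q z' g - P.Q s.z g))) := by
  unfold T
  rw [← Finset.sum_add_distrib]
  refine Finset.sum_le_sum fun g _ => ?_
  have hQ := Q_mono h.c_pos hz g
  have hC := h.C_pos g
  have hB := h.B_pos
  have key : P.B * P.raise v' z' g ≤ P.B * v' g + (P.Q z' g - P.Q s.z g) := by
    unfold raise
    rcases (hs.le_V g).lt_or_eq with hlt | heq
    · have h1 := hs.Q_le g hlt
      have h2 : max (v' g) (P.Q z' g / P.B) ≤ v' g + (P.Q z' g - P.Q s.z g) / P.B := by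
        refine max_le (le_add_of_nonneg_right (div_nonneg (by linarith) hB.le)) ?_
        rw [div_le_iff₀ hB, add_mul, div_mul_cancel₀ _ hB.ne']
        nlinarith [hv g]
      calc P.B * min P.V (max (v' g) (P.Q z' g / P.B))
          ≤ P.B * (v' g + (P.Q z' g - P.Q s.z g) / P.B) := by
            gcongr; exact (min_le_right _ _).trans h2
        _ = _ := by field_simp
    · have : P.B * min P.V (max (v' g) (P.Q z' g / P.B)) ≤ P.B * v' g := by
        gcongr; exact (min_le_left _ _).trans (heq ▸ hv g)
      linarith
  have := mul_le_mul_of_nonneg_left key hC.le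
  simp only
  nlinarith

theorem frac_nonneg (h : P.Good a Am n) (hs : P.Inv s) (u : υ) : 0 ≤ P.frac s u := by
  have := h.v0_pos.trans_le (hs.v0_le (P.par u))
  have := h.z0_pos.trans_le (hs.z0_le u)
  unfold frac; positivity

theorem gsum_nonneg (h : P.Good a Am n) (hs : P.Inv s) (A : Finset υ) (g : γ) :
    0 ≤ P.gsum s A g := Finset.sum_nonneg fun u _ => frac_nonneg h hs u

theorem gcov_nonneg (h : P.Good a Am n) (hs : P.Inv s) (A : Finset υ) (g : γ) :
    0 ≤ P.gcov s A g := by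
  have := h.v0_pos.trans_le (hs.v0_le g)
  have := gsum_nonneg h hs A g
  unfold gcov; positivity

theorem le_microV (h : P.Good a Am n) (hs : P.Inv s) (A : Finset υ) (g : γ) :
    s.v g ≤ P.microV s A g := by
  unfold microV
  have h1 := h.v0_pos.trans_le (hs.v0_le g)
  have h2 : 0 ≤ P.ε / (P.C g * P.B) := div_nonneg h.ε_pos.le (mul_pos (h.C_pos g) h.B_pos).le
  split_ifs
  · nlinarith
  · exact le_rfl

theorem le_microZ (h : P.Good a Am n) (hs : P.Inv s) (A : Finset υ) (u : υ) :
    s.z u ≤ P.microZ s A u := by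
  unfold microZ
  have h1 := h.z0_pos.trans_le (hs.z0_le u)
  have h2 : 0 ≤ P.ε / (P.C (P.par u) * P.c u * max 1 (s.v (P.par u))) :=
    div_nonneg h.ε_pos.le (mul_pos (mul_pos (h.C_pos _) (h.c_pos u))
      (lt_of_lt_of_le one_pos (le_max_left _ _))).le
  split_ifs
  · nlinarith
  · exact le_rfl

theorem le_loadZ (h : P.Good a Am n) (hs : P.Inv s) (hJ : ∀ u, 0 ≤ J.lam u) (u : υ) :
    s.z u ≤ P.loadZ J s u := by
  unfold loadZ
  have h1 := h.z0_pos.trans_le (hs.z0_le u)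
  have h2 := hJ u
  split_ifs
  · nlinarith
  · exact le_rfl

theorem micro_spec (h : P.Good a Am n) (hs : P.Inv s) : P.Inv (P.micro J s) ∧
    (∀ g, s.v g ≤ (P.micro J s).v g) ∧ ∀ u, s.z u ≤ (P.micro J s).z u := by
  unfold micro
  split_ifs
  · exact ⟨hs, fun _ => le_rfl, fun _ => le_rfl⟩
  · obtain ⟨h1, h2⟩ := hs.of_raise h (k := s.k + 1) (le_microV h hs (P.act J s))
      (le_microZ h hs (P.act J s))
    exact ⟨h1, h2, le_microZ h hs _⟩

theorem charge_spec (h : P.Good a Am n) (hs : P.Inv s) (hJ : ∀ u, 0 ≤ J.lam u) :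
    P.Inv (P.charge J s) ∧
    (∀ g, s.v g ≤ (P.charge J s).v g) ∧ ∀ u, s.z u ≤ (P.charge J s).z u := by
  obtain ⟨h1, h2⟩ := hs.of_raise h (k := 0) (fun _ => le_rfl) (le_loadZ h hs hJ)
  exact ⟨h1, h2, le_loadZ h hs hJ⟩

theorem lt_one_of_not_cov (h : P.Good a Am n) (hs : P.Inv s) {A : Finset υ} (hn : ¬ P.Cov s A)
    {g : γ} (hg : 1 ≤ P.gsum s A g) : s.v g < 1 := by
  by_contra hc
  refine hn ?_
  have : P.gcov s A g = 1 := by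
    unfold gcov; rw [min_eq_left hg, min_eq_left (not_lt.mp hc)]; norm_num
  unfold Cov
  rw [← this]
  exact Finset.single_le_sum (f := P.gcov s A) (fun g _ => gcov_nonneg h hs A g) (by simp)

/-- In an unsaturated group no fraction is truncated. Price increments therefore act on a slot only
while `z < v ≤ V`, which later bounds the logarithmic growth of `z`. -/
theorem frac_of_gsum_lt (h : P.Good a Am n) (hs : P.Inv s) {A : Finset υ} {u : υ} (hu : u ∈ A)
    (hg : P.gsum s A (P.par u) < 1) : P.frac s u = s.z u / s.v (P.par u) ∧
      s.z u < s.v (P.par u) := by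
  have h1 : P.frac s u ≤ P.gsum s A (P.par u) := by
    unfold gsum
    exact Finset.single_le_sum (f := P.frac s) (fun u _ => frac_nonneg h hs u) (by simp [hu])
  have h2 : P.frac s u < 1 := h1.trans_lt hg
  have h3 := h.v0_pos.trans_le (hs.v0_le (P.par u))
  unfold frac at h2 ⊢
  have h4 : s.z u / s.v (P.par u) < 1 := by
    by_contra hc
    rw [min_eq_left (not_lt.mp hc)] at h2
    exact lt_irrefl _ h2
  exact ⟨min_eq_right h4.le, (div_lt_one h3).mp h4⟩

/-- The growth rates are chosen so that a group adds exactly `ε` times its coverage to the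
potential, whether its own value grows (saturated case, where `v < 1`) or those of its slots. The
job is uncovered, so the coverages sum to less than one; the domination step at most doubles the
total. -/
theorem T_micro_le (h : P.Good a Am n) (hs : P.Inv s) (hn : ¬ P.Cov s (P.act J s)) :
    P.T (P.micro J s) ≤ P.T s + 2 * P.ε := by
  unfold micro
  rw [if_neg hn]
  refine (T_raise_le h hs (le_microV h hs _) (le_microZ h hs _)).trans ?_
  set A := P.act J s with hA
  have key : ∀ g, P.C g * P.B * (P.microV s A g - s.v g)
      + 2 * (P.C g * (P.Q (P.microZ s A) g - P.Q s.z g)) ≤ 2 * P.ε * P.gcov s A g := by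
    intro g
    have hC := h.C_pos g
    have hB := h.B_pos
    have hv := h.v0_pos.trans_le (hs.v0_le g)
    by_cases hg : 1 ≤ P.gsum s A g
    · have hv1 := lt_one_of_not_cov h hs hn hg
      have e1 : P.Q (P.microZ s A) g = P.Q s.z g := by
        refine Finset.sum_congr rfl fun u hu => ?_
        have hu' : P.par u = g := by simpa using hu
        have : ¬ (u ∈ A ∧ P.gsum s A (P.par u) < 1) := by
          rw [hu']; exact fun hc => absurd hg (not_le.mpr hc.2)
        simp only [microZ, if_neg this]
      have e2 : P.gcov s A g = s.v g := by
        unfold gcov; rw [min_eq_left hg, min_eq_right hv1.le, mul_one]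
      have e3 : P.C g * P.B * (P.microV s A g - s.v g) = P.ε * s.v g := by
        unfold microV; rw [if_pos hg]; field_simp; ring
      rw [e1, e2, e3]
      nlinarith [mul_pos h.ε_pos hv]
    · have e1 : P.microV s A g = s.v g := by unfold microV; rw [if_neg hg]
      have hg' := not_le.mp hg
      have e2 : P.C g * (P.Q (P.microZ s A) g - P.Q s.z g)
          = ∑ u with P.par u = g, if u ∈ A then P.ε * (P.frac s u * min 1 (s.v g)) else 0 := by
        unfold Q
        rw [← Finset.sum_sub_distrib, Finset.mul_sum]
        refine Finset.sum_congr rfl fun u hu => ?_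
        have hu' : P.par u = g := by simpa using hu
        by_cases huA : u ∈ A
        · have hgu : P.gsum s A (P.par u) < 1 := by rw [hu']; exact hg'
          have hc := h.c_pos u
          simp only [microZ, if_pos (And.intro huA hgu), if_pos huA]
          rw [(frac_of_gsum_lt h hs huA hgu).1, hu']
          -- The factor `max 1 v` in the growth rate of slots turns `z` into `frac * min 1 v`, which
          -- is the coverage by the slot.
          have hm : s.v g = min 1 (s.v g) * max 1 (s.v g) := by
            rw [min_mul_max, one_mul]
          have hmx : 0 < max 1 (s.v g) := lt_of_lt_of_le one_pos (le_max_left _ _)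
          have h6 : s.z u / s.v g * min 1 (s.v g) = s.z u / max 1 (s.v g) := by
            rw [div_mul_eq_mul_div, div_eq_div_iff hv.ne' hmx.ne', mul_assoc, ← hm]
          rw [h6]
          field_simp
          ring
        · simp [microZ, huA]
      rw [e1, e2, ← Finset.sum_filter, Finset.filter_filter, ← Finset.mul_sum, ← Finset.sum_mul]
      have e3 : ∑ u with P.par u = g ∧ u ∈ A, P.frac s u = P.gsum s A g := by
        unfold gsum
        refine Finset.sum_congr ?_ fun _ _ => rfl
        ext u; simp [and_comm]
      rw [e3]
      have e4 : P.gcov s A g = min 1 (s.v g) * P.gsum s A g := by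
        unfold gcov; rw [min_eq_right hg'.le]
      rw [e4]
      apply le_of_eq; ring
  have h2 := Finset.sum_le_sum fun g (_ : g ∈ Finset.univ) => key g
  rw [← Finset.mul_sum] at h2
  have h3 : ∑ g, P.gcov s A g ≤ 1 := (not_le.mp hn).le
  have h4 := mul_le_mul_of_nonneg_left h3 (by linarith [h.ε_pos] : 0 ≤ 2 * P.ε)
  linarith

/-- Single fractions and single group coverages are at most one, so partial sums can be stopped
between `1` and `2`: first over the slots of each group, then over the groups. -/
theorem exists_isSel (h : P.Good a Am n) (hs : P.Inv s) {A : Finset υ} (hA : P.Cov s A) :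
    ∃ U, P.IsSel s A U := by
  classical
  have h1 : ∀ g, ∃ U ⊆ A.filter (fun u => P.par u = g),
      min 1 (∑ u ∈ U, P.frac s u) = min 1 (P.gsum s A g) ∧
      ∑ u ∈ U, P.frac s u ≤ 2 * min 1 (∑ u ∈ U, P.frac s u) := by
    intro g
    by_cases hg : 1 ≤ P.gsum s A g
    · obtain ⟨U, hU, hU1, hU2⟩ := exists_subset_sum_mem_Icc (P.frac s)
        (A.filter fun u => P.par u = g) (fun u _ => min_le_left _ _) hg
      exact ⟨U, hU, by rw [min_eq_left hU1, min_eq_left hg], by rw [min_eq_left hU1]; linarith⟩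
    · refine ⟨_, subset_rfl, rfl, ?_⟩
      have := gsum_nonneg h hs A g
      have h2 : P.gsum s A g < 1 := not_le.mp hg
      change P.gsum s A g ≤ 2 * min 1 (P.gsum s A g)
      rw [min_eq_right h2.le]; linarith
  choose W hWs hW1 hW2 using h1
  obtain ⟨G, _, hG1, hG2⟩ := exists_subset_sum_mem_Icc (P.gcov s A) Finset.univ
    (fun g _ => mul_le_one₀ (min_le_left _ _) (le_min zero_le_one (gsum_nonneg h hs A g))
      (min_le_left _ _)) hA
  have hpar : ∀ g, ∀ u ∈ W g, u ∈ A ∧ P.par u = g := fun g u hu => by simpa using hWs g hu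
  have hgs : ∀ g, P.gsum s (G.biUnion W) g = if g ∈ G then ∑ u ∈ W g, P.frac s u else 0 := by
    intro g
    unfold gsum
    by_cases hg : g ∈ G
    · rw [if_pos hg]
      refine Finset.sum_congr ?_ fun _ _ => rfl
      ext u
      simp only [Finset.mem_filter, Finset.mem_biUnion]
      constructor
      · rintro ⟨⟨g', _, hu⟩, e⟩
        rw [← e, (hpar g' u hu).2]; exact hu
      · exact fun hu => ⟨⟨g, hg, hu⟩, (hpar g u hu).2⟩
    · rw [if_neg hg]
      refine Finset.sum_eq_zero fun u hu => ?_
      simp only [Finset.mem_filter, Finset.mem_biUnion] at hu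
      obtain ⟨⟨g', hg', hu⟩, e⟩ := hu
      exact absurd (by rw [← e, (hpar g' u hu).2]; exact hg') hg
  have hcv : ∑ g, P.gcov s (G.biUnion W) g = ∑ g ∈ G, P.gcov s A g := by
    rw [← Finset.sum_subset (Finset.subset_univ G)]
    · refine Finset.sum_congr rfl fun g hg => ?_
      unfold gcov
      rw [hgs, if_pos hg, hW1]
    · intro g _ hg
      unfold gcov
      rw [hgs, if_neg hg]; simp
  refine ⟨G.biUnion W, fun u hu => ?_, fun g => ?_, by rw [hcv]; exact hG1, by rw [hcv]; exact hG2⟩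
  · obtain ⟨g, _, hu⟩ := Finset.mem_biUnion.mp hu
    exact (hpar g u hu).1
  · rw [hgs]
    split_ifs
    · exact hW2 g
    · simp

theorem used_spec (h : P.Good a Am n) (hs : P.Inv s) (hA : P.Cov s (P.act J s)) :
    P.IsSel s (P.act J s) (P.used J s) := by
  have := exists_isSel h hs hA
  unfold used
  rw [dif_pos this]
  exact this.choose_spec

theorem used_subset : P.used J s ⊆ J.al := by
  classical
  unfold used
  split_ifs with h
  · exact h.choose_spec.1.trans (Finset.filter_subset _ _)
  · exact Finset.empty_subset _

/-- The growth of `C * c * z` on a used slot is its price times its effective fraction `min 1 v *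
frac`. Used slots are affordable, and a selection without waste has total effective fraction at most
`2 * 2`; the domination step doubles this to `8`. -/
theorem T_charge_le (h : P.Good a Am n) (hs : P.Inv s) (hJ : ∀ u, 0 ≤ J.lam u) :
    P.T (P.charge J s) ≤ P.T s + 8 * (P.ε * (s.k + 1)) := by
  classical
  have hy : 0 ≤ P.ε * (s.k + 1) := mul_nonneg h.ε_pos.le (by positivity)
  unfold charge
  refine (T_raise_le h hs (fun _ => le_rfl) (le_loadZ h hs hJ)).trans ?_
  simp only [sub_self, mul_zero, zero_add]
  set U := P.used J s with hU
  have hspec : U = ∅ ∨ P.IsSel s (P.act J s) U := by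
    by_cases hex : ∃ U, P.IsSel s (P.act J s) U
    · right; rw [hU]; unfold used; rw [dif_pos hex]; exact hex.choose_spec
    · left; rw [hU]; unfold used; rw [dif_neg hex]
  have key : ∀ g, P.C g * (P.Q (P.loadZ J s) g - P.Q s.z g)
      ≤ P.ε * (s.k + 1) * (min 1 (s.v g) * P.gsum s U g) := by
    intro g
    have hC := h.C_pos g
    have hv := h.v0_pos.trans_le (hs.v0_le g)
    unfold Q gsum
    rw [← Finset.sum_sub_distrib, Finset.mul_sum, Finset.mul_sum, Finset.mul_sum,
      Finset.filter_congr_decidable]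
    have : ∑ u ∈ U with P.par u = g, P.ε * (s.k + 1) * (min 1 (s.v g) * P.frac s u)
        = ∑ u with P.par u = g,
          if u ∈ U then P.ε * (s.k + 1) * (min 1 (s.v g) * P.frac s u) else 0 := by
      rw [← Finset.sum_filter, Finset.filter_filter]
      refine Finset.sum_congr ?_ fun _ _ => rfl
      ext u; simp [and_comm]
    rw [this]
    refine Finset.sum_le_sum fun u hu => ?_
    have hu' : P.par u = g := by simpa using hu
    by_cases huU : u ∈ U
    · have hact : u ∈ P.act J s := by
        rcases hspec with he | hsel
        · rw [he] at huU; simp at huU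
        · exact hsel.1 huU
      have hpr : P.price J s u ≤ P.ε * (s.k + 1) := by
        unfold act at hact; exact (Finset.mem_filter.mp hact).2
      rw [if_pos huU]
      simp only [loadZ, ← hU, if_pos huU]
      have hz := h.z0_pos.trans_le (hs.z0_le u)
      unfold price at hpr
      rw [hu'] at hpr
      unfold frac
      rw [hu']
      -- This factorisation explains the two maxima in `price`: they are what remains of `z` after
      -- division by the effective fraction.
      have hid : s.z u = min 1 (s.v g) * min 1 (s.z u / s.v g) *
          (max 1 (s.z u / s.v g) * max 1 (s.v g)) := by
        have e1 : min 1 (s.v g) * max 1 (s.v g) = s.v g := by rw [min_mul_max, one_mul]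
        have e2 : min 1 (s.z u / s.v g) * max 1 (s.z u / s.v g) = s.z u / s.v g := by
          rw [min_mul_max, one_mul]
        calc s.z u = s.v g * (s.z u / s.v g) := by field_simp
          _ = (min 1 (s.v g) * max 1 (s.v g)) *
              (min 1 (s.z u / s.v g) * max 1 (s.z u / s.v g)) := by rw [e1, e2]
          _ = _ := by ring
      have h0 : 0 ≤ min 1 (s.v g) * min 1 (s.z u / s.v g) := by positivity
      calc P.C g * (P.c u * (s.z u * (1 + J.lam u)) - P.c u * s.z u)
          = P.C g * P.c u * J.lam u * s.z u := by ring
        _ = P.C g * P.c u * J.lam u * (min 1 (s.v g) * min 1 (s.z u / s.v g) *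
          (max 1 (s.z u / s.v g) * max 1 (s.v g))) := by rw [← hid]
        _ = (P.C g * P.c u * J.lam u * max 1 (s.z u / s.v g) * max 1 (s.v g)) *
          (min 1 (s.v g) * min 1 (s.z u / s.v g)) := by ring
        _ ≤ _ := mul_le_mul_of_nonneg_right hpr h0
    · simp only [loadZ, ← hU, if_neg huU]; simp
  have hsum : ∑ g, min 1 (s.v g) * P.gsum s U g ≤ 4 := by
    rcases hspec with he | hsel
    · simp [he, gsum]
    · have : ∀ g, min 1 (s.v g) * P.gsum s U g ≤ 2 * P.gcov s U g := by
        intro g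
        have hv := h.v0_pos.trans_le (hs.v0_le g)
        have h0 : 0 ≤ min 1 (s.v g) := by positivity
        have := mul_le_mul_of_nonneg_left (hsel.2.1 g) h0
        unfold gcov; linarith
      have h1 := Finset.sum_le_sum fun g (_ : g ∈ Finset.univ) => this g
      rw [← Finset.mul_sum] at h1
      linarith [hsel.2.2.2]
  have h2 := Finset.sum_le_sum fun g (_ : g ∈ Finset.univ) => key g
  rw [← Finset.mul_sum] at h2
  have h3 := mul_le_mul_of_nonneg_left hsum hy
  rw [← Finset.mul_sum]
  linarith

end Steps

end Mwu

/-! ### The whole run, compared with an offline solution -/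

theorem le_two_mul_log_one_add {x : ℝ} (h0 : 0 ≤ x) (h1 : x ≤ 1) : x ≤ 2 * Real.log (1 + x) := by
  have h := Real.one_sub_inv_le_log_of_pos (by linarith : 0 < 1 + x)
  have h2 : x / 2 ≤ 1 - (1 + x)⁻¹ := by
    have e : 1 - (1 + x)⁻¹ = x / (1 + x) := by field_simp; ring
    rw [e]
    exact div_le_div_of_nonneg_left h0 (by linarith) (by linarith)
  linarith

namespace Mwu

variable {γ υ : Type} [Fintype γ] [Fintype υ] [DecidableEq γ] [DecidableEq υ]
variable {P : Mwu γ υ} {a Am n N : ℕ} {J : ℕ → MJob υ}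

theorem tr_succ_micro {j i : ℕ} (hi : i < N) :
    P.tr N J (j * (N + 1) + (i + 1)) = P.micro (J j) (P.tr N J (j * (N + 1) + i)) := by
  have h1 : (j * (N + 1) + i) % (N + 1) = i := by
    rw [mul_comm, Nat.mul_add_mod, Nat.mod_eq_of_lt (by omega)]
  have h2 : (j * (N + 1) + i) / (N + 1) = j := by
    rw [mul_comm, Nat.mul_add_div (by omega), Nat.div_eq_of_lt (by omega), add_zero]
  rw [← add_assoc]
  show P.step N J _ _ = _
  unfold step
  rw [h1, h2, if_neg (by omega)]

theorem tr_succ_charge {j : ℕ} :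
    P.tr N J ((j + 1) * (N + 1)) = P.charge (J j) (P.tr N J (j * (N + 1) + N)) := by
  have h1 : (j * (N + 1) + N) % (N + 1) = N := by
    rw [mul_comm, Nat.mul_add_mod, Nat.mod_eq_of_lt (by omega)]
  have h2 : (j * (N + 1) + N) / (N + 1) = j := by
    rw [mul_comm, Nat.mul_add_div (by omega), Nat.div_eq_of_lt (by omega), add_zero]
  rw [show (j + 1) * (N + 1) = j * (N + 1) + N + 1 by ring]
  show P.step N J _ _ = _
  unfold step
  rw [h1, h2, if_pos rfl]

/-- The states up to the charge of a job depend on the jobs up to it only. -/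
theorem tr_congr {J' : ℕ → MJob υ} {t : ℕ} (hJ : ∀ j ≤ t, J j = J' j) :
    ∀ τ ≤ t * (N + 1) + N, P.tr N J τ = P.tr N J' τ := by
  intro τ
  induction τ with
  | zero => intro _; rfl
  | succ τ ih =>
    intro hτ
    have h1 : τ / (N + 1) ≤ t := by
      have : τ < (t + 1) * (N + 1) := by nlinarith
      have := (Nat.div_lt_iff_lt_mul (by omega : 0 < N + 1)).mpr this
      omega
    show P.step N J τ _ = P.step N J' τ _
    unfold step
    rw [ih (by omega), hJ _ h1]

section
variable (h : P.Good a Am n) (hJ : ∀ j u, 0 ≤ (J j).lam u)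
include h hJ

theorem tr_inv (τ : ℕ) : P.Inv (P.tr N J τ) := by
  induction τ with
  | zero =>
    refine ⟨fun _ => le_rfl, fun _ => ?_, fun _ => le_rfl, fun g _ => ?_⟩
    · exact h.v0_le_one.trans (by linarith [h.V_ge])
    · refine (h.sum_c g).trans (mul_le_mul_of_nonneg_right ?_ h.v0_pos.le)
      rw [h.B_eq]
      have : (0 : ℝ) ≤ Am := by positivity
      nlinarith
  | succ τ ih =>
    show P.Inv (P.step N J τ _)
    unfold step
    split_ifs
    · exact (charge_spec h ih (hJ _)).1
    · exact (micro_spec h ih).1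

theorem tr_mono : (∀ g, Monotone fun τ => (P.tr N J τ).v g) ∧
    ∀ u, Monotone fun τ => (P.tr N J τ).z u := by
  have key : ∀ τ, (∀ g, (P.tr N J τ).v g ≤ (P.tr N J (τ + 1)).v g) ∧
      ∀ u, (P.tr N J τ).z u ≤ (P.tr N J (τ + 1)).z u := by
    intro τ
    show (∀ g, _ ≤ (P.step N J τ _).v g) ∧ ∀ u, _ ≤ (P.step N J τ _).z u
    unfold step
    split_ifs
    · exact (charge_spec h (tr_inv h hJ τ) (hJ _)).2
    · exact (micro_spec h (tr_inv h hJ τ)).2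
  exact ⟨fun g => monotone_nat_of_le_succ fun τ => (key τ).1 g,
    fun u => monotone_nat_of_le_succ fun τ => (key τ).2 u⟩

omit h hJ in
theorem tr_k_zero (j : ℕ) : (P.tr N J (j * (N + 1))).k = 0 := by
  cases j with
  | zero => simp [tr]
  | succ j => rw [tr_succ_charge]; rfl

theorem T_job_le (j : ℕ) {i : ℕ} (hi : i ≤ N) : P.T (P.tr N J (j * (N + 1) + i))
    ≤ P.T (P.tr N J (j * (N + 1))) + 2 * P.ε * (P.tr N J (j * (N + 1) + i)).k := by
  induction i with
  | zero => simp [tr_k_zero]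
  | succ i ih =>
    have ih := ih (by omega)
    rw [tr_succ_micro (by omega)]
    by_cases hc : P.Cov (P.tr N J (j * (N + 1) + i)) (P.act (J j) (P.tr N J (j * (N + 1) + i)))
    · simpa [micro, hc] using ih
    · have h1 := T_micro_le h (tr_inv h hJ _) hc
      have h2 : (P.micro (J j) (P.tr N J (j * (N + 1) + i))).k
          = (P.tr N J (j * (N + 1) + i)).k + 1 := by simp [micro, hc]
      rw [h2]; push_cast
      linarith

theorem T_le_sum (m : ℕ) : P.T (P.tr N J (m * (N + 1))) ≤ P.T (P.tr N J 0)
    + 10 * ∑ j ∈ Finset.range m, P.ε * ((P.tr N J (j * (N + 1) + N)).k + 1) := by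
  induction m with
  | zero => simp
  | succ m ih =>
    rw [Finset.sum_range_succ, tr_succ_charge]
    have h1 := T_charge_le h (tr_inv h hJ (N := N) (m * (N + 1) + N)) (hJ m)
    have h2 := T_job_le h hJ m (le_refl N)
    have := h.ε_pos
    nlinarith

theorem T_zero_le : P.T (P.tr N J 0) ≤ 2 * P.B * (a + 1) := by
  have h1 : ∀ g, P.C g * (P.B * P.v0 + P.Q (fun _ => P.z0) g) ≤ P.C g * P.v0 * (2 * P.B) := by
    intro g
    have h2 := h.sum_c g
    have h3 : ((Am : ℝ) + 1) * P.v0 ≤ P.B * P.v0 := by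
      refine mul_le_mul_of_nonneg_right ?_ h.v0_pos.le
      rw [h.B_eq]
      have : (0 : ℝ) ≤ Am := by positivity
      nlinarith
    have := mul_le_mul_of_nonneg_left (h2.trans h3) (h.C_pos g).le
    linarith
  refine (Finset.sum_le_sum fun g _ => h1 g).trans ?_
  rw [← Finset.sum_mul, ← Finset.sum_mul]
  have := mul_le_mul_of_nonneg_right h.sum_C (by linarith [h.B_pos] : 0 ≤ 2 * P.B)
  linarith

/-- Truncated logarithm of a group value. -/
noncomputable def logV (s : MState γ υ) (g : γ) : ℝ := Real.log (min (s.v g) 2)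

/-- Truncated logarithm of a slot value. -/
noncomputable def logZ (P : Mwu γ υ) (s : MState γ υ) (u : υ) : ℝ := Real.log (min (s.z u) (2 * P.V))

omit hJ in
-- The dual accounting. If an uncovered job could use `o`, then either `o` is still too expensive,
-- or the group of `o` is saturated and `log v` grows, or it is not saturated and `log z` of `o`
-- grows. The logarithms are truncated so that their total growth is bounded whatever the run does.
theorem micro_progress {s : MState γ υ} (hs : P.Inv s) {M : MJob υ}
    (hn : ¬ P.Cov s (P.act M s)) {o : υ} (ho : o ∈ M.al) :
    P.ε * (s.k + 1) ≤ P.price M s o ∨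
    P.ε ≤ 2 * (P.C (P.par o) * P.B) * (logV (P.micro M s) (P.par o) - logV s (P.par o)) ∨
    P.ε ≤ 2 * (P.C (P.par o) * P.c o * max 1 (s.v (P.par o))) *
      (P.logZ (P.micro M s) o - P.logZ s o) := by
  set A := P.act M s with hA
  by_cases hoA : o ∈ A
  swap
  · left
    rw [hA] at hoA
    unfold act at hoA
    simp only [Finset.mem_filter, ho, true_and, not_le] at hoA
    exact hoA.le
  right
  have hε := h.ε_pos
  have hv := h.v0_pos.trans_le (hs.v0_le (P.par o))
  have hz := h.z0_pos.trans_le (hs.z0_le o)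
  have hC := h.C_pos (P.par o)
  have hc := h.c_pos o
  have hB := h.B_pos
  have hV := h.V_ge
  have hstep : P.micro M s = ⟨P.raise (P.microV s A) (P.microZ s A), P.microZ s A, s.k + 1⟩ := by
    unfold micro; rw [if_neg hn]
  by_cases hg : 1 ≤ P.gsum s A (P.par o)
  · left
    have hv1 := lt_one_of_not_cov h hs hn hg
    have hCB : 0 < P.C (P.par o) * P.B := by positivity
    set x := P.ε / (P.C (P.par o) * P.B) with hx
    have hx0 : 0 ≤ x := by positivity
    have hx1 : x ≤ 1 := by
      rw [hx, div_le_one hCB]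
      have := h.ε_le_C (P.par o)
      nlinarith [h.B_ge]
    have h1 : s.v (P.par o) * (1 + x) ≤ min ((P.micro M s).v (P.par o)) 2 := by
      refine le_min ?_ (by nlinarith)
      rw [hstep]
      refine le_min (by nlinarith) (le_trans ?_ (le_max_left _ _))
      unfold microV; rw [if_pos hg]
    have h2 := Real.log_le_log (by positivity) h1
    rw [Real.log_mul hv.ne' (by positivity)] at h2
    have h3 : logV s (P.par o) = Real.log (s.v (P.par o)) := by
      unfold logV; rw [min_eq_left (by linarith)]
    have h4 := le_two_mul_log_one_add hx0 hx1
    have h5 : P.ε = P.C (P.par o) * P.B * x := by rw [hx]; field_simp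
    rw [h3]
    unfold logV
    calc P.ε = P.C (P.par o) * P.B * x := h5
      _ ≤ P.C (P.par o) * P.B * (2 * Real.log (1 + x)) := by gcongr
      _ = 2 * (P.C (P.par o) * P.B) * Real.log (1 + x) := by ring
      _ ≤ _ := by gcongr; linarith
  · right
    obtain ⟨_, hlt⟩ := frac_of_gsum_lt h hs hoA (not_le.mp hg)
    have hm : 1 ≤ max 1 (s.v (P.par o)) := le_max_left _ _
    have hCc : 0 < P.C (P.par o) * P.c o * max 1 (s.v (P.par o)) := by positivity
    set x := P.ε / (P.C (P.par o) * P.c o * max 1 (s.v (P.par o))) with hx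
    have hx0 : 0 ≤ x := by positivity
    have hx1 : x ≤ 1 := by
      rw [hx, div_le_one hCc]
      have := h.ε_le o
      have h7 : 0 < P.C (P.par o) * P.c o := by positivity
      nlinarith
    have hzV : s.z o ≤ P.V := hlt.le.trans (hs.le_V _)
    have h1 : s.z o * (1 + x) ≤ min ((P.micro M s).z o) (2 * P.V) := by
      refine le_min ?_ (by nlinarith)
      rw [hstep]
      show _ ≤ P.microZ s A o
      unfold microZ; rw [if_pos ⟨hoA, not_le.mp hg⟩]
    have h2 := Real.log_le_log (by positivity) h1
    rw [Real.log_mul hz.ne' (by positivity)] at h2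
    have h3 : P.logZ s o = Real.log (s.z o) := by
      unfold logZ; rw [min_eq_left (by linarith)]
    have h4 := le_two_mul_log_one_add hx0 hx1
    have h5 : P.ε = P.C (P.par o) * P.c o * max 1 (s.v (P.par o)) * x := by rw [hx]; field_simp
    rw [h3]
    unfold logZ
    calc P.ε = P.C (P.par o) * P.c o * max 1 (s.v (P.par o)) * x := h5
      _ ≤ P.C (P.par o) * P.c o * max 1 (s.v (P.par o)) * (2 * Real.log (1 + x)) := by gcongr
      _ = 2 * (P.C (P.par o) * P.c o * max 1 (s.v (P.par o))) * Real.log (1 + x) := by ring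
      _ ≤ _ := by gcongr; linarith

theorem logV_mono (g : γ) : Monotone fun τ => logV (P.tr N J τ) g := by
  intro τ τ' hτ
  have := h.v0_pos.trans_le ((tr_inv h hJ (N := N) τ).v0_le g)
  exact Real.log_le_log (lt_min this two_pos) (min_le_min_right _ ((tr_mono h hJ (N := N)).1 g hτ))

theorem logZ_mono (u : υ) : Monotone fun τ => P.logZ (P.tr N J τ) u := by
  intro τ τ' hτ
  have := h.z0_pos.trans_le ((tr_inv h hJ (N := N) τ).z0_le u)
  exact Real.log_le_log (lt_min this (by linarith [h.V_pos]))
    (min_le_min_right _ ((tr_mono h hJ (N := N)).2 u hτ))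

omit h hJ in
open Classical in
/-- The last time at which a group value is below a dyadic threshold. -/
noncomputable def lastBelow (P : Mwu γ υ) (N : ℕ) (J : ℕ → MJob υ) (E : ℕ) (g : γ) (e : ℕ) : ℕ :=
  Nat.findGreatest (fun τ => (P.tr N J τ).v g < 2 ^ (e + 1) * P.v0) E

omit h hJ in
/-- A bound on the ratio of a slot value and its group value while the latter is below `1`. -/
noncomputable def ratioBound (P : Mwu γ υ) (N : ℕ) (J : ℕ → MJob υ) (E a : ℕ) (u : υ) : ℝ :=
  ∑ e ∈ Finset.range a, (P.tr N J (P.lastBelow N J E (P.par u) e)).z u / (2 ^ e * P.v0)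

theorem ratioBound_nonneg (E : ℕ) (u : υ) : 0 ≤ P.ratioBound N J E a u :=
  Finset.sum_nonneg fun e _ => div_nonneg
    (h.z0_pos.trans_le ((tr_inv h hJ (N := N) _).z0_le u)).le
    (mul_nonneg (by positivity) h.v0_pos.le)

/-- Let `v` lie between `2 ^ e * v0` and twice that. Since `z` is monotone, it is at most its value
at the last time `v` is below the upper threshold. Summing over all `e < a` makes the bound
independent of the time. -/
theorem ratio_le (E : ℕ) {τ : ℕ} (hτ : τ ≤ E) (u : υ) (hv : (P.tr N J τ).v (P.par u) < 1) :
    (P.tr N J τ).z u / (P.tr N J τ).v (P.par u) ≤ P.ratioBound N J E a u := by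
  have hv0 := h.v0_pos
  have hge := (tr_inv h hJ (N := N) τ).v0_le (P.par u)
  obtain ⟨e, he1, he2⟩ := exists_nat_pow_near (x := (P.tr N J τ).v (P.par u) / P.v0)
    (by rwa [le_div_iff₀ hv0, one_mul]) (one_lt_two)
  rw [le_div_iff₀ hv0] at he1
  rw [div_lt_iff₀ hv0] at he2
  have hea : e < a := by
    by_contra hc
    have h1 : (2 : ℝ) ^ a ≤ 2 ^ e := pow_le_pow_right₀ (by norm_num) (by omega)
    have h2 : (2 : ℝ) ^ a * P.v0 = 1 := by
      rw [h.v0_eq, ← mul_pow]; norm_num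
    nlinarith
  have hlast : τ ≤ P.lastBelow N J E (P.par u) e := by
    classical
    unfold lastBelow
    exact Nat.le_findGreatest hτ he2
  have hz := (tr_mono h hJ (N := N)).2 u hlast
  calc _ ≤ (P.tr N J (P.lastBelow N J E (P.par u) e)).z u / (2 ^ e * P.v0) := by
        have := h.z0_pos.trans_le ((tr_inv h hJ (N := N) (P.lastBelow N J E (P.par u) e)).z0_le u)
        have : 0 < 2 ^ e * P.v0 := by positivity
        gcongr
    _ ≤ _ := by
      unfold ratioBound
      refine Finset.single_le_sum
        (f := fun e => (P.tr N J (P.lastBelow N J E (P.par u) e)).z u / (2 ^ e * P.v0))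
        (fun e _ => div_nonneg (h.z0_pos.trans_le ((tr_inv h hJ (N := N) _).z0_le u)).le
          (mul_nonneg (by positivity) h.v0_pos.le)) (by simpa using hea)

/-- At each of the `a` threshold times domination gives `Q ≤ B v < 2 * B * (2 ^ e * v0)`. -/
theorem sum_ratioBound_le (E : ℕ) (g : γ) :
    ∑ u with P.par u = g, P.c u * P.ratioBound N J E a u ≤ 2 * P.B * a := by
  have hv0 := h.v0_pos
  have e1 : ∑ u with P.par u = g, P.c u * P.ratioBound N J E a u = ∑ e ∈ Finset.range a,
      P.Q (P.tr N J (P.lastBelow N J E g e)).z g / (2 ^ e * P.v0) := by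
    unfold ratioBound Q
    simp only [Finset.mul_sum, Finset.sum_div]
    rw [Finset.sum_comm]
    refine Finset.sum_congr rfl fun e _ => Finset.sum_congr rfl fun u hu => ?_
    have hu' : P.par u = g := by simpa using hu
    rw [hu', mul_div_assoc]
  rw [e1]
  have h2 : ∀ e ∈ Finset.range a,
      P.Q (P.tr N J (P.lastBelow N J E g e)).z g / (2 ^ e * P.v0) ≤ 2 * P.B := by
    intro e he
    have he' : e + 1 ≤ a := Finset.mem_range.mp he
    have hlt : (P.tr N J (P.lastBelow N J E g e)).v g < 2 ^ (e + 1) * P.v0 := by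
      classical
      unfold lastBelow
      refine Nat.findGreatest_spec (P := fun τ => (P.tr N J τ).v g < 2 ^ (e + 1) * P.v0) (m := 0)
        (Nat.zero_le _) ?_
      show P.v0 < _
      have : (1 : ℝ) < 2 ^ (e + 1) := one_lt_pow₀ (by norm_num) (by omega)
      nlinarith
    have h3 : (2 : ℝ) ^ (e + 1) * P.v0 ≤ 1 := by
      have h1 : (2 : ℝ) ^ (e + 1) ≤ 2 ^ a := pow_le_pow_right₀ (by norm_num) he'
      have h2 : (2 : ℝ) ^ a * P.v0 = 1 := by
        rw [h.v0_eq, ← mul_pow]; norm_num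
      nlinarith
    have h4 := (tr_inv h hJ (N := N) (P.lastBelow N J E g e)).Q_le g (by linarith [h.V_ge])
    rw [div_le_iff₀ (by positivity)]
    have h5 := mul_le_mul_of_nonneg_left hlt.le h.B_pos.le
    rw [pow_succ] at h5
    linarith
  refine (Finset.sum_le_sum h2).trans (le_of_eq ?_)
  simp; ring

/-- For `v ≥ 1` the two maxima in the price multiply to `max v z`, which is bounded by final values
and hence by the potential. For `v < 1` the ratio `z / v` occurs, which the final values do not
control; `ratioBound` takes its place. -/
theorem price_le (E : ℕ) {τ : ℕ} (hτ : τ ≤ E) (j : ℕ) (o : υ) :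
    P.price (J j) (P.tr N J τ) o ≤ P.C (P.par o) * P.c o * (J j).lam o *
      (max 1 ((P.tr N J E).v (P.par o)) + (P.tr N J E).z o + P.ratioBound N J E a o) := by
  have hC := h.C_pos (P.par o)
  have hc := h.c_pos o
  have hl := hJ j o
  have hv := h.v0_pos.trans_le ((tr_inv h hJ (N := N) τ).v0_le (P.par o))
  have hz := h.z0_pos.trans_le ((tr_inv h hJ (N := N) τ).z0_le o)
  have hvE := (tr_mono h hJ (N := N)).1 (P.par o) hτ
  have hzE := (tr_mono h hJ (N := N)).2 o hτ
  have hR := ratioBound_nonneg h hJ (N := N) E o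
  unfold price
  rw [mul_assoc]
  refine mul_le_mul_of_nonneg_left ?_ (by positivity)
  simp only at hvE hzE
  rcases lt_or_ge ((P.tr N J τ).v (P.par o)) 1 with h1 | h1
  · rw [max_eq_left h1.le, mul_one]
    have h2 := ratio_le h hJ E hτ o h1
    have h3 := le_max_left 1 ((P.tr N J E).v (P.par o))
    refine max_le ?_ ?_ <;> linarith
  · rw [max_eq_right h1, max_mul_of_nonneg _ _ hv.le, one_mul, div_mul_cancel₀ _ hv.ne']
    have h3 := le_max_right 1 ((P.tr N J E).v (P.par o))
    refine max_le ?_ ?_ <;> linarith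

/-- Induction over the increments of one job: as long as the price of `o` has not been reached, the
first term pays for everything so far; every other increment is paid for by logarithmic growth. -/
theorem k_le (E j : ℕ) (hE : (j + 1) * (N + 1) ≤ E) {o : υ} (ho : o ∈ (J j).al) :
    P.ε * (P.tr N J (j * (N + 1) + N)).k ≤ P.C (P.par o) * P.c o * (J j).lam o *
      (max 1 ((P.tr N J E).v (P.par o)) + (P.tr N J E).z o + P.ratioBound N J E a o)
      + 2 * (P.C (P.par o) * P.B) * (logV (P.tr N J ((j + 1) * (N + 1))) (P.par o)
        - logV (P.tr N J (j * (N + 1))) (P.par o))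
      + 2 * (P.C (P.par o) * P.c o * max 1 ((P.tr N J E).v (P.par o))) *
        (P.logZ (P.tr N J ((j + 1) * (N + 1))) o - P.logZ (P.tr N J (j * (N + 1))) o) := by
  have hC := h.C_pos (P.par o)
  have hc := h.c_pos o
  have hB := h.B_pos
  have hl := hJ j o
  have hvEp := h.v0_pos.trans_le ((tr_inv h hJ (N := N) E).v0_le (P.par o))
  have hzEp := h.z0_pos.trans_le ((tr_inv h hJ (N := N) E).z0_le o)
  have hR := ratioBound_nonneg h hJ (N := N) E o
  set Θ := P.C (P.par o) * P.c o * (J j).lam o *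
      (max 1 ((P.tr N J E).v (P.par o)) + (P.tr N J E).z o + P.ratioBound N J E a o) with hΘ
  have hΘ0 : 0 ≤ Θ := by positivity
  set X := 2 * (P.C (P.par o) * P.B) with hX
  set Y := 2 * (P.C (P.par o) * P.c o * max 1 ((P.tr N J E).v (P.par o))) with hY
  have hX0 : 0 ≤ X := by positivity
  have hY0 : 0 ≤ Y := by positivity
  have key : ∀ i ≤ N, P.ε * (P.tr N J (j * (N + 1) + i)).k ≤ Θ
      + X * (logV (P.tr N J (j * (N + 1) + i)) (P.par o)
        - logV (P.tr N J (j * (N + 1))) (P.par o))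
      + Y * (P.logZ (P.tr N J (j * (N + 1) + i)) o - P.logZ (P.tr N J (j * (N + 1))) o) := by
    intro i
    induction i with
    | zero => intro _; simp [tr_k_zero, hΘ0]
    | succ i ih =>
      intro hi
      have ih := ih (by omega)
      set s := P.tr N J (j * (N + 1) + i) with hs
      have e := tr_succ_micro (P := P) (J := J) (j := j) (by omega : i < N)
      have hd1 := logV_mono h hJ (N := N) (P.par o)
        (show j * (N + 1) + i ≤ j * (N + 1) + (i + 1) by omega)
      have hd2 := logZ_mono h hJ (N := N) o
        (show j * (N + 1) + i ≤ j * (N + 1) + (i + 1) by omega)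
      have hd3 := logV_mono h hJ (N := N) (P.par o)
        (show j * (N + 1) ≤ j * (N + 1) + i by omega)
      have hd4 := logZ_mono h hJ (N := N) o
        (show j * (N + 1) ≤ j * (N + 1) + i by omega)
      simp only [← hs] at hd1 hd2 hd3 hd4
      by_cases hcov : P.Cov s (P.act (J j) s)
      · have e2 : P.micro (J j) s = s := by unfold micro; rw [if_pos hcov]
        rw [e, ← hs, e2]; exact ih
      · have hk : (P.tr N J (j * (N + 1) + (i + 1))).k = s.k + 1 := by
          rw [e, ← hs]; simp [micro, hcov]
        rw [hk]; push_cast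
        have hm1 := mul_le_mul_of_nonneg_left hd1 hX0
        have hm2 := mul_le_mul_of_nonneg_left hd2 hY0
        have hm3 := mul_le_mul_of_nonneg_left hd3 hX0
        have hm4 := mul_le_mul_of_nonneg_left hd4 hY0
        have hτE : j * (N + 1) + i ≤ E := by nlinarith
        rcases micro_progress h (tr_inv h hJ (N := N) (j * (N + 1) + i)) hcov ho with h1 | h1 | h1
        · have := price_le h hJ (N := N) E hτE j o
          rw [← hs] at h1 this
          linarith
        · rw [← hs, ← e] at h1
          linarith
        · rw [← hs, ← e] at h1
          have hvm := (tr_mono h hJ (N := N)).1 (P.par o) hτE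
          have h3 : max 1 (s.v (P.par o)) ≤ max 1 ((P.tr N J E).v (P.par o)) :=
            max_le_max_left _ hvm
          have h4 : 2 * (P.C (P.par o) * P.c o * max 1 (s.v (P.par o))) *
              (P.logZ (P.tr N J (j * (N + 1) + (i + 1))) o - P.logZ s o) ≤
              Y * (P.logZ (P.tr N J (j * (N + 1) + (i + 1))) o - P.logZ s o) := by
            refine mul_le_mul_of_nonneg_right ?_ (by linarith)
            rw [hY]; gcongr
          linarith
  refine (key N le_rfl).trans ?_
  have hd1 := logV_mono h hJ (N := N) (P.par o)
    (show j * (N + 1) + N ≤ (j + 1) * (N + 1) by nlinarith)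
  have hd2 := logZ_mono h hJ (N := N) o
    (show j * (N + 1) + N ≤ (j + 1) * (N + 1) by nlinarith)
  have hm1 := mul_le_mul_of_nonneg_left hd1 hX0
  have hm2 := mul_le_mul_of_nonneg_left hd2 hY0
  linarith

/-- An offline solution of the first `n` jobs, as a witness for the analysis: job `j` uses the slot
`o j`. -/
structure Offline (P : Mwu γ υ) (a Am n : ℕ) (J : ℕ → MJob υ) (o : ℕ → υ) (O : Finset υ)
    (G : Finset γ) : Prop where
  mem_al : ∀ j < n, o j ∈ (J j).al
  mem_O : ∀ j < n, o j ∈ O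
  par_mem : ∀ u ∈ O, P.par u ∈ G
  sum_C : ∑ g ∈ G, P.C g ≤ a + 1
  sum_c : ∀ g ∈ G, ∑ u ∈ O with P.par u = g, P.c u ≤ Am + 1
  sum_lam : ∀ u ∈ O, ∑ j ∈ Finset.range n with o j = u, (J j).lam u ≤ 1 / 40

omit h hJ in
theorem sum_slots_eq (O : Finset υ) (G : Finset γ) (hG : ∀ u ∈ O, P.par u ∈ G) (X : γ → ℝ)
    (Y : υ → ℝ) : ∑ u ∈ O, X (P.par u) * Y u = ∑ g ∈ G, X g * ∑ u ∈ O with P.par u = g, Y u := by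
  rw [← Finset.sum_fiberwise_of_maps_to hG]
  refine Finset.sum_congr rfl fun g _ => ?_
  rw [Finset.mul_sum]
  refine Finset.sum_congr rfl fun u hu => ?_
  rw [(Finset.mem_filter.mp hu).2]

theorem logV_total_le (τ : ℕ) (g : γ) :
    logV (P.tr N J τ) g - logV (P.tr N J 0) g ≤ a + 1 := by
  have hv := h.v0_pos.trans_le ((tr_inv h hJ (N := N) τ).v0_le g)
  have h1 : logV (P.tr N J τ) g ≤ Real.log 2 :=
    Real.log_le_log (lt_min hv two_pos) (min_le_right _ _)
  have h2 : logV (P.tr N J 0) g = -(a * Real.log 2) := by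
    show Real.log (min P.v0 2) = _
    rw [min_eq_left (by linarith [h.v0_le_one]), h.v0_eq, Real.log_pow, one_div, Real.log_inv]
    ring
  have h3 := Real.log_two_lt_d9
  have h4 : (0 : ℝ) ≤ a := by positivity
  rw [h2]
  nlinarith

theorem logZ_total_le (τ : ℕ) (u : υ) :
    P.logZ (P.tr N J τ) u - P.logZ (P.tr N J 0) u ≤ 6 * (Am + 1) := by
  have hz := h.z0_pos.trans_le ((tr_inv h hJ (N := N) τ).z0_le u)
  have h1 : P.logZ (P.tr N J τ) u ≤ Real.log (2 * P.V) :=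
    Real.log_le_log (lt_min hz (by linarith [h.V_pos])) (min_le_right _ _)
  have h2 : P.logZ (P.tr N J 0) u = -((a + Am) * Real.log 2) := by
    show Real.log (min P.z0 (2 * P.V)) = _
    have : P.z0 ≤ 1 := by rw [h.z0_eq]; exact pow_le_one₀ (by norm_num) (by norm_num)
    rw [min_eq_left (by linarith [h.V_ge]), h.z0_eq, Real.log_pow, one_div, Real.log_inv]
    push_cast; ring
  have h3 : Real.log (2 * P.V) = (3 * a + 8) * Real.log 2 := by
    rw [h.V_eq, ← pow_succ', Real.log_pow]; push_cast; ring
  have h4 := Real.log_two_lt_d9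
  have h5 : (0 : ℝ) ≤ a := by positivity
  have h6 : (a : ℝ) ≤ Am := by exact_mod_cast h.ham
  have h7 := Real.log_two_gt_d9
  rw [h2]
  nlinarith

omit h hJ in
theorem sum_jobs_le (o : ℕ → υ) (O : Finset υ) (ho : ∀ j < n, o j ∈ O) (f : υ → ℕ → ℝ)
    (hf : ∀ u j, 0 ≤ f u j) :
    ∑ j ∈ Finset.range n, f (o j) j ≤ ∑ u ∈ O, ∑ j ∈ Finset.range n, f u j := by
  rw [Finset.sum_comm]
  refine Finset.sum_le_sum fun j hj => ?_
  exact Finset.single_le_sum (f := fun u => f u j) (fun u _ => hf u j)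
    (ho j (Finset.mem_range.mp hj))

omit h hJ in
-- The constants make the coefficient of `T` on the right-hand side at most one half: offline loads
-- `1 / 40` contribute `T / 4` directly, and with `B = 960 * m ^ 2` the slot logarithms contribute
-- `120 * m ^ 2 * T / B = T / 8`. The remaining term `m * T / B` is negligible.
theorem numeric_bound {m l B T : ℝ} (hm : 1 ≤ m) (hl : 1 ≤ l) (hB : B = 960 * m ^ 2) (hT : 0 ≤ T)
    (h : T ≤ 2 * B * l + 10 * (1 + 1 / 40 * (m * (l + T / B) + T
      + 2 * B * l ^ 2) + 2 * B * l ^ 2 + 12 * m ^ 2 * (l + T / B))) :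
    10 * (1 + 1 / 40 * (m * (l + T / B) + T + 2 * B * l ^ 2) + 2 * B * l ^ 2
        + 12 * m ^ 2 * (l + T / B)) ≤ T / 2 + 25 * B * l ^ 2 ∧ T ≤ 70 * B * l ^ 2 := by
  have hm2 : m ≤ m ^ 2 := by nlinarith
  have hB1 : 960 ≤ B := by nlinarith
  have hl2 : l ≤ l ^ 2 := by nlinarith
  obtain ⟨D, hD⟩ : ∃ D, D = T / B := ⟨_, rfl⟩
  rw [← hD] at h ⊢
  have hD0 : 0 ≤ D := by rw [hD]; positivity
  have hTD : T = 960 * (m ^ 2 * D) := by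
    rw [← mul_assoc, ← hB, hD]; field_simp
  have h1 : m * D ≤ m ^ 2 * D := by gcongr
  have h2 : m * l ≤ m ^ 2 * l ^ 2 := by gcongr
  have h3 : m ^ 2 * l ≤ m ^ 2 * l ^ 2 := by gcongr
  have h4 : B * l ≤ B * l ^ 2 := by gcongr
  have h5 : B * l ^ 2 = 960 * (m ^ 2 * l ^ 2) := by rw [hB]; ring
  have h6 : 1 ≤ m ^ 2 * l ^ 2 := by nlinarith
  have h7 : m ^ 2 * (l + D) = m ^ 2 * l + m ^ 2 * D := by ring
  have h8 : m * (l + D) = m * l + m * D := by ring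
  have e1 : 12 * m ^ 2 * (l + D) = 12 * (m ^ 2 * (l + D)) := by ring
  have e2 : 2 * B * l ^ 2 = 2 * (B * l ^ 2) := by ring
  have e3 : 25 * B * l ^ 2 = 25 * (B * l ^ 2) := by ring
  have e4 : 70 * B * l ^ 2 = 70 * (B * l ^ 2) := by ring
  have e5 : 2 * B * l = 2 * (B * l) := by ring
  rw [e1, e2, h7, h8] at h ⊢
  rw [e3, e4]
  rw [e5] at h
  constructor <;> linarith

/-- The sum of `k_le` over the jobs, with telescoping logarithms and the three offline budgets,
bounds the sum of all prices by terms that again contain `T`; `numeric_bound` absorbs them. The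
square of `a + 1` comes from the outer budget times the `a` dyadic ranges of group values below one.
-/
theorem T_bound {o : ℕ → υ} {O : Finset υ} {G : Finset γ} (hO : P.Offline a Am n J o O G) :
    P.T (P.tr N J (n * (N + 1))) ≤ 70 * P.B * (a + 1) ^ 2 ∧
    ∀ j < n, P.ε * ((P.tr N J (j * (N + 1) + N)).k + 1) ≤ 70 * P.B * (a + 1) ^ 2 := by
  set E := n * (N + 1) with hE
  set l : ℝ := a + 1 with hl
  set m : ℝ := Am + 1 with hm
  have hl1 : 1 ≤ l := by have : (0 : ℝ) ≤ a := by positivity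
                         linarith
  have hm1 : 1 ≤ m := by have : (0 : ℝ) ≤ Am := by positivity
                         linarith
  have hlm : l ≤ m := by have : (a : ℝ) ≤ Am := by exact_mod_cast h.ham
                         linarith
  have hBm : P.B = 960 * m ^ 2 := h.B_eq
  have hB := h.B_pos
  have hε := h.ε_pos
  set vE := (P.tr N J E).v with hvE
  set zE := (P.tr N J E).z with hzE
  set R := P.ratioBound N J E a with hR
  set T := P.T (P.tr N J E) with hT
  have hInv := tr_inv h hJ (N := N) E
  have hv : ∀ g, 0 < vE g := fun g => h.v0_pos.trans_le (hInv.v0_le g)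
  have hz : ∀ u, 0 < zE u := fun u => h.z0_pos.trans_le (hInv.z0_le u)
  have hR0 : ∀ u, 0 ≤ R u := ratioBound_nonneg h hJ (N := N) E
  have hQ0 : ∀ g, 0 ≤ P.Q zE g := fun g =>
    Finset.sum_nonneg fun u _ => mul_nonneg (h.c_pos u).le (hz u).le
  have hTv : ∑ g ∈ G, P.C g * (P.B * vE g) ≤ T := by
    refine (Finset.sum_le_univ_sum_of_nonneg (fun g => ?_)).trans
      (Finset.sum_le_sum fun g _ => ?_)
    · have := h.C_pos g; have := hv g; positivity
    · have := h.C_pos g; have := hQ0 g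
      gcongr; linarith
  have hTz : ∑ g ∈ G, P.C g * P.Q zE g ≤ T := by
    refine (Finset.sum_le_univ_sum_of_nonneg (fun g => ?_)).trans
      (Finset.sum_le_sum fun g _ => ?_)
    · have := h.C_pos g; have := hQ0 g; positivity
    · have := h.C_pos g; have := hv g
      have : 0 ≤ P.B * vE g := by positivity
      gcongr; linarith
  have hmaxsum : ∑ u ∈ O, P.C (P.par u) * P.c u * max 1 (vE (P.par u)) ≤ m * (l + T / P.B) := by
    have e : ∑ u ∈ O, P.C (P.par u) * P.c u * max 1 (vE (P.par u))
        = ∑ u ∈ O, (P.C (P.par u) * max 1 (vE (P.par u))) * P.c u :=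
      Finset.sum_congr rfl fun u _ => by ring
    rw [e, sum_slots_eq O G hO.par_mem (fun g => P.C g * max 1 (vE g)) P.c]
    calc _ ≤ ∑ g ∈ G, P.C g * (1 + vE g) * m := by
          refine Finset.sum_le_sum fun g hg => ?_
          have := h.C_pos g; have := hv g
          refine mul_le_mul ?_ (hO.sum_c g hg)
            (Finset.sum_nonneg fun u _ => (h.c_pos u).le) (by positivity)
          gcongr
          exact max_le (by linarith) (by linarith)
      _ = m * (∑ g ∈ G, P.C g + (∑ g ∈ G, P.C g * (P.B * vE g)) / P.B) := by
          rw [← Finset.sum_mul, Finset.sum_div, ← Finset.sum_add_distrib, mul_comm]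
          congr 1
          refine Finset.sum_congr rfl fun g _ => ?_
          field_simp
      _ ≤ _ := by gcongr; exact hO.sum_C
  have hzsum : ∑ u ∈ O, P.C (P.par u) * P.c u * zE u ≤ T := by
    have e : ∑ u ∈ O, P.C (P.par u) * P.c u * zE u = ∑ u ∈ O, P.C (P.par u) * (P.c u * zE u) :=
      Finset.sum_congr rfl fun u _ => by ring
    rw [e, sum_slots_eq O G hO.par_mem P.C fun u => P.c u * zE u]
    refine le_trans (Finset.sum_le_sum fun g _ => ?_) hTz
    refine mul_le_mul_of_nonneg_left ?_ (h.C_pos g).le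
    exact Finset.sum_le_sum_of_subset_of_nonneg
      (fun u hu => by simpa using (Finset.mem_filter.mp hu).2)
      fun u _ _ => mul_nonneg (h.c_pos u).le (hz u).le
  have hRsum : ∑ u ∈ O, P.C (P.par u) * P.c u * R u ≤ 2 * P.B * l ^ 2 := by
    have e : ∑ u ∈ O, P.C (P.par u) * P.c u * R u = ∑ u ∈ O, P.C (P.par u) * (P.c u * R u) :=
      Finset.sum_congr rfl fun u _ => by ring
    rw [e, sum_slots_eq O G hO.par_mem P.C fun u => P.c u * R u]
    calc _ ≤ ∑ g ∈ G, P.C g * (2 * P.B * l) := by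
          refine Finset.sum_le_sum fun g _ => mul_le_mul_of_nonneg_left ?_ (h.C_pos g).le
          refine le_trans ?_ ((sum_ratioBound_le h hJ (N := N) E g).trans ?_)
          · exact Finset.sum_le_sum_of_subset_of_nonneg
              (fun u hu => by simpa using (Finset.mem_filter.mp hu).2)
              fun u _ _ => mul_nonneg (h.c_pos u).le (hR0 u)
          · gcongr; rw [hl]; linarith
      _ = (∑ g ∈ G, P.C g) * (2 * P.B * l) := by rw [Finset.sum_mul]
      _ ≤ l * (2 * P.B * l) := by gcongr; exact hO.sum_C
      _ = _ := by ring
  have hS1 : ∑ j ∈ Finset.range n, 2 * (P.C (P.par (o j)) * P.B) *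
      (logV (P.tr N J ((j + 1) * (N + 1))) (P.par (o j))
        - logV (P.tr N J (j * (N + 1))) (P.par (o j))) ≤ 2 * P.B * l ^ 2 := by
    have hstep : ∀ g j, 0 ≤ 2 * (P.C g * P.B) * (logV (P.tr N J ((j + 1) * (N + 1))) g
        - logV (P.tr N J (j * (N + 1))) g) := fun g j => by
      have h1 := logV_mono h hJ (N := N) g (show j * (N + 1) ≤ (j + 1) * (N + 1) by nlinarith)
      have h2 := h.C_pos g
      simp only at h1
      exact mul_nonneg (by positivity) (by linarith)
    refine (sum_jobs_le (υ := γ) (fun j => P.par (o j)) G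
      (fun j hj => hO.par_mem _ (hO.mem_O j hj)) _ hstep).trans ?_
    calc _ ≤ ∑ g ∈ G, P.C g * (2 * P.B * l) := by
          refine Finset.sum_le_sum fun g _ => ?_
          rw [← Finset.mul_sum,
            Finset.sum_range_sub (fun j => logV (P.tr N J (j * (N + 1))) g)]
          have := logV_total_le h hJ (N := N) (n * (N + 1)) g
          have h2 := h.C_pos g
          calc _ ≤ 2 * (P.C g * P.B) * l := by
                gcongr; simpa using this
            _ = _ := by ring
      _ = (∑ g ∈ G, P.C g) * (2 * P.B * l) := by rw [Finset.sum_mul]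
      _ ≤ l * (2 * P.B * l) := by gcongr; exact hO.sum_C
      _ = _ := by ring
  have hS2 : ∑ j ∈ Finset.range n, 2 * (P.C (P.par (o j)) * P.c (o j) *
      max 1 (vE (P.par (o j)))) * (P.logZ (P.tr N J ((j + 1) * (N + 1))) (o j)
        - P.logZ (P.tr N J (j * (N + 1))) (o j)) ≤ 12 * m ^ 2 * (l + T / P.B) := by
    have hpos : ∀ u, 0 ≤ 2 * (P.C (P.par u) * P.c u * max 1 (vE (P.par u))) := fun u => by
      have := h.C_pos (P.par u); have := h.c_pos u; positivity
    have hstep : ∀ u j, 0 ≤ 2 * (P.C (P.par u) * P.c u * max 1 (vE (P.par u))) *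
        (P.logZ (P.tr N J ((j + 1) * (N + 1))) u - P.logZ (P.tr N J (j * (N + 1))) u) :=
      fun u j => by
        have h1 := logZ_mono h hJ (N := N) u (show j * (N + 1) ≤ (j + 1) * (N + 1) by nlinarith)
        simp only at h1
        exact mul_nonneg (hpos u) (by linarith)
    refine (sum_jobs_le o O hO.mem_O _ hstep).trans ?_
    calc _ ≤ ∑ u ∈ O, (P.C (P.par u) * P.c u * max 1 (vE (P.par u))) * (12 * m) := by
          refine Finset.sum_le_sum fun u _ => ?_
          rw [← Finset.mul_sum,
            Finset.sum_range_sub (fun j => P.logZ (P.tr N J (j * (N + 1))) u)]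
          have := logZ_total_le h hJ (N := N) (n * (N + 1)) u
          calc _ ≤ 2 * (P.C (P.par u) * P.c u * max 1 (vE (P.par u))) * (6 * m) := by
                gcongr
                · exact hpos u
                · simpa using this
            _ = _ := by ring
      _ ≤ m * (l + T / P.B) * (12 * m) := by
          rw [← Finset.sum_mul]; gcongr
      _ = _ := by ring
  have hS3 : ∑ j ∈ Finset.range n, P.C (P.par (o j)) * P.c (o j) * (J j).lam (o j) *
      (max 1 (vE (P.par (o j))) + zE (o j) + R (o j))
      ≤ 1 / 40 * (m * (l + T / P.B) + T + 2 * P.B * l ^ 2) := by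
    have hX : ∀ u, 0 ≤ P.C (P.par u) * P.c u * (max 1 (vE (P.par u)) + zE u + R u) := fun u => by
      have := h.C_pos (P.par u); have := h.c_pos u; have := hz u; have := hR0 u
      positivity
    have e1 : ∑ j ∈ Finset.range n, P.C (P.par (o j)) * P.c (o j) * (J j).lam (o j) *
        (max 1 (vE (P.par (o j))) + zE (o j) + R (o j)) = ∑ u ∈ O,
        (P.C (P.par u) * P.c u * (max 1 (vE (P.par u)) + zE u + R u)) *
          ∑ j ∈ Finset.range n with o j = u, (J j).lam u := by
      rw [← Finset.sum_fiberwise_of_maps_to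
        (fun j hj => hO.mem_O j (Finset.mem_range.mp hj) : ∀ j ∈ Finset.range n, o j ∈ O)]
      refine Finset.sum_congr rfl fun u _ => ?_
      rw [Finset.mul_sum]
      refine Finset.sum_congr rfl fun j hj => ?_
      rw [(Finset.mem_filter.mp hj).2]; ring
    rw [e1]
    calc _ ≤ ∑ u ∈ O, (P.C (P.par u) * P.c u * (max 1 (vE (P.par u)) + zE u + R u)) * (1 / 40) :=
          Finset.sum_le_sum fun u hu => mul_le_mul_of_nonneg_left (hO.sum_lam u hu) (hX u)
      _ = 1 / 40 * (∑ u ∈ O, P.C (P.par u) * P.c u * max 1 (vE (P.par u))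
          + ∑ u ∈ O, P.C (P.par u) * P.c u * zE u + ∑ u ∈ O, P.C (P.par u) * P.c u * R u) := by
          rw [← Finset.sum_add_distrib, ← Finset.sum_add_distrib, Finset.mul_sum]
          exact Finset.sum_congr rfl fun u _ => by ring
      _ ≤ _ := by gcongr
  have hY : ∑ j ∈ Finset.range n, P.ε * ((P.tr N J (j * (N + 1) + N)).k + 1)
      ≤ 1 + 1 / 40 * (m * (l + T / P.B) + T + 2 * P.B * l ^ 2) + 2 * P.B * l ^ 2
        + 12 * m ^ 2 * (l + T / P.B) := by
    calc _ = ∑ j ∈ Finset.range n, P.ε * (P.tr N J (j * (N + 1) + N)).k + n * P.ε := by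
          rw [← sub_eq_iff_eq_add', ← sub_eq_zero]
          simp only [mul_add, mul_one, Finset.sum_add_distrib]
          simp
      _ ≤ (∑ j ∈ Finset.range n, P.C (P.par (o j)) * P.c (o j) * (J j).lam (o j) *
            (max 1 (vE (P.par (o j))) + zE (o j) + R (o j))
          + ∑ j ∈ Finset.range n, 2 * (P.C (P.par (o j)) * P.B) *
            (logV (P.tr N J ((j + 1) * (N + 1))) (P.par (o j))
              - logV (P.tr N J (j * (N + 1))) (P.par (o j)))
          + ∑ j ∈ Finset.range n, 2 * (P.C (P.par (o j)) * P.c (o j) *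
            max 1 (vE (P.par (o j)))) * (P.logZ (P.tr N J ((j + 1) * (N + 1))) (o j)
              - P.logZ (P.tr N J (j * (N + 1))) (o j))) + 1 := by
          refine add_le_add ?_ h.nε
          rw [← Finset.sum_add_distrib, ← Finset.sum_add_distrib]
          refine Finset.sum_le_sum fun j hj => ?_
          have hj' := Finset.mem_range.mp hj
          exact k_le h hJ E j (Nat.mul_le_mul_right _ hj') (hO.mem_al j hj')
      _ ≤ _ := by linarith
  have hTT := T_le_sum h hJ (N := N) n
  have hT0 := T_zero_le h hJ (N := N)
  have hTpos : 0 ≤ T := Finset.sum_nonneg fun g _ => by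
    have := h.C_pos g; have := hv g; have := hQ0 g
    exact mul_nonneg (by positivity) (by positivity)
  obtain ⟨hYT, hfin⟩ := numeric_bound hm1 hl1 hBm hTpos
    (by rw [← hE] at hTT; linarith : T ≤ 2 * P.B * l + 10 * (1 + 1 / 40 * (m * (l + T / P.B) + T
      + 2 * P.B * l ^ 2) + 2 * P.B * l ^ 2 + 12 * m ^ 2 * (l + T / P.B)))
  refine ⟨hfin, fun j hj => ?_⟩
  have := Finset.single_le_sum
    (f := fun j => P.ε * (((P.tr N J (j * (N + 1) + N)).k : ℝ) + 1))
    (fun j _ => by positivity) (Finset.mem_range.mpr hj)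
  linarith [mul_nonneg hB.le (sq_nonneg l)]

/-- Guarantees of the multiplicative weights process. -/
theorem process_spec {o : ℕ → υ} {O : Finset υ} {G : Finset γ} (hO : P.Offline a Am n J o O G)
    (hN : 70 * P.B * (a + 1) ^ 2 ≤ P.ε * N) :
    ∑ g, P.C g * (P.tr N J (n * (N + 1))).v g ≤ 70 * ((a : ℝ) + 1) ^ 2 ∧
    (∀ τ ≤ n * (N + 1), ∀ g, (P.tr N J τ).v g < P.V ∧
      P.Q (P.tr N J τ).z g ≤ P.B * (P.tr N J τ).v g) ∧
    ∀ j < n, P.Cov (P.tr N J (j * (N + 1) + N)) (P.act (J j) (P.tr N J (j * (N + 1) + N))) := by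
  obtain ⟨hT, hk⟩ := T_bound h hJ (N := N) hO
  have hB := h.B_pos
  have hInv := tr_inv h hJ (N := N) (n * (N + 1))
  have h1 : ∑ g, P.C g * (P.tr N J (n * (N + 1))).v g ≤ 70 * ((a : ℝ) + 1) ^ 2 := by
    have : P.B * ∑ g, P.C g * (P.tr N J (n * (N + 1))).v g ≤ P.T (P.tr N J (n * (N + 1))) := by
      rw [Finset.mul_sum]
      refine Finset.sum_le_sum fun g _ => ?_
      have h2 : 0 ≤ P.Q (P.tr N J (n * (N + 1))).z g := Finset.sum_nonneg fun u _ =>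
        mul_nonneg (h.c_pos u).le (h.z0_pos.le.trans (hInv.z0_le u))
      have := mul_nonneg (h.C_pos g).le h2
      linarith
    have h3 : P.B * ∑ g, P.C g * (P.tr N J (n * (N + 1))).v g ≤ P.B * (70 * ((a : ℝ) + 1) ^ 2) := by
      linarith
    exact le_of_mul_le_mul_left h3 hB
  -- Since `C ≥ 2 ^ (-a)`, the bound on `∑ C v` keeps every value below `70 * (a + 1) ^ 2 * 2 ^ a <
  -- 2 ^ (3 a + 7) = V`. The cap is thus never active, and `Q ≤ B v` holds at all times.
  have hlt : ∀ g, (P.tr N J (n * (N + 1))).v g < P.V := by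
    intro g
    have hvp := fun g => h.v0_pos.trans_le (hInv.v0_le g)
    have h2 : P.C g * (P.tr N J (n * (N + 1))).v g ≤ 70 * ((a : ℝ) + 1) ^ 2 :=
      (Finset.single_le_sum (f := fun g => P.C g * (P.tr N J (n * (N + 1))).v g)
        (fun g _ => (mul_pos (h.C_pos g) (hvp g)).le) (Finset.mem_univ g)).trans h1
    have h3 := mul_le_mul_of_nonneg_right (h.C_ge g) (hvp g).le
    have h4 : (a : ℝ) + 1 ≤ 2 ^ a := by exact_mod_cast Nat.lt_two_pow_self
    have h5 : (1 / 2 : ℝ) ^ a * 2 ^ a = 1 := by rw [← mul_pow]; norm_num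
    have h6 : (0 : ℝ) < 2 ^ a := by positivity
    have h7 : (P.tr N J (n * (N + 1))).v g ≤ 70 * ((a : ℝ) + 1) ^ 2 * 2 ^ a := by
      calc (P.tr N J (n * (N + 1))).v g
          = ((1 / 2 : ℝ) ^ a * (P.tr N J (n * (N + 1))).v g) * 2 ^ a := by
            rw [mul_right_comm, h5, one_mul]
        _ ≤ _ := mul_le_mul_of_nonneg_right (h3.trans h2) h6.le
    rw [h.V_eq]
    calc _ ≤ 70 * ((a : ℝ) + 1) ^ 2 * 2 ^ a := h7
      _ ≤ 70 * (2 ^ a) ^ 2 * 2 ^ a := by gcongr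
      _ = 70 * (2 : ℝ) ^ (3 * a) := by ring
      _ < 128 * 2 ^ (3 * a) := by gcongr; norm_num
      _ = _ := by rw [pow_add]; norm_num; ring
  refine ⟨h1, fun τ hτ g => ?_, fun j hj => ?_⟩
  · have h2 := ((tr_mono h hJ (N := N)).1 g hτ).trans_lt (hlt g)
    exact ⟨h2, (tr_inv h hJ τ).Q_le g h2⟩
  · by_contra hc
    -- A job uncovered to the end would have made all `N` increments, and its price would exceed the
    -- bound just proved.
    have key : ∀ i ≤ N, (P.tr N J (j * (N + 1) + i)).k = i ∨
        P.Cov (P.tr N J (j * (N + 1) + i)) (P.act (J j) (P.tr N J (j * (N + 1) + i))) := by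
      intro i
      induction i with
      | zero => intro _; left; exact tr_k_zero j
      | succ i ih =>
        intro hi
        rw [tr_succ_micro (by omega)]
        by_cases hcov : P.Cov (P.tr N J (j * (N + 1) + i))
          (P.act (J j) (P.tr N J (j * (N + 1) + i)))
        · right
          have : P.micro (J j) (P.tr N J (j * (N + 1) + i)) = P.tr N J (j * (N + 1) + i) := by
            unfold micro; rw [if_pos hcov]
          rw [this]; exact hcov
        · left
          rcases ih (by omega) with h2 | h2
          · simp [micro, hcov, h2]
          · exact absurd h2 hcov
    rcases key N le_rfl with h2 | h2
    · have := hk j hj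
      rw [h2] at this
      nlinarith [h.ε_pos]
    · exact hc h2

end

end Mwu

/-! ### The normalised scheduling problem as a covering problem -/

/-- Each of the `A + 1` levels contributes at most one, by `card_lev_le`. This is how a norm
constraint becomes a linear budget. -/
theorem SymMono.sum_inv_cap_lev_le {ι : Type*} [Fintype ι] [DecidableEq ι] [Nonempty ι]
    {N : Seminorm ℝ (ι → ℝ)} (hN : SymMono N) {A : ℕ} (hA : Fintype.card ι ≤ 2 ^ A) {y : ι → ℝ}
    (h0 : ∀ i, 0 ≤ y i) (hy : N y ≤ 1) (T : Finset ι) :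
    ∑ i ∈ T, 1 / (cap N (lev A (y i)) : ℝ) ≤ A + 1 := by
  have hmaps : ∀ i ∈ T, lev A (y i) ∈ Finset.range (A + 1) := fun i _ => by
    simpa [Nat.lt_succ_iff] using lev_le A (y i)
  rw [← Finset.sum_fiberwise_of_maps_to hmaps]
  calc _ ≤ ∑ s ∈ Finset.range (A + 1), (1 : ℝ) := by
        refine Finset.sum_le_sum fun s _ => ?_
        have hc : (0 : ℝ) < cap N s := by exact_mod_cast hN.one_le_cap s
        calc _ = ∑ i ∈ T with lev A (y i) = s, 1 / (cap N s : ℝ) :=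
              Finset.sum_congr rfl fun i hi => by rw [(Finset.mem_filter.mp hi).2]
          _ = (T.filter fun i => lev A (y i) = s).card / (cap N s : ℝ) := by simp [div_eq_mul_inv]
          _ ≤ 1 := by
            rw [div_le_one hc]
            exact_mod_cast hN.card_lev_le hA h0 hy s _ fun i hi => (Finset.mem_filter.mp hi).2
    _ = _ := by simp

/-- The dyadic class of a number `x ≥ 1`. -/
noncomputable def cls (x : ℝ) : ℕ := Nat.log 2 ⌊x⌋₊

theorem pow_cls_le {x : ℝ} (hx : 1 ≤ x) : (2 : ℝ) ^ cls x ≤ x := by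
  have h1 : ⌊x⌋₊ ≠ 0 := by
    have := (Nat.one_le_floor_iff x).mpr hx; omega
  have h2 : ((2 ^ cls x : ℕ) : ℝ) ≤ ⌊x⌋₊ := by exact_mod_cast Nat.pow_log_le_self 2 h1
  push_cast at h2
  exact h2.trans (Nat.floor_le (by linarith))

theorem lt_pow_cls {x : ℝ} : x < (2 : ℝ) ^ (cls x + 1) := by
  have h2 : ⌊x⌋₊ + 1 ≤ 2 ^ (cls x + 1) := Nat.lt_pow_succ_log_self (by norm_num) _
  have h3 : ((⌊x⌋₊ + 1 : ℕ) : ℝ) ≤ ((2 ^ (cls x + 1) : ℕ) : ℝ) := by exact_mod_cast h2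
  push_cast at h3
  exact (Nat.lt_floor_add_one x).trans_le h3

theorem cls_mono {x y : ℝ} (h : x ≤ y) : cls x ≤ cls y :=
  Nat.log_mono_right (Nat.floor_le_floor h)

theorem cls_lt {x : ℝ} {k : ℕ} (hx : 1 ≤ x) (h : x < 2 ^ k) : cls x < k := by
  by_contra hc
  have : (2 : ℝ) ^ k ≤ 2 ^ cls x := pow_le_pow_right₀ (by norm_num) (not_lt.mp hc)
  linarith [pow_cls_le hx]

/-- Normalised norms of a scheduling problem with groups `ι` of machines `σ ℓ` and `n` jobs. -/
structure Core (ι : Type) [Fintype ι] [DecidableEq ι] (σ : ι → Type) [∀ ℓ, Fintype (σ ℓ)]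
    [∀ ℓ, DecidableEq (σ ℓ)] (n : ℕ) where
  out : Seminorm ℝ (ι → ℝ)
  inn : ∀ ℓ, Seminorm ℝ (σ ℓ → ℝ)
  mach : (Σ ℓ, σ ℓ) → Seminorm ℝ (Fin n → ℝ)
  a : ℕ
  Am : ℕ
  An : ℕ
  hout : SymMono out
  hinn : ∀ ℓ, SymMono (inn ℓ)
  hmach : ∀ i, SymMono (mach i)
  card_out : Fintype.card ι ≤ 2 ^ a
  card_inn : ∀ ℓ, Fintype.card (σ ℓ) ≤ 2 ^ Am
  card_jobs : n ≤ 2 ^ An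
  a_le : a ≤ Am

namespace Core

variable {ι : Type} [Fintype ι] [DecidableEq ι] {σ : ι → Type} [∀ ℓ, Fintype (σ ℓ)]
  [∀ ℓ, DecidableEq (σ ℓ)] {n : ℕ} (K : Core ι σ n)

/-- Load of a machine. -/
noncomputable def cload (w : Fin n → (Σ ℓ, σ ℓ) → ℝ≥0∞) (y : Fin n → Σ ℓ, σ ℓ) (i : Σ ℓ, σ ℓ) : ℝ :=
  K.mach i fun j => if y j = i then (w j i).toReal else 0

/-- Aggregated value of machine loads. -/
noncomputable def agg (x : (Σ ℓ, σ ℓ) → ℝ) : ℝ := K.out fun ℓ => K.inn ℓ fun i => x ⟨ℓ, i⟩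

/-- Groups with a level. -/
abbrev Grp : Type := ι × Fin (K.a + 1)

/-- Machines with a level of the group and a level of the machine. -/
abbrev Slot : Type := (Σ ℓ, σ ℓ) × Fin (K.a + 1) × Fin (K.Am + 1)

/-- Capacity of the outer norm at a level. -/
noncomputable def capO (b : ℕ) : ℕ := cap K.out b

/-- Capacity of an inner norm at a level. -/
noncomputable def capI (ℓ : ι) (b : ℕ) : ℕ := cap (K.inn ℓ) b

/-- Load scale of a slot. -/
noncomputable def tau (u : K.Slot) : ℝ := (1 / 2) ^ (u.2.1 + u.2.2 : ℕ)

theorem tau_pos (u : K.Slot) : 0 < K.tau u := by unfold tau; positivity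

/-- Relative load of a job of size `x` on a slot. -/
noncomputable def quo (x : ℝ≥0∞) (u : K.Slot) : ℝ :=
  1 / (cap (K.mach u.1) (lev K.An (x.toReal / K.tau u)) : ℝ)

/-- Parameters of the multiplicative weights process. -/
noncomputable def mwu : Mwu K.Grp K.Slot where
  par u := (u.1.1, u.2.1)
  C g := 1 / (K.capO g.2 : ℝ)
  c u := 1 / (K.capI u.1.1 u.2.2 : ℝ)
  v0 := (1 / 2) ^ K.a
  z0 := (1 / 2) ^ (K.a + K.Am)
  B := 960 * ((K.Am : ℝ) + 1) ^ 2
  V := 2 ^ (3 * K.a + 7)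
  ε := (1 / 2) ^ (K.a + K.Am + K.An)

open Classical in
/-- The jobs as seen by the multiplicative weights process. -/
noncomputable def mjob (w : Fin n → (Σ ℓ, σ ℓ) → ℝ≥0∞) (j : ℕ) : MJob K.Slot :=
  if h : j < n then
    ⟨Finset.univ.filter fun u => w ⟨j, h⟩ u.1 ≤ ENNReal.ofReal (K.tau u),
      fun u => K.quo (w ⟨j, h⟩ u.1) u / (40 * (K.An + 1))⟩
  else ⟨∅, fun _ => 0⟩

theorem mjob_nonneg (w : Fin n → (Σ ℓ, σ ℓ) → ℝ≥0∞) (j : ℕ) (u : K.Slot) :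
    0 ≤ (K.mjob w j).lam u := by
  unfold mjob
  split_ifs
  · unfold quo; positivity
  · exact le_rfl

/-- Capacities lie between `1` and the number of coordinates, so `C` lies in `[2 ^ (-a), 1]` and `c`
in `[2 ^ (-Am), 1]`. The initial values `2 ^ (-a)` and `2 ^ (-(a + Am))` are small enough for all
groups and slots to be open to that extent from the start. -/
theorem mwu_good [Nonempty ι] [∀ ℓ, Nonempty (σ ℓ)] : K.mwu.Good K.a K.Am n := by
  have hP : ∀ b, (1 : ℝ) ≤ K.capO b := fun b => by exact_mod_cast K.hout.one_le_cap b
  have hM : ∀ ℓ b, (1 : ℝ) ≤ K.capI ℓ b := fun ℓ b => by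
    exact_mod_cast (K.hinn ℓ).one_le_cap b
  have hPle : ∀ b, (K.capO b : ℝ) ≤ 2 ^ K.a := fun b => by
    exact_mod_cast (cap_le_card K.out b).trans K.card_out
  have hMle : ∀ ℓ b, (K.capI ℓ b : ℝ) ≤ 2 ^ K.Am := fun ℓ b => by
    exact_mod_cast (cap_le_card (K.inn ℓ) b).trans (K.card_inn ℓ)
  have hC : ∀ g : K.Grp, (1 / 2 : ℝ) ^ K.a ≤ K.mwu.C g := fun g => by
    show _ ≤ 1 / (K.capO g.2 : ℝ)
    rw [one_div_pow]
    exact one_div_le_one_div_of_le (by linarith [hP g.2]) (hPle _)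
  have hc : ∀ u : K.Slot, (1 / 2 : ℝ) ^ K.Am ≤ K.mwu.c u := fun u => by
    show _ ≤ 1 / (K.capI u.1.1 u.2.2 : ℝ)
    rw [one_div_pow]
    exact one_div_le_one_div_of_le (by linarith [hM u.1.1 u.2.2]) (hMle _ _)
  have hhalf : ∀ k, (1 / 2 : ℝ) ^ k ≤ 1 := fun k => pow_le_one₀ (by norm_num) (by norm_num)
  refine ⟨K.a_le, rfl, rfl, rfl, rfl, ?_, ?_, hC, ?_, ?_, ?_, ?_, ?_⟩
  · show (0 : ℝ) < (1 / 2) ^ (K.a + K.Am + K.An)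
    positivity
  · show (n : ℝ) * (1 / 2) ^ (K.a + K.Am + K.An) ≤ 1
    have h1 : (n : ℝ) ≤ 2 ^ K.An := by exact_mod_cast K.card_jobs
    calc (n : ℝ) * (1 / 2) ^ (K.a + K.Am + K.An) ≤ 2 ^ K.An * (1 * (1 / 2) ^ K.An) := by
          rw [pow_add]; gcongr; exact hhalf _
      _ = 1 := by rw [one_mul, ← mul_pow]; norm_num
  · intro u
    exact lt_of_lt_of_le (by positivity) (hc u)
  · intro g
    refine le_trans ?_ (hC g)
    exact pow_le_pow_of_le_one (by norm_num) (by norm_num) (by omega)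
  · intro u
    calc (1 / 2 : ℝ) ^ (K.a + K.Am + K.An) ≤ (1 / 2) ^ (K.a + K.Am) :=
          pow_le_pow_of_le_one (by norm_num) (by norm_num) (by omega)
      _ = (1 / 2) ^ K.a * (1 / 2) ^ K.Am := pow_add _ _ _
      _ ≤ _ := by
        have h1 := hC (K.mwu.par u)
        have h2 := hc u
        exact mul_le_mul h1 h2 (by positivity) (le_trans (by positivity) h1)
  · have h1 : ∑ g, K.mwu.C g ≤ Fintype.card ι * (K.a + 1) := by
      calc ∑ g, K.mwu.C g ≤ ∑ _g : K.Grp, (1 : ℝ) := Finset.sum_le_sum fun g _ => by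
            show 1 / (K.capO g.2 : ℝ) ≤ 1
            rw [div_le_one (by linarith [hP g.2])]; exact hP _
        _ = _ := by simp
    have h2 : (Fintype.card ι : ℝ) ≤ 2 ^ K.a := by exact_mod_cast K.card_out
    calc (∑ g, K.mwu.C g) * (1 / 2) ^ K.a ≤ (2 ^ K.a * (K.a + 1)) * (1 / 2) ^ K.a := by
          gcongr; exact h1.trans (by gcongr)
      _ = (K.a + 1) * (2 * (1 / 2)) ^ K.a := by rw [mul_pow]; ring
      _ = _ := by norm_num
  · intro g
    show ∑ u with K.mwu.par u = g, K.mwu.c u * (1 / 2) ^ (K.a + K.Am)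
      ≤ (K.Am + 1) * (1 / 2) ^ K.a
    have h1 : ∑ u with K.mwu.par u = g, K.mwu.c u * (1 / 2 : ℝ) ^ (K.a + K.Am)
        ≤ ∑ u with K.mwu.par u = g, (1 / 2 : ℝ) ^ (K.a + K.Am) := by
      refine Finset.sum_le_sum fun u _ => ?_
      have : K.mwu.c u ≤ 1 := by
        show 1 / (K.capI u.1.1 u.2.2 : ℝ) ≤ 1
        rw [div_le_one (by linarith [hM u.1.1 u.2.2])]; exact hM _ _
      exact mul_le_of_le_one_left (by positivity) this
    have h2 : (Finset.univ.filter fun u => K.mwu.par u = g).card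
        ≤ Fintype.card (σ g.1) * (K.Am + 1) := by
      have e : Fintype.card (σ g.1) * (K.Am + 1)
          = (Finset.univ : Finset (σ g.1 × Fin (K.Am + 1))).card := by simp
      rw [e]
      have hsub : (Finset.univ.filter fun u => K.mwu.par u = g) ⊆
          (Finset.univ : Finset (σ g.1 × Fin (K.Am + 1))).image
            fun x => ((⟨g.1, x.1⟩, g.2, x.2) : K.Slot) := by
        rintro ⟨⟨ℓ, i⟩, b, t⟩ hu
        have h3 : (ℓ, b) = g := by simpa [mwu] using hu
        subst h3
        simp
      exact (Finset.card_le_card hsub).trans Finset.card_image_le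
    have h3 : (Fintype.card (σ g.1) : ℝ) ≤ 2 ^ K.Am := by exact_mod_cast K.card_inn g.1
    refine h1.trans ?_
    rw [Finset.sum_const, nsmul_eq_mul]
    calc _ ≤ ((Fintype.card (σ g.1) * (K.Am + 1) : ℕ) : ℝ) * (1 / 2) ^ (K.a + K.Am) := by
          gcongr
      _ ≤ (2 ^ K.Am * (K.Am + 1)) * (1 / 2) ^ (K.a + K.Am) := by
          push_cast; gcongr
      _ = (K.Am + 1) * (1 / 2) ^ K.a * (2 * (1 / 2)) ^ K.Am := by
          rw [pow_add, mul_pow]; ring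
      _ = _ := by norm_num

/-- Number of price increments per job. -/
noncomputable def rounds : ℕ := ⌈70 * K.mwu.B * ((K.a : ℝ) + 1) ^ 2 / K.mwu.ε⌉₊

/-- The state of the multiplicative weights process when job `j` is charged. -/
noncomputable def stAt (w : Fin n → (Σ ℓ, σ ℓ) → ℝ≥0∞) (j : ℕ) : MState K.Grp K.Slot :=
  K.mwu.tr K.rounds (K.mjob w) (j * (K.rounds + 1) + K.rounds)

section Offline

variable [Nonempty ι] [∀ ℓ, Nonempty (σ ℓ)] [NeZero n]
variable {w : Fin n → (Σ ℓ, σ ℓ) → ℝ≥0∞} {y : Fin n → Σ ℓ, σ ℓ}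

/-- Level of a group in an allocation. -/
noncomputable def lvO (w : Fin n → (Σ ℓ, σ ℓ) → ℝ≥0∞) (y : Fin n → Σ ℓ, σ ℓ) (ℓ : ι) : ℕ :=
  lev K.a (K.inn ℓ fun i => K.cload w y ⟨ℓ, i⟩)

/-- Level of a machine in an allocation. -/
noncomputable def lvI (w : Fin n → (Σ ℓ, σ ℓ) → ℝ≥0∞) (y : Fin n → Σ ℓ, σ ℓ) (i : Σ ℓ, σ ℓ) : ℕ :=
  lev K.Am (K.cload w y i / (1 / 2) ^ K.lvO w y i.1)

/-- Slot of a machine in an allocation. -/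
noncomputable def slotOf (w : Fin n → (Σ ℓ, σ ℓ) → ℝ≥0∞) (y : Fin n → Σ ℓ, σ ℓ) (i : Σ ℓ, σ ℓ) :
    K.Slot :=
  (i, ⟨K.lvO w y i.1, Nat.lt_succ_of_le (lev_le _ _)⟩, ⟨K.lvI w y i, Nat.lt_succ_of_le (lev_le _ _)⟩)

theorem cload_nonneg (i : Σ ℓ, σ ℓ) : 0 ≤ K.cload w y i := apply_nonneg _ _

theorem inn_cload_le (hy : K.agg (K.cload w y) ≤ 1) (ℓ : ι) :
    K.inn ℓ (fun i => K.cload w y ⟨ℓ, i⟩) ≤ (1 / 2) ^ K.lvO w y ℓ :=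
  le_of_lev ((K.hout.le_of_apply_le (fun _ => apply_nonneg _ _) ℓ).trans hy)

theorem cload_div_le (hy : K.agg (K.cload w y) ≤ 1) (i : Σ ℓ, σ ℓ) :
    K.cload w y i / (1 / 2) ^ K.lvO w y i.1 ≤ 1 := by
  rw [div_le_one (by positivity)]
  refine le_trans ?_ (K.inn_cload_le hy i.1)
  exact (K.hinn i.1).le_of_apply_le (y := fun k => K.cload w y ⟨i.1, k⟩)
    (fun _ => K.cload_nonneg _) i.2

theorem cload_le_tau (hy : K.agg (K.cload w y) ≤ 1) (i : Σ ℓ, σ ℓ) :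
    K.cload w y i ≤ K.tau (K.slotOf w y i) := by
  have h1 := le_of_lev (A := K.Am) (K.cload_div_le hy i)
  rw [div_le_iff₀ (by positivity)] at h1
  unfold tau slotOf
  rw [pow_add, mul_comm]
  exact h1

/-- Each group receives the level of its inner norm, and each machine the level of its load relative
to the scale of its group. The three budgets are three applications of `sum_inv_cap_lev_le`, to the
outer, inner and machine norms; the bound `1 / 40` is the normalisation in `mjob`. The slot chosen
for `j ≥ n` is a mere default. -/
theorem offline_spec (hfin : ∀ j, w j (y j) ≠ ∞) (hy : K.agg (K.cload w y) ≤ 1) :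
    K.mwu.Offline K.a K.Am n (K.mjob w)
      (fun j => if h : j < n then K.slotOf w y (y ⟨j, h⟩) else K.slotOf w y (y 0))
      (Finset.univ.image (K.slotOf w y))
      (Finset.univ.image fun ℓ => ((ℓ, ⟨K.lvO w y ℓ, Nat.lt_succ_of_le (lev_le _ _)⟩) : K.Grp)) where
  mem_al j hj := by
    simp only [mjob, hj, dif_pos, Finset.mem_filter, Finset.mem_univ, true_and]
    have h1 := (K.hmach (y ⟨j, hj⟩)).le_of_apply_le
      (y := fun k => if y k = y ⟨j, hj⟩ then (w k (y ⟨j, hj⟩)).toReal else 0)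
      (fun k => by split_ifs <;> positivity) ⟨j, hj⟩
    simp only [if_true] at h1
    have h2 := h1.trans (K.cload_le_tau hy (y ⟨j, hj⟩))
    exact (ENNReal.le_ofReal_iff_toReal_le (hfin _) (K.tau_pos _).le).mpr h2
  mem_O j hj := by simp [hj]
  par_mem u hu := by
    obtain ⟨i, _, rfl⟩ := Finset.mem_image.mp hu
    exact Finset.mem_image.mpr ⟨i.1, Finset.mem_univ _, rfl⟩
  sum_C := by
    rw [Finset.sum_image (fun ℓ _ ℓ' _ h => (Prod.ext_iff.mp h).1)]
    exact K.hout.sum_inv_cap_lev_le K.card_out (fun _ => apply_nonneg _ _) hy Finset.univ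
  sum_c g hg := by
    obtain ⟨ℓ, _, rfl⟩ := Finset.mem_image.mp hg
    have hN : K.inn ℓ (fun i => K.cload w y ⟨ℓ, i⟩ / (1 / 2) ^ K.lvO w y ℓ) ≤ 1 := by
      have e : (fun i => K.cload w y ⟨ℓ, i⟩ / (1 / 2 : ℝ) ^ K.lvO w y ℓ)
          = ((1 / 2 : ℝ) ^ K.lvO w y ℓ)⁻¹ • fun i => K.cload w y ⟨ℓ, i⟩ := by
        funext i; simp [div_eq_inv_mul]
      rw [e, map_smul_eq_mul, Real.norm_of_nonneg (by positivity), inv_mul_le_iff₀ (by positivity),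
        mul_one]
      exact K.inn_cload_le hy ℓ
    have h1 := (K.hinn ℓ).sum_inv_cap_lev_le (K.card_inn ℓ)
      (fun i => div_nonneg (K.cload_nonneg (w := w) (y := y) ⟨ℓ, i⟩) (by positivity)) hN
      Finset.univ
    refine le_trans ?_ h1
    have hsub : ((Finset.univ.image (K.slotOf w y)).filter fun u => K.mwu.par u =
        ((ℓ, ⟨K.lvO w y ℓ, Nat.lt_succ_of_le (lev_le _ _)⟩) : K.Grp)) ⊆
        Finset.univ.image fun i : σ ℓ => K.slotOf w y ⟨ℓ, i⟩ := by
      intro u hu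
      obtain ⟨hu1, hu2⟩ := Finset.mem_filter.mp hu
      obtain ⟨⟨ℓ', i⟩, _, rfl⟩ := Finset.mem_image.mp hu1
      have : ℓ' = ℓ := (Prod.ext_iff.mp hu2).1
      subst this
      exact Finset.mem_image.mpr ⟨i, Finset.mem_univ _, rfl⟩
    refine (Finset.sum_le_sum_of_subset_of_nonneg hsub fun u _ _ => ?_).trans ?_
    · exact (K.mwu_good.c_pos u).le
    · rw [Finset.sum_image]
      · exact le_of_eq rfl
      · intro i _ i' _ h
        have h2 : (⟨ℓ, i⟩ : Σ ℓ, σ ℓ) = ⟨ℓ, i'⟩ := (Prod.ext_iff.mp h).1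
        simpa using h2
  sum_lam u hu := by
    obtain ⟨i, _, rfl⟩ := Finset.mem_image.mp hu
    have hN : K.mach i (fun j => (if y j = i then (w j i).toReal else 0)
        / K.tau (K.slotOf w y i)) ≤ 1 := by
      have e : (fun j => (if y j = i then (w j i).toReal else 0) / K.tau (K.slotOf w y i))
          = (K.tau (K.slotOf w y i))⁻¹ • fun j => if y j = i then (w j i).toReal else 0 := by
        funext j; simp [div_eq_inv_mul]
      have hτ := K.tau_pos (K.slotOf w y i)
      rw [e, map_smul_eq_mul, Real.norm_of_nonneg (by positivity), inv_mul_le_iff₀ hτ, mul_one]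
      exact K.cload_le_tau hy i
    have h1 := (K.hmach i).sum_inv_cap_lev_le (A := K.An) (by simpa using K.card_jobs)
      (fun j => div_nonneg (by split_ifs <;> positivity) (K.tau_pos (K.slotOf w y i)).le) hN
      (Finset.univ.filter fun j => y j = i)
    have e1 : ∑ j ∈ Finset.range n with (if h : j < n then K.slotOf w y (y ⟨j, h⟩)
          else K.slotOf w y (y 0)) = K.slotOf w y i, (K.mjob w j).lam (K.slotOf w y i)
        = ∑ j : Fin n, if y j = i then
          K.quo (w j i) (K.slotOf w y i) / (40 * (K.An + 1)) else 0 := by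
      rw [Finset.sum_filter, Finset.sum_range]
      refine Finset.sum_congr rfl fun j _ => ?_
      have hs : (K.slotOf w y (y j) = K.slotOf w y i) ↔ y j = i :=
        ⟨fun h => (Prod.ext_iff.mp h).1, fun h => by rw [h]⟩
      simp only [j.2, dif_pos, Fin.eta, hs, mjob]
      rfl
    rw [e1, ← Finset.sum_filter, ← Finset.sum_div, div_le_div_iff₀ (by positivity) (by norm_num)]
    have e2 : ∑ j ∈ Finset.univ.filter (fun j => y j = i), K.quo (w j i) (K.slotOf w y i)
        = ∑ j ∈ Finset.univ.filter (fun j => y j = i), 1 / (cap (K.mach i) (lev K.An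
          ((if y j = i then (w j i).toReal else 0) / K.tau (K.slotOf w y i))) : ℝ) := by
      refine Finset.sum_congr rfl fun j hj => ?_
      rw [if_pos (Finset.mem_filter.mp hj).2]; rfl
    rw [e2]
    linarith

/-- The guarantees of the multiplicative weights process for an instance of optimum at most `1`. -/
theorem run_spec (hfin : ∀ j, w j (y j) ≠ ∞) (hy : K.agg (K.cload w y) ≤ 1) :
    ∑ g, K.mwu.C g * (K.mwu.tr K.rounds (K.mjob w) (n * (K.rounds + 1))).v g
      ≤ 70 * ((K.a : ℝ) + 1) ^ 2 ∧
    (∀ τ ≤ n * (K.rounds + 1), ∀ g, (K.mwu.tr K.rounds (K.mjob w) τ).v g < K.mwu.V ∧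
      K.mwu.Q (K.mwu.tr K.rounds (K.mjob w) τ).z g
        ≤ K.mwu.B * (K.mwu.tr K.rounds (K.mjob w) τ).v g) ∧
    ∀ j < n, K.mwu.Cov (K.stAt w j) (K.mwu.act (K.mjob w j) (K.stAt w j)) := by
  refine Mwu.process_spec K.mwu_good (K.mjob_nonneg w) (K.offline_spec hfin hy) ?_
  have h1 := Nat.le_ceil (70 * K.mwu.B * ((K.a : ℝ) + 1) ^ 2 / K.mwu.ε)
  rw [div_le_iff₀ K.mwu_good.ε_pos] at h1
  rw [mul_comm K.mwu.ε]
  exact h1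

end Offline

end Core

/-! ### Tokens: dyadic classes of the fractional values -/

theorem sum_fin_pow_two_le (M c : ℕ) :
    ∑ e : Fin M, (if (e : ℕ) ≤ c then (2 : ℝ) ^ (e : ℕ) else 0) ≤ 2 * 2 ^ c := by
  rw [Fin.sum_univ_eq_sum_range (fun e => if e ≤ c then (2 : ℝ) ^ e else 0) M, ← Finset.sum_filter]
  calc _ ≤ ∑ e ∈ Finset.range (c + 1), (2 : ℝ) ^ e := by
        refine Finset.sum_le_sum_of_subset_of_nonneg (fun e he => ?_) fun _ _ _ => by positivity
        simp only [Finset.mem_filter, Finset.mem_range] at he ⊢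
        omega
    _ ≤ 2 * 2 ^ c := by
      rw [geom_sum_eq (by norm_num), pow_succ]
      norm_num
      linarith [pow_pos (two_pos : (0 : ℝ) < 2) c]

/-- Each use multiplies a quantity that is at least `zb` by `1 + lam`, and before each use it is
still below `2 * zb`. So the earlier loads sum to less than one, and the last use adds at most one.
-/
theorem sum_le_two_of_growth {zb : ℝ} (hzb : 0 < zb) {lam zs : ℕ → ℝ} (h0 : ∀ t, 0 ≤ lam t)
    (hz : ∀ t, zs t ≤ zs (t + 1))
    (h : ∀ t, lam t = 0 ∨ (lam t ≤ 1 ∧ zs t < 2 * zb ∧ zb * (1 + lam t) ≤ zs (t + 1) ∧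
      zs t * (1 + lam t) ≤ zs (t + 1))) (t : ℕ) : ∑ j ∈ Finset.range t, lam j ≤ 2 := by
  have key : ∀ t, ∑ j ∈ Finset.range t, lam j = 0 ∨
      zb * (1 + ∑ j ∈ Finset.range t, lam j) ≤ zs t := by
    intro t
    induction t with
    | zero => left; simp
    | succ t ih =>
      rw [Finset.sum_range_succ]
      have hl := h0 t
      have hs0 : 0 ≤ ∑ j ∈ Finset.range t, lam j := Finset.sum_nonneg fun j _ => h0 j
      rcases h t with hH | ⟨_, _, h1, h2⟩
      · rw [hH, add_zero]
        rcases ih with h | h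
        · exact Or.inl h
        · exact Or.inr (h.trans (hz t))
      · right
        rcases ih with h | h
        · rw [h, zero_add]; exact h1
        · calc zb * (1 + (∑ j ∈ Finset.range t, lam j + lam t))
              ≤ zb * ((1 + ∑ j ∈ Finset.range t, lam j) * (1 + lam t)) := by
                refine mul_le_mul_of_nonneg_left ?_ hzb.le
                nlinarith
            _ = zb * (1 + ∑ j ∈ Finset.range t, lam j) * (1 + lam t) := by ring
            _ ≤ zs t * (1 + lam t) := mul_le_mul_of_nonneg_right h (by linarith)
            _ ≤ _ := h2
  induction t with
  | zero => simp
  | succ t ih =>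
    rw [Finset.sum_range_succ]
    rcases h t with hH | ⟨h1, h2, _, _⟩
    · rw [hH, add_zero]; exact ih
    · rcases key t with h | h
      · rw [h]; linarith
      · have h3 : zb * (1 + ∑ j ∈ Finset.range t, lam j) < zb * 2 := by linarith
        have := lt_of_mul_lt_mul_left h3 hzb.le
        linarith

namespace Core

variable {ι : Type} [Fintype ι] [DecidableEq ι] {σ : ι → Type} [∀ ℓ, Fintype (σ ℓ)]
  [∀ ℓ, DecidableEq (σ ℓ)] {n : ℕ} (K : Core ι σ n)

/-- Group tokens: a group with the dyadic class of its value. -/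
abbrev GTok : Type := K.Grp × Fin (4 * K.a + 8)

/-- Slot tokens: a slot with the dyadic classes of the group value and the slot value. -/
abbrev Tok : Type := K.Slot × Fin (4 * K.a + 8) × Fin (8 * K.Am + 18)

/-- Group of a slot token. -/
def grp (H : K.Tok) : K.GTok := ((H.1.1.1, H.1.2.1), H.2.1)

/-- Value of a group token. -/
noncomputable def vbar (G : K.GTok) : ℝ := 2 ^ (G.2 : ℕ) / 2 ^ K.a

/-- Value of a slot token relative to its group. -/
noncomputable def rho (H : K.Tok) : ℝ := 2 ^ (H.2.2 : ℕ) / (2 ^ (H.2.1 : ℕ) * 2 ^ K.Am)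

/-- Token of a slot in a state. -/
noncomputable def tok (s : MState K.Grp K.Slot) (u : K.Slot) : K.Tok :=
  (u, ⟨min (cls (s.v (K.mwu.par u) / K.mwu.v0)) (4 * K.a + 7), by omega⟩,
    ⟨min (cls (s.z u / K.mwu.z0)) (8 * K.Am + 17), by omega⟩)

/-- Tokens used by a job. -/
noncomputable def toks (w : Fin n → (Σ ℓ, σ ℓ) → ℝ≥0∞) (j : Fin n) : Finset K.Tok :=
  (K.mwu.used (K.mjob w j) (K.stAt w j)).image (K.tok (K.stAt w j))

/-- What the rounding needs to know about the tokens used by the jobs. -/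
structure TokOK (w : Fin n → (Σ ℓ, σ ℓ) → ℝ≥0∞) (U : Fin n → Finset K.Tok) : Prop where
  allowed : ∀ j, ∀ H ∈ U j, w j H.1.1 ≤ ENNReal.ofReal (K.tau H.1)
  cover : ∀ j, 1 / 4 ≤ ∑ G, min 1 (K.vbar G) *
    min 1 (∑ H ∈ U j with K.grp H = G, min 1 (K.rho H))
  sum_quo : ∀ H, ∑ j with H ∈ U j, K.quo (w j H.1.1) H.1 ≤ 80 * (K.An + 1)
  sum_rho : ∀ G, ∑ H ∈ Finset.univ.biUnion U with K.grp H = G, K.mwu.c H.1 * K.rho H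
    ≤ 4 * K.mwu.B
  sum_vbar : ∑ G ∈ (Finset.univ.biUnion U).image K.grp, K.mwu.C G.1 * K.vbar G
    ≤ 140 * ((K.a : ℝ) + 1) ^ 2

theorem tok_injective (s : MState K.Grp K.Slot) : Function.Injective (K.tok s) :=
  fun _ _ h => (Prod.ext_iff.mp h).1

theorem vbar_pos (G : K.GTok) : 0 < K.vbar G := by unfold vbar; positivity
theorem rho_pos (H : K.Tok) : 0 < K.rho H := by unfold rho; positivity

variable [Nonempty ι] [∀ ℓ, Nonempty (σ ℓ)] [NeZero n]
variable {w : Fin n → (Σ ℓ, σ ℓ) → ℝ≥0∞} {y : Fin n → Σ ℓ, σ ℓ}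

theorem B_lt : K.mwu.B ≤ 2 ^ (10 + 2 * K.Am) := by
  show 960 * ((K.Am : ℝ) + 1) ^ 2 ≤ _
  have h1 : (K.Am : ℝ) + 1 ≤ 2 ^ K.Am := by exact_mod_cast Nat.lt_two_pow_self
  calc 960 * ((K.Am : ℝ) + 1) ^ 2 ≤ 1024 * (2 ^ K.Am) ^ 2 := by gcongr; norm_num
    _ = _ := by rw [pow_add, mul_comm 2 K.Am, pow_mul]; norm_num

theorem c_ge (u : K.Slot) : (1 / 2 : ℝ) ^ K.Am ≤ K.mwu.c u := by
  have h1 : (1 : ℝ) ≤ K.capI u.1.1 u.2.2 := by exact_mod_cast (K.hinn u.1.1).one_le_cap _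
  have h2 : (K.capI u.1.1 u.2.2 : ℝ) ≤ 2 ^ K.Am := by
    exact_mod_cast (cap_le_card (K.inn u.1.1) _).trans (K.card_inn u.1.1)
  show _ ≤ 1 / (K.capI u.1.1 u.2.2 : ℝ)
  rw [one_div_pow]
  exact one_div_le_one_div_of_le (by linarith) h2

theorem c_le_one (u : K.Slot) : K.mwu.c u ≤ 1 := by
  have h1 : (1 : ℝ) ≤ K.capI u.1.1 u.2.2 := by exact_mod_cast (K.hinn u.1.1).one_le_cap _
  show 1 / (K.capI u.1.1 u.2.2 : ℝ) ≤ 1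
  rw [div_le_one (by linarith)]; exact h1

theorem quo_le_one (x : ℝ≥0∞) (u : K.Slot) : K.quo x u ≤ 1 := by
  have h1 : (1 : ℝ) ≤ cap (K.mach u.1) (lev K.An (x.toReal / K.tau u)) := by
    exact_mod_cast (K.hmach u.1).one_le_cap _
  unfold quo
  rw [div_le_one (by linarith)]; exact h1

omit [Nonempty ι] [∀ ℓ, Nonempty (σ ℓ)] [NeZero n] in
theorem mjob_of_lt (w : Fin n → (Σ ℓ, σ ℓ) → ℝ≥0∞) (j : Fin n) {u : K.Slot} :
    (K.mjob w j).lam u = K.quo (w j u.1) u / (40 * (K.An + 1)) := by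
  unfold mjob
  rw [dif_pos j.2]

section Run

variable (hfin : ∀ j, w j (y j) ≠ ∞) (hy : K.agg (K.cload w y) ≤ 1)
include hfin hy

theorem time_le {j : ℕ} (hj : j < n) : j * (K.rounds + 1) + K.rounds ≤ n * (K.rounds + 1) := by
  nlinarith

theorem stAt_inv (j : ℕ) : K.mwu.Inv (K.stAt w j) :=
  Mwu.tr_inv K.mwu_good (K.mjob_nonneg w) _

theorem class_v {j : ℕ} (hj : j < n) (u : K.Slot) :
    K.vbar (K.grp (K.tok (K.stAt w j) u)) ≤ (K.stAt w j).v (K.mwu.par u) ∧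
    (K.stAt w j).v (K.mwu.par u) < 2 * K.vbar (K.grp (K.tok (K.stAt w j) u)) ∧
    (((K.tok (K.stAt w j) u).2.1 : ℕ) = cls ((K.stAt w j).v (K.mwu.par u) / K.mwu.v0)) := by
  have hg := K.mwu_good
  set v := (K.stAt w j).v (K.mwu.par u) with hv
  have hv0 := hg.v0_pos
  have h1 : 1 ≤ v / K.mwu.v0 := by
    rw [le_div_iff₀ hv0, one_mul]; exact (K.stAt_inv hfin hy j).v0_le _
  have h2 : v / K.mwu.v0 < 2 ^ (4 * K.a + 7) := by
    rw [div_lt_iff₀ hv0]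
    have h3 := (((K.run_spec hfin hy).2.1 _ (K.time_le hfin hy hj)) (K.mwu.par u)).1
    refine lt_of_lt_of_eq h3 ?_
    show (2 : ℝ) ^ (3 * K.a + 7) = 2 ^ (4 * K.a + 7) * (1 / 2) ^ K.a
    rw [show 4 * K.a + 7 = (3 * K.a + 7) + K.a by ring, pow_add _ (3 * K.a + 7) K.a, mul_assoc,
      ← mul_pow]
    norm_num
  have h3 : ((K.tok (K.stAt w j) u).2.1 : ℕ) = cls (v / K.mwu.v0) := by
    show min (cls (v / K.mwu.v0)) (4 * K.a + 7) = _
    exact min_eq_left (cls_lt h1 h2).le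
  have h4 : K.vbar (K.grp (K.tok (K.stAt w j) u)) = 2 ^ cls (v / K.mwu.v0) * K.mwu.v0 := by
    show (2 : ℝ) ^ ((K.tok (K.stAt w j) u).2.1 : ℕ) / 2 ^ K.a = _
    rw [h3, hg.v0_eq, one_div_pow]; ring
  refine ⟨?_, ?_, h3⟩
  · rw [h4, ← le_div_iff₀ hv0]; exact pow_cls_le h1
  · rw [h4, ← mul_assoc, ← pow_succ', ← div_lt_iff₀ hv0]; exact lt_pow_cls

/-- The truncation of classes in `tok` never binds: `c ≥ 2 ^ (-Am)` and `Q ≤ B v < B V` bound `z` by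
a power of two that fits into the range of classes. -/
theorem class_z {j : ℕ} (hj : j < n) (u : K.Slot) :
    2 ^ ((K.tok (K.stAt w j) u).2.2 : ℕ) * K.mwu.z0 ≤ (K.stAt w j).z u ∧
    (K.stAt w j).z u < 2 * (2 ^ ((K.tok (K.stAt w j) u).2.2 : ℕ) * K.mwu.z0) ∧
    (((K.tok (K.stAt w j) u).2.2 : ℕ) = cls ((K.stAt w j).z u / K.mwu.z0)) := by
  have hg := K.mwu_good
  set z := (K.stAt w j).z u with hz
  have hz0 := hg.z0_pos
  have h1 : 1 ≤ z / K.mwu.z0 := by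
    rw [le_div_iff₀ hz0, one_mul]; exact (K.stAt_inv hfin hy j).z0_le _
  have hzp : 0 < z := hz0.trans_le ((K.stAt_inv hfin hy j).z0_le _)
  have h2 : z / K.mwu.z0 < 2 ^ (8 * K.Am + 17) := by
    rw [div_lt_iff₀ hz0]
    obtain ⟨h3, h4⟩ := ((K.run_spec hfin hy).2.1 _ (K.time_le hfin hy hj)) (K.mwu.par u)
    have h5 : K.mwu.c u * z ≤ K.mwu.Q (K.stAt w j).z (K.mwu.par u) :=
      Finset.single_le_sum (f := fun u => K.mwu.c u * (K.stAt w j).z u)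
        (fun u _ => mul_nonneg (hg.c_pos u).le
          (hz0.le.trans ((K.stAt_inv hfin hy j).z0_le _))) (by simp)
    have h6 : (1 / 2 : ℝ) ^ K.Am * z < 2 ^ (10 + 2 * K.Am) * 2 ^ (3 * K.a + 7) := by
      calc (1 / 2 : ℝ) ^ K.Am * z ≤ K.mwu.c u * z := by gcongr; exact K.c_ge u
        _ ≤ K.mwu.B * (K.stAt w j).v (K.mwu.par u) := h5.trans h4
        _ < K.mwu.B * K.mwu.V := by
          have := hg.B_pos
          gcongr
          exact h3
        _ ≤ _ := by
          have := hg.B_pos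
          show K.mwu.B * 2 ^ (3 * K.a + 7) ≤ _
          gcongr
          exact K.B_lt
    have h7 : (2 : ℝ) ^ K.Am * (1 / 2) ^ K.Am = 1 := by rw [← mul_pow]; norm_num
    calc z = 2 ^ K.Am * ((1 / 2 : ℝ) ^ K.Am * z) := by rw [← mul_assoc, h7, one_mul]
      _ < 2 ^ K.Am * (2 ^ (10 + 2 * K.Am) * 2 ^ (3 * K.a + 7)) := by gcongr
      _ = 2 ^ (K.Am + (10 + 2 * K.Am) + (3 * K.a + 7)) := by rw [pow_add, pow_add]; ring
      _ ≤ 2 ^ (8 * K.Am + 17 - (K.a + K.Am)) := by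
        refine pow_le_pow_right₀ (by norm_num) ?_
        have := K.a_le; omega
      _ = 2 ^ (8 * K.Am + 17) * (1 / 2) ^ (K.a + K.Am) := by
        rw [pow_sub₀ _ (by norm_num) (by have := K.a_le; omega), one_div_pow, one_div]
      _ = 2 ^ (8 * K.Am + 17) * K.mwu.z0 := by rw [hg.z0_eq]
  have h3 : ((K.tok (K.stAt w j) u).2.2 : ℕ) = cls (z / K.mwu.z0) := by
    show min (cls (z / K.mwu.z0)) (8 * K.Am + 17) = _
    exact min_eq_left (cls_lt h1 h2).le
  refine ⟨?_, ?_, h3⟩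
  · rw [h3, ← le_div_iff₀ hz0]; exact pow_cls_le h1
  · rw [h3, ← mul_assoc, ← pow_succ', ← div_lt_iff₀ hz0]; exact lt_pow_cls

omit hfin hy [Nonempty ι] [∀ ℓ, Nonempty (σ ℓ)] [NeZero n] in
theorem rho_mul_vbar (H : K.Tok) :
    K.rho H * K.vbar (K.grp H) = 2 ^ (H.2.2 : ℕ) * K.mwu.z0 := by
  show 2 ^ (H.2.2 : ℕ) / (2 ^ (H.2.1 : ℕ) * 2 ^ K.Am) * (2 ^ (H.2.1 : ℕ) / 2 ^ K.a)
    = 2 ^ (H.2.2 : ℕ) * (1 / 2) ^ (K.a + K.Am)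
  rw [one_div_pow, pow_add]
  field_simp

omit hfin hy [Nonempty ι] [∀ ℓ, Nonempty (σ ℓ)] [NeZero n] in
theorem mem_toks {j : Fin n} {H : K.Tok} (hH : H ∈ K.toks w j) :
    H.1 ∈ K.mwu.used (K.mjob w j) (K.stAt w j) ∧ H = K.tok (K.stAt w j) H.1 := by
  obtain ⟨u, hu, rfl⟩ := Finset.mem_image.mp hH
  exact ⟨hu, rfl⟩

/-- Passing to classes loses a factor at most `2` in `v` and at most `2` in `z / v`; the used slots
had coverage at least one. -/
theorem toks_cover (j : Fin n) : 1 / 4 ≤ ∑ G, min 1 (K.vbar G) *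
    min 1 (∑ H ∈ K.toks w j with K.grp H = G, min 1 (K.rho H)) := by
  have hg := K.mwu_good
  set s := K.stAt w j with hs
  have hInv : K.mwu.Inv s := K.stAt_inv hfin hy j
  have hsel := Mwu.used_spec hg hInv ((K.run_spec hfin hy).2.2 j j.2)
  set A := K.mwu.used (K.mjob w j) s with hA
  set F : K.GTok → ℝ := fun G => min 1 (K.vbar G) *
    min 1 (∑ H ∈ K.toks w j with K.grp H = G, min 1 (K.rho H)) with hF
  have hF0 : ∀ G, 0 ≤ F G := fun G => by
    have := K.vbar_pos G
    refine mul_nonneg (by positivity) (le_min zero_le_one (Finset.sum_nonneg fun H _ => ?_))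
    have := K.rho_pos H
    positivity
  let φ : K.Grp → K.GTok := fun g =>
    (g, ⟨min (cls (s.v g / K.mwu.v0)) (4 * K.a + 7), by omega⟩)
  have hφ : Function.Injective φ := fun g g' h => (Prod.ext_iff.mp h).1
  have hφt : ∀ u, K.grp (K.tok s u) = φ (K.mwu.par u) := fun u => rfl
  have h1 : ∑ g, F (φ g) ≤ ∑ G, F G := by
    rw [← Finset.sum_image (s := Finset.univ) (f := F) (fun g _ g' _ h => hφ h)]
    exact Finset.sum_le_sum_of_subset_of_nonneg (Finset.subset_univ _) fun G _ _ => hF0 G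
  have hmin2 : ∀ x : ℝ, 0 ≤ x → min 1 (2 * x) ≤ 2 * min 1 x := fun x hx => by
    rcases le_total 1 x with h | h
    · rw [min_eq_left h]; exact (min_le_left _ _).trans (by norm_num)
    · rw [min_eq_right h]; exact min_le_right _ _
  have h2 : ∀ g, K.mwu.gcov s A g ≤ 4 * F (φ g) := by
    intro g
    by_cases hne : ∃ u ∈ A, K.mwu.par u = g
    · obtain ⟨u₀, hu₀, rfl⟩ := hne
      set g := K.mwu.par u₀ with hgdef
      have hcv := K.class_v hfin hy j.2 u₀
      rw [← hs, hφt] at hcv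
      have e1 : ∑ H ∈ K.toks w j with K.grp H = φ g, min 1 (K.rho H)
          = ∑ u ∈ A with K.mwu.par u = g, min 1 (K.rho (K.tok s u)) := by
        rw [← Finset.sum_image (s := A.filter fun u => K.mwu.par u = g)
          (f := fun H => min 1 (K.rho H)) (fun u _ u' _ h => K.tok_injective s h)]
        refine Finset.sum_congr ?_ fun _ _ => rfl
        ext H
        simp only [Finset.mem_filter, Finset.mem_image, toks]
        constructor
        · rintro ⟨⟨u, hu, rfl⟩, e⟩
          exact ⟨u, ⟨hu, hφ (by rw [← hφt]; exact e)⟩, rfl⟩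
        · rintro ⟨u, ⟨hu, hu'⟩, rfl⟩
          exact ⟨⟨u, hu, rfl⟩, by rw [hφt, hu']⟩
      have h3 : K.mwu.gsum s A g ≤ 2 * ∑ u ∈ A with K.mwu.par u = g, min 1 (K.rho (K.tok s u)) := by
        unfold Mwu.gsum
        rw [Finset.mul_sum, Finset.filter_congr_decidable]
        refine Finset.sum_le_sum fun u hu => ?_
        have hu' : K.mwu.par u = g := (Finset.mem_filter.mp hu).2
        have hz := K.class_z hfin hy j.2 u
        have hv := K.class_v hfin hy j.2 u
        rw [← hs] at hz hv
        have hrv := K.rho_mul_vbar (K.tok s u)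
        have hvp := K.vbar_pos (K.grp (K.tok s u))
        have hrp := K.rho_pos (K.tok s u)
        unfold Mwu.frac
        refine le_trans (min_le_min_left 1 ?_) (hmin2 _ hrp.le)
        rw [div_le_iff₀ (hvp.trans_le hv.1)]
        have h4 := hz.2.1
        rw [← hrv] at h4
        nlinarith [hv.1]
      have hv0 := K.vbar_pos (φ g)
      have hS0 : 0 ≤ ∑ u ∈ A with K.mwu.par u = g, min 1 (K.rho (K.tok s u)) :=
        Finset.sum_nonneg fun u _ => by have := K.rho_pos (K.tok s u); positivity
      simp only [hF, e1]
      unfold Mwu.gcov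
      have h4 : min 1 (s.v g) ≤ 2 * min 1 (K.vbar (φ g)) :=
        (min_le_min_left 1 hcv.2.1.le).trans (hmin2 _ hv0.le)
      have h5 : min 1 (K.mwu.gsum s A g) ≤
          2 * min 1 (∑ u ∈ A with K.mwu.par u = g, min 1 (K.rho (K.tok s u))) :=
        (min_le_min_left 1 h3).trans (hmin2 _ hS0)
      have h6 : 0 ≤ min 1 (K.mwu.gsum s A g) := le_min zero_le_one (Mwu.gsum_nonneg hg hInv A g)
      calc _ ≤ (2 * min 1 (K.vbar (φ g))) *
            (2 * min 1 (∑ u ∈ A with K.mwu.par u = g, min 1 (K.rho (K.tok s u)))) :=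
            mul_le_mul h4 h5 h6 (by positivity)
        _ = _ := by ring
    · have : K.mwu.gsum s A g = 0 := by
        unfold Mwu.gsum
        refine Finset.sum_eq_zero fun u hu => absurd ?_ hne
        obtain ⟨h3, h4⟩ := Finset.mem_filter.mp hu
        exact ⟨u, h3, h4⟩
      have h3 := hF0 (φ g)
      unfold Mwu.gcov
      rw [this]; simpa using h3
  have h3 := Finset.sum_le_sum fun g (_ : g ∈ Finset.univ) => h2 g
  rw [← Finset.mul_sum] at h3
  have h4 := hsel.2.2.1
  linarith

/-- Group values increase, so the classes that ever occur are at most the final one, and their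
values sum geometrically to at most twice the final value. -/
theorem toks_sum_vbar : ∑ G ∈ (Finset.univ.biUnion (K.toks w)).image K.grp,
    K.mwu.C G.1 * K.vbar G ≤ 140 * ((K.a : ℝ) + 1) ^ 2 := by
  have hg := K.mwu_good
  set vE := (K.mwu.tr K.rounds (K.mjob w) (n * (K.rounds + 1))).v with hvE
  have hInv := Mwu.tr_inv hg (K.mjob_nonneg w) (N := K.rounds) (n * (K.rounds + 1))
  have hsub : ∀ G ∈ (Finset.univ.biUnion (K.toks w)).image K.grp,
      (G.2 : ℕ) ≤ cls (vE G.1 / K.mwu.v0) := by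
    intro G hG
    obtain ⟨H, hH, rfl⟩ := Finset.mem_image.mp hG
    obtain ⟨j, _, hj⟩ := Finset.mem_biUnion.mp hH
    obtain ⟨_, e⟩ := K.mem_toks hj
    rw [e]
    refine (K.class_v hfin hy j.2 H.1).2.2.trans_le (cls_mono ?_)
    have := hg.v0_pos
    refine div_le_div_of_nonneg_right ?_ this.le
    exact (Mwu.tr_mono hg (K.mjob_nonneg w) (N := K.rounds)).1 _ (K.time_le hfin hy j.2)
  calc _ ≤ ∑ G : K.GTok, if (G.2 : ℕ) ≤ cls (vE G.1 / K.mwu.v0) then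
          K.mwu.C G.1 * K.vbar G else 0 := by
        rw [← Finset.sum_filter]
        refine Finset.sum_le_sum_of_subset_of_nonneg (fun G hG => by simp [hsub G hG])
          fun G _ _ => ?_
        have := hg.C_pos G.1; have := K.vbar_pos G; positivity
    _ = ∑ g, K.mwu.C g * K.mwu.v0 * ∑ e : Fin (4 * K.a + 8),
          if (e : ℕ) ≤ cls (vE g / K.mwu.v0) then (2 : ℝ) ^ (e : ℕ) else 0 := by
        rw [Fintype.sum_prod_type]
        refine Finset.sum_congr rfl fun g _ => ?_
        rw [Finset.mul_sum]
        refine Finset.sum_congr rfl fun e _ => ?_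
        split_ifs
        · show K.mwu.C g * (2 ^ (e : ℕ) / 2 ^ K.a) = K.mwu.C g * (1 / 2) ^ K.a * 2 ^ (e : ℕ)
          rw [one_div_pow]; ring
        · simp
    _ ≤ ∑ g, 2 * (K.mwu.C g * vE g) := by
        refine Finset.sum_le_sum fun g _ => ?_
        have hC := hg.C_pos g
        have hv0 := hg.v0_pos
        have h1 : 1 ≤ vE g / K.mwu.v0 := by
          rw [le_div_iff₀ hv0, one_mul]; exact hInv.v0_le g
        have h2 := pow_cls_le h1
        rw [le_div_iff₀ hv0] at h2
        calc _ ≤ K.mwu.C g * K.mwu.v0 * (2 * 2 ^ cls (vE g / K.mwu.v0)) := by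
              gcongr; exact sum_fin_pow_two_le _ _
          _ = 2 * (K.mwu.C g * (2 ^ cls (vE g / K.mwu.v0) * K.mwu.v0)) := by ring
          _ ≤ _ := by gcongr
    _ = 2 * ∑ g, K.mwu.C g * vE g := by rw [Finset.mul_sum]
    _ ≤ _ := by have := (K.run_spec hfin hy).1; linarith

/-- All tokens of `G` can be measured at a single time, that of the last job using `G`: slot values
sum geometrically up to their classes then, domination gives `Q ≤ B v`, and `v < 2 * vbar` because
`G` is still current. -/
theorem toks_sum_rho (G : K.GTok) : ∑ H ∈ Finset.univ.biUnion (K.toks w) with K.grp H = G,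
    K.mwu.c H.1 * K.rho H ≤ 4 * K.mwu.B := by
  have hg := K.mwu_good
  have hB := hg.B_pos
  set S := Finset.univ.filter fun j : Fin n => ∃ H ∈ K.toks w j, K.grp H = G with hS
  rcases S.eq_empty_or_nonempty with he | hne
  · rw [Finset.sum_eq_zero]
    · positivity
    · intro H hH
      obtain ⟨h1, h2⟩ := Finset.mem_filter.mp hH
      obtain ⟨j, _, hj⟩ := Finset.mem_biUnion.mp h1
      have : j ∈ S := by rw [hS]; simp only [Finset.mem_filter, Finset.mem_univ, true_and]
                         exact ⟨H, hj, h2⟩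
      rw [he] at this; simp at this
  obtain ⟨t, ht, hmax⟩ := Finset.exists_max_image S id hne
  obtain ⟨H₀, hH₀, hG₀⟩ := (Finset.mem_filter.mp ht).2
  set s := K.stAt w t with hs
  have hInv : K.mwu.Inv s := K.stAt_inv hfin hy t
  have hz0 := hg.z0_pos
  have hvb := K.vbar_pos G
  have hv : s.v G.1 < 2 * K.vbar G := by
    obtain ⟨_, e⟩ := K.mem_toks hH₀
    have := (K.class_v hfin hy t.2 H₀.1).2.1
    rw [← e, hG₀] at this
    have e2 : K.mwu.par H₀.1 = G.1 := by rw [← hG₀]; rfl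
    rwa [e2] at this
  have hQ := (((K.run_spec hfin hy).2.1 _ (K.time_le hfin hy t.2)) G.1).2
  have hlive : ∀ H ∈ Finset.univ.biUnion (K.toks w), K.grp H = G →
      K.mwu.par H.1 = G.1 ∧ H.2.1 = G.2 ∧ (H.2.2 : ℕ) ≤ cls (s.z H.1 / K.mwu.z0) := by
    intro H hH hHG
    obtain ⟨j, _, hj⟩ := Finset.mem_biUnion.mp hH
    have hjt : j ≤ t := hmax j (by
      rw [hS]; simp only [Finset.mem_filter, Finset.mem_univ, true_and]; exact ⟨H, hj, hHG⟩)
    obtain ⟨_, e⟩ := K.mem_toks hj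
    refine ⟨by rw [← hHG]; rfl, by rw [← hHG]; rfl, ?_⟩
    rw [e]
    refine (K.class_z hfin hy j.2 H.1).2.2.trans_le (cls_mono ?_)
    refine div_le_div_of_nonneg_right ?_ hz0.le
    refine (Mwu.tr_mono hg (K.mjob_nonneg w) (N := K.rounds)).2 _ ?_
    have : (j : ℕ) ≤ t := hjt
    exact Nat.add_le_add_right (Nat.mul_le_mul_right _ this) _
  calc _ ≤ ∑ u with K.mwu.par u = G.1, ∑ e' : Fin (8 * K.Am + 18),
          if (e' : ℕ) ≤ cls (s.z u / K.mwu.z0) then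
            K.mwu.c u * (2 ^ (e' : ℕ) * K.mwu.z0 / K.vbar G) else 0 := by
        rw [← Finset.sum_product']
        rw [← Finset.sum_filter]
        have hinj : Set.InjOn (fun H : K.Tok => (H.1, H.2.2))
            ((Finset.univ.biUnion (K.toks w)).filter fun H => K.grp H = G) := by
          intro H hH H' hH' h
          have h1 := (Finset.mem_filter.mp hH)
          have h2 := (Finset.mem_filter.mp hH')
          have h3 := (hlive H h1.1 h1.2).2.1
          have h4 := (hlive H' h2.1 h2.2).2.1
          simp only [Prod.mk.injEq] at h
          exact Prod.ext h.1 (Prod.ext (h3.trans h4.symm) h.2)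
        have e : ∀ H ∈ (Finset.univ.biUnion (K.toks w)).filter fun H => K.grp H = G,
            K.mwu.c H.1 * K.rho H = (fun x : K.Slot × Fin (8 * K.Am + 18) =>
              K.mwu.c x.1 * (2 ^ (x.2 : ℕ) * K.mwu.z0 / K.vbar G)) (H.1, H.2.2) := by
          intro H hH
          have h1 := (Finset.mem_filter.mp hH).2
          simp only
          rw [← K.rho_mul_vbar H, h1, mul_div_assoc, div_self hvb.ne', mul_one]
        rw [Finset.sum_congr rfl e, ← Finset.sum_image (g := fun H : K.Tok => (H.1, H.2.2))
          (f := fun x : K.Slot × Fin (8 * K.Am + 18) =>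
            K.mwu.c x.1 * (2 ^ (x.2 : ℕ) * K.mwu.z0 / K.vbar G)) hinj]
        refine Finset.sum_le_sum_of_subset_of_nonneg (fun x hx => ?_) fun x _ _ => ?_
        · obtain ⟨H, hH, rfl⟩ := Finset.mem_image.mp hx
          have h1 := Finset.mem_filter.mp hH
          have h2 := hlive H h1.1 h1.2
          simp [h2.1, h2.2.2]
        · have := hg.c_pos x.1
          positivity
    _ = ∑ u with K.mwu.par u = G.1, K.mwu.c u * (K.mwu.z0 / K.vbar G) *
          ∑ e' : Fin (8 * K.Am + 18),
            if (e' : ℕ) ≤ cls (s.z u / K.mwu.z0) then (2 : ℝ) ^ (e' : ℕ) else 0 := by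
        refine Finset.sum_congr rfl fun u _ => ?_
        rw [Finset.mul_sum]
        refine Finset.sum_congr rfl fun e _ => ?_
        split_ifs
        · ring
        · simp
    _ ≤ ∑ u with K.mwu.par u = G.1, 2 / K.vbar G * (K.mwu.c u * s.z u) := by
        refine Finset.sum_le_sum fun u _ => ?_
        have hc := hg.c_pos u
        have h1 : 1 ≤ s.z u / K.mwu.z0 := by
          rw [le_div_iff₀ hz0, one_mul]; exact hInv.z0_le u
        have h2 := pow_cls_le h1
        rw [le_div_iff₀ hz0] at h2
        calc _ ≤ K.mwu.c u * (K.mwu.z0 / K.vbar G) * (2 * 2 ^ cls (s.z u / K.mwu.z0)) := by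
              gcongr; exact sum_fin_pow_two_le _ _
          _ = 2 / K.vbar G * (K.mwu.c u * (2 ^ cls (s.z u / K.mwu.z0) * K.mwu.z0)) := by ring
          _ ≤ _ := by gcongr
    _ = 2 / K.vbar G * K.mwu.Q s.z G.1 := by
        rw [← Finset.mul_sum]; unfold Mwu.Q; rw [Finset.filter_congr_decidable]
    _ ≤ 2 / K.vbar G * (K.mwu.B * (2 * K.vbar G)) := by
        have h3 : K.mwu.Q s.z G.1 ≤ K.mwu.B * (2 * K.vbar G) := hQ.trans (by
          exact mul_le_mul_of_nonneg_left hv.le hB.le)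
        exact mul_le_mul_of_nonneg_left h3 (by positivity)
    _ = _ := by field_simp; ring

/-- A token fixes the class of `z`, while each job using it multiplies `z` by one plus its
normalised load. So `sum_le_two_of_growth` bounds these loads by `2`, which is `80 * (An + 1)`
before normalisation. -/
theorem toks_sum_quo (H : K.Tok) :
    ∑ j with H ∈ K.toks w j, K.quo (w j H.1.1) H.1 ≤ 80 * (K.An + 1) := by
  classical
  have hg := K.mwu_good
  have hz0 := hg.z0_pos
  set zb : ℝ := 2 ^ (H.2.2 : ℕ) * K.mwu.z0 with hzb
  have hzbp : 0 < zb := by positivity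
  let lamS : ℕ → ℝ := fun j => if h : j < n then
    (if H ∈ K.toks w ⟨j, h⟩ then (K.mjob w j).lam H.1 else 0) else 0
  have hS0 : ∀ j, 0 ≤ lamS j := fun j => by
    simp only [lamS]; split_ifs
    · exact K.mjob_nonneg w j _
    · exact le_rfl
    · exact le_rfl
  let zs : ℕ → ℝ := fun t => (K.mwu.tr K.rounds (K.mjob w) (t * (K.rounds + 1))).z H.1
  have hzmono := (Mwu.tr_mono hg (K.mjob_nonneg w) (N := K.rounds)).2 H.1
  have hstep : ∀ t (ht : t < n), H ∈ K.toks w ⟨t, ht⟩ → lamS t ≤ 1 ∧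
      zs t < 2 * zb ∧ zb * (1 + lamS t) ≤ zs (t + 1) ∧ zs t * (1 + lamS t) ≤ zs (t + 1) := by
    intro t ht hH
    obtain ⟨hu, e⟩ := K.mem_toks hH
    have hcz := K.class_z hfin hy ht H.1
    rw [← e] at hcz
    have hl : lamS t = (K.mjob w t).lam H.1 := by
      simp only [lamS]
      rw [dif_pos ht, if_pos hH]
    have hz1 : zs (t + 1) = (K.stAt w t).z H.1 * (1 + lamS t) := by
      show (K.mwu.tr K.rounds (K.mjob w) ((t + 1) * (K.rounds + 1))).z H.1 = _
      rw [Mwu.tr_succ_charge, hl]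
      show K.mwu.loadZ _ _ _ = _
      unfold Mwu.loadZ
      exact if_pos hu
    have hle : zs t ≤ (K.stAt w t).z H.1 := hzmono (Nat.le_add_right _ _)
    have h0 := hS0 t
    refine ⟨?_, hle.trans_lt hcz.2.1, ?_, ?_⟩
    · rw [hl, K.mjob_of_lt w ⟨t, ht⟩]
      have := K.quo_le_one (w ⟨t, ht⟩ H.1.1) H.1
      have h3 : (0 : ℝ) ≤ K.An := by positivity
      rw [div_le_one (by positivity)]; linarith
    · rw [hz1]
      have := hcz.1
      gcongr
    · rw [hz1]; gcongr
  have hno : ∀ t, (∀ ht : t < n, H ∉ K.toks w ⟨t, ht⟩) → lamS t = 0 := by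
    intro t h
    simp only [lamS]
    split_ifs with h1 h2
    · exact absurd h2 (h h1)
    · rfl
    · rfl
  have hzs : ∀ t, zs t ≤ zs (t + 1) := fun t => hzmono (Nat.mul_le_mul_right _ (Nat.le_succ t))
  have key2 := sum_le_two_of_growth hzbp hS0 hzs (fun t => by
    by_cases hH : ∃ ht : t < n, H ∈ K.toks w ⟨t, ht⟩
    · exact Or.inr (hstep t hH.choose hH.choose_spec)
    · push Not at hH
      exact Or.inl (hno t hH))
  have e1 : ∑ j ∈ Finset.range n, lamS j = ∑ j with H ∈ K.toks w j,
      K.quo (w j H.1.1) H.1 / (40 * (K.An + 1)) := by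
    rw [Finset.sum_range, Finset.sum_filter]
    refine Finset.sum_congr rfl fun j _ => ?_
    simp only [lamS]
    rw [dif_pos j.2, K.mjob_of_lt w j]
  have h3 := key2 n
  rw [e1, ← Finset.sum_div, div_le_iff₀ (by positivity)] at h3
  linarith

theorem toks_ok : K.TokOK w (K.toks w) where
  allowed j H hH := by
    have h1 := Mwu.used_subset (K.mem_toks hH).1
    simp only [mjob, j.2, dif_pos, Finset.mem_filter] at h1
    exact h1.2
  cover := K.toks_cover hfin hy
  sum_quo := K.toks_sum_quo hfin hy
  sum_rho := K.toks_sum_rho hfin hy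
  sum_vbar := K.toks_sum_vbar hfin hy

end Run

omit [Nonempty ι] [∀ ℓ, Nonempty (σ ℓ)] [NeZero n] in
theorem toks_congr {w w' : Fin n → (Σ ℓ, σ ℓ) → ℝ≥0∞} {t : Fin n} (h : ∀ j ≤ t, w j = w' j) :
    K.toks w t = K.toks w' t := by
  have hJ : ∀ j ≤ (t : ℕ), K.mjob w j = K.mjob w' j := by
    intro j hj
    have hjn : j < n := lt_of_le_of_lt hj t.2
    simp only [mjob, hjn, dif_pos]
    rw [h ⟨j, hjn⟩ hj]
  have hs : K.stAt w t = K.stAt w' t := Mwu.tr_congr hJ _ le_rfl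
  unfold toks
  rw [hs, hJ t le_rfl]

end Core

/-! ### Randomised rounding in bundles of doubling rate -/

theorem bernE_prod_inj {β κ : Type*} [Fintype β] [DecidableEq β] [DecidableEq κ] (p : β → ℝ)
    (s : Finset κ) (φ : κ → β) (hφ : Set.InjOn φ s) (f : κ → Bool → ℝ) :
    bernE p (fun ω => ∏ k ∈ s, f k (ω (φ k)))
      = ∏ k ∈ s, (p (φ k) * f k true + (1 - p (φ k)) * f k false) := by
  induction s using Finset.induction_on with
  | empty => simp [bernE_const]
  | insert k s hk ih =>
    simp only [Finset.prod_insert hk]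
    rw [bernE_mul_of_dependsOn p (A := {φ k}) (F := fun ω => f k (ω (φ k)))
      (G := fun ω => ∏ k ∈ s, f k (ω (φ k))), bernE_single p (φ k) (f k),
      ih fun a ha b hb h => hφ (by simp [Finset.mem_coe.mp ha]) (by simp [Finset.mem_coe.mp hb]) h]
    · intro x y hxy
      simp only
      rw [hxy (φ k) rfl]
    · intro x y hxy
      refine Finset.prod_congr rfl fun k' hk' => ?_
      rw [hxy (φ k')]
      intro h
      exact hk (by rw [hφ (by simp) (by simp [hk']) (Set.mem_singleton_iff.mp h).symm]; exact hk')

namespace Core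

variable {ι : Type} [Fintype ι] [DecidableEq ι] {σ : ι → Type} [∀ ℓ, Fintype (σ ℓ)]
  [∀ ℓ, DecidableEq (σ ℓ)] {n : ℕ} (K : Core ι σ n)

/-- Number of rounding bundles. -/
def bundles : ℕ := Nat.clog 2 (K.An + 1)

theorem le_pow_bundles : K.An + 1 ≤ 2 ^ K.bundles := Nat.le_pow_clog (by norm_num) _

theorem pow_bundles_le : 2 ^ K.bundles ≤ 2 * (K.An + 1) := by
  unfold bundles
  rcases Nat.eq_zero_or_pos K.An with h | h
  · simp [h]
  · have h1 := Nat.pow_pred_clog_lt_self (b := 2) (by norm_num) (x := K.An + 1) (by omega)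
    have h2 : 0 < Nat.clog 2 (K.An + 1) := Nat.clog_pos (by norm_num) (by omega)
    have h3 : 2 ^ Nat.clog 2 (K.An + 1) = 2 ^ (Nat.clog 2 (K.An + 1)).pred * 2 := by
      rw [← pow_succ]; congr 1; have := Nat.succ_pred_eq_of_pos h2; omega
    rw [h3]; omega

/-- Random bits of the rounding: one for every token and bundle. -/
abbrev Bit : Type := (K.GTok × Fin K.bundles) ⊕ (K.Tok × Fin K.bundles)

instance : DecidableEq K.Bit := instDecidableEqSum

/-- Opening rate of a bundle. -/
def rate (r : ℕ) : ℝ := 64 * 2 ^ r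

theorem rate_pos (r : ℕ) : 0 < rate r := by unfold rate; positivity

/-- Truncated value of a group token. -/
noncomputable def vhat (G : K.GTok) : ℝ := min 1 (K.vbar G)

theorem vhat_pos (G : K.GTok) : 0 < K.vhat G := lt_min one_pos (K.vbar_pos G)

/-- Opening rate of the slot tokens of an open group token. -/
noncomputable def mu (G : K.GTok) (r : ℕ) : ℝ := max 1 (rate r * K.vhat G)

theorem one_le_mu (G : K.GTok) (r : ℕ) : 1 ≤ K.mu G r := le_max_left _ _

/-- Opening probability of a group token. -/
noncomputable def pG (G : K.GTok) (r : ℕ) : ℝ := min 1 (rate r * K.vhat G)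

/-- Opening probability of a slot token within an open group token. -/
noncomputable def pH (H : K.Tok) (r : ℕ) : ℝ := min 1 (K.mu (K.grp H) r * K.rho H)

theorem pG_mul_mu (G : K.GTok) (r : ℕ) : K.pG G r * K.mu G r = rate r * K.vhat G := by
  unfold pG mu; rw [min_mul_max, one_mul]

theorem pG_nonneg (G : K.GTok) (r : ℕ) : 0 ≤ K.pG G r :=
  le_min zero_le_one (mul_pos (rate_pos r) (K.vhat_pos G)).le

theorem pH_nonneg (H : K.Tok) (r : ℕ) : 0 ≤ K.pH H r :=
  le_min zero_le_one (mul_nonneg (zero_le_one.trans (K.one_le_mu _ _)) (K.rho_pos H).le)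

/-- Probabilities of the random bits. -/
noncomputable def prb : K.Bit → ℝ :=
  Sum.elim (fun x => K.pG x.1 x.2) fun x => K.pH x.1 x.2

theorem prb_mem (i : K.Bit) : 0 ≤ K.prb i ∧ K.prb i ≤ 1 := by
  rcases i with x | x
  · exact ⟨K.pG_nonneg _ _, min_le_left _ _⟩
  · exact ⟨K.pH_nonneg _ _, min_le_left _ _⟩

/-- Bit of a group token, as a real number. -/
def gbit (ω : K.Bit → Bool) (G : K.GTok) (r : Fin K.bundles) : ℝ := bit (ω (Sum.inl (G, r)))

/-- Bit of a slot token, as a real number. -/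
def hbit (ω : K.Bit → Bool) (H : K.Tok) (r : Fin K.bundles) : ℝ := bit (ω (Sum.inr (H, r)))

/-- A slot token is open in a bundle. -/
def Open (ω : K.Bit → Bool) (H : K.Tok) (r : Fin K.bundles) : Prop :=
  ω (Sum.inl (K.grp H, r)) = true ∧ ω (Sum.inr (H, r)) = true

/-- A job with the given tokens is accepted in a bundle. -/
def Acc (ω : K.Bit → Bool) (S : Finset K.Tok) (r : Fin K.bundles) : Prop := ∃ H ∈ S, K.Open ω H r

/-- A job with the given tokens is not accepted in the bundles before `r`. -/
def Reach (ω : K.Bit → Bool) (S : Finset K.Tok) (r : ℕ) : Prop :=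
  ∀ r' : Fin K.bundles, (r' : ℕ) < r → ¬ K.Acc ω S r'

/-- Indicator that a job is not accepted in a bundle. -/
def failInd (ω : K.Bit → Bool) (S : Finset K.Tok) (r : Fin K.bundles) : ℝ :=
  ∏ G, (1 - K.gbit ω G r * (1 - ∏ H ∈ S with K.grp H = G, (1 - K.hbit ω H r)))

/-- Indicator that a job is not accepted before a bundle. -/
def reachInd (ω : K.Bit → Bool) (S : Finset K.Tok) (r : ℕ) : ℝ :=
  ∏ r' ∈ Finset.univ.filter (fun r' : Fin K.bundles => (r' : ℕ) < r), K.failInd ω S r'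

theorem failInd_nonneg (ω : K.Bit → Bool) (S : Finset K.Tok) (r : Fin K.bundles) :
    0 ≤ K.failInd ω S r := by
  refine Finset.prod_nonneg fun G _ => ?_
  have h1 := bit_nonneg (ω (Sum.inl (G, r)))
  have h2 := bit_le_one (ω (Sum.inl (G, r)))
  have h3 : 0 ≤ ∏ H ∈ S with K.grp H = G, (1 - K.hbit ω H r) :=
    Finset.prod_nonneg fun H _ => sub_nonneg.mpr (bit_le_one _)
  unfold gbit
  nlinarith

theorem reachInd_nonneg (ω : K.Bit → Bool) (S : Finset K.Tok) (r : ℕ) : 0 ≤ K.reachInd ω S r :=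
  Finset.prod_nonneg fun _ _ => K.failInd_nonneg ω S _

theorem failInd_eq_one {ω : K.Bit → Bool} {S : Finset K.Tok} {r : Fin K.bundles}
    (h : ¬ K.Acc ω S r) : K.failInd ω S r = 1 := by
  refine Finset.prod_eq_one fun G _ => ?_
  by_cases hG : ω (Sum.inl (G, r)) = true
  · have : ∏ H ∈ S with K.grp H = G, (1 - K.hbit ω H r) = 1 := by
      refine Finset.prod_eq_one fun H hH => ?_
      obtain ⟨h1, h2⟩ := Finset.mem_filter.mp hH
      have h3 : ω (Sum.inr (H, r)) = false := by
        by_contra hc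
        exact h ⟨H, h1, by rw [h2]; exact hG, by simpa using hc⟩
      unfold hbit bit; simp [h3]
    rw [this]; simp
  · unfold gbit bit; simp [hG]

theorem reachInd_eq_one {ω : K.Bit → Bool} {S : Finset K.Tok} {r : ℕ} (h : K.Reach ω S r) :
    K.reachInd ω S r = 1 :=
  Finset.prod_eq_one fun r' hr' => K.failInd_eq_one (h r' (by simpa using hr'))

/-- Let `x = rate r * vhat G`. If `x < 1`, the group opens with probability `x`, and then one of its
tokens opens with probability at least `1 - exp (-s) ≥ min 1 s / 2`. If `x ≥ 1`, the group is surely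
open and the surplus rate `x` passes to the slot tokens. -/
theorem bernE_block_le (S : Finset K.Tok) (r : Fin K.bundles) (G : K.GTok) :
    bernE K.prb (fun ω => 1 - K.gbit ω G r * (1 - ∏ H ∈ S with K.grp H = G, (1 - K.hbit ω H r)))
      ≤ Real.exp (-(1 / 2 * rate r * (K.vhat G *
        min 1 (∑ H ∈ S with K.grp H = G, min 1 (K.rho H))))) := by
  set T := S.filter fun H => K.grp H = G with hT
  set s := ∑ H ∈ T, min 1 (K.rho H) with hs
  have hs0 : 0 ≤ s := Finset.sum_nonneg fun H _ => le_min zero_le_one (K.rho_pos H).le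
  have e1 : bernE K.prb (fun ω => ∏ H ∈ T, (1 - K.hbit ω H r)) = ∏ H ∈ T, (1 - K.pH H r) := by
    have h2 := bernE_prod_inj K.prb T (fun H => (Sum.inr (H, r) : K.Bit))
      (fun H _ H' _ h => by simpa using h) (fun _ b => 1 - bit b)
    refine h2.trans (Finset.prod_congr rfl fun H _ => ?_)
    simp [bit, prb]
  have e2 : bernE K.prb (fun ω => 1 - K.gbit ω G r * (1 - ∏ H ∈ T, (1 - K.hbit ω H r)))
      = 1 - K.pG G r * (1 - ∏ H ∈ T, (1 - K.pH H r)) := by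
    have e3 : (fun ω : K.Bit → Bool => 1 - K.gbit ω G r * (1 - ∏ H ∈ T, (1 - K.hbit ω H r)))
        = fun ω => 1 + ((-1) * K.gbit ω G r + K.gbit ω G r * ∏ H ∈ T, (1 - K.hbit ω H r)) := by
      funext ω; ring
    rw [e3, bernE_add, bernE_const, bernE_add, bernE_const_mul,
      bernE_mul_of_dependsOn K.prb (A := {Sum.inl (G, r)}) (F := fun ω => K.gbit ω G r), e1]
    · have : bernE K.prb (fun ω => K.gbit ω G r) = K.pG G r :=
        bernE_bit K.prb (Sum.inl (G, r))
      rw [this]; ring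
    · intro x y h
      simp only [gbit]
      rw [h _ rfl]
    · intro x y h
      refine Finset.prod_congr rfl fun H _ => ?_
      unfold hbit; rw [h _ (by simp)]
  rw [e2]
  have hprod : ∀ q : K.Tok → ℝ, (∀ H ∈ T, q H ≤ 1) →
      ∏ H ∈ T, (1 - q H) ≤ Real.exp (-∑ H ∈ T, q H) := by
    intro q hq
    rw [← Finset.sum_neg_distrib, Real.exp_sum]
    refine Finset.prod_le_prod (fun H hH => by linarith [hq H hH]) fun H _ => ?_
    linarith [Real.add_one_le_exp (-q H)]
  have hgrp : ∀ H ∈ T, K.grp H = G := fun H hH => (Finset.mem_filter.mp hH).2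
  set x := rate r * K.vhat G with hx
  have hx0 : 0 < x := mul_pos (rate_pos _) (K.vhat_pos G)
  set m := min 1 s with hm
  have hm0 : 0 ≤ m := le_min zero_le_one hs0
  have hm1 : m ≤ 1 := min_le_left _ _
  have hgoal : -(1 / 2 * rate r * (K.vhat G * m)) = -(x * m / 2) := by rw [hx]; ring
  rw [hgoal]
  rcases lt_or_ge x 1 with h | h
  · have hp : K.pG G r = x := min_eq_right h.le
    have hq : ∀ H ∈ T, K.pH H r = min 1 (K.rho H) := fun H hH => by
      unfold pH mu; rw [hgrp H hH, ← hx, max_eq_left h.le, one_mul]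
    have h1 : ∏ H ∈ T, (1 - K.pH H r) ≤ Real.exp (-s) := by
      rw [Finset.prod_congr rfl fun H hH => by rw [hq H hH]]
      exact hprod _ fun H _ => min_le_left _ _
    have h2 : Real.exp (-s) ≤ 1 - m / 2 := by
      have h3 : Real.exp (-s) ≤ Real.exp (-m) := Real.exp_le_exp.mpr (by
        have := min_le_right 1 s; linarith)
      have h4 : Real.exp (-m) ≤ 1 / (1 + m) := by
        rw [Real.exp_neg, ← one_div]
        exact one_div_le_one_div_of_le (by linarith) (by linarith [Real.add_one_le_exp m])
      have h5 : 1 / (1 + m) ≤ 1 - m / 2 := by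
        rw [div_le_iff₀ (by linarith)]; nlinarith
      linarith
    rw [hp]
    have h6 := Real.add_one_le_exp (-(x * m / 2))
    nlinarith
  · have hp : K.pG G r = 1 := min_eq_left h
    rw [hp]
    have hq : ∀ H ∈ T, K.pH H r = min 1 (x * K.rho H) := fun H hH => by
      unfold pH mu; rw [hgrp H hH, ← hx, max_eq_right h]
    by_cases hex : ∃ H ∈ T, 1 ≤ x * K.rho H
    · obtain ⟨H, hH, h1⟩ := hex
      have : ∏ H ∈ T, (1 - K.pH H r) = 0 :=
        Finset.prod_eq_zero hH (by rw [hq H hH, min_eq_left h1]; norm_num)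
      rw [this]
      have := Real.exp_pos (-(x * m / 2))
      linarith
    · push Not at hex
      have h1 : ∏ H ∈ T, (1 - K.pH H r) ≤ Real.exp (-∑ H ∈ T, x * K.rho H) := by
        rw [Finset.prod_congr rfl fun H hH => by rw [hq H hH, min_eq_right (hex H hH).le]]
        exact hprod _ fun H hH => (hex H hH).le
      have h2 : x * m ≤ ∑ H ∈ T, x * K.rho H := by
        rw [← Finset.mul_sum]
        refine mul_le_mul_of_nonneg_left ((min_le_right _ _).trans ?_) hx0.le
        exact Finset.sum_le_sum fun H _ => min_le_right _ _
      have h3 : Real.exp (-∑ H ∈ T, x * K.rho H) ≤ Real.exp (-(x * m / 2)) :=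
        Real.exp_le_exp.mpr (by nlinarith)
      linarith

/-- Distinct group tokens use disjoint bits. The factor `64` in `rate` makes the exponent `1 / 2 *
64 * 1 / 4 = 8` per unit of `2 ^ r`. -/
theorem bernE_failInd_le {S : Finset K.Tok} (r : Fin K.bundles)
    (hS : 1 / 4 ≤ ∑ G, K.vhat G * min 1 (∑ H ∈ S with K.grp H = G, min 1 (K.rho H))) :
    bernE K.prb (fun ω => K.failInd ω S r) ≤ Real.exp (-8) ^ 2 ^ (r : ℕ) := by
  unfold failInd
  rw [bernE_prod_of_blocks K.prb (Sum.elim (fun x => x.1) fun x => K.grp x.1)]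
  · calc _ ≤ ∏ G, Real.exp (-(1 / 2 * rate r * (K.vhat G *
          min 1 (∑ H ∈ S with K.grp H = G, min 1 (K.rho H))))) := by
          refine Finset.prod_le_prod (fun G _ => bernE_nonneg K.prb_mem fun ω => ?_)
            fun G _ => K.bernE_block_le S r G
          have h1 := bit_nonneg (ω (Sum.inl (G, r)))
          have h2 := bit_le_one (ω (Sum.inl (G, r)))
          have h3 : 0 ≤ ∏ H ∈ S with K.grp H = G, (1 - K.hbit ω H r) :=
            Finset.prod_nonneg fun H _ => sub_nonneg.mpr (bit_le_one _)
          unfold gbit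
          nlinarith
      _ ≤ Real.exp (-8) ^ 2 ^ (r : ℕ) := by
          rw [← Real.exp_sum, ← Real.exp_nat_mul, Finset.sum_neg_distrib, ← Finset.mul_sum]
          refine Real.exp_le_exp.mpr ?_
          have h1 := mul_le_mul_of_nonneg_left hS
            (show 0 ≤ 1 / 2 * rate r by have := rate_pos r; positivity)
          push_cast
          unfold rate at h1 ⊢
          linarith
  · intro G _ x y hxy
    have h1 : x (Sum.inl (G, r)) = y (Sum.inl (G, r)) := hxy _ (by simp)
    have h2 : ∏ H ∈ S with K.grp H = G, (1 - K.hbit x H r)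
        = ∏ H ∈ S with K.grp H = G, (1 - K.hbit y H r) := by
      refine Finset.prod_congr rfl fun H hH => ?_
      unfold hbit
      rw [hxy (Sum.inr (H, r)) (by simpa using (Finset.mem_filter.mp hH).2)]
    simp only [gbit, h1, h2]

theorem failInd_dependsOn (S : Finset K.Tok) (r : Fin K.bundles) :
    DependsOn (fun ω => K.failInd ω S r)
      ((Sum.elim (fun x => x.2) fun x => x.2 : K.Bit → Fin K.bundles) ⁻¹' {r}) := by
  intro x y hxy
  refine Finset.prod_congr rfl fun G _ => ?_
  have h1 : x (Sum.inl (G, r)) = y (Sum.inl (G, r)) := hxy _ (by simp)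
  have h2 : ∏ H ∈ S with K.grp H = G, (1 - K.hbit x H r)
      = ∏ H ∈ S with K.grp H = G, (1 - K.hbit y H r) := by
    refine Finset.prod_congr rfl fun H hH => ?_
    unfold hbit
    rw [hxy (Sum.inr (H, r)) (by simp)]
  simp only [gbit, h1, h2]

/-- The bits of the bundles before `r`. -/
def before (r : ℕ) : Set K.Bit :=
  {i | ((Sum.elim (fun x => x.2) fun x => x.2 : K.Bit → Fin K.bundles) i : ℕ) < r}

theorem reachInd_dependsOn (S : Finset K.Tok) (r : ℕ) :
    DependsOn (fun ω => K.reachInd ω S r) (K.before r) := by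
  intro x y hxy
  refine Finset.prod_congr rfl fun r' hr' => K.failInd_dependsOn S r' fun i hi => hxy i ?_
  have h1 : (Sum.elim (fun x => x.2) fun x => x.2 : K.Bit → Fin K.bundles) i = r' := hi
  show ((Sum.elim (fun x => x.2) fun x => x.2 : K.Bit → Fin K.bundles) i : ℕ) < r
  rw [h1]
  simpa using hr'

/-- Bundles are independent, and the exponents `1, 2, 4, …` of the earlier ones add up to `2 ^ r -
1`. -/
theorem bernE_reachInd_le {S : Finset K.Tok} {r : ℕ} (hr : r ≤ K.bundles)
    (hS : 1 / 4 ≤ ∑ G, K.vhat G * min 1 (∑ H ∈ S with K.grp H = G, min 1 (K.rho H))) :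
    bernE K.prb (fun ω => K.reachInd ω S r) ≤ Real.exp (-8) ^ (2 ^ r - 1) := by
  unfold reachInd
  rw [bernE_prod_of_blocks K.prb (Sum.elim (fun x => x.2) fun x => x.2) _
    (fun r' ω => K.failInd ω S r') fun r' _ => K.failInd_dependsOn S r']
  calc _ ≤ ∏ r' ∈ Finset.univ.filter (fun r' : Fin K.bundles => (r' : ℕ) < r), Real.exp (-8) ^ 2 ^ (r' : ℕ) :=
        Finset.prod_le_prod (fun r' _ => bernE_nonneg K.prb_mem fun ω => K.failInd_nonneg ω S r')
          fun r' _ => K.bernE_failInd_le r' hS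
    _ = Real.exp (-8) ^ ∑ r' ∈ Finset.univ.filter (fun r' : Fin K.bundles => (r' : ℕ) < r), 2 ^ (r' : ℕ) := by
        rw [Finset.prod_pow_eq_pow_sum]
    _ = _ := by
        congr 1
        rw [Finset.sum_filter, Fin.sum_univ_eq_sum_range (fun k => if k < r then 2 ^ k else 0),
          ← Finset.sum_filter]
        have : (Finset.range K.bundles).filter (· < r) = Finset.range r := by
          ext k; simp only [Finset.mem_filter, Finset.mem_range]; omega
        rw [this, Nat.geomSum_eq (le_refl 2)]
        simp

end Core

/-! ### Deterministic bounds for the value of a group token -/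

section

variable {ι : Type*} [Fintype ι] [DecidableEq ι]

theorem SymMono.le_sum {N : Seminorm ℝ (ι → ℝ)} (hN : SymMono N) {y : ι → ℝ} (h0 : ∀ i, 0 ≤ y i) :
    N y ≤ ∑ i, y i := by
  have h1 : y = ∑ i, y i • (Pi.single i 1 : ι → ℝ) := by
    funext k
    simp [Finset.sum_apply, Pi.single_apply]
  conv_lhs => rw [h1]
  refine (Finset.le_sum_of_subadditive N (map_zero N).le (map_add_le_add N) _ _).trans ?_
  refine Finset.sum_le_sum fun i _ => ?_
  rw [map_smul_eq_mul, hN.unit, mul_one, Real.norm_of_nonneg (h0 i)]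

theorem SymMono.mono' {N : Seminorm ℝ (ι → ℝ)} (hN : SymMono N) {x y : ι → ℝ} (h0 : ∀ i, 0 ≤ x i)
    (h : ∀ i, x i ≤ y i) : N x ≤ N y :=
  hN.mono (fun i => h0 i) (fun i => (h0 i).trans (h i)) h

theorem seminorm_sum_le {κ : Type*} (N : Seminorm ℝ (ι → ℝ)) (s : Finset κ) (f : κ → ι → ℝ) :
    N (fun i => ∑ k ∈ s, f k i) ≤ ∑ k ∈ s, N (f k) := by
  have : (fun i => ∑ k ∈ s, f k i) = ∑ k ∈ s, f k := by
    funext i; rw [Finset.sum_apply]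
  rw [this]
  exact Finset.le_sum_of_subadditive N (map_zero N).le (map_add_le_add N) _ _

theorem seminorm_mul (N : Seminorm ℝ (ι → ℝ)) {c : ℝ} (hc : 0 ≤ c) (f : ι → ℝ) :
    N (fun i => c * f i) = c * N f := by
  have : (fun i => c * f i) = c • f := rfl
  rw [this, map_smul_eq_mul, Real.norm_of_nonneg hc]

end

/-- Number of smaller indices with a set bit. -/
def rank {E : ℕ} (β : Fin E → Bool) (e : Fin E) : ℕ :=
  (Finset.univ.filter fun e' => e' < e ∧ β e' = true).card

theorem rank_lt {E : ℕ} (β : Fin E → Bool) (e : Fin E) : rank β e < E := by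
  have h : (Finset.univ.filter fun e' => e' < e ∧ β e' = true) ⊂ (Finset.univ : Finset (Fin E)) := by
    refine Finset.ssubset_iff_subset_ne.mpr ⟨Finset.subset_univ _, fun h => ?_⟩
    have : e ∈ Finset.univ.filter fun e' => e' < e ∧ β e' = true := by rw [h]; simp
    simp at this
  simpa [rank] using Finset.card_lt_card h

theorem rank_strict {E : ℕ} {β : Fin E → Bool} {e e' : Fin E} (h : e < e') (he : β e = true) :
    rank β e < rank β e' := by
  refine Finset.card_lt_card (Finset.ssubset_iff_subset_ne.mpr ⟨fun k hk => ?_, fun hc => ?_⟩)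
  · simp only [Finset.mem_filter, Finset.mem_univ, true_and] at hk ⊢
    exact ⟨hk.1.trans h, hk.2⟩
  · have : e ∈ Finset.univ.filter fun k => k < e' ∧ β k = true := by simp [h, he]
    rw [← hc] at this
    simp at this

/-- The product form makes the expectation of `2 ^ rank` computable for independent bits. -/
theorem two_pow_rank {E : ℕ} (β : Fin E → Bool) (e : Fin E) :
    (2 : ℝ) ^ rank β e = ∏ e' ∈ Finset.univ.filter (· < e), (1 + bit (β e')) := by
  unfold rank
  rw [← Finset.filter_filter, ← Finset.prod_const, Finset.prod_filter]
  refine Finset.prod_congr rfl fun e' _ => ?_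
  unfold bit
  split_ifs <;> norm_num

namespace Core

variable {ι : Type} [Fintype ι] [DecidableEq ι] {σ : ι → Type} [∀ ℓ, Fintype (σ ℓ)]
  [∀ ℓ, DecidableEq (σ ℓ)] {n : ℕ} (K : Core ι σ n)

/-- The slot token of a group token with given machine level, machine and class. -/
def mkTok (G : K.GTok) (t : Fin (K.Am + 1)) (i : σ G.1.1) (e : Fin (8 * K.Am + 18)) : K.Tok :=
  ((⟨G.1.1, i⟩, G.1.2, t), G.2, e)

theorem sum_grp (G : K.GTok) (F : K.Tok → ℝ) :
    ∑ H with K.grp H = G, F H = ∑ t, ∑ i, ∑ e, F (K.mkTok G t i e) := by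
  have h : ∑ t, ∑ i, ∑ e, F (K.mkTok G t i e)
      = ∑ x : Fin (K.Am + 1) × σ G.1.1 × Fin (8 * K.Am + 18), F (K.mkTok G x.1 x.2.1 x.2.2) := by
    rw [Fintype.sum_prod_type]
    refine Finset.sum_congr rfl fun t _ => ?_
    rw [Fintype.sum_prod_type]
  rw [h]
  symm
  refine Finset.sum_bij (fun x _ => K.mkTok G x.1 x.2.1 x.2.2) (fun x _ => ?_) ?_ ?_
    fun _ _ => rfl
  · simp only [Finset.mem_filter, Finset.mem_univ, true_and]
    rfl
  · rintro ⟨t, i, e⟩ _ ⟨t', i', e'⟩ _ h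
    simp only [mkTok, Prod.mk.injEq, Sigma.mk.injEq, heq_eq_eq, true_and] at h
    obtain ⟨⟨h1, h2⟩, h3⟩ := h
    rw [h1, h2, h3]
  · intro H hH
    obtain rfl : K.grp H = G := (Finset.mem_filter.mp hH).2
    exact ⟨(H.1.2.2, H.1.1.2, H.2.2), Finset.mem_univ _, rfl⟩

/-- Value of a group token whose slot tokens carry the loads `x`. -/
noncomputable def xval (x : K.Tok → ℝ) (G : K.GTok) : ℝ :=
  ∑ t : Fin (K.Am + 1), (1 / 2) ^ (t : ℕ) * K.inn G.1.1 fun i => ∑ e, x (K.mkTok G t i e)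

theorem xval_nonneg (x : K.Tok → ℝ) (G : K.GTok) : 0 ≤ K.xval x G :=
  Finset.sum_nonneg fun _ _ => mul_nonneg (by positivity) (apply_nonneg _ _)

theorem xval_mono {x x' : K.Tok → ℝ} {G : K.GTok} (h0 : ∀ H, K.grp H = G → 0 ≤ x H)
    (h : ∀ H, K.grp H = G → x H ≤ x' H) : K.xval x G ≤ K.xval x' G := by
  refine Finset.sum_le_sum fun t _ => mul_le_mul_of_nonneg_left ?_ (by positivity)
  exact (K.hinn G.1.1).mono' (fun i => Finset.sum_nonneg fun e _ => h0 _ rfl)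
    fun i => Finset.sum_le_sum fun e _ => h _ rfl

theorem xval_sum_le {κ : Type*} (s : Finset κ) (x : κ → K.Tok → ℝ) (G : K.GTok) :
    K.xval (fun H => ∑ k ∈ s, x k H) G ≤ ∑ k ∈ s, K.xval (x k) G := by
  unfold xval
  rw [Finset.sum_comm]
  refine Finset.sum_le_sum fun t _ => ?_
  rw [← Finset.mul_sum]
  refine mul_le_mul_of_nonneg_left ?_ (by positivity)
  have : (fun i => ∑ e, ∑ k ∈ s, x k (K.mkTok G t i e))
      = fun i => ∑ k ∈ s, ∑ e, x k (K.mkTok G t i e) := by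
    funext i; exact Finset.sum_comm
  rw [this]
  exact seminorm_sum_le _ s fun k i => ∑ e, x k (K.mkTok G t i e)

theorem xval_add_le (x y : K.Tok → ℝ) (G : K.GTok) :
    K.xval (fun H => x H + y H) G ≤ K.xval x G + K.xval y G := by
  have := K.xval_sum_le (Finset.univ : Finset Bool) (fun b => if b then x else y) G
  simpa using this

theorem xval_mul {c : ℝ} (hc : 0 ≤ c) (x : K.Tok → ℝ) (G : K.GTok) :
    K.xval (fun H => c * x H) G = c * K.xval x G := by
  unfold xval
  rw [Finset.mul_sum]
  refine Finset.sum_congr rfl fun t _ => ?_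
  have : (fun i => ∑ e, c * x (K.mkTok G t i e)) = fun i => c * ∑ e, x (K.mkTok G t i e) := by
    funext i; rw [Finset.mul_sum]
  rw [this, seminorm_mul _ hc]; ring

theorem xval_le_sum {x : K.Tok → ℝ} {G : K.GTok} (h0 : ∀ H, K.grp H = G → 0 ≤ x H) :
    K.xval x G ≤ ∑ H with K.grp H = G, x H := by
  rw [K.sum_grp]
  refine Finset.sum_le_sum fun t _ => ?_
  have hs : ∀ i, 0 ≤ ∑ e, x (K.mkTok G t i e) := fun i => Finset.sum_nonneg fun e _ => h0 _ rfl
  refine le_trans ?_ ((K.hinn G.1.1).le_sum hs)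
  exact mul_le_of_le_one_left (apply_nonneg _ _) (pow_le_one₀ (by norm_num) (by norm_num))

variable [∀ ℓ, Nonempty (σ ℓ)]

theorem capI_pos (ℓ : ι) (t : ℕ) : (0 : ℝ) < K.capI ℓ t := by
  exact_mod_cast (K.hinn ℓ).one_le_cap t

/-- Bound for tokens of load at most `D`, class by class. -/
theorem xval_le_classes {x : K.Tok → ℝ} {G : K.GTok} {D : ℝ} (hD : 0 ≤ D)
    (h0 : ∀ H, K.grp H = G → 0 ≤ x H) (hx : ∀ H, K.grp H = G → x H ≤ D) :
    K.xval x G ≤ 2 * ((K.Am + 1) * (8 * K.Am + 18)) * D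
      + 2 * ∑ H with K.grp H = G, K.mwu.c H.1 * x H := by
  rw [K.sum_grp]
  have h1 : ∀ t : Fin (K.Am + 1), (1 / 2 : ℝ) ^ (t : ℕ) * K.inn G.1.1
      (fun i => ∑ e, x (K.mkTok G t i e)) ≤ ∑ e : Fin (8 * K.Am + 18),
        (2 * D + 2 * ∑ i, K.mwu.c (K.mkTok G t i e).1 * x (K.mkTok G t i e)) := by
    intro t
    -- The classes are treated one at a time. At the full capacity of level `t` the profile is at
    -- most `2 ^ (t + 1)`, which the scale `2 ^ (-t)` cancels.
    refine (mul_le_mul_of_nonneg_left (seminorm_sum_le (K.inn G.1.1) Finset.univ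
      fun e i => x (K.mkTok G t i e)) (by positivity)).trans ?_
    rw [Finset.mul_sum]
    refine Finset.sum_le_sum fun e _ => ?_
    have hc := K.capI_pos G.1.1 t
    have h2 := seminorm_le_prof (K.inn G.1.1) ((K.hinn G.1.1).one_le_cap t) hD
      (fun i => h0 (K.mkTok G t i e) rfl) fun i => hx (K.mkTok G t i e) rfl
    have h3 := prof_cap_le (K.inn G.1.1) t
    have h4 : 0 ≤ D + (∑ i, x (K.mkTok G t i e)) / (cap (K.inn G.1.1) t : ℝ) :=
      add_nonneg hD (div_nonneg (Finset.sum_nonneg fun i _ => h0 _ rfl) hc.le)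
    calc _ ≤ (1 / 2 : ℝ) ^ (t : ℕ) * (2 ^ ((t : ℕ) + 1) *
          (D + (∑ i, x (K.mkTok G t i e)) / (cap (K.inn G.1.1) t : ℝ))) := by
          refine mul_le_mul_of_nonneg_left (h2.trans ?_) (by positivity)
          exact mul_le_mul_of_nonneg_right h3 h4
      _ = 2 * ((1 / 2 : ℝ) * 2) ^ (t : ℕ) *
          (D + (∑ i, x (K.mkTok G t i e)) / (cap (K.inn G.1.1) t : ℝ)) := by
          rw [mul_pow]; ring
      _ = 2 * D + 2 * ((∑ i, x (K.mkTok G t i e)) / (cap (K.inn G.1.1) t : ℝ)) := by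
          norm_num; ring
      _ = _ := by
          rw [Finset.sum_div]
          congr 2
          refine Finset.sum_congr rfl fun i _ => ?_
          show _ = 1 / (K.capI G.1.1 t : ℝ) * x (K.mkTok G t i e)
          unfold capI; ring
  refine (Finset.sum_le_sum fun t _ => h1 t).trans (le_of_eq ?_)
  simp only [Finset.sum_add_distrib, ← Finset.mul_sum]
  simp only [Finset.sum_const, Finset.card_univ, Fintype.card_fin, nsmul_eq_mul]
  congr 1
  · push_cast; ring
  · congr 1
    refine Finset.sum_congr rfl fun t _ => ?_
    exact Finset.sum_comm

/-- Bound for the open tokens of load at most `D`, weighted by the number of open tokens of smaller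
class in the same slot. -/
theorem xval_le_rank (β : K.Tok → Bool) {x : K.Tok → ℝ} {G : K.GTok} {D : ℝ} (hD : 0 ≤ D)
    (h0 : ∀ H, K.grp H = G → 0 ≤ x H) (hx : ∀ H, K.grp H = G → x H ≤ D) :
    K.xval (fun H => bit (β H) * x H) G ≤ (24 * K.Am + 44) * D
      + 3 * ∑ H with K.grp H = G, bit (β H) * 2 ^ rank (fun e => β (H.1, H.2.1, e)) H.2.2 *
        (K.mwu.c H.1 * x H) := by
  rw [K.sum_grp]
  set E := 8 * K.Am + 18 with hE
  let rk : Fin (K.Am + 1) → σ G.1.1 → Fin E → ℕ := fun t i e =>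
    rank (fun e => β (K.mkTok G t i e)) e
  -- Layers by rank rather than by class: open tokens of one slot have distinct ranks, so a layer
  -- has at most one open token per machine and entries at most `D`. Layer `k` is compared with the
  -- capacity thinned by `2 ^ k`, which costs the weight `2 ^ k` on the sum.
  let vec : Fin (K.Am + 1) → ℕ → σ G.1.1 → ℝ := fun t k i =>
    ∑ e, if rk t i e = k then bit (β (K.mkTok G t i e)) * x (K.mkTok G t i e) else 0
  have hterm : ∀ t i e, 0 ≤ bit (β (K.mkTok G t i e)) * x (K.mkTok G t i e) := fun t i e =>
    mul_nonneg (bit_nonneg _) (h0 _ rfl)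
  have hvec0 : ∀ t k i, 0 ≤ vec t k i := fun t k i => Finset.sum_nonneg fun e _ => by
    split_ifs
    · exact hterm t i e
    · exact le_rfl
  have hvecD : ∀ t k i, vec t k i ≤ D := by
    intro t k i
    simp only [vec]
    have e1 : ∀ e : Fin E, (if rk t i e = k then bit (β (K.mkTok G t i e)) * x (K.mkTok G t i e)
        else 0) = if rk t i e = k ∧ β (K.mkTok G t i e) = true then x (K.mkTok G t i e) else 0 := by
      intro e
      by_cases h1 : rk t i e = k <;> by_cases h2 : β (K.mkTok G t i e) = true <;>
        simp [h1, h2, bit]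
    simp only [e1]
    rw [← Finset.sum_filter]
    have hcard : (Finset.univ.filter fun e => rk t i e = k ∧ β (K.mkTok G t i e) = true).card
        ≤ 1 := by
      refine Finset.card_le_one.mpr fun e he e' he' => ?_
      simp only [Finset.mem_filter, Finset.mem_univ, true_and] at he he'
      rcases lt_trichotomy e e' with h | h | h
      · have := rank_strict (β := fun e => β (K.mkTok G t i e)) h he.2
        have h3 : rk t i e < rk t i e' := this
        omega
      · exact h
      · have := rank_strict (β := fun e => β (K.mkTok G t i e)) h he'.2
        have h3 : rk t i e' < rk t i e := this
        omega
    calc _ ≤ ∑ e ∈ Finset.univ.filter fun e => rk t i e = k ∧ β (K.mkTok G t i e) = true, D :=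
          Finset.sum_le_sum fun e _ => hx _ rfl
      _ = (Finset.univ.filter fun e => rk t i e = k ∧ β (K.mkTok G t i e) = true).card * D := by
          simp
      _ ≤ 1 * D := by gcongr; exact_mod_cast hcard
      _ = D := one_mul D
  have hsplit : ∀ t i, ∑ e, bit (β (K.mkTok G t i e)) * x (K.mkTok G t i e)
      = ∑ k ∈ Finset.range E, vec t k i := by
    intro t i
    simp only [vec]
    rw [Finset.sum_comm]
    refine Finset.sum_congr rfl fun e _ => ?_
    rw [Finset.sum_ite_eq, if_pos]
    exact Finset.mem_range.mpr (rank_lt _ e)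
  have hlin : ∀ t : Fin (K.Am + 1), ∀ k, (1 / 2 : ℝ) ^ (t : ℕ) * K.inn G.1.1 (vec t k) ≤
      (1 / 2 : ℝ) ^ (t : ℕ) * prof (K.inn G.1.1) (cap (K.inn G.1.1) t / 2 ^ k + 1) * D
      + 3 * ∑ i, ∑ e, if rk t i e = k then bit (β (K.mkTok G t i e)) * 2 ^ rk t i e *
        (K.mwu.c (K.mkTok G t i e).1 * x (K.mkTok G t i e)) else 0 := by
    intro t k
    set m := cap (K.inn G.1.1) t with hm
    have hc : (0 : ℝ) < m := K.capI_pos G.1.1 t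
    have h2 := seminorm_le_prof (K.inn G.1.1) (Nat.le_add_left 1 (m / 2 ^ k)) hD (hvec0 t k)
      (hvecD t k)
    have h3 := (K.hinn G.1.1).level_term_le t k
    rw [← hm] at h3
    have hs0 : 0 ≤ ∑ i, vec t k i := Finset.sum_nonneg fun i _ => hvec0 t k i
    have ht : (m : ℝ) / 2 ^ k ≤ ((m / 2 ^ k + 1 : ℕ) : ℝ) := by
      have := Nat.lt_floor_add_one ((m : ℝ) / ((2 ^ k : ℕ) : ℝ))
      rw [Nat.floor_div_eq_div] at this
      push_cast at this ⊢
      exact this.le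
    have ht0 : (0 : ℝ) < ((m / 2 ^ k + 1 : ℕ) : ℝ) := by positivity
    have h4 : (∑ i, vec t k i) / ((m / 2 ^ k + 1 : ℕ) : ℝ) ≤ (∑ i, vec t k i) * (2 ^ k / m) := by
      have h6 := one_div_le_one_div_of_le (by positivity : (0 : ℝ) < (m : ℝ) / 2 ^ k) ht
      rw [one_div_div] at h6
      rw [div_eq_mul_one_div]
      exact mul_le_mul_of_nonneg_left h6 hs0
    have h5 : (∑ i, vec t k i) * (2 ^ k / m) = ∑ i, ∑ e, if rk t i e = k then
        bit (β (K.mkTok G t i e)) * 2 ^ rk t i e *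
        (K.mwu.c (K.mkTok G t i e).1 * x (K.mkTok G t i e)) else 0 := by
      rw [Finset.sum_mul]
      refine Finset.sum_congr rfl fun i _ => ?_
      simp only [vec]
      rw [Finset.sum_mul]
      refine Finset.sum_congr rfl fun e _ => ?_
      split_ifs with h
      · rw [h]
        show _ = bit (β (K.mkTok G t i e)) * 2 ^ k * (1 / (m : ℝ) * x (K.mkTok G t i e))
        ring
      · simp
    rw [← h5]
    calc _ ≤ (1 / 2 : ℝ) ^ (t : ℕ) * (prof (K.inn G.1.1) (m / 2 ^ k + 1) *
          (D + (∑ i, vec t k i) / ((m / 2 ^ k + 1 : ℕ) : ℝ))) :=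
          mul_le_mul_of_nonneg_left h2 (by positivity)
      _ = (1 / 2 : ℝ) ^ (t : ℕ) * prof (K.inn G.1.1) (m / 2 ^ k + 1) * D
          + (1 / 2 : ℝ) ^ (t : ℕ) * prof (K.inn G.1.1) (m / 2 ^ k + 1) *
          ((∑ i, vec t k i) / ((m / 2 ^ k + 1 : ℕ) : ℝ)) := by ring
      _ ≤ _ := by
          have : 0 ≤ (∑ i, vec t k i) / ((m / 2 ^ k + 1 : ℕ) : ℝ) := by positivity
          gcongr
  -- Thinning makes the coefficient of `D` linear in `Am`; a bound class by class would be
  -- quadratic.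
  have hdouble := (K.hinn G.1.1).level_double_sum_le (K.card_inn G.1.1) E
  rw [← Fin.sum_univ_eq_sum_range (fun s => ∑ k ∈ Finset.range E, (1 / 2 : ℝ) ^ s *
    prof (K.inn G.1.1) (cap (K.inn G.1.1) s / 2 ^ k + 1)) (K.Am + 1)] at hdouble
  unfold xval
  calc _ ≤ ∑ t : Fin (K.Am + 1), ∑ k ∈ Finset.range E,
        ((1 / 2 : ℝ) ^ (t : ℕ) * prof (K.inn G.1.1) (cap (K.inn G.1.1) t / 2 ^ k + 1) * D
        + 3 * ∑ i, ∑ e, if rk t i e = k then bit (β (K.mkTok G t i e)) * 2 ^ rk t i e *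
          (K.mwu.c (K.mkTok G t i e).1 * x (K.mkTok G t i e)) else 0) := by
        refine Finset.sum_le_sum fun t _ => ?_
        have e1 : (fun i => ∑ e, bit (β (K.mkTok G t i e)) * x (K.mkTok G t i e))
            = fun i => ∑ k ∈ Finset.range E, vec t k i := by
          funext i; exact hsplit t i
        rw [e1]
        refine (mul_le_mul_of_nonneg_left (seminorm_sum_le (K.inn G.1.1) (Finset.range E)
          fun k i => vec t k i) (by positivity)).trans ?_
        rw [Finset.mul_sum]
        exact Finset.sum_le_sum fun k _ => hlin t k
    _ = (∑ t : Fin (K.Am + 1), ∑ k ∈ Finset.range E,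
        (1 / 2 : ℝ) ^ (t : ℕ) * prof (K.inn G.1.1) (cap (K.inn G.1.1) t / 2 ^ k + 1)) * D
        + 3 * ∑ t : Fin (K.Am + 1), ∑ k ∈ Finset.range E, ∑ i, ∑ e,
          if rk t i e = k then bit (β (K.mkTok G t i e)) * 2 ^ rk t i e *
          (K.mwu.c (K.mkTok G t i e).1 * x (K.mkTok G t i e)) else 0 := by
        simp only [Finset.sum_add_distrib, Finset.mul_sum, Finset.sum_mul]
    _ ≤ _ := by
        refine add_le_add ?_ (le_of_eq ?_)
        · refine mul_le_mul_of_nonneg_right (hdouble.trans ?_) hD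
          rw [hE]; push_cast; linarith
        · congr 1
          refine Finset.sum_congr rfl fun t _ => ?_
          rw [Finset.sum_comm]
          refine Finset.sum_congr rfl fun i _ => ?_
          rw [Finset.sum_comm]
          refine Finset.sum_congr rfl fun e _ => ?_
          rw [Finset.sum_ite_eq, if_pos (Finset.mem_range.mpr (rank_lt _ e))]
          rfl

end Core

/-! ### Placement of jobs and loads of tokens -/

theorem seminorm_add_le {J : Type*} (N : Seminorm ℝ (J → ℝ)) (f g : J → ℝ) :
    N (fun i => f i + g i) ≤ N f + N g := map_add_le_add N f g

/-- At each level, jobs up to the thinned capacity form the base load, and the others are paid for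
linearly at rate `3 * 2 ^ k`. The exponent `k` is free and will be adapted to the bundle. -/
theorem SymMono.level_count_le {J : Type*} [Fintype J] [DecidableEq J] [Nonempty J]
    {N : Seminorm ℝ (J → ℝ)} (hN : SymMono N) (A k : ℕ) (f : J → ℕ) (hf : ∀ j, f j ≤ A)
    (T : Finset J) :
    ∑ s ∈ Finset.range (A + 1), (1 / 2 : ℝ) ^ s * prof N (T.filter fun j => f j = s).card
      ≤ thinLoad N A k + 3 * 2 ^ k * ∑ j ∈ T, 1 / (cap N (f j) : ℝ) := by
  have h1 : ∀ s, (1 / 2 : ℝ) ^ s * prof N (T.filter fun j => f j = s).card ≤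
      (1 / 2 : ℝ) ^ s * prof N (cap N s / 2 ^ k + 1)
      + 3 * 2 ^ k * ∑ j ∈ T with f j = s, 1 / (cap N (f j) : ℝ) := by
    intro s
    set c := (T.filter fun j => f j = s).card with hc
    set m := cap N s with hm
    have hm0 : (0 : ℝ) < m := by exact_mod_cast hN.one_le_cap s
    have h2 := prof_le_of_pos N c (Nat.le_add_left 1 (m / 2 ^ k))
    have h3 := hN.level_term_le s k
    rw [← hm] at h3
    have ht : (m : ℝ) / 2 ^ k ≤ ((m / 2 ^ k + 1 : ℕ) : ℝ) := by
      have := Nat.lt_floor_add_one ((m : ℝ) / ((2 ^ k : ℕ) : ℝ))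
      rw [Nat.floor_div_eq_div] at this
      push_cast at this ⊢
      exact this.le
    have h4 : (c : ℝ) / ((m / 2 ^ k + 1 : ℕ) : ℝ) ≤ c * (2 ^ k / m) := by
      have h6 := one_div_le_one_div_of_le (by positivity : (0 : ℝ) < (m : ℝ) / 2 ^ k) ht
      rw [one_div_div] at h6
      rw [div_eq_mul_one_div]
      exact mul_le_mul_of_nonneg_left h6 (Nat.cast_nonneg _)
    have h5 : ∑ j ∈ T with f j = s, 1 / (cap N (f j) : ℝ) = c * (1 / m) := by
      rw [Finset.sum_congr rfl fun j hj => by rw [(Finset.mem_filter.mp hj).2],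
        Finset.sum_const, nsmul_eq_mul]
    rw [h5]
    have h6 : 0 ≤ prof N (m / 2 ^ k + 1) := prof_nonneg N _
    calc _ ≤ (1 / 2 : ℝ) ^ s * ((1 + c / ((m / 2 ^ k + 1 : ℕ) : ℝ)) * prof N (m / 2 ^ k + 1)) := by
          gcongr
      _ = (1 / 2 : ℝ) ^ s * prof N (m / 2 ^ k + 1) + (1 / 2 : ℝ) ^ s * prof N (m / 2 ^ k + 1) *
          (c / ((m / 2 ^ k + 1 : ℕ) : ℝ)) := by ring
      _ ≤ (1 / 2 : ℝ) ^ s * prof N (m / 2 ^ k + 1) + 3 * (c * (2 ^ k / m)) := by gcongr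
      _ = _ := by ring
  refine (Finset.sum_le_sum fun s _ => h1 s).trans (le_of_eq ?_)
  rw [Finset.sum_add_distrib, ← Finset.mul_sum]
  congr 2
  exact Finset.sum_fiberwise_of_maps_to (fun j _ => by simpa using Nat.lt_succ_of_le (hf j)) _

namespace Core

variable {ι : Type} [Fintype ι] [DecidableEq ι] {σ : ι → Type} [∀ ℓ, Fintype (σ ℓ)]
  [∀ ℓ, DecidableEq (σ ℓ)] {n : ℕ} (K : Core ι σ n)

instance : DecidableEq (K.Tok × Fin K.bundles) := instDecidableEqProd

instance : DecidableEq (Option (K.Tok × Fin K.bundles)) :=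
  Option.instDecidableEq

open Classical in
/-- The token and bundle in which a job with the given tokens is accepted. -/
noncomputable def chosen (ω : K.Bit → Bool) (S : Finset K.Tok) : Option (K.Tok × Fin K.bundles) :=
  if h : ∃ x : K.Tok × Fin K.bundles, x.1 ∈ S ∧ K.Open ω x.1 x.2 ∧ K.Reach ω S x.2 then
    some h.choose else none

theorem chosen_some {ω : K.Bit → Bool} {S : Finset K.Tok} {x : K.Tok × Fin K.bundles}
    (h : K.chosen ω S = some x) : x.1 ∈ S ∧ K.Open ω x.1 x.2 ∧ K.Reach ω S x.2 := by
  unfold chosen at h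
  split_ifs at h with hx
  rw [← Option.some_injective _ h]
  exact hx.choose_spec

theorem chosen_none {ω : K.Bit → Bool} {S : Finset K.Tok} (h : K.chosen ω S = none) :
    K.Reach ω S K.bundles := by
  have hx : ¬ ∃ x : K.Tok × Fin K.bundles, x.1 ∈ S ∧ K.Open ω x.1 x.2 ∧ K.Reach ω S x.2 := by
    intro hx
    unfold chosen at h
    rw [dif_pos hx] at h
    exact Option.some_ne_none _ h
  have key : ∀ r, r ≤ K.bundles → K.Reach ω S r := by
    intro r
    induction r with
    | zero => exact fun _ r' h => absurd h (by omega)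
    | succ r ih =>
      intro hr r' hr' ⟨H, hH, ho⟩
      have h1 := ih (by omega)
      rcases Nat.lt_succ_iff_lt_or_eq.mp hr' with h2 | h2
      · exact h1 r' h2 ⟨H, hH, ho⟩
      · exact hx ⟨(H, r'), hH, ho, by simpa [h2] using h1⟩
  exact key _ le_rfl

/-- Placement of a job with the given tokens and fallback machine. -/
noncomputable def place (ω : K.Bit → Bool) (S : Finset K.Tok) (f : Σ ℓ, σ ℓ) : Σ ℓ, σ ℓ :=
  (K.chosen ω S).elim f fun x => x.1.1.1

section

variable (w : Fin n → (Σ ℓ, σ ℓ) → ℝ≥0∞) (U : Fin n → Finset K.Tok)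

/-- Level of a job relative to a slot. -/
noncomputable def jlev (j : Fin n) (u : K.Slot) : ℕ := lev K.An ((w j u.1).toReal / K.tau u)

/-- Load of the jobs accepted by a slot token in a bundle, relative to the scale of the slot. -/
noncomputable def tload (ω : K.Bit → Bool) (H : K.Tok) (r : Fin K.bundles) : ℝ :=
  ∑ s ∈ Finset.range (K.An + 1), (1 / 2 : ℝ) ^ s * prof (K.mach H.1.1)
    ((Finset.univ.filter fun j => K.chosen ω (U j) = some (H, r)).filter
      fun j => K.jlev w j H.1 = s).card

/-- Load of a slot token. -/
noncomputable def nTok (ω : K.Bit → Bool) (H : K.Tok) : ℝ := ∑ r, K.tload w U ω H r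

/-- Excess load of a slot token in a bundle. -/
noncomputable def exc (ω : K.Bit → Bool) (H : K.Tok) (r : Fin K.bundles) : ℝ :=
  3 * 2 ^ (2 ^ (r : ℕ) - 1) * ∑ j with H ∈ U j, K.quo (w j H.1.1) H.1 * K.reachInd ω (U j) r

/-- Bound on the load of a slot token. -/
noncomputable def maxLoad : ℝ := 243 * (K.An + 1)

/-- Typical load of a slot token in a bundle. -/
noncomputable def base (H : K.Tok) (r : ℕ) : ℝ := thinLoad (K.mach H.1.1) K.An (2 ^ r - 1)

theorem quo_nonneg (x : ℝ≥0∞) (u : K.Slot) : 0 ≤ K.quo x u := by unfold quo; positivity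

theorem base_nonneg (H : K.Tok) (r : ℕ) : 0 ≤ K.base H r := thinLoad_nonneg _ _ _

theorem exc_nonneg (ω : K.Bit → Bool) (H : K.Tok) (r : Fin K.bundles) : 0 ≤ K.exc w U ω H r :=
  mul_nonneg (by positivity) (Finset.sum_nonneg fun _ _ =>
    mul_nonneg (K.quo_nonneg _ _) (K.reachInd_nonneg _ _ _))

theorem tload_nonneg (ω : K.Bit → Bool) (H : K.Tok) (r : Fin K.bundles) : 0 ≤ K.tload w U ω H r :=
  Finset.sum_nonneg fun _ _ => mul_nonneg (by positivity) (prof_nonneg _ _)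

theorem nTok_nonneg (ω : K.Bit → Bool) (H : K.Tok) : 0 ≤ K.nTok w U ω H :=
  Finset.sum_nonneg fun _ _ => K.tload_nonneg w U ω H _

variable {w U}

theorem tload_eq_zero {ω : K.Bit → Bool} {H : K.Tok} {r : Fin K.bundles}
    (h : ∀ j, K.chosen ω (U j) ≠ some (H, r)) : K.tload w U ω H r = 0 := by
  unfold tload
  refine Finset.sum_eq_zero fun s _ => ?_
  rw [Finset.filter_false_of_mem (fun j _ => h j)]
  simp [prof_zero]

theorem nTok_eq_zero {ω : K.Bit → Bool} {H : K.Tok} (h : H ∉ Finset.univ.biUnion U) :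
    K.nTok w U ω H = 0 :=
  Finset.sum_eq_zero fun _ _ => K.tload_eq_zero fun j hj =>
    h (Finset.mem_biUnion.mpr ⟨j, Finset.mem_univ _, (K.chosen_some hj).1⟩)

variable [NeZero n]

theorem tload_le_count (k : ℕ) (ω : K.Bit → Bool) (H : K.Tok) (r : Fin K.bundles) :
    K.tload w U ω H r ≤ thinLoad (K.mach H.1.1) K.An k + 3 * 2 ^ k *
      ∑ j with K.chosen ω (U j) = some (H, r), K.quo (w j H.1.1) H.1 :=
  (K.hmach H.1.1).level_count_le K.An k (fun j => K.jlev w j H.1) (fun _ => lev_le _ _) _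

/-- Without thinning, `k = 0`: the constant is `3 + 3 * 80 = 243`. -/
theorem tload_le_maxLoad (hU : K.TokOK w U) (ω : K.Bit → Bool) (H : K.Tok) (r : Fin K.bundles) :
    K.tload w U ω H r ≤ K.maxLoad := by
  refine (K.tload_le_count 0 ω H r).trans ?_
  have h1 : thinLoad (K.mach H.1.1) K.An 0 ≤ 3 * (K.An + 1) := by
    unfold thinLoad
    refine (Finset.sum_le_sum fun s _ => (K.hmach H.1.1).level_term_le s 0).trans ?_
    simp; linarith
  have h2 : ∑ j with K.chosen ω (U j) = some (H, r), K.quo (w j H.1.1) H.1 ≤ 80 * (K.An + 1) := by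
    refine le_trans (Finset.sum_le_sum_of_subset_of_nonneg (fun j hj => ?_)
      fun _ _ _ => K.quo_nonneg _ _) (hU.sum_quo H)
    simp only [Finset.mem_filter, Finset.mem_univ, true_and] at hj ⊢
    exact (K.chosen_some hj).1
  unfold maxLoad
  linarith

/-- A token accepts jobs in only one bundle: once it is open in some bundle, every job that has it
is accepted there or before, and none of them reaches a later bundle. Hence the sum over the bundles
costs nothing. -/
theorem nTok_le_maxLoad (hU : K.TokOK w U) (ω : K.Bit → Bool) (H : K.Tok) :
    K.nTok w U ω H ≤ K.maxLoad := by
  by_cases h : ∃ r j, K.chosen ω (U j) = some (H, r)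
  · obtain ⟨r, j, hj⟩ := h
    have : K.nTok w U ω H = K.tload w U ω H r := by
      refine Finset.sum_eq_single r (fun r' _ hr' => K.tload_eq_zero fun j' hj' => ?_)
        fun h => absurd (Finset.mem_univ _) h
      obtain ⟨h1, h2, h3⟩ := K.chosen_some hj
      obtain ⟨h4, h5, h6⟩ := K.chosen_some hj'
      rcases lt_or_gt_of_ne hr' with h | h
      · exact h3 r' h ⟨H, h1, h5⟩
      · exact h6 r h ⟨H, h4, h2⟩
    rw [this]
    exact K.tload_le_maxLoad hU ω H r
  · push Not at h
    have : K.nTok w U ω H = 0 := Finset.sum_eq_zero fun r _ => K.tload_eq_zero (h r)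
    rw [this]; unfold maxLoad; positivity

/-- Load occurs only in an open token. Thinning by `2 ^ (2 ^ r - 1)` is affordable because only jobs
that reach bundle `r` count. The right-hand side separates the bits of bundle `r` from `exc`, which
is determined by earlier bundles. -/
theorem tload_le (hU : K.TokOK w U) (ω : K.Bit → Bool) (H : K.Tok) (r : Fin K.bundles) :
    K.tload w U ω H r ≤ K.gbit ω (K.grp H) r * K.hbit ω H r *
      (K.base H r + min (K.exc w U ω H r) K.maxLoad) := by
  have hm : 0 ≤ K.maxLoad := by unfold maxLoad; positivity
  by_cases ho : K.Open ω H r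
  · have h1 : K.gbit ω (K.grp H) r = 1 := by unfold gbit bit; simp [ho.1]
    have h2 : K.hbit ω H r = 1 := by unfold hbit bit; simp [ho.2]
    rw [h1, h2, one_mul, one_mul]
    have h3 := K.tload_le_maxLoad hU ω H r
    have h4 := K.tload_le_count (w := w) (U := U) (2 ^ (r : ℕ) - 1) ω H r
    have h5 : ∑ j with K.chosen ω (U j) = some (H, r), K.quo (w j H.1.1) H.1
        ≤ ∑ j with H ∈ U j, K.quo (w j H.1.1) H.1 * K.reachInd ω (U j) r := by
      calc _ = ∑ j with K.chosen ω (U j) = some (H, r),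
            K.quo (w j H.1.1) H.1 * K.reachInd ω (U j) r := by
            refine Finset.sum_congr rfl fun j hj => ?_
            rw [K.reachInd_eq_one (K.chosen_some (Finset.mem_filter.mp hj).2).2.2, mul_one]
        _ ≤ _ := by
            refine Finset.sum_le_sum_of_subset_of_nonneg (fun j hj => ?_) fun _ _ _ =>
              mul_nonneg (K.quo_nonneg _ _) (K.reachInd_nonneg _ _ _)
            simp only [Finset.mem_filter, Finset.mem_univ, true_and] at hj ⊢
            exact (K.chosen_some hj).1
    have h6 : K.tload w U ω H r ≤ K.base H r + K.exc w U ω H r := by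
      refine h4.trans ?_
      unfold base exc
      gcongr
    have h7 := K.base_nonneg H r
    rcases le_total (K.exc w U ω H r) K.maxLoad with h | h
    · rwa [min_eq_left h]
    · rw [min_eq_right h]; linarith
  · rw [K.tload_eq_zero fun j hj => ho (K.chosen_some hj).2.1]
    exact mul_nonneg (mul_nonneg (bit_nonneg _) (bit_nonneg _))
      (add_nonneg (K.base_nonneg H r) (le_min (K.exc_nonneg w U ω H r) hm))

/-- Load of the jobs accepted by a slot token in a bundle. -/
theorem mach_chosen_le (hU : K.TokOK w U) (ω : K.Bit → Bool) (H : K.Tok) (r : Fin K.bundles) :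
    K.mach H.1.1 (fun j => if K.chosen ω (U j) = some (H, r) then (w j H.1.1).toReal else 0)
      ≤ K.tau H.1 * K.tload w U ω H r := by
  have ht := K.tau_pos H.1
  set T := Finset.univ.filter fun j => K.chosen ω (U j) = some (H, r) with hT
  let f : ℕ → Fin n → ℝ := fun s j =>
    (K.tau H.1 * (1 / 2) ^ s) * indVec (T.filter fun j => K.jlev w j H.1 = s) j
  have h1 : ∀ j, (if K.chosen ω (U j) = some (H, r) then (w j H.1.1).toReal else 0)
      ≤ ∑ s ∈ Finset.range (K.An + 1), f s j := by
    intro j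
    have h0 : ∀ s, 0 ≤ f s j := fun s => mul_nonneg (by positivity) (indVec_nonneg _ j)
    split_ifs with h
    · have h2 := hU.allowed j H (K.chosen_some h).1
      have h3 : (w j H.1.1).toReal ≤ K.tau H.1 := ENNReal.toReal_le_of_le_ofReal ht.le h2
      have h4 : (w j H.1.1).toReal / K.tau H.1 ≤ (1 / 2) ^ K.jlev w j H.1 :=
        le_of_lev ((div_le_one ht).mpr h3)
      rw [div_le_iff₀ ht] at h4
      have h5 : f (K.jlev w j H.1) j = K.tau H.1 * (1 / 2) ^ K.jlev w j H.1 := by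
        simp [f, indVec, hT, h]
      refine le_trans (by rw [h5]; linarith) (Finset.single_le_sum (fun s _ => h0 s)
        (Finset.mem_range.mpr (Nat.lt_succ_of_le (lev_le K.An _) : K.jlev w j H.1 < K.An + 1)))
    · exact Finset.sum_nonneg fun s _ => h0 s
  refine ((K.hmach H.1.1).mono' (fun j => by split_ifs <;> simp) h1).trans
    ((seminorm_sum_le _ _ _).trans (le_of_eq ?_))
  unfold tload
  rw [Finset.mul_sum]
  refine Finset.sum_congr rfl fun s _ => ?_
  show K.mach H.1.1 (fun j => (K.tau H.1 * (1 / 2) ^ s) *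
    indVec (T.filter fun j => K.jlev w j H.1 = s) j) = _
  rw [seminorm_mul _ (by positivity)]
  have := (K.hmach H.1.1).apply_indVec (T.filter fun j => K.jlev w j H.1 = s)
  rw [this]
  ring

theorem cload_place_le (hU : K.TokOK w U) {fb : Fin n → Σ ℓ, σ ℓ} (hfb : ∀ j, w j (fb j) ≤ 1)
    (ω : K.Bit → Bool) (i : Σ ℓ, σ ℓ) :
    K.cload w (fun j => K.place ω (U j) (fb j)) i ≤
      ∑ k : Fin (K.a + 1) × Fin (4 * K.a + 8) × Fin (K.Am + 1),
        (1 / 2) ^ (k.1 + k.2.2 : ℕ) *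
          ∑ e, K.nTok w U ω (K.mkTok ((i.1, k.1), k.2.1) k.2.2 i.2 e)
      + ∑ j, if K.chosen ω (U j) = none ∧ fb j = i then 1 else 0 := by
  let X : Type := (Fin (K.a + 1) × Fin (4 * K.a + 8) × Fin (K.Am + 1)) × Fin (8 * K.Am + 18) ×
    Fin K.bundles
  let φ : X → K.Tok := fun k => K.mkTok ((i.1, k.1.1), k.1.2.1) k.1.2.2 i.2 k.2.1
  let f : X → Fin n → ℝ := fun k j =>
    if K.chosen ω (U j) = some (φ k, k.2.2) then (w j i).toReal else 0
  let g : Fin n → ℝ := fun j => if K.chosen ω (U j) = none ∧ fb j = i then (w j i).toReal else 0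
  have hf0 : ∀ k j, 0 ≤ f k j := fun k j => by simp only [f]; split_ifs <;> simp
  have hg0 : ∀ j, 0 ≤ g j := fun j => by simp only [g]; split_ifs <;> simp
  have h1 : ∀ j, (if K.place ω (U j) (fb j) = i then (w j i).toReal else 0)
      ≤ (∑ k, f k j) + g j := by
    intro j
    have hs : 0 ≤ ∑ k, f k j := Finset.sum_nonneg fun k _ => hf0 k j
    split_ifs with h
    · rcases hc : K.chosen ω (U j) with _ | ⟨H, r⟩
      · have h2 : fb j = i := by unfold place at h; rw [hc] at h; exact h
        have h3 : g j = (w j i).toReal := by simp [g, hc, h2]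
        linarith
      · have h2 : H.1.1 = i := by unfold place at h; rw [hc] at h; exact h
        subst h2
        have h3 : f ((H.1.2.1, H.2.1, H.1.2.2), H.2.2, r) j = (w j H.1.1).toReal := by
          have : φ ((H.1.2.1, H.2.1, H.1.2.2), H.2.2, r) = H := rfl
          simp [f, this, hc]
        have h4 := Finset.single_le_sum (fun k _ => hf0 k j)
          (Finset.mem_univ ((H.1.2.1, H.2.1, H.1.2.2), H.2.2, r))
        have h5 := hg0 j
        rw [h3] at h4
        linarith
    · have := hg0 j; linarith
  have h2 : K.cload w (fun j => K.place ω (U j) (fb j)) i ≤ ∑ k, K.mach i (f k) + ∑ j, g j := by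
    unfold cload
    refine ((K.hmach i).mono' (fun j => by split_ifs <;> simp) h1).trans ?_
    refine (seminorm_add_le _ _ _).trans ?_
    exact add_le_add (seminorm_sum_le _ _ _) ((K.hmach i).le_sum hg0)
  have h3 : ∀ k : X, K.mach i (f k) ≤ (1 / 2) ^ (k.1.1 + k.1.2.2 : ℕ) * K.tload w U ω (φ k) k.2.2 :=
    fun k => K.mach_chosen_le hU ω (φ k) k.2.2
  refine h2.trans (add_le_add ((Finset.sum_le_sum fun k _ => h3 k).trans (le_of_eq ?_))
    (Finset.sum_le_sum fun j _ => ?_))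
  · rw [Fintype.sum_prod_type]
    refine Finset.sum_congr rfl fun k _ => ?_
    rw [Fintype.sum_prod_type, Finset.mul_sum]
    refine Finset.sum_congr rfl fun e _ => ?_
    unfold nTok
    rw [Finset.mul_sum]
  · simp only [g]
    split_ifs with h
    · have := ENNReal.toReal_mono ENNReal.one_ne_top (hfb j)
      rw [h.2] at this
      simpa using this
    · exact le_rfl

/-- Cost of the rounded placement in terms of the loads of the tokens. -/
theorem agg_place_le (hU : K.TokOK w U) {fb : Fin n → Σ ℓ, σ ℓ} (hfb : ∀ j, w j (fb j) ≤ 1)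
    (ω : K.Bit → Bool) :
    K.agg (K.cload w fun j => K.place ω (U j) (fb j)) ≤
      ∑ b : Fin (K.a + 1), (1 / 2) ^ (b : ℕ) * K.out (fun ℓ =>
        ∑ e : Fin (4 * K.a + 8), K.xval (K.nTok w U ω) ((ℓ, b), e))
      + ∑ j, if K.chosen ω (U j) = none then 1 else 0 := by
  let F : (Σ ℓ, σ ℓ) → ℝ := fun i => ∑ j, if K.chosen ω (U j) = none ∧ fb j = i then 1 else 0
  have hF0 : ∀ i, 0 ≤ F i := fun i => Finset.sum_nonneg fun j _ => by split_ifs <;> simp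
  have h1 : ∀ ℓ, K.inn ℓ (fun i => K.cload w (fun j => K.place ω (U j) (fb j)) ⟨ℓ, i⟩) ≤
      ∑ b : Fin (K.a + 1), (1 / 2) ^ (b : ℕ) *
        ∑ e : Fin (4 * K.a + 8), K.xval (K.nTok w U ω) ((ℓ, b), e) + ∑ i, F ⟨ℓ, i⟩ := by
    intro ℓ
    refine ((K.hinn ℓ).mono' (fun i => apply_nonneg _ _)
      fun i => K.cload_place_le hU hfb ω ⟨ℓ, i⟩).trans ?_
    refine (seminorm_add_le _ _ _).trans ?_
    refine add_le_add ((seminorm_sum_le _ _ _).trans (le_of_eq ?_))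
      ((K.hinn ℓ).le_sum fun i => hF0 _)
    rw [Fintype.sum_prod_type]
    refine Finset.sum_congr rfl fun b _ => ?_
    rw [Fintype.sum_prod_type, Finset.mul_sum]
    refine Finset.sum_congr rfl fun e _ => ?_
    unfold xval
    rw [Finset.mul_sum]
    refine Finset.sum_congr rfl fun t _ => ?_
    rw [seminorm_mul _ (by positivity), pow_add, mul_assoc]
  have hx0 : ∀ ℓ b, 0 ≤ ∑ e : Fin (4 * K.a + 8), K.xval (K.nTok w U ω) ((ℓ, b), e) :=
    fun ℓ b => Finset.sum_nonneg fun e _ => K.xval_nonneg _ _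
  unfold agg
  refine (K.hout.mono' (fun ℓ => apply_nonneg _ _) h1).trans ?_
  refine (seminorm_add_le _ _ _).trans ?_
  refine add_le_add ((seminorm_sum_le _ _ _).trans (le_of_eq ?_))
    ((K.hout.le_sum fun ℓ => Finset.sum_nonneg fun i _ => hF0 _).trans (le_of_eq ?_))
  · refine Finset.sum_congr rfl fun b _ => ?_
    rw [seminorm_mul _ (by positivity)]
  · rw [← Fintype.sum_sigma' (fun ℓ i => F ⟨ℓ, i⟩)]
    show ∑ i : (Σ ℓ, σ ℓ), F i = _
    simp only [F]
    rw [Finset.sum_comm]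
    refine Finset.sum_congr rfl fun j _ => ?_
    by_cases h : K.chosen ω (U j) = none <;> simp [h]

end

end Core

/-! ### Expected value of a group token -/

/-- While `w > 2`, splitting off one factor, at most `2`, halves `w`. Once `w ≤ 2`, the remaining
product is at most `exp 2 ≤ 8`. -/
theorem prod_one_add_min_le (M : ℕ) {w : ℝ} (hw : 0 ≤ w) :
    ∏ k ∈ Finset.range M, (1 + min 1 (w / 2 ^ (M - k))) ≤ 8 * max 1 w := by
  have step : ∀ (M : ℕ) (w : ℝ), ∏ k ∈ Finset.range (M + 1), (1 + min 1 (w / 2 ^ (M + 1 - k)))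
      = (∏ k ∈ Finset.range M, (1 + min 1 (w / 2 / 2 ^ (M - k)))) * (1 + min 1 (w / 2)) := by
    intro M w
    rw [Finset.prod_range_succ]
    congr 1
    · refine Finset.prod_congr rfl fun k hk => ?_
      have : M + 1 - k = (M - k) + 1 := by have := Finset.mem_range.mp hk; omega
      rw [this, pow_succ', div_div]
    · rw [show M + 1 - M = 1 by omega, pow_one]
  have hexp : ∀ (M : ℕ) {w : ℝ}, 0 ≤ w →
      ∏ k ∈ Finset.range M, (1 + min 1 (w / 2 ^ (M - k))) ≤ Real.exp w := by
    intro M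
    induction M with
    | zero => intro w hw; simpa using hw
    | succ M ih =>
      intro w hw
      rw [step]
      have h1 : 1 + min 1 (w / 2) ≤ Real.exp (w / 2) := by
        have := Real.add_one_le_exp (w / 2)
        have := min_le_right 1 (w / 2)
        linarith
      have h2 : (0 : ℝ) ≤ 1 + min 1 (w / 2) := by positivity
      calc _ ≤ Real.exp (w / 2) * Real.exp (w / 2) :=
            mul_le_mul (ih (by positivity)) h1 h2 (Real.exp_pos _).le
        _ = Real.exp w := by rw [← Real.exp_add]; congr 1; ring
  have he : Real.exp 2 ≤ 8 := by
    have h1 := Real.exp_one_lt_d9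
    have h2 : Real.exp 2 = Real.exp 1 * Real.exp 1 := by rw [← Real.exp_add]; norm_num
    have h3 := Real.exp_pos 1
    nlinarith
  induction M generalizing w with
  | zero => simp; have := le_max_left 1 w; linarith
  | succ M ih =>
    rcases le_total w 2 with h | h
    · refine (hexp _ hw).trans ((Real.exp_le_exp.mpr h).trans (he.trans ?_))
      have := le_max_left 1 w; linarith
    · rw [step]
      have h1 := ih (w := w / 2) (by positivity)
      have h2 : max 1 (w / 2) = w / 2 := max_eq_right (by linarith)
      have h3 : max 1 w = w := max_eq_right (by linarith)
      have h4 : (1 : ℝ) + min 1 (w / 2) ≤ 2 := by have := min_le_left 1 (w / 2); linarith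
      rw [h2] at h1
      rw [h3]
      calc _ ≤ 8 * (w / 2) * 2 := mul_le_mul h1 h4 (by positivity) (by positivity)
        _ = 8 * w := by ring

theorem two_mul_exp_le : 2 * Real.exp (-8) ≤ 1 / 512 := by
  have h1 := Real.exp_one_gt_d9
  have h2 : Real.exp 8 = Real.exp 1 ^ 8 := by rw [← Real.exp_nat_mul]; norm_num
  have h3 : (1024 : ℝ) ≤ Real.exp 8 := by
    rw [h2]
    calc (1024 : ℝ) ≤ 2.7 ^ 8 := by norm_num
      _ ≤ _ := by gcongr; linarith
  rw [Real.exp_neg, ← div_eq_mul_inv, div_le_div_iff₀ (by positivity) (by norm_num)]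
  linarith

theorem bernE_prod_insert {β κ : Type*} [Fintype β] [DecidableEq β] [DecidableEq κ] (p : β → ℝ)
    (s : Finset κ) (φ : κ → β) (hφ : Function.Injective φ) {k₀ : κ} (hk : k₀ ∉ s) :
    bernE p (fun ω => bit (ω (φ k₀)) * ∏ k ∈ s, (1 + bit (ω (φ k))))
      = p (φ k₀) * ∏ k ∈ s, (1 + p (φ k)) := by
  have h := bernE_prod_inj p (insert k₀ s) φ hφ.injOn
    (fun k b => if k = k₀ then bit b else 1 + bit b)
  have e : ∀ k ∈ s, k ≠ k₀ := fun k hks h => hk (h ▸ hks)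
  simp only [Finset.prod_insert hk, if_true] at h
  have h1 : (fun ω : β → Bool => bit (ω (φ k₀)) * ∏ k ∈ s, (1 + bit (ω (φ k))))
      = fun ω => bit (ω (φ k₀)) * ∏ k ∈ s, if k = k₀ then bit (ω (φ k)) else 1 + bit (ω (φ k)) := by
    funext ω
    congr 1
    exact Finset.prod_congr rfl fun k hks => by rw [if_neg (e k hks)]
  rw [h1, h]
  congr 1
  · simp [bit]
  · refine Finset.prod_congr rfl fun k hks => ?_
    rw [if_neg (e k hks), if_neg (e k hks)]
    simp [bit]; ring

namespace Core

variable {ι : Type} [Fintype ι] [DecidableEq ι] {σ : ι → Type} [∀ ℓ, Fintype (σ ℓ)]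
  [∀ ℓ, DecidableEq (σ ℓ)] {n : ℕ} (K : Core ι σ n)

theorem mu_le_rate (G : K.GTok) (r : ℕ) : K.mu G r ≤ rate r := by
  unfold mu
  have h1 : (1 : ℝ) ≤ 2 ^ r := one_le_pow₀ (by norm_num)
  have h2 : (1 : ℝ) ≤ rate r := by unfold rate; linarith
  refine max_le h2 ?_
  exact mul_le_of_le_one_right (rate_pos r).le (min_le_left _ _)

theorem pH_le (H : K.Tok) (r : ℕ) : K.pH H r ≤ K.mu (K.grp H) r * K.rho H := min_le_right _ _

theorem pG_le_one (G : K.GTok) (r : ℕ) : K.pG G r ≤ 1 := min_le_left _ _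

theorem pG_le (G : K.GTok) (r : ℕ) : K.pG G r ≤ rate r * K.vhat G := min_le_right _ _

/-- The group bit, the slot bits of bundle `r` and the bits of earlier bundles are disjoint sets of
bits. -/
theorem bernE_gbit_mul (G : K.GTok) (r : Fin K.bundles) {Q y : (K.Bit → Bool) → ℝ}
    (hQ : DependsOn Q {i | ∃ H, i = Sum.inr (H, r)}) (hy : DependsOn y (K.before r)) :
    bernE K.prb (fun ω => K.gbit ω G r * (Q ω * y ω))
      = K.pG G r * (bernE K.prb Q * bernE K.prb y) := by
  rw [bernE_mul_of_dependsOn K.prb (A := {Sum.inl (G, r)}) (F := fun ω => K.gbit ω G r),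
    bernE_mul_of_dependsOn K.prb (A := {i | ∃ H, i = Sum.inr (H, r)}) hQ]
  · congr 1
    exact bernE_bit K.prb (Sum.inl (G, r))
  · intro x x' h
    refine hy fun i hi => h i ?_
    rintro ⟨H, rfl⟩
    exact lt_irrefl _ (show (r : ℕ) < r from hi)
  · intro x x' h
    simp only [gbit]; rw [h _ rfl]
  · intro x x' h
    simp only
    rw [hQ (x := x) (y := x') fun i hi => h i ?_, hy (x := x) (y := x') fun i hi => h i ?_]
    · rintro rfl
      exact lt_irrefl _ (show (r : ℕ) < r from hi)
    · rintro rfl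
      obtain ⟨H, hH⟩ := hi
      exact absurd hH (by simp)

theorem rho_class (H : K.Tok) (e : Fin (8 * K.Am + 18)) (he : e < H.2.2) :
    K.rho (H.1, H.2.1, e) = K.rho H / 2 ^ ((H.2.2 : ℕ) - e) := by
  unfold rho
  have h : (H.2.2 : ℕ) = e + ((H.2.2 : ℕ) - e) := by have : (e : ℕ) < H.2.2 := he; omega
  have h2 : (2 : ℝ) ^ (H.2.2 : ℕ) = 2 ^ (e : ℕ) * 2 ^ ((H.2.2 : ℕ) - e) := by
    rw [← pow_add, ← h]
  rw [h2]
  field_simp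

/-- Tokens of smaller class in the same slot open with probabilities that halve with each class, so
`2 ^ rank` has expectation at most `8 * max 1 w`. With the opening probability `min 1 w` this gives
`8 * w`: the weight by rank costs only a constant. -/
theorem bernE_rank_le (H : K.Tok) (r : Fin K.bundles) :
    bernE K.prb (fun ω => K.hbit ω H r *
      2 ^ rank (fun e => ω (Sum.inr ((H.1, H.2.1, e), r))) H.2.2)
      ≤ 8 * (K.mu (K.grp H) r * K.rho H) := by
  simp only [two_pow_rank]
  have h := bernE_prod_insert K.prb (Finset.univ.filter (· < H.2.2))
    (fun e => (Sum.inr ((H.1, H.2.1, e), r) : K.Bit)) (fun e e' h => by simpa using h)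
    (k₀ := H.2.2) (by simp)
  refine h.le.trans ?_
  set w := K.mu (K.grp H) r * K.rho H with hw
  have hw0 : 0 < w := mul_pos (zero_lt_one.trans_le (K.one_le_mu _ _)) (K.rho_pos H)
  have h1 : ∏ e ∈ Finset.univ.filter (· < H.2.2), (1 + K.prb (Sum.inr ((H.1, H.2.1, e), r)))
      ≤ 8 * max 1 w := by
    refine le_trans (le_of_eq ?_) (prod_one_add_min_le (H.2.2 : ℕ) hw0.le)
    calc _ = ∏ e ∈ Finset.univ.filter (· < H.2.2), (1 + min 1 (w / 2 ^ ((H.2.2 : ℕ) - e))) := by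
          refine Finset.prod_congr rfl fun e he => ?_
          show 1 + min 1 (K.mu (K.grp H) r * K.rho (H.1, H.2.1, e)) = _
          rw [K.rho_class H e (Finset.mem_filter.mp he).2, hw, mul_div_assoc]
      _ = _ := by
          rw [Finset.prod_filter]
          have := Fin.prod_univ_eq_prod_range
            (fun k => if k < (H.2.2 : ℕ) then 1 + min 1 (w / 2 ^ ((H.2.2 : ℕ) - k)) else 1)
            (8 * K.Am + 18)
          refine this.trans ?_
          rw [← Finset.prod_filter]
          refine Finset.prod_congr ?_ fun _ _ => rfl
          ext k
          have := H.2.2.2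
          simp only [Finset.mem_filter, Finset.mem_range]
          omega
  have h2 : K.prb (Sum.inr ((H.1, H.2.1, H.2.2), r)) = min 1 w := rfl
  rw [h2]
  calc _ ≤ min 1 w * (8 * max 1 w) := mul_le_mul_of_nonneg_left h1 (le_min zero_le_one hw0.le)
    _ = 8 * (min 1 w * max 1 w) := by ring
    _ = 8 * w := by rw [min_mul_max, one_mul]

theorem hrank_dependsOn (H : K.Tok) (r : Fin K.bundles) :
    DependsOn (fun ω : K.Bit → Bool => K.hbit ω H r *
      2 ^ rank (fun e => ω (Sum.inr ((H.1, H.2.1, e), r))) H.2.2)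
      {i | ∃ H, i = Sum.inr (H, r)} := by
  intro x y h
  have h1 : ∀ H, x (Sum.inr (H, r)) = y (Sum.inr (H, r)) := fun H => h _ ⟨H, rfl⟩
  simp only [hbit, h1]

theorem hbit_dependsOn (H : K.Tok) (r : Fin K.bundles) :
    DependsOn (fun ω : K.Bit → Bool => K.hbit ω H r) {i | ∃ H, i = Sum.inr (H, r)} := by
  intro x y h
  simp only [hbit]
  rw [h _ ⟨H, rfl⟩]

variable [∀ ℓ, Nonempty (σ ℓ)]

theorem c_nonneg (u : K.Slot) : 0 ≤ K.mwu.c u := by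
  show 0 ≤ 1 / (K.capI u.1.1 u.2.2 : ℝ)
  positivity

/-- Expected value of a group token in a bundle, when the loads are bounded and determined by the
previous bundles. -/
theorem bernE_gbit_xval_le (r : Fin K.bundles) (G : K.GTok) {x : (K.Bit → Bool) → K.Tok → ℝ} {D : ℝ}
    (hD : 0 ≤ D) (h0 : ∀ ω H, 0 ≤ x ω H) (hx : ∀ ω H, x ω H ≤ D)
    (hdep : ∀ H, DependsOn (fun ω => x ω H) (K.before r)) :
    bernE K.prb (fun ω => K.gbit ω G r * K.xval (fun H => K.hbit ω H r * x ω H) G)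
      ≤ K.pG G r * ((24 * K.Am + 44) * D) + 24 * (rate r * K.vhat G) *
        ∑ H with K.grp H = G, K.mwu.c H.1 * K.rho H * bernE K.prb fun ω => x ω H := by
  calc _ ≤ bernE K.prb (fun ω => (24 * K.Am + 44) * D * K.gbit ω G r + ∑ H with K.grp H = G,
        3 * K.mwu.c H.1 * (K.gbit ω G r * ((K.hbit ω H r *
          2 ^ rank (fun e => ω (Sum.inr ((H.1, H.2.1, e), r))) H.2.2) * x ω H))) := by
        refine bernE_mono K.prb_mem fun ω => ?_
        have h1 := K.xval_le_rank (fun H => ω (Sum.inr (H, r))) (x := x ω) (G := G) hD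
          (fun H _ => h0 ω H) fun H _ => hx ω H
        have h2 := mul_le_mul_of_nonneg_left h1 (bit_nonneg (ω (Sum.inl (G, r))))
        refine h2.trans (le_of_eq ?_)
        unfold gbit hbit
        rw [mul_add, Finset.mul_sum, Finset.mul_sum]
        congr 1
        · ring
        · refine Finset.sum_congr rfl fun H _ => ?_
          ring
    _ = (24 * K.Am + 44) * D * K.pG G r + ∑ H with K.grp H = G, 3 * K.mwu.c H.1 *
        (K.pG G r * (bernE K.prb (fun ω => K.hbit ω H r *
          2 ^ rank (fun e => ω (Sum.inr ((H.1, H.2.1, e), r))) H.2.2) *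
          bernE K.prb fun ω => x ω H)) := by
        rw [bernE_add, bernE_const_mul, bernE_sum]
        congr 1
        · congr 1
          exact bernE_bit K.prb (Sum.inl (G, r))
        · refine Finset.sum_congr rfl fun H _ => ?_
          rw [bernE_const_mul, K.bernE_gbit_mul G r (K.hrank_dependsOn H r) (hdep H)]
    _ ≤ _ := by
        refine add_le_add (le_of_eq (by ring)) ?_
        rw [Finset.mul_sum]
        refine Finset.sum_le_sum fun H hH => ?_
        have hG : K.grp H = G := (Finset.mem_filter.mp hH).2
        have h1 := K.bernE_rank_le H r
        have h2 : 0 ≤ bernE K.prb fun ω => x ω H := bernE_nonneg K.prb_mem fun ω => h0 ω H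
        have h3 := K.pG_nonneg G r
        have h4 := K.c_nonneg H.1
        have h5 := K.pG_mul_mu G r
        rw [hG] at h1
        calc _ ≤ 3 * K.mwu.c H.1 * (K.pG G r * (8 * (K.mu G r * K.rho H) *
              bernE K.prb fun ω => x ω H)) := by gcongr
          _ = 24 * (K.pG G r * K.mu G r) * (K.mwu.c H.1 * K.rho H * bernE K.prb fun ω => x ω H) := by
              ring
          _ = _ := by rw [h5]

/-- A crude version with the sum of all loads in place of the norm. It loses up to `2 ^ Am` and
serves only the late bundles, where the loads are doubly exponentially small. -/
theorem bernE_gbit_xval_le_sum (r : Fin K.bundles) (G : K.GTok) {x : (K.Bit → Bool) → K.Tok → ℝ}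
    (h0 : ∀ ω H, 0 ≤ x ω H) (hdep : ∀ H, DependsOn (fun ω => x ω H) (K.before r)) :
    bernE K.prb (fun ω => K.gbit ω G r * K.xval (fun H => K.hbit ω H r * x ω H) G)
      ≤ rate r * K.vhat G * ∑ H with K.grp H = G, K.rho H * bernE K.prb fun ω => x ω H := by
  calc _ ≤ bernE K.prb (fun ω => ∑ H with K.grp H = G,
        K.gbit ω G r * (K.hbit ω H r * x ω H)) := by
        refine bernE_mono K.prb_mem fun ω => ?_
        rw [← Finset.mul_sum]
        exact mul_le_mul_of_nonneg_left (K.xval_le_sum fun H _ => mul_nonneg (bit_nonneg _) (h0 ω H))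
          (bit_nonneg _)
    _ = ∑ H with K.grp H = G, K.pG G r * (K.pH H r * bernE K.prb fun ω => x ω H) := by
        rw [bernE_sum]
        refine Finset.sum_congr rfl fun H _ => ?_
        rw [K.bernE_gbit_mul G r (K.hbit_dependsOn H r) (hdep H)]
        congr 2
        exact bernE_bit K.prb (Sum.inr (H, r))
    _ ≤ _ := by
        rw [Finset.mul_sum]
        refine Finset.sum_le_sum fun H hH => ?_
        have hG : K.grp H = G := (Finset.mem_filter.mp hH).2
        have h1 := K.pH_le H r
        rw [hG] at h1
        have h2 : 0 ≤ bernE K.prb fun ω => x ω H := bernE_nonneg K.prb_mem fun ω => h0 ω H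
        have h3 := K.pG_nonneg G r
        calc _ ≤ K.pG G r * (K.mu G r * K.rho H * bernE K.prb fun ω => x ω H) := by gcongr
          _ = (K.pG G r * K.mu G r) * (K.rho H * bernE K.prb fun ω => x ω H) := by ring
          _ = _ := by rw [K.pG_mul_mu]

section

variable {w : Fin n → (Σ ℓ, σ ℓ) → ℝ≥0∞} {U : Fin n → Finset K.Tok}

/-- Indicator of the tokens used by some job. -/
noncomputable def liv (U : Fin n → Finset K.Tok) (H : K.Tok) : ℝ :=
  if H ∈ Finset.univ.biUnion U then 1 else 0

theorem liv_nonneg (H : K.Tok) : 0 ≤ K.liv U H := by unfold liv; split_ifs <;> norm_num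

theorem liv_le_one (H : K.Tok) : K.liv U H ≤ 1 := by unfold liv; split_ifs <;> norm_num

theorem maxLoad_nonneg : 0 ≤ K.maxLoad := by unfold maxLoad; positivity

theorem exc_dependsOn (H : K.Tok) (r : Fin K.bundles) :
    DependsOn (fun ω => K.exc w U ω H r) (K.before r) := by
  intro x y h
  have h1 : ∀ j, K.reachInd x (U j) r = K.reachInd y (U j) r := fun j =>
    K.reachInd_dependsOn (U j) r h
  simp only [exc, h1]

/-- The probability `exp (-8 k)` of reaching the bundle beats the thinning factor `2 ^ k`, as `2 *
exp (-8) ≤ 1 / 512`; the constant is `3 * 80`. -/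
theorem bernE_exc_le (hU : K.TokOK w U) (H : K.Tok) (r : Fin K.bundles) :
    bernE K.prb (fun ω => K.exc w U ω H r) ≤
      240 * (K.An + 1) * (1 / 512) ^ (2 ^ (r : ℕ) - 1) := by
  set k := 2 ^ (r : ℕ) - 1 with hk
  unfold exc
  rw [bernE_const_mul, bernE_sum]
  have h1 : ∑ j with H ∈ U j, bernE K.prb (fun ω => K.quo (w j H.1.1) H.1 * K.reachInd ω (U j) r)
      ≤ 80 * (K.An + 1) * Real.exp (-8) ^ k := by
    refine le_trans ?_ (mul_le_mul_of_nonneg_right (hU.sum_quo H) (by positivity))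
    rw [Finset.sum_mul]
    refine Finset.sum_le_sum fun j _ => ?_
    rw [bernE_const_mul]
    exact mul_le_mul_of_nonneg_left (K.bernE_reachInd_le r.2.le (hU.cover j)) (K.quo_nonneg _ _)
  calc _ ≤ 3 * 2 ^ k * (80 * (K.An + 1) * Real.exp (-8) ^ k) := by gcongr
    _ = 240 * (K.An + 1) * (2 * Real.exp (-8)) ^ k := by rw [mul_pow]; ring
    _ ≤ _ := by
        have := two_mul_exp_le
        gcongr

variable [NeZero n]

theorem sum_base_le (H : K.Tok) : ∑ r : Fin K.bundles, 2 ^ (r : ℕ) * K.base H r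
    ≤ 36 * (K.An + 1) := by
  have h := (K.hmach H.1.1).sum_thinLoad_le (A := K.An) (by simpa using K.card_jobs) K.pow_bundles_le
  rwa [← Fin.sum_univ_eq_sum_range (fun r => 2 ^ r * thinLoad (K.mach H.1.1) K.An (2 ^ r - 1))] at h

theorem pow_mul_base_le (H : K.Tok) (r : Fin K.bundles) :
    2 ^ (r : ℕ) * K.base H r ≤ 36 * (K.An + 1) :=
  (Finset.single_le_sum (f := fun r : Fin K.bundles => 2 ^ (r : ℕ) * K.base H r)
    (fun r _ => mul_nonneg (by positivity) (K.base_nonneg H r)) (Finset.mem_univ r)).trans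
    (K.sum_base_le H)

theorem base_le (H : K.Tok) (r : Fin K.bundles) : K.base H r ≤ 36 * (K.An + 1) * (1 / 2) ^ (r : ℕ) := by
  have h := K.pow_mul_base_le H r
  rw [one_div, inv_pow, ← div_eq_mul_inv, le_div_iff₀ (by positivity)]
  linarith

theorem nTok_le (hU : K.TokOK w U) (ω : K.Bit → Bool) (H : K.Tok) :
    K.nTok w U ω H ≤ ∑ r, K.gbit ω (K.grp H) r * (K.hbit ω H r * (K.liv U H * K.base H r)
      + K.hbit ω H r * (K.liv U H * min (K.exc w U ω H r) K.maxLoad)) := by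
  by_cases h : H ∈ Finset.univ.biUnion U
  · refine Finset.sum_le_sum fun r _ => (K.tload_le hU ω H r).trans (le_of_eq ?_)
    unfold liv; rw [if_pos h]; ring
  · rw [K.nTok_eq_zero h]
    unfold liv; rw [if_neg h]; simp

theorem xval_nTok_le (hU : K.TokOK w U) (ω : K.Bit → Bool) (G : K.GTok) :
    K.xval (K.nTok w U ω) G ≤ ∑ r,
      (K.gbit ω G r * K.xval (fun H => K.hbit ω H r * (K.liv U H * K.base H r)) G
      + K.gbit ω G r *
        K.xval (fun H => K.hbit ω H r * (K.liv U H * min (K.exc w U ω H r) K.maxLoad)) G) := by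
  refine (K.xval_mono (fun H _ => K.nTok_nonneg w U ω H)
    (x' := fun H => ∑ r, K.gbit ω G r * (K.hbit ω H r * (K.liv U H * K.base H r)
      + K.hbit ω H r * (K.liv U H * min (K.exc w U ω H r) K.maxLoad)))
    fun H hH => (K.nTok_le hU ω H).trans (by rw [hH])).trans ?_
  refine (K.xval_sum_le _ _ _).trans (Finset.sum_le_sum fun r _ => ?_)
  rw [K.xval_mul (c := K.gbit ω G r) (bit_nonneg _), ← mul_add]
  exact mul_le_mul_of_nonneg_left (K.xval_add_le _ _ _) (bit_nonneg _)

end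

end Core

theorem sum_fin_half_le (R a : ℕ) :
    ∑ r : Fin R, (if a ≤ (r : ℕ) then (1 / 2 : ℝ) ^ (r : ℕ) else 0) ≤ 2 * (1 / 2) ^ a := by
  rw [Fin.sum_univ_eq_sum_range (fun r => if a ≤ r then (1 / 2 : ℝ) ^ r else 0) R,
    ← Finset.sum_filter]
  refine le_trans (le_of_eq (Finset.sum_congr ?_ fun _ _ => rfl)) (sum_half_pow_Ico_le a R)
  ext k; simp [and_comm]

theorem sum_fin_half_le_two (R : ℕ) : ∑ r : Fin R, (1 / 2 : ℝ) ^ (r : ℕ) ≤ 2 := by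
  simpa using sum_fin_half_le R 0

theorem sum_fin_pow_two_filter_le (R : ℕ) {m : ℕ} (hm : m ≠ 0) :
    ∑ r : Fin R, (if 2 ^ (r : ℕ) ≤ m then (2 : ℝ) ^ (r : ℕ) else 0) ≤ 2 * m := by
  have h := sum_fin_pow_two_le R (Nat.log 2 m)
  have e : ∀ r : Fin R, 2 ^ (r : ℕ) ≤ m ↔ (r : ℕ) ≤ Nat.log 2 m := fun r =>
    (Nat.le_log_iff_pow_le (by norm_num) hm).symm
  simp only [e]
  refine h.trans ?_
  have : ((2 ^ Nat.log 2 m : ℕ) : ℝ) ≤ m := by exact_mod_cast Nat.pow_log_le_self 2 hm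
  push_cast at this
  linarith

theorem pow_two_mul_decay_le (r : ℕ) :
    (2 : ℝ) ^ r * (1 / 512) ^ (2 ^ r - 1) ≤ (1 / 2) ^ r * (1 / 128) ^ (2 ^ r - 1) := by
  have hr : r ≤ 2 ^ r - 1 := by have := @Nat.lt_two_pow_self r; omega
  set k := 2 ^ r - 1
  calc (2 : ℝ) ^ r * (1 / 512) ^ k ≤ 2 ^ k * (1 / 512) ^ k := by gcongr; norm_num
    _ = (1 / 2) ^ k * (1 / 128) ^ k := by rw [← mul_pow, ← mul_pow]; norm_num
    _ ≤ (1 / 2) ^ r * (1 / 128) ^ k := by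
        gcongr ?_ * _
        exact pow_le_pow_of_le_one (by norm_num) (by norm_num) hr

theorem pow_two_mul_decay_le_half (r : ℕ) :
    (2 : ℝ) ^ r * (1 / 512) ^ (2 ^ r - 1) ≤ (1 / 2) ^ r := by
  refine (pow_two_mul_decay_le r).trans ?_
  exact mul_le_of_le_one_right (by positivity) (pow_le_one₀ (by norm_num) (by norm_num))

namespace Core

variable {ι : Type} [Fintype ι] [DecidableEq ι] {σ : ι → Type} [∀ ℓ, Fintype (σ ℓ)]
  [∀ ℓ, DecidableEq (σ ℓ)] {n : ℕ} (K : Core ι σ n) [Nonempty ι] [∀ ℓ, Nonempty (σ ℓ)] [NeZero n]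

theorem half_pow_le_vhat (G : K.GTok) : (1 / 2 : ℝ) ^ K.a ≤ K.vhat G := by
  refine le_min (pow_le_one₀ (by norm_num) (by norm_num)) ?_
  unfold vbar
  rw [one_div, inv_pow, ← one_div]
  exact div_le_div_of_nonneg_right (one_le_pow₀ (by norm_num)) (by positivity)

/-- For `r < a` the factor `2 ^ (-r)` cancels the growth of the rate and each bundle costs `64 *
vhat`. From `r = a` on, probabilities are bounded by one, and the geometric tail is at most `2 * 2 ^
(-a) ≤ 2 * vhat`. -/
theorem sum_pG_half_le (G : K.GTok) :
    ∑ r : Fin K.bundles, K.pG G r * (1 / 2) ^ (r : ℕ) ≤ 66 * (K.Am + 1) * K.vhat G := by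
  have h1 : ∀ r : Fin K.bundles, K.pG G r * (1 / 2) ^ (r : ℕ) ≤
      (if (r : ℕ) < K.a then 64 * K.vhat G else 0)
      + if K.a ≤ (r : ℕ) then (1 / 2 : ℝ) ^ (r : ℕ) else 0 := by
    intro r
    have hv := K.vhat_pos G
    rcases lt_or_ge (r : ℕ) K.a with h | h
    · rw [if_pos h, if_neg (by omega), add_zero]
      calc _ ≤ 64 * 2 ^ (r : ℕ) * K.vhat G * (1 / 2) ^ (r : ℕ) :=
            mul_le_mul_of_nonneg_right (K.pG_le G r) (by positivity)
        _ = 64 * K.vhat G * (2 * (1 / 2)) ^ (r : ℕ) := by rw [mul_pow]; ring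
        _ = _ := by norm_num
    · rw [if_neg (by omega), if_pos h, zero_add]
      exact mul_le_of_le_one_left (by positivity) (K.pG_le_one G r)
  refine (Finset.sum_le_sum fun r _ => h1 r).trans ?_
  rw [Finset.sum_add_distrib]
  have h2 := sum_fin_half_le K.bundles K.a
  have h3 := K.half_pow_le_vhat G
  have hv := K.vhat_pos G
  have h4 : ∑ r : Fin K.bundles, (if (r : ℕ) < K.a then 64 * K.vhat G else 0)
      ≤ K.a * (64 * K.vhat G) := by
    rw [← Finset.sum_filter, Finset.sum_const, nsmul_eq_mul]
    refine mul_le_mul_of_nonneg_right ?_ (by positivity)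
    have : (Finset.univ.filter fun r : Fin K.bundles => (r : ℕ) < K.a).card
        ≤ (Finset.range K.a).card :=
      Finset.card_le_card_of_injOn (fun r => (r : ℕ)) (fun r hr => by simpa using hr)
        fun r _ r' _ h => Fin.ext h
    rw [Finset.card_range] at this
    exact_mod_cast this
  have h5 : (K.a : ℝ) ≤ K.Am := by exact_mod_cast K.a_le
  nlinarith

theorem rho_le (H : K.Tok) : K.rho H ≤ 2 ^ K.Am * (K.mwu.c H.1 * K.rho H) := by
  have h := K.c_ge H.1
  have h2 := (K.rho_pos H).le
  calc K.rho H = 2 ^ K.Am * ((1 / 2) ^ K.Am * K.rho H) := by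
        rw [← mul_assoc, ← mul_pow]; norm_num
    _ ≤ _ := by gcongr

variable {w : Fin n → (Σ ℓ, σ ℓ) → ℝ≥0∞} {U : Fin n → Finset K.Tok}

theorem sum_liv (F : K.Tok → ℝ) (G : K.GTok) :
    ∑ H with K.grp H = G, F H * K.liv U H
      = ∑ H ∈ Finset.univ.biUnion U with K.grp H = G, F H := by
  unfold liv
  simp only [mul_ite, mul_one, mul_zero]
  rw [← Finset.sum_filter]
  refine Finset.sum_congr ?_ fun _ _ => rfl
  ext H
  simp only [Finset.mem_filter, Finset.mem_univ, true_and]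
  tauto

theorem sum_rho_liv_le (hU : K.TokOK w U) (G : K.GTok) :
    ∑ H with K.grp H = G, K.mwu.c H.1 * K.rho H * K.liv U H ≤ 4 * K.mwu.B := by
  rw [K.sum_liv (fun H => K.mwu.c H.1 * K.rho H)]
  exact hU.sum_rho G

theorem crho_nonneg (H : K.Tok) : 0 ≤ K.mwu.c H.1 * K.rho H :=
  mul_nonneg (K.c_nonneg _) (K.rho_pos _).le

theorem B_nonneg : 0 ≤ K.mwu.B := by
  show 0 ≤ 960 * ((K.Am : ℝ) + 1) ^ 2
  positivity

/-- Base loads decay like `2 ^ (-r)`, which makes the maximum term summable by `sum_pG_half_le`. In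
the linear term the rates `2 ^ r` meet the base loads, and `sum_base_le` applies. -/
theorem bernE_xval_base_le (hU : K.TokOK w U) (G : K.GTok) :
    ∑ r, bernE K.prb (fun ω => K.gbit ω G r *
      K.xval (fun H => K.hbit ω H r * (K.liv U H * K.base H r)) G)
      ≤ 10 ^ 9 * (((K.Am : ℝ) + 1) ^ 2 * (K.An + 1) * K.vhat G) := by
  set m : ℝ := (K.Am : ℝ) + 1 with hm
  set N : ℝ := (K.An : ℝ) + 1 with hN
  have hN0 : 0 ≤ N := by positivity
  have hv := (K.vhat_pos G).le
  have h1 : ∀ r : Fin K.bundles, bernE K.prb (fun ω => K.gbit ω G r *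
      K.xval (fun H => K.hbit ω H r * (K.liv U H * K.base H r)) G)
      ≤ 44 * m * (36 * N) * (K.pG G r * (1 / 2) ^ (r : ℕ)) + 1536 * K.vhat G *
        ∑ H with K.grp H = G, K.mwu.c H.1 * K.rho H * K.liv U H * (2 ^ (r : ℕ) * K.base H r) := by
    intro r
    have h2 := K.bernE_gbit_xval_le r G (x := fun _ H => K.liv U H * K.base H r)
      (D := 36 * N * (1 / 2) ^ (r : ℕ)) (by positivity)
      (fun _ H => mul_nonneg (K.liv_nonneg H) (K.base_nonneg H r))
      (fun _ H => (mul_le_of_le_one_left (K.base_nonneg H r) (K.liv_le_one H)).trans (K.base_le H r))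
      fun H x y _ => rfl
    simp only [bernE_const] at h2
    refine h2.trans (add_le_add ?_ (le_of_eq ?_))
    · have h3 := K.pG_nonneg G r
      have h4 : 24 * (K.Am : ℝ) + 44 ≤ 44 * m := by
        rw [hm]; have : (0 : ℝ) ≤ K.Am := Nat.cast_nonneg _; linarith
      calc _ ≤ K.pG G r * (44 * m * (36 * N * (1 / 2) ^ (r : ℕ))) := by gcongr
        _ = _ := by ring
    · unfold rate
      rw [Finset.mul_sum, Finset.mul_sum]
      exact Finset.sum_congr rfl fun H _ => by ring
  refine (Finset.sum_le_sum fun r _ => h1 r).trans ?_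
  rw [Finset.sum_add_distrib, ← Finset.mul_sum, ← Finset.mul_sum, Finset.sum_comm]
  simp only [← Finset.mul_sum]
  have h5 := K.sum_pG_half_le G
  have h6 : ∑ H with K.grp H = G, K.mwu.c H.1 * K.rho H * K.liv U H *
      ∑ r : Fin K.bundles, 2 ^ (r : ℕ) * K.base H r ≤ 4 * (960 * m ^ 2) * (36 * N) := by
    refine le_trans (Finset.sum_le_sum fun H _ => mul_le_mul_of_nonneg_left (K.sum_base_le H)
      (mul_nonneg (K.crho_nonneg H) (K.liv_nonneg H))) ?_
    rw [← Finset.sum_mul]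
    exact mul_le_mul_of_nonneg_right (K.sum_rho_liv_le hU G) (by positivity)
  calc _ ≤ 44 * m * (36 * N) * (66 * m * K.vhat G) + 1536 * K.vhat G *
        (4 * (960 * m ^ 2) * (36 * N)) := by gcongr
    _ = 212441184 * (m ^ 2 * N * K.vhat G) := by ring
    _ ≤ _ := by gcongr; norm_num

theorem bernE_min_exc_le (hU : K.TokOK w U) (H : K.Tok) (r : Fin K.bundles) :
    bernE K.prb (fun ω => K.liv U H * min (K.exc w U ω H r) K.maxLoad) ≤
      K.liv U H * (240 * (K.An + 1) * (1 / 512) ^ (2 ^ (r : ℕ) - 1)) := by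
  rw [bernE_const_mul]
  refine mul_le_mul_of_nonneg_left ?_ (K.liv_nonneg H)
  exact (bernE_mono K.prb_mem fun ω => min_le_left _ _).trans (K.bernE_exc_le hU H r)

theorem min_exc_dependsOn (H : K.Tok) (r : Fin K.bundles) :
    DependsOn (fun ω => K.liv U H * min (K.exc w U ω H r) K.maxLoad) (K.before r) := by
  intro x y h
  have := K.exc_dependsOn (w := w) (U := U) H r h
  simp only at this ⊢
  rw [this]

theorem min_exc_nonneg (ω : K.Bit → Bool) (H : K.Tok) (r : Fin K.bundles) :
    0 ≤ K.liv U H * min (K.exc w U ω H r) K.maxLoad :=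
  mul_nonneg (K.liv_nonneg H) (le_min (K.exc_nonneg w U ω H r) K.maxLoad_nonneg)

/-- While `2 ^ r ≤ Am + 1`, the uniform bound `maxLoad` suffices, as these rates sum to `O(Am + 1)`.
Afterwards the factor `(1 / 128) ^ (2 ^ r - 1)` outweighs the loss `2 ^ Am` of the crude bound. -/
theorem bernE_xval_exc_le (hU : K.TokOK w U) (G : K.GTok) :
    ∑ r, bernE K.prb (fun ω => K.gbit ω G r *
      K.xval (fun H => K.hbit ω H r * (K.liv U H * min (K.exc w U ω H r) K.maxLoad)) G)
      ≤ 3 * 10 ^ 9 * (((K.Am : ℝ) + 1) ^ 2 * (K.An + 1) * K.vhat G) := by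
  set m : ℝ := (K.Am : ℝ) + 1 with hm
  set N : ℝ := (K.An : ℝ) + 1 with hN
  have hN0 : 0 ≤ N := by positivity
  have hv := (K.vhat_pos G).le
  have hB : K.mwu.B = 960 * m ^ 2 := rfl
  have h1 : ∀ r : Fin K.bundles, bernE K.prb (fun ω => K.gbit ω G r *
      K.xval (fun H => K.hbit ω H r * (K.liv U H * min (K.exc w U ω H r) K.maxLoad)) G)
      ≤ 64 * K.vhat G * (44 * m * (243 * N)) *
        (if 2 ^ (r : ℕ) ≤ K.Am + 1 then (2 : ℝ) ^ (r : ℕ) else 0)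
        + 1536 * K.vhat G * (4 * (960 * m ^ 2)) * (240 * N) * (1 / 2) ^ (r : ℕ) := by
    intro r
    set q : ℝ := (1 / 512) ^ (2 ^ (r : ℕ) - 1) with hq
    by_cases hr : 2 ^ (r : ℕ) ≤ K.Am + 1
    · rw [if_pos hr]
      have h2 := K.bernE_gbit_xval_le r G
        (x := fun ω H => K.liv U H * min (K.exc w U ω H r) K.maxLoad)
        (D := K.maxLoad) K.maxLoad_nonneg (fun ω H => K.min_exc_nonneg ω H r)
        (fun ω H => (mul_le_of_le_one_left (le_min (K.exc_nonneg w U ω H r) K.maxLoad_nonneg)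
          (K.liv_le_one H)).trans (min_le_right _ _)) fun H => K.min_exc_dependsOn H r
      refine h2.trans (add_le_add ?_ ?_)
      · have h3 := K.pG_le G r
        have h4 : 24 * (K.Am : ℝ) + 44 ≤ 44 * m := by
          rw [hm]; have : (0 : ℝ) ≤ K.Am := Nat.cast_nonneg _; linarith
        have h5 : K.maxLoad = 243 * N := rfl
        rw [h5]
        unfold rate at h3
        calc _ ≤ 64 * 2 ^ (r : ℕ) * K.vhat G * (44 * m * (243 * N)) := by gcongr
          _ = _ := by ring
      · have h3 : ∑ H with K.grp H = G, K.mwu.c H.1 * K.rho H *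
            bernE K.prb (fun ω => K.liv U H * min (K.exc w U ω H r) K.maxLoad)
            ≤ 4 * (960 * m ^ 2) * (240 * N * q) := by
          calc _ ≤ ∑ H with K.grp H = G, K.mwu.c H.1 * K.rho H * K.liv U H * (240 * N * q) := by
                refine Finset.sum_le_sum fun H _ => ?_
                rw [mul_assoc (K.mwu.c H.1 * K.rho H)]
                exact mul_le_mul_of_nonneg_left (K.bernE_min_exc_le hU H r) (K.crho_nonneg H)
            _ ≤ _ := by
                rw [← Finset.sum_mul, ← hB]
                exact mul_le_mul_of_nonneg_right (K.sum_rho_liv_le hU G) (by positivity)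
        have h4 := pow_two_mul_decay_le_half r
        rw [← hq] at h4
        have h6 : 0 ≤ rate r * K.vhat G := mul_nonneg (rate_pos _).le hv
        calc _ ≤ 24 * (rate r * K.vhat G) * (4 * (960 * m ^ 2) * (240 * N * q)) := by gcongr
          _ = 1536 * K.vhat G * (4 * (960 * m ^ 2)) * (240 * N) * (2 ^ (r : ℕ) * q) := by
              unfold rate; ring
          _ ≤ _ := by gcongr
    · rw [if_neg hr, mul_zero, zero_add]
      have h2 := K.bernE_gbit_xval_le_sum r G
        (x := fun ω H => K.liv U H * min (K.exc w U ω H r) K.maxLoad)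
        (fun ω H => K.min_exc_nonneg ω H r) fun H => K.min_exc_dependsOn H r
      refine h2.trans ?_
      have h3 : ∑ H with K.grp H = G, K.rho H *
            bernE K.prb (fun ω => K.liv U H * min (K.exc w U ω H r) K.maxLoad)
            ≤ 2 ^ K.Am * (4 * (960 * m ^ 2)) * (240 * N * q) := by
        calc _ ≤ ∑ H with K.grp H = G, 2 ^ K.Am *
              (K.mwu.c H.1 * K.rho H * K.liv U H) * (240 * N * q) := by
              refine Finset.sum_le_sum fun H _ => ?_
              have h4 := K.bernE_min_exc_le hU H r
              have h5 := K.rho_le H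
              have h6 : 0 ≤ bernE K.prb
                  (fun ω => K.liv U H * min (K.exc w U ω H r) K.maxLoad) :=
                bernE_nonneg K.prb_mem fun ω => K.min_exc_nonneg ω H r
              have h7 := K.crho_nonneg H
              calc _ ≤ 2 ^ K.Am * (K.mwu.c H.1 * K.rho H) * (K.liv U H * (240 * N * q)) :=
                    mul_le_mul h5 h4 h6 (by positivity)
                _ = _ := by ring
          _ ≤ _ := by
              rw [← Finset.sum_mul, ← Finset.mul_sum, ← hB]
              have := K.sum_rho_liv_le hU G
              gcongr
      have h4 := pow_two_mul_decay_le r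
      rw [← hq] at h4
      have h5 : (1 / 128 : ℝ) ^ (2 ^ (r : ℕ) - 1) * 2 ^ K.Am ≤ 1 := by
        calc (1 / 128 : ℝ) ^ (2 ^ (r : ℕ) - 1) * 2 ^ K.Am ≤ (1 / 2) ^ K.Am * 2 ^ K.Am := by
              gcongr ?_ * _
              calc (1 / 128 : ℝ) ^ (2 ^ (r : ℕ) - 1) ≤ (1 / 2) ^ (2 ^ (r : ℕ) - 1) :=
                    pow_le_pow_left₀ (by norm_num) (by norm_num) _
                _ ≤ _ := pow_le_pow_of_le_one (by norm_num) (by norm_num) (by omega)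
          _ = 1 := by rw [← mul_pow]; norm_num
      have h6 : 0 ≤ rate r * K.vhat G := mul_nonneg (rate_pos _).le hv
      calc _ ≤ rate r * K.vhat G * (2 ^ K.Am * (4 * (960 * m ^ 2)) * (240 * N * q)) := by gcongr
        _ = 64 * K.vhat G * (4 * (960 * m ^ 2)) * (240 * N) * 2 ^ K.Am * (2 ^ (r : ℕ) * q) := by
            unfold rate; ring
        _ ≤ 64 * K.vhat G * (4 * (960 * m ^ 2)) * (240 * N) * 2 ^ K.Am *
            ((1 / 2) ^ (r : ℕ) * (1 / 128) ^ (2 ^ (r : ℕ) - 1)) := by gcongr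
        _ = 64 * K.vhat G * (4 * (960 * m ^ 2)) * (240 * N) * (1 / 2) ^ (r : ℕ) *
            ((1 / 128) ^ (2 ^ (r : ℕ) - 1) * 2 ^ K.Am) := by ring
        _ ≤ 64 * K.vhat G * (4 * (960 * m ^ 2)) * (240 * N) * (1 / 2) ^ (r : ℕ) * 1 := by gcongr
        _ ≤ _ := by rw [mul_one]; gcongr; norm_num
  refine (Finset.sum_le_sum fun r _ => h1 r).trans ?_
  rw [Finset.sum_add_distrib, ← Finset.mul_sum, ← Finset.mul_sum]
  have h2 := sum_fin_pow_two_filter_le K.bundles (Nat.succ_ne_zero K.Am)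
  have h3 := sum_fin_half_le_two K.bundles
  have h4 : ((K.Am.succ : ℕ) : ℝ) = m := by rw [hm]; push_cast; rfl
  rw [h4] at h2
  calc _ ≤ 64 * K.vhat G * (44 * m * (243 * N)) * (2 * m)
        + 1536 * K.vhat G * (4 * (960 * m ^ 2)) * (240 * N) * 2 := by gcongr
    _ = 2832523776 * (m ^ 2 * N * K.vhat G) := by ring
    _ ≤ _ := by gcongr; norm_num

/-- Expected value of a group token. -/
theorem bernE_xval_nTok_le (hU : K.TokOK w U) (G : K.GTok) :
    bernE K.prb (fun ω => K.xval (K.nTok w U ω) G)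
      ≤ 4 * 10 ^ 9 * (((K.Am : ℝ) + 1) ^ 2 * (K.An + 1) * K.vhat G) := by
  refine (bernE_mono K.prb_mem fun ω => K.xval_nTok_le hU ω G).trans ?_
  rw [bernE_sum]
  simp only [bernE_add]
  rw [Finset.sum_add_distrib]
  have h1 := K.bernE_xval_base_le hU G
  have h2 := K.bernE_xval_exc_le hU G
  linarith

theorem xval_nTok_eq_zero {G : K.GTok} (hG : G ∉ (Finset.univ.biUnion U).image K.grp)
    (ω : K.Bit → Bool) : K.xval (K.nTok w U ω) G = 0 := by
  refine le_antisymm ((K.xval_le_sum fun H _ => K.nTok_nonneg w U ω H).trans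
    (Finset.sum_nonpos fun H hH => ?_)) (K.xval_nonneg _ _)
  rw [K.nTok_eq_zero fun h => hG (Finset.mem_image.mpr ⟨H, h, (Finset.mem_filter.mp hH).2⟩)]

end Core

/-! ### Concentration of the values of groups -/

theorem exp_neg_le_half_pow {x : ℝ} {k : ℕ} (h : (k : ℝ) ≤ x) : Real.exp (-x) ≤ (1 / 2) ^ k := by
  have h1 : Real.exp (-1) ≤ 1 / 2 := by
    rw [Real.exp_neg, ← one_div]
    exact one_div_le_one_div_of_le (by norm_num) (by linarith [Real.add_one_le_exp (1 : ℝ)])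
  calc Real.exp (-x) ≤ Real.exp (-k) := Real.exp_le_exp.mpr (by linarith)
    _ = Real.exp (-1) ^ k := by rw [← Real.exp_nat_mul]; congr 1; ring
    _ ≤ _ := by gcongr

theorem succ_le_two_pow (a : ℕ) : (a : ℝ) + 1 ≤ 2 ^ a := by
  exact_mod_cast Nat.lt_two_pow_self

namespace Core

variable {ι : Type} [Fintype ι] [DecidableEq ι] {σ : ι → Type} [∀ ℓ, Fintype (σ ℓ)]
  [∀ ℓ, DecidableEq (σ ℓ)] {n : ℕ} (K : Core ι σ n) [Nonempty ι] [∀ ℓ, Nonempty (σ ℓ)] [NeZero n]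
  {w : Fin n → (Σ ℓ, σ ℓ) → ℝ≥0∞} {U : Fin n → Finset K.Tok}

theorem sum_lump (Λ : Finset K.GTok) (F : K.Tok → ℝ) :
    ∑ H with K.grp H ∈ Λ, F H = ∑ G ∈ Λ, ∑ H with K.grp H = G, F H := by
  simp only [Finset.sum_filter]
  rw [Finset.sum_comm]
  refine Finset.sum_congr rfl fun H _ => ?_
  rw [Finset.sum_ite_eq]

theorem sum_rho_lump_le (hU : K.TokOK w U) {Λ : Finset K.GTok} (hΛ : Λ.card ≤ K.a + 1) :
    ∑ H with K.grp H ∈ Λ, K.mwu.c H.1 * K.rho H * K.liv U H ≤ ((K.a : ℝ) + 1) * (4 * K.mwu.B) := by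
  rw [K.sum_lump]
  calc _ ≤ ∑ _G ∈ Λ, 4 * K.mwu.B := Finset.sum_le_sum fun G _ => K.sum_rho_liv_le hU G
    _ = Λ.card * (4 * K.mwu.B) := by rw [Finset.sum_const, nsmul_eq_mul]
    _ ≤ _ := by
      have : (Λ.card : ℝ) ≤ K.a + 1 := by exact_mod_cast hΛ
      have := K.B_nonneg
      gcongr

theorem pH_le_rate (H : K.Tok) (r : ℕ) : K.pH H r ≤ rate r * K.rho H :=
  (K.pH_le H r).trans (mul_le_mul_of_nonneg_right (K.mu_le_rate _ _) (K.rho_pos H).le)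

theorem B_ge : 960 * ((K.a : ℝ) + 1) ≤ K.mwu.B := by
  show _ ≤ 960 * ((K.Am : ℝ) + 1) ^ 2
  have h : (K.a : ℝ) ≤ K.Am := by exact_mod_cast K.a_le
  have h0 : (0 : ℝ) ≤ K.a := Nat.cast_nonneg _
  nlinarith

/-- Base part of the weight of a set of group tokens. -/
noncomputable def baseWeight (U : Fin n → Finset K.Tok) (Λ : Finset K.GTok) (ω : K.Bit → Bool) : ℝ :=
  ∑ H with K.grp H ∈ Λ, ∑ r : Fin K.bundles, K.hbit ω H r * (K.mwu.c H.1 * K.liv U H * K.base H r)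

/-- Divided by `36 * (An + 1)`, the weights of the bits lie in `[0, 1]`. The mean is at most `64 *
(a + 1) * 4 * B` because `sum_base_le` absorbs the rates. -/
theorem bernE_baseWeight_le (hU : K.TokOK w U) {Λ : Finset K.GTok} (hΛ : Λ.card ≤ K.a + 1) :
    bernE K.prb (fun ω => max 0 (K.baseWeight U Λ ω / (36 * (K.An + 1))
      - 4 * (256 * (K.a + 1) * K.mwu.B))) ≤ (1 / 2) ^ K.a := by
  set N : ℝ := (K.An : ℝ) + 1 with hN
  have hN0 : 0 < N := by positivity
  let c : K.Bit → ℝ := Sum.elim (fun _ => 0) fun x =>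
    if K.grp x.1 ∈ Λ then K.mwu.c x.1.1 * K.liv U x.1 * K.base x.1 x.2 / (36 * N) else 0
  have hc : ∀ i, 0 ≤ c i ∧ c i ≤ 1 := by
    rintro (x | ⟨H, r⟩)
    · exact ⟨le_rfl, zero_le_one⟩
    · simp only [c, Sum.elim_inr]
      have h1 := K.c_nonneg H.1
      have h2 := K.liv_nonneg (U := U) H
      have h3 := K.base_nonneg H r
      split_ifs
      · refine ⟨by positivity, (div_le_one (by positivity)).mpr ?_⟩
        have h4 := K.c_le_one H.1
        have h5 := K.liv_le_one (U := U) H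
        have h6 : K.base H r ≤ 36 * N := by
          refine (K.base_le H r).trans ?_
          exact mul_le_of_le_one_right (by positivity) (pow_le_one₀ (by norm_num) (by norm_num))
        calc _ ≤ 1 * 1 * (36 * N) := by gcongr
          _ = _ := by ring
      · exact ⟨le_rfl, zero_le_one⟩
  have hsum : ∀ q : K.Bit → ℝ, ∑ i, q i * c i = (∑ H with K.grp H ∈ Λ, ∑ r : Fin K.bundles,
      q (Sum.inr (H, r)) * (K.mwu.c H.1 * K.liv U H * K.base H r)) / (36 * N) := by
    intro q
    rw [Fintype.sum_sum_type, Fintype.sum_prod_type (γ := ℝ) (f := fun x => q (Sum.inr x) * c (Sum.inr x)),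
      Finset.sum_div, Finset.sum_filter]
    have e0 : ∑ x, q (Sum.inl x) * c (Sum.inl x) = 0 :=
      Finset.sum_eq_zero fun x _ => mul_zero _
    rw [e0, zero_add]
    refine Finset.sum_congr rfl fun H _ => ?_
    split_ifs with h
    · rw [Finset.sum_div]
      refine Finset.sum_congr rfl fun r _ => ?_
      show _ * (if _ then _ else _) = _
      rw [if_pos h]; ring
    · refine Finset.sum_eq_zero fun r _ => ?_
      show _ * (if _ then _ else _) = _
      rw [if_neg h, mul_zero]
  have hM : ∑ i, K.prb i * c i ≤ 256 * (K.a + 1) * K.mwu.B := by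
    rw [hsum, div_le_iff₀ (by positivity)]
    calc _ ≤ ∑ H with K.grp H ∈ Λ, 64 * (K.mwu.c H.1 * K.rho H * K.liv U H) * (36 * N) := by
          refine Finset.sum_le_sum fun H _ => ?_
          have h1 := K.crho_nonneg H
          have h2 := K.liv_nonneg (U := U) H
          refine le_trans ?_ (mul_le_mul_of_nonneg_left (K.sum_base_le H) (by positivity))
          rw [Finset.mul_sum]
          refine Finset.sum_le_sum fun r _ => ?_
          have h3 := K.pH_le_rate H r
          have h4 := K.c_nonneg H.1
          have h5 := K.base_nonneg H r
          calc _ ≤ rate r * K.rho H * (K.mwu.c H.1 * K.liv U H * K.base H r) :=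
                mul_le_mul_of_nonneg_right h3 (by positivity)
            _ = _ := by unfold rate; ring
      _ = 64 * (∑ H with K.grp H ∈ Λ, K.mwu.c H.1 * K.rho H * K.liv U H) * (36 * N) := by
          rw [← Finset.sum_mul, ← Finset.mul_sum]
      _ ≤ 64 * (((K.a : ℝ) + 1) * (4 * K.mwu.B)) * (36 * N) := by
          have := K.sum_rho_lump_le hU hΛ
          gcongr
      _ = _ := by ring
  have h := bernE_excess_le K.prb_mem c hc hM
  have e : (fun ω : K.Bit → Bool => max 0 (∑ i, bit (ω i) * c i - 4 * (256 * (K.a + 1) * K.mwu.B)))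
      = fun ω => max 0 (K.baseWeight U Λ ω / (36 * N) - 4 * (256 * (K.a + 1) * K.mwu.B)) := by
    funext ω
    rw [hsum (fun i => bit (ω i))]
    rfl
  rw [e] at h
  refine h.trans (exp_neg_le_half_pow ?_)
  have h1 := K.B_ge
  have h0 : (0 : ℝ) ≤ K.a := Nat.cast_nonneg _
  nlinarith

/-- Weight of the open slot tokens of a group token in a bundle. -/
noncomputable def slotWeight (U : Fin n → Finset K.Tok) (G : K.GTok) (r : Fin K.bundles)
    (ω : K.Bit → Bool) : ℝ :=
  ∑ H with K.grp H = G, K.hbit ω H r * (K.mwu.c H.1 * K.liv U H)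

/-- The exponent `3 * a` leaves room for a union over the group tokens of a band and the early
bundles. -/
theorem bernE_slotWeight_le (hU : K.TokOK w U) (G : K.GTok) (r : Fin K.bundles) :
    bernE K.prb (fun ω => max 0 (K.slotWeight U G r ω - 4 * (K.mu G r * (4 * K.mwu.B))))
      ≤ (1 / 2) ^ (3 * K.a) := by
  let c : K.Bit → ℝ := Sum.elim (fun _ => 0) fun x =>
    if x.2 = r then if K.grp x.1 = G then K.mwu.c x.1.1 * K.liv U x.1 else 0 else 0
  have hc : ∀ i, 0 ≤ c i ∧ c i ≤ 1 := by
    rintro (x | ⟨H, r'⟩)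
    · exact ⟨le_rfl, zero_le_one⟩
    · simp only [c, Sum.elim_inr]
      have h1 := K.c_nonneg H.1
      have h2 := K.liv_nonneg (U := U) H
      split_ifs
      · exact ⟨by positivity, mul_le_one₀ (K.c_le_one _) h2 (K.liv_le_one _)⟩
      · exact ⟨le_rfl, zero_le_one⟩
      · exact ⟨le_rfl, zero_le_one⟩
  have hsum : ∀ q : K.Bit → ℝ, ∑ i, q i * c i = ∑ H with K.grp H = G,
      q (Sum.inr (H, r)) * (K.mwu.c H.1 * K.liv U H) := by
    intro q
    rw [Fintype.sum_sum_type, Fintype.sum_prod_type (γ := ℝ) (f := fun x => q (Sum.inr x) * c (Sum.inr x)),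
      Finset.sum_filter]
    have e0 : ∑ x, q (Sum.inl x) * c (Sum.inl x) = 0 :=
      Finset.sum_eq_zero fun x _ => mul_zero _
    rw [e0, zero_add]
    refine Finset.sum_congr rfl fun H _ => ?_
    rw [Finset.sum_eq_single r]
    · show _ * (if _ then if _ then _ else _ else _) = _
      rw [if_pos rfl]
      split_ifs <;> simp
    · intro r' _ hr
      show _ * (if _ then if _ then _ else _ else _) = _
      rw [if_neg hr, mul_zero]
    · exact fun h => absurd (Finset.mem_univ _) h
  have hmu := K.one_le_mu G r
  have hB := K.B_ge
  have hM : ∑ i, K.prb i * c i ≤ K.mu G r * (4 * K.mwu.B) := by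
    rw [hsum]
    calc _ ≤ ∑ H with K.grp H = G, K.mu G r * (K.mwu.c H.1 * K.rho H * K.liv U H) := by
          refine Finset.sum_le_sum fun H hH => ?_
          have h1 := K.pH_le H r
          rw [(Finset.mem_filter.mp hH).2] at h1
          have h2 := K.liv_nonneg (U := U) H
          have h4 := K.c_nonneg H.1
          calc _ ≤ K.mu G r * K.rho H * (K.mwu.c H.1 * K.liv U H) :=
                mul_le_mul_of_nonneg_right h1 (by positivity)
            _ = _ := by ring
      _ ≤ _ := by
          rw [← Finset.mul_sum]
          exact mul_le_mul_of_nonneg_left (K.sum_rho_liv_le hU G) (by linarith)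
  have h := bernE_excess_le K.prb_mem c hc hM
  have e : (fun ω : K.Bit → Bool => max 0 (∑ i, bit (ω i) * c i - 4 * (K.mu G r * (4 * K.mwu.B))))
      = fun ω => max 0 (K.slotWeight U G r ω - 4 * (K.mu G r * (4 * K.mwu.B))) := by
    funext ω
    rw [hsum (fun i => bit (ω i))]
    rfl
  rw [e] at h
  refine h.trans (exp_neg_le_half_pow ?_)
  have h0 : (0 : ℝ) ≤ K.a := Nat.cast_nonneg _
  push_cast
  nlinarith

/-- Number of open group tokens of a set in the early bundles. -/
noncomputable def openCount (Λ : Finset K.GTok) (ω : K.Bit → Bool) : ℝ :=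
  ∑ G ∈ Λ, ∑ r : Fin K.bundles, if 2 ^ (r : ℕ) ≤ K.a + 1 then K.gbit ω G r else 0

theorem sum_rate_vhat_le {Λ : Finset K.GTok} (hv : ∑ G ∈ Λ, K.vhat G ≤ 2) :
    ∑ G ∈ Λ, ∑ r : Fin K.bundles, (if 2 ^ (r : ℕ) ≤ K.a + 1 then rate r * K.vhat G else 0)
      ≤ 256 * ((K.a : ℝ) + 1) := by
  have h := sum_fin_pow_two_filter_le K.bundles (Nat.succ_ne_zero K.a)
  push_cast at h
  calc _ = ∑ G ∈ Λ, K.vhat G * (64 * ∑ r : Fin K.bundles,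
        if 2 ^ (r : ℕ) ≤ K.a.succ then (2 : ℝ) ^ (r : ℕ) else 0) := by
        refine Finset.sum_congr rfl fun G _ => ?_
        rw [Finset.mul_sum, Finset.mul_sum]
        refine Finset.sum_congr rfl fun r _ => ?_
        unfold rate
        split_ifs <;> ring
    _ ≤ 2 * (64 * (2 * ((K.a : ℝ) + 1))) := by
        rw [← Finset.sum_mul]
        refine mul_le_mul hv (by gcongr) ?_ (by norm_num)
        exact mul_nonneg (by norm_num) (Finset.sum_nonneg fun r _ => by split_ifs <;> positivity)
    _ = _ := by ring

theorem bernE_openCount_le {Λ : Finset K.GTok} (hv : ∑ G ∈ Λ, K.vhat G ≤ 2) :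
    bernE K.prb (fun ω => max 0 (K.openCount Λ ω - 4 * (256 * (K.a + 1)))) ≤ (1 / 2) ^ K.a := by
  let c : K.Bit → ℝ := Sum.elim (fun x => if x.1 ∈ Λ then if 2 ^ (x.2 : ℕ) ≤ K.a + 1 then 1 else 0
    else 0) fun _ => 0
  have hc : ∀ i, 0 ≤ c i ∧ c i ≤ 1 := by
    rintro (x | x)
    · simp only [c, Sum.elim_inl]
      split_ifs <;> norm_num
    · exact ⟨le_rfl, zero_le_one⟩
  have hsum : ∀ q : K.Bit → ℝ, ∑ i, q i * c i = ∑ G ∈ Λ, ∑ r : Fin K.bundles,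
      if 2 ^ (r : ℕ) ≤ K.a + 1 then q (Sum.inl (G, r)) else 0 := by
    intro q
    rw [Fintype.sum_sum_type, Fintype.sum_prod_type (γ := ℝ) (f := fun x => q (Sum.inl x) * c (Sum.inl x))]
    have e0 : ∑ x, q (Sum.inr x) * c (Sum.inr x) = 0 :=
      Finset.sum_eq_zero fun x _ => mul_zero _
    have e1 : ∀ G, ∑ r : Fin K.bundles, q (Sum.inl (G, r)) * c (Sum.inl (G, r))
        = if G ∈ Λ then ∑ r : Fin K.bundles, (if 2 ^ (r : ℕ) ≤ K.a + 1 then q (Sum.inl (G, r)) else 0)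
          else 0 := by
      intro G
      split_ifs with h
      · refine Finset.sum_congr rfl fun r _ => ?_
        show _ * (if _ then if _ then _ else _ else _) = _
        rw [if_pos h]
        split_ifs <;> simp
      · refine Finset.sum_eq_zero fun r _ => ?_
        show _ * (if _ then if _ then _ else _ else _) = _
        rw [if_neg h, mul_zero]
    rw [e0, add_zero, Finset.sum_congr rfl fun G _ => e1 G, Finset.sum_ite_mem, Finset.univ_inter]
  have hM : ∑ i, K.prb i * c i ≤ 256 * (K.a + 1) := by
    rw [hsum]
    refine le_trans (Finset.sum_le_sum fun G _ => Finset.sum_le_sum fun r _ => ?_)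
      (K.sum_rate_vhat_le hv)
    split_ifs
    · exact K.pG_le G r
    · exact le_rfl
  have h := bernE_excess_le K.prb_mem c hc hM
  have e : (fun ω : K.Bit → Bool => max 0 (∑ i, bit (ω i) * c i - 4 * (256 * (K.a + 1))))
      = fun ω => max 0 (K.openCount Λ ω - 4 * (256 * (K.a + 1))) := by
    funext ω
    rw [hsum (fun i => bit (ω i))]
    rfl
  rw [e] at h
  refine h.trans (exp_neg_le_half_pow ?_)
  have h0 : (0 : ℝ) ≤ K.a := Nat.cast_nonneg _
  nlinarith

/-- Excess part of the weight of a set of group tokens in the late bundles. -/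
noncomputable def lateWeight (w : Fin n → (Σ ℓ, σ ℓ) → ℝ≥0∞) (U : Fin n → Finset K.Tok)
    (Λ : Finset K.GTok) (ω : K.Bit → Bool) : ℝ :=
  ∑ H with K.grp H ∈ Λ, ∑ r : Fin K.bundles, if 2 ^ (r : ℕ) ≤ K.a + 1 then 0 else
    K.mwu.c H.1 * K.liv U H * (K.hbit ω H r * K.exc w U ω H r)

theorem bernE_hbit_mul_exc (H : K.Tok) (r : Fin K.bundles) :
    bernE K.prb (fun ω => K.hbit ω H r * K.exc w U ω H r)
      = K.pH H r * bernE K.prb fun ω => K.exc w U ω H r := by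
  rw [bernE_mul_of_dependsOn K.prb (A := {i | ∃ H, i = Sum.inr (H, r)}) (K.hbit_dependsOn H r)]
  · congr 1
    exact bernE_bit K.prb (Sum.inr (H, r))
  · intro x y h
    refine K.exc_dependsOn H r fun i hi => h i ?_
    rintro ⟨H, rfl⟩
    exact lt_irrefl _ (show (r : ℕ) < r from hi)

/-- No concentration is needed after the early bundles: the decay in `2 ^ r > a + 1` alone makes the
expectation of order `2 ^ (-a)`. -/
theorem bernE_lateWeight_le (hU : K.TokOK w U) {Λ : Finset K.GTok} (hΛ : Λ.card ≤ K.a + 1) :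
    bernE K.prb (K.lateWeight w U Λ) ≤ 122880 * (K.mwu.B * (K.An + 1)) * (1 / 2) ^ K.a := by
  set N : ℝ := (K.An : ℝ) + 1 with hN
  have hN0 : 0 < N := by positivity
  unfold lateWeight
  rw [bernE_sum]
  calc _ ≤ ∑ H with K.grp H ∈ Λ, ∑ r : Fin K.bundles, (K.mwu.c H.1 * K.rho H * K.liv U H) *
        (15360 * N * (1 / 128) ^ (K.a + 1) * (1 / 2) ^ (r : ℕ)) := by
        refine Finset.sum_le_sum fun H _ => ?_
        rw [bernE_sum]
        refine Finset.sum_le_sum fun r _ => ?_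
        have h0 := K.crho_nonneg H
        have h2 := K.liv_nonneg (U := U) H
        split_ifs with hr
        · rw [bernE_const]; positivity
        · rw [bernE_const_mul, K.bernE_hbit_mul_exc]
          have h1 := K.pH_le_rate H r
          have h3 := K.bernE_exc_le hU H r
          have h4 := pow_two_mul_decay_le r
          have h5 : (1 / 128 : ℝ) ^ (2 ^ (r : ℕ) - 1) ≤ (1 / 128) ^ (K.a + 1) :=
            pow_le_pow_of_le_one (by norm_num) (by norm_num) (by omega)
          have h6 : 0 ≤ bernE K.prb fun ω => K.exc w U ω H r :=
            bernE_nonneg K.prb_mem fun ω => K.exc_nonneg w U ω H r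
          have h7 := K.c_nonneg H.1
          have h8 := (K.rho_pos H).le
          have h9 := (rate_pos r).le
          calc _ ≤ K.mwu.c H.1 * K.liv U H * (rate r * K.rho H *
                (240 * N * (1 / 512) ^ (2 ^ (r : ℕ) - 1))) := by gcongr
            _ = (K.mwu.c H.1 * K.rho H * K.liv U H) * (15360 * N *
                (2 ^ (r : ℕ) * (1 / 512) ^ (2 ^ (r : ℕ) - 1))) := by unfold rate; ring
            _ ≤ (K.mwu.c H.1 * K.rho H * K.liv U H) * (15360 * N *
                ((1 / 2) ^ (r : ℕ) * (1 / 128) ^ (K.a + 1))) := by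
                refine mul_le_mul_of_nonneg_left (mul_le_mul_of_nonneg_left (h4.trans ?_)
                  (by positivity)) (by positivity)
                exact mul_le_mul_of_nonneg_left h5 (by positivity)
            _ = _ := by ring
    _ = (∑ H with K.grp H ∈ Λ, K.mwu.c H.1 * K.rho H * K.liv U H) *
        (15360 * N * (1 / 128) ^ (K.a + 1) * ∑ r : Fin K.bundles, (1 / 2) ^ (r : ℕ)) := by
        rw [Finset.sum_mul]
        refine Finset.sum_congr rfl fun H _ => ?_
        rw [Finset.mul_sum, Finset.mul_sum]
    _ ≤ ((K.a : ℝ) + 1) * (4 * K.mwu.B) * (15360 * N * (1 / 128) ^ (K.a + 1) * 2) := by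
        have h1 := K.sum_rho_lump_le hU hΛ
        have h2 := sum_fin_half_le_two K.bundles
        have h3 := K.B_nonneg
        gcongr
    _ = 122880 * (K.mwu.B * N) * (((K.a : ℝ) + 1) * (1 / 128) ^ (K.a + 1)) := by ring
    _ ≤ _ := by
        have h3 := K.B_nonneg
        refine mul_le_mul_of_nonneg_left ?_ (by positivity)
        have h1 := succ_le_two_pow K.a
        calc ((K.a : ℝ) + 1) * (1 / 128) ^ (K.a + 1) ≤ 2 ^ K.a * (1 / 4) ^ K.a := by
              refine mul_le_mul h1 ?_ (by positivity) (by positivity)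
              calc (1 / 128 : ℝ) ^ (K.a + 1) ≤ (1 / 128) ^ K.a :=
                    pow_le_pow_of_le_one (by norm_num) (by norm_num) (by omega)
                _ ≤ _ := pow_le_pow_left₀ (by norm_num) (by norm_num) _
          _ = (1 / 2) ^ K.a := by rw [← mul_pow]; norm_num

end Core

/-- Truncation at `D`; the overflow is paid for in the sum norm, which is affordable when its
expectation is inversely proportional to the number of coordinates. -/
theorem SymMono.excess_le {J : Type*} [Fintype J] [DecidableEq J] {N : Seminorm ℝ (J → ℝ)}
    (hN : SymMono N) {t : ℕ} (ht : 1 ≤ t) {D : ℝ} (hD : 0 ≤ D) {V : J → ℝ} (hV : ∀ i, 0 ≤ V i) :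
    N V ≤ prof N t * (D + (∑ i, V i) / t) + ∑ i, max 0 (V i - D) := by
  have h1 : ∀ i, V i ≤ min (V i) D + max 0 (V i - D) := by
    intro i
    rcases le_total (V i) D with h | h
    · rw [min_eq_left h]; linarith [le_max_left 0 (V i - D)]
    · rw [min_eq_right h]; linarith [le_max_right 0 (V i - D)]
  refine (hN.mono' hV h1).trans ((seminorm_add_le N _ _).trans (add_le_add ?_
    (hN.le_sum fun i => le_max_left _ _)))
  refine (seminorm_le_prof N ht hD (fun i => le_min (hV i) hD) fun i => min_le_right _ _).trans ?_
  refine mul_le_mul_of_nonneg_left ?_ (prof_nonneg N t)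
  have : ∑ i, min (V i) D ≤ ∑ i, V i := Finset.sum_le_sum fun i _ => min_le_left _ _
  gcongr

namespace Core

variable {ι : Type} [Fintype ι] [DecidableEq ι] {σ : ι → Type} [∀ ℓ, Fintype (σ ℓ)]
  [∀ ℓ, DecidableEq (σ ℓ)] {n : ℕ} (K : Core ι σ n) [Nonempty ι] [∀ ℓ, Nonempty (σ ℓ)] [NeZero n]
  {w : Fin n → (Σ ℓ, σ ℓ) → ℝ≥0∞} {U : Fin n → Finset K.Tok}

/-- Three parts, concentrated by different means: base loads, early excess bounded by `maxLoad`, and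
late excess. Group bits are kept only in the early excess, where the number of open groups matters.
-/
theorem c_mul_nTok_le (hU : K.TokOK w U) (ω : K.Bit → Bool) (H : K.Tok) :
    K.mwu.c H.1 * K.nTok w U ω H ≤
      ∑ r : Fin K.bundles, K.hbit ω H r * (K.mwu.c H.1 * K.liv U H * K.base H r)
      + K.maxLoad * ∑ r : Fin K.bundles, (if 2 ^ (r : ℕ) ≤ K.a + 1 then
          K.gbit ω (K.grp H) r * (K.hbit ω H r * (K.mwu.c H.1 * K.liv U H)) else 0)
      + ∑ r : Fin K.bundles, (if 2 ^ (r : ℕ) ≤ K.a + 1 then 0 else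
          K.mwu.c H.1 * K.liv U H * (K.hbit ω H r * K.exc w U ω H r)) := by
  have h1 := mul_le_mul_of_nonneg_left (K.nTok_le hU ω H) (K.c_nonneg H.1)
  refine h1.trans ?_
  rw [Finset.mul_sum, Finset.mul_sum, ← Finset.sum_add_distrib, ← Finset.sum_add_distrib]
  refine Finset.sum_le_sum fun r _ => ?_
  have hg : 0 ≤ K.gbit ω (K.grp H) r := bit_nonneg _
  have hg1 : K.gbit ω (K.grp H) r ≤ 1 := bit_le_one _
  have hh : 0 ≤ K.hbit ω H r := bit_nonneg _
  have hc := K.c_nonneg H.1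
  have hl := K.liv_nonneg (U := U) H
  have hb := K.base_nonneg H r
  have he := K.exc_nonneg w U ω H r
  have hm := K.maxLoad_nonneg
  set g := K.gbit ω (K.grp H) r
  set h := K.hbit ω H r
  set x := min (K.exc w U ω H r) K.maxLoad with hx
  have hx0 : 0 ≤ x := le_min he hm
  have hs1 : 0 ≤ h * (K.mwu.c H.1 * K.liv U H * K.base H r) := by positivity
  have hs2 : 0 ≤ K.mwu.c H.1 * K.liv U H * h := by positivity
  have e : K.mwu.c H.1 * (g * (h * (K.liv U H * K.base H r) + h * (K.liv U H * x)))
      = g * (h * (K.mwu.c H.1 * K.liv U H * K.base H r)) + g * (K.mwu.c H.1 * K.liv U H * h) * x := by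
    ring
  rw [e]
  have h2 : g * (h * (K.mwu.c H.1 * K.liv U H * K.base H r))
      ≤ h * (K.mwu.c H.1 * K.liv U H * K.base H r) := mul_le_of_le_one_left hs1 hg1
  split_ifs
  · have h3 : g * (K.mwu.c H.1 * K.liv U H * h) * x ≤ g * (K.mwu.c H.1 * K.liv U H * h) * K.maxLoad :=
      mul_le_mul_of_nonneg_left (min_le_right _ _) (by positivity)
    have h4 : K.maxLoad * (g * (h * (K.mwu.c H.1 * K.liv U H)))
      = g * (K.mwu.c H.1 * K.liv U H * h) * K.maxLoad := by ring
    linarith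
  · have h3 : g * (K.mwu.c H.1 * K.liv U H * h) * x ≤ (K.mwu.c H.1 * K.liv U H * h) * K.exc w U ω H r :=
      mul_le_mul (mul_le_of_le_one_left hs2 hg1) (min_le_left _ _) hx0 hs2
    linarith

/-- Excess of the weights of the slot tokens of a set of group tokens in the early bundles. -/
noncomputable def slotExcess (U : Fin n → Finset K.Tok) (Λ : Finset K.GTok) (ω : K.Bit → Bool) : ℝ :=
  ∑ G ∈ Λ, ∑ r : Fin K.bundles, if 2 ^ (r : ℕ) ≤ K.a + 1 then
    max 0 (K.slotWeight U G r ω - 4 * (K.mu G r * (4 * K.mwu.B))) else 0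

theorem slotExcess_nonneg (Λ : Finset K.GTok) (ω : K.Bit → Bool) : 0 ≤ K.slotExcess U Λ ω :=
  Finset.sum_nonneg fun G _ => Finset.sum_nonneg fun r _ => by
    split_ifs
    · exact le_max_left _ _
    · exact le_rfl

theorem lateWeight_nonneg (Λ : Finset K.GTok) (ω : K.Bit → Bool) : 0 ≤ K.lateWeight w U Λ ω :=
  Finset.sum_nonneg fun H _ => Finset.sum_nonneg fun r _ => by
    split_ifs
    · exact le_rfl
    · exact mul_nonneg (mul_nonneg (K.c_nonneg _) (K.liv_nonneg _))
        (mul_nonneg (bit_nonneg _) (K.exc_nonneg _ _ _ _ _))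

theorem bernE_slotExcess_le (hU : K.TokOK w U) {Λ : Finset K.GTok} (hΛ : Λ.card ≤ K.a + 1) :
    bernE K.prb (K.slotExcess U Λ) ≤ 2 * (1 / 2) ^ K.a := by
  unfold slotExcess
  rw [bernE_sum]
  have h := sum_fin_pow_two_filter_le K.bundles (Nat.succ_ne_zero K.a)
  push_cast at h
  calc _ ≤ ∑ _G ∈ Λ, (1 / 2 : ℝ) ^ (3 * K.a) * ∑ r : Fin K.bundles,
        (if 2 ^ (r : ℕ) ≤ K.a.succ then (2 : ℝ) ^ (r : ℕ) else 0) := by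
        refine Finset.sum_le_sum fun G _ => ?_
        rw [bernE_sum, Finset.mul_sum]
        refine Finset.sum_le_sum fun r _ => ?_
        split_ifs with hr
        · refine (K.bernE_slotWeight_le hU G r).trans ?_
          exact le_mul_of_one_le_right (by positivity) (one_le_pow₀ (by norm_num))
        · rw [bernE_const]; simp
    _ ≤ ∑ _G ∈ Λ, (1 / 2 : ℝ) ^ (3 * K.a) * (2 * ((K.a : ℝ) + 1)) := by gcongr
    _ = Λ.card * ((1 / 2 : ℝ) ^ (3 * K.a) * (2 * ((K.a : ℝ) + 1))) := by
        rw [Finset.sum_const, nsmul_eq_mul]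
    _ ≤ 2 ^ K.a * ((1 / 2 : ℝ) ^ (3 * K.a) * (2 * 2 ^ K.a)) := by
        have h1 := succ_le_two_pow K.a
        have h2 : (Λ.card : ℝ) ≤ K.a + 1 := by exact_mod_cast hΛ
        gcongr
        exact h2.trans h1
    _ = 2 * (1 / 2) ^ K.a := by
        rw [pow_mul]
        calc _ = 2 * (2 * 2 * (1 / 2 : ℝ) ^ 3) ^ K.a := by rw [mul_pow, mul_pow]; ring
          _ = _ := by norm_num

/-- Each slot weight is at most `16 * B * mu` plus its excess, and `mu ≤ 1 + rate * vhat`. Summed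
over open group tokens, the one gives `openCount` and the rest is at most `256 * (a + 1)`. -/
theorem sum_gbit_slotWeight_le {Λ : Finset K.GTok} (hv : ∑ G ∈ Λ, K.vhat G ≤ 2) (ω : K.Bit → Bool) :
    ∑ G ∈ Λ, ∑ r : Fin K.bundles, (if 2 ^ (r : ℕ) ≤ K.a + 1 then
      K.gbit ω G r * K.slotWeight U G r ω else 0) ≤
      16 * K.mwu.B * (256 * (K.a + 1) + K.openCount Λ ω) + K.slotExcess U Λ ω := by
  have h1 : ∀ G, ∀ r : Fin K.bundles, (if 2 ^ (r : ℕ) ≤ K.a + 1 then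
      K.gbit ω G r * K.slotWeight U G r ω else 0) ≤
      16 * K.mwu.B * ((if 2 ^ (r : ℕ) ≤ K.a + 1 then rate r * K.vhat G else 0)
        + if 2 ^ (r : ℕ) ≤ K.a + 1 then K.gbit ω G r else 0)
      + if 2 ^ (r : ℕ) ≤ K.a + 1 then
          max 0 (K.slotWeight U G r ω - 4 * (K.mu G r * (4 * K.mwu.B))) else 0 := by
    intro G r
    split_ifs
    · have hg : 0 ≤ K.gbit ω G r := bit_nonneg _
      have hg1 : K.gbit ω G r ≤ 1 := bit_le_one _
      have hB := K.B_nonneg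
      have hr : 0 ≤ rate r * K.vhat G := mul_nonneg (rate_pos _).le (K.vhat_pos G).le
      have hm : K.mu G r ≤ 1 + rate r * K.vhat G := max_le (by linarith) (by linarith)
      set X := max 0 (K.slotWeight U G r ω - 4 * (K.mu G r * (4 * K.mwu.B))) with hX
      have hX0 : 0 ≤ X := le_max_left _ _
      have h2 : K.slotWeight U G r ω ≤ 16 * K.mwu.B * (1 + rate r * K.vhat G) + X := by
        have h3 : K.slotWeight U G r ω - 4 * (K.mu G r * (4 * K.mwu.B)) ≤ X := le_max_right _ _
        nlinarith
      calc _ ≤ K.gbit ω G r * (16 * K.mwu.B * (1 + rate r * K.vhat G) + X) := by gcongr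
        _ = 16 * K.mwu.B * (K.gbit ω G r * (rate r * K.vhat G) + K.gbit ω G r)
            + K.gbit ω G r * X := by ring
        _ ≤ 16 * K.mwu.B * (1 * (rate r * K.vhat G) + K.gbit ω G r) + 1 * X := by gcongr
        _ = _ := by ring
    · simp
  refine (Finset.sum_le_sum fun G _ => Finset.sum_le_sum fun r _ => h1 G r).trans ?_
  simp only [Finset.sum_add_distrib, ← Finset.mul_sum]
  have h2 := K.sum_rate_vhat_le hv
  have hB := K.B_nonneg
  unfold openCount slotExcess
  gcongr

theorem lump_le (hU : K.TokOK w U) {Λ : Finset K.GTok} (hΛ : Λ.card ≤ K.a + 1)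
    (hv : ∑ G ∈ Λ, K.vhat G ≤ 2) (ω : K.Bit → Bool) :
    ∑ G ∈ Λ, K.xval (K.nTok w U ω) G ≤
      8748 * (((K.a : ℝ) + 1) * (K.Am + 1) ^ 2 * (K.An + 1)) + 2 * (K.baseWeight U Λ ω
        + K.maxLoad * (16 * K.mwu.B * (256 * (K.a + 1) + K.openCount Λ ω) + K.slotExcess U Λ ω)
        + K.lateWeight w U Λ ω) := by
  have h1 : ∀ G ∈ Λ, K.xval (K.nTok w U ω) G ≤ 2 * ((K.Am + 1) * (8 * K.Am + 18)) * K.maxLoad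
      + 2 * ∑ H with K.grp H = G, K.mwu.c H.1 * K.nTok w U ω H := fun G _ =>
    K.xval_le_classes K.maxLoad_nonneg (fun H _ => K.nTok_nonneg w U ω H)
      fun H _ => K.nTok_le_maxLoad hU ω H
  refine (Finset.sum_le_sum h1).trans ?_
  rw [Finset.sum_add_distrib, Finset.sum_const, nsmul_eq_mul, ← Finset.mul_sum, ← K.sum_lump Λ]
  refine add_le_add ?_ (mul_le_mul_of_nonneg_left ?_ (by norm_num))
  · have h2 : (Λ.card : ℝ) ≤ K.a + 1 := by exact_mod_cast hΛ
    have h3 : (8 * (K.Am : ℝ) + 18) ≤ 18 * (K.Am + 1) := by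
      have : (0 : ℝ) ≤ K.Am := Nat.cast_nonneg _
      linarith
    unfold maxLoad
    calc _ ≤ ((K.a : ℝ) + 1) * (2 * ((K.Am + 1) * (18 * (K.Am + 1))) * (243 * (K.An + 1))) := by
          gcongr
      _ = _ := by ring
  · refine (Finset.sum_le_sum fun H _ => K.c_mul_nTok_le hU ω H).trans ?_
    rw [Finset.sum_add_distrib, Finset.sum_add_distrib, ← Finset.mul_sum]
    have hm := K.maxLoad_nonneg
    refine add_le_add (add_le_add le_rfl (mul_le_mul_of_nonneg_left ?_ hm)) le_rfl
    refine le_trans (le_of_eq ?_) (K.sum_gbit_slotWeight_le hv ω)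
    rw [K.sum_lump]
    refine Finset.sum_congr rfl fun G _ => ?_
    rw [Finset.sum_comm]
    refine Finset.sum_congr rfl fun r _ => ?_
    split_ifs
    · unfold slotWeight
      rw [Finset.mul_sum]
      refine Finset.sum_congr rfl fun H hH => ?_
      rw [(Finset.mem_filter.mp hH).2]
    · exact Finset.sum_const_zero

/-- Expected excess of the value of a set of group tokens. -/
theorem bernE_excess_lump_le (hU : K.TokOK w U) {Λ : Finset K.GTok} (hΛ : Λ.card ≤ K.a + 1)
    (hv : ∑ G ∈ Λ, K.vhat G ≤ 2) :
    bernE K.prb (fun ω => max 0 (∑ G ∈ Λ, K.xval (K.nTok w U ω) G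
      - 10 ^ 10 * (((K.a : ℝ) + 1) * (K.Am + 1) ^ 2 * (K.An + 1))))
      ≤ 10 ^ 9 * ((K.Am + 1) ^ 2 * (K.An + 1)) * (1 / 2) ^ K.a := by
  set N : ℝ := (K.An : ℝ) + 1 with hN
  set m : ℝ := (K.Am : ℝ) + 1 with hm
  set l : ℝ := (K.a : ℝ) + 1 with hl
  have hN0 : 0 < N := by positivity
  have hm1 : 1 ≤ m := by rw [hm]; have : (0 : ℝ) ≤ K.Am := Nat.cast_nonneg _; linarith
  have hl1 : 1 ≤ l := by rw [hl]; have : (0 : ℝ) ≤ K.a := Nat.cast_nonneg _; linarith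
  have hB : K.mwu.B = 960 * m ^ 2 := rfl
  have hB0 := K.B_nonneg
  let X := fun ω : K.Bit → Bool => max 0 (K.baseWeight U Λ ω / (36 * N) - 4 * (256 * l * K.mwu.B))
  let Y := fun ω : K.Bit → Bool => max 0 (K.openCount Λ ω - 4 * (256 * l))
  have hX : bernE K.prb X ≤ (1 / 2) ^ K.a := K.bernE_baseWeight_le hU hΛ
  have hY : bernE K.prb Y ≤ (1 / 2) ^ K.a := K.bernE_openCount_le hv
  have h1 : ∀ ω, max 0 (∑ G ∈ Λ, K.xval (K.nTok w U ω) G - 10 ^ 10 * (l * m ^ 2 * N)) ≤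
      72 * N * X ω + (7776 * (N * K.mwu.B) * Y ω + (486 * N * K.slotExcess U Λ ω
        + 2 * K.lateWeight w U Λ ω)) := by
    intro ω
    have hX0 : 0 ≤ X ω := le_max_left _ _
    have hY0 : 0 ≤ Y ω := le_max_left _ _
    have hS0 := K.slotExcess_nonneg (U := U) Λ ω
    have hL0 := K.lateWeight_nonneg (w := w) (U := U) Λ ω
    refine max_le (by positivity) ?_
    have h2 := K.lump_le hU hΛ hv ω
    have h3 : K.baseWeight U Λ ω / (36 * N) - 4 * (256 * l * K.mwu.B) ≤ X ω := le_max_right _ _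
    have h4 : K.openCount Λ ω - 4 * (256 * l) ≤ Y ω := le_max_right _ _
    rw [sub_le_iff_le_add, div_le_iff₀ (by positivity)] at h3
    have h5 : K.openCount Λ ω ≤ 1024 * l + Y ω := by linarith
    have h6 : K.maxLoad = 243 * N := rfl
    rw [h6] at h2
    have h7 : 243 * N * (16 * K.mwu.B * (256 * l + K.openCount Λ ω) + K.slotExcess U Λ ω) ≤
        243 * N * (16 * K.mwu.B * (256 * l + (1024 * l + Y ω)) + K.slotExcess U Λ ω) := by
      gcongr
    rw [hB] at h3 h7 h2 ⊢
    have h8 : 0 ≤ l * m ^ 2 * N := by positivity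
    -- All deterministic terms together are below the threshold `10 ^ 10`; only the excesses `X`,
    -- `Y`, `slotExcess` and the late weight remain.
    calc _ ≤ 8748 * (l * m ^ 2 * N) + 2 * ((X ω + 4 * (256 * l * (960 * m ^ 2))) * (36 * N)
          + 243 * N * (16 * (960 * m ^ 2) * (256 * l + (1024 * l + Y ω)) + K.slotExcess U Λ ω)
          + K.lateWeight w U Λ ω) - 10 ^ 10 * (l * m ^ 2 * N) := by linarith
      _ = 72 * N * X ω + (7776 * (N * (960 * m ^ 2)) * Y ω + (486 * N * K.slotExcess U Λ ω
        + 2 * K.lateWeight w U Λ ω)) - 374063572 * (l * m ^ 2 * N) := by ring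
      _ ≤ _ := by linarith
  refine (bernE_mono K.prb_mem h1).trans ?_
  rw [bernE_add, bernE_add, bernE_add, bernE_const_mul, bernE_const_mul, bernE_const_mul,
    bernE_const_mul]
  have hS := K.bernE_slotExcess_le hU hΛ
  have hL := K.bernE_lateWeight_le hU hΛ
  set h : ℝ := (1 / 2) ^ K.a with hh
  have hh0 : 0 ≤ h := by positivity
  have hm2 : 1 ≤ m ^ 2 := one_le_pow₀ hm1
  calc _ ≤ 72 * N * h + (7776 * (N * K.mwu.B) * h + (486 * N * (2 * h)
        + 2 * (122880 * (K.mwu.B * N) * h))) := by gcongr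
    _ = (1044 + 243394560 * m ^ 2) * (N * h) := by rw [hB]; ring
    _ ≤ (10 ^ 9 * m ^ 2) * (N * h) := by
        refine mul_le_mul_of_nonneg_right ?_ (by positivity)
        linarith
    _ = _ := by ring

end Core

/-! ### The outer norm by bands of group values -/

namespace Core

variable {ι : Type} [Fintype ι] [DecidableEq ι] {σ : ι → Type} [∀ ℓ, Fintype (σ ℓ)]
  [∀ ℓ, DecidableEq (σ ℓ)] {n : ℕ} (K : Core ι σ n)

/-- The classes of group values whose excess over one is `2 ^ h`; those below one for `h = 0`. -/
def band (h : ℕ) : Finset (Fin (4 * K.a + 8)) := Finset.univ.filter fun e => (e : ℕ) - K.a = h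

/-- The group tokens of a group and level in a band. -/
def bandToks (ℓ : ι) (b : Fin (K.a + 1)) (h : ℕ) : Finset K.GTok :=
  (K.band h).map ⟨fun e => ((ℓ, b), e), fun _ _ h => (Prod.mk.injEq _ _ _ _ ▸ h).2⟩

theorem sum_bandToks (ℓ : ι) (b : Fin (K.a + 1)) (h : ℕ) (F : K.GTok → ℝ) :
    ∑ G ∈ K.bandToks ℓ b h, F G = ∑ e ∈ K.band h, F ((ℓ, b), e) := Finset.sum_map _ _ _

theorem band_spec {h : ℕ} {e : Fin (4 * K.a + 8)} (he : e ∈ K.band h) :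
    h ≤ e ∧ (e : ℕ) - h ≤ K.a ∧ (0 < h → (e : ℕ) - h = K.a) := by
  have : (e : ℕ) - K.a = h := (Finset.mem_filter.mp he).2
  omega

theorem band_injOn (h : ℕ) : Set.InjOn (fun e : Fin (4 * K.a + 8) => (e : ℕ) - h) (K.band h) := by
  intro e he e' he' heq
  have h1 := K.band_spec he
  have h2 := K.band_spec he'
  simp only at heq
  exact Fin.ext (by omega)

theorem card_bandToks_le (ℓ : ι) (b : Fin (K.a + 1)) (h : ℕ) :
    (K.bandToks ℓ b h).card ≤ K.a + 1 := by
  unfold bandToks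
  rw [Finset.card_map, ← Finset.card_range (K.a + 1)]
  refine Finset.card_le_card_of_injOn _ (fun e he => ?_) (K.band_injOn h)
  have := K.band_spec he
  simp only [Finset.coe_range, Set.mem_Iio]
  omega

theorem vhat_band (ℓ : ι) (b : Fin (K.a + 1)) {h : ℕ} {e : Fin (4 * K.a + 8)} (he : e ∈ K.band h) :
    K.vhat ((ℓ, b), e) ≤ 2 ^ ((e : ℕ) - h) / 2 ^ K.a := by
  obtain ⟨h1, h2, h3⟩ := K.band_spec he
  rcases Nat.eq_zero_or_pos h with rfl | hpos
  · exact min_le_right _ _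
  · rw [h3 hpos, div_self (by positivity)]
    exact min_le_left _ _

/-- Rounding charges a group only for its value truncated at one. In band `h` this is smaller than
the fractional value by the factor `2 ^ h`, which pays for thinning the outer capacity by `2 ^ h`.
-/
theorem vhat_mul_le (ℓ : ι) (b : Fin (K.a + 1)) {h : ℕ} {e : Fin (4 * K.a + 8)} (he : e ∈ K.band h) :
    K.vhat ((ℓ, b), e) * 2 ^ h ≤ K.vbar ((ℓ, b), e) := by
  have h1 := K.vhat_band ℓ b he
  have h2 := (K.band_spec he).1
  calc _ ≤ (2 : ℝ) ^ ((e : ℕ) - h) / 2 ^ K.a * 2 ^ h := by gcongr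
    _ = (2 : ℝ) ^ (e : ℕ) / 2 ^ K.a := by
        rw [div_mul_eq_mul_div, ← pow_add, Nat.sub_add_cancel h2]
    _ = _ := rfl

theorem sum_vhat_bandToks_le (ℓ : ι) (b : Fin (K.a + 1)) (h : ℕ) :
    ∑ G ∈ K.bandToks ℓ b h, K.vhat G ≤ 2 := by
  rw [K.sum_bandToks]
  calc _ ≤ ∑ e ∈ K.band h, (2 : ℝ) ^ ((e : ℕ) - h) / 2 ^ K.a :=
        Finset.sum_le_sum fun e he => K.vhat_band ℓ b he
    _ = ∑ k ∈ (K.band h).image fun e : Fin (4 * K.a + 8) => (e : ℕ) - h, (2 : ℝ) ^ k / 2 ^ K.a :=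
        (Finset.sum_image (f := fun k : ℕ => (2 : ℝ) ^ k / 2 ^ K.a) (K.band_injOn h)).symm
    _ ≤ ∑ k ∈ Finset.range (K.a + 1), (2 : ℝ) ^ k / 2 ^ K.a := by
        refine Finset.sum_le_sum_of_subset_of_nonneg (fun k hk => ?_) fun _ _ _ => by positivity
        obtain ⟨e, he, rfl⟩ := Finset.mem_image.mp hk
        have := K.band_spec he
        exact Finset.mem_range.mpr (by omega)
    _ ≤ 2 := by
        rw [← Finset.sum_div, div_le_iff₀ (by positivity), geom_sum_eq (by norm_num), pow_succ]
        norm_num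
        linarith

theorem sum_band (F : Fin (4 * K.a + 8) → ℝ) :
    ∑ e, F e = ∑ h ∈ Finset.range (3 * K.a + 8), ∑ e ∈ K.band h, F e := by
  unfold band
  refine (Finset.sum_fiberwise_of_maps_to (fun e _ => ?_) F).symm
  have := e.2
  exact Finset.mem_range.mpr (by omega)

variable [Nonempty ι] [∀ ℓ, Nonempty (σ ℓ)] [NeZero n]
  {w : Fin n → (Σ ℓ, σ ℓ) → ℝ≥0∞} {U : Fin n → Finset K.Tok}

/-- Value of a group in a band. -/
noncomputable def bandVal (w : Fin n → (Σ ℓ, σ ℓ) → ℝ≥0∞) (U : Fin n → Finset K.Tok)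
    (b : Fin (K.a + 1)) (h : ℕ) (ω : K.Bit → Bool) (ℓ : ι) : ℝ :=
  ∑ e ∈ K.band h, K.xval (K.nTok w U ω) ((ℓ, b), e)

theorem bandVal_nonneg (b : Fin (K.a + 1)) (h : ℕ) (ω : K.Bit → Bool) (ℓ : ι) :
    0 ≤ K.bandVal w U b h ω ℓ := Finset.sum_nonneg fun _ _ => K.xval_nonneg _ _

/-- Weighted value of a used group token. -/
noncomputable def gval (U : Fin n → Finset K.Tok) (G : K.GTok) : ℝ :=
  if G ∈ (Finset.univ.biUnion U).image K.grp then K.mwu.C G.1 * K.vbar G else 0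

/-- The thinned capacity is at least `capO b / 2 ^ h`, so its inverse is at most `2 ^ h * C`; the
factor `2 ^ h` is absorbed by `vhat_mul_le`, leaving the fractional cost `C * vbar`. -/
theorem bernE_sum_bandVal_le (hU : K.TokOK w U) (b : Fin (K.a + 1)) (h : ℕ) :
    bernE K.prb (fun ω => (∑ ℓ, K.bandVal w U b h ω ℓ) / ((K.capO b / 2 ^ h + 1 : ℕ) : ℝ))
      ≤ 4 * 10 ^ 9 * ((K.Am + 1) ^ 2 * (K.An + 1)) * ∑ ℓ, ∑ e ∈ K.band h, K.gval U ((ℓ, b), e) := by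
  set c : ℝ := 4 * 10 ^ 9 * (((K.Am : ℝ) + 1) ^ 2 * (K.An + 1)) with hc
  have hc0 : 0 ≤ c := by positivity
  have hP : (0 : ℝ) < K.capO b := by exact_mod_cast K.hout.one_le_cap b
  have ht : (K.capO b : ℝ) / 2 ^ h ≤ ((K.capO b / 2 ^ h + 1 : ℕ) : ℝ) := by
    have := Nat.lt_floor_add_one ((K.capO b : ℝ) / ((2 ^ h : ℕ) : ℝ))
    rw [Nat.floor_div_eq_div] at this
    push_cast at this ⊢
    exact this.le
  set t : ℝ := ((K.capO b / 2 ^ h + 1 : ℕ) : ℝ) with htd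
  have hit : 1 / t ≤ 2 ^ h / K.capO b := by
    have h6 := one_div_le_one_div_of_le (by positivity : (0 : ℝ) < (K.capO b : ℝ) / 2 ^ h) ht
    rwa [one_div_div] at h6
  have ht0 : 0 ≤ 1 / t := by positivity
  have e1 : (fun ω => (∑ ℓ, K.bandVal w U b h ω ℓ) / t) = fun ω =>
      1 / t * ∑ ℓ, K.bandVal w U b h ω ℓ := by funext ω; ring
  rw [e1, bernE_const_mul, bernE_sum, Finset.mul_sum, Finset.mul_sum]
  refine Finset.sum_le_sum fun ℓ _ => ?_
  unfold bandVal
  rw [bernE_sum, Finset.mul_sum, Finset.mul_sum]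
  refine Finset.sum_le_sum fun e he => ?_
  unfold gval
  split_ifs with hG
  · have h1 := K.bernE_xval_nTok_le hU ((ℓ, b), e)
    have h2 := K.vhat_mul_le ℓ b he
    have hv := (K.vhat_pos ((ℓ, b), e)).le
    calc _ ≤ 2 ^ h / K.capO b * (c * K.vhat ((ℓ, b), e)) := by
          refine mul_le_mul hit (h1.trans (le_of_eq (by rw [hc]; ring))) ?_ (by positivity)
          exact bernE_nonneg K.prb_mem fun ω => K.xval_nonneg _ _
      _ = c * (1 / K.capO b * (K.vhat ((ℓ, b), e) * 2 ^ h)) := by ring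
      _ ≤ c * (1 / K.capO b * K.vbar ((ℓ, b), e)) := by gcongr
      _ = _ := rfl
  · simp only [K.xval_nTok_eq_zero hG, bernE_const, mul_zero, le_refl]

/-- Expected cost of the accepted jobs. -/
theorem bernE_out_le (hU : K.TokOK w U) :
    bernE K.prb (fun ω => ∑ b : Fin (K.a + 1), (1 / 2) ^ (b : ℕ) * K.out (fun ℓ =>
        ∑ e : Fin (4 * K.a + 8), K.xval (K.nTok w U ω) ((ℓ, b), e)))
      ≤ 2 * 10 ^ 12 * (((K.a : ℝ) + 1) ^ 2 * (K.Am + 1) ^ 2 * (K.An + 1)) := by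
  set l : ℝ := (K.a : ℝ) + 1 with hl
  set q : ℝ := ((K.Am : ℝ) + 1) ^ 2 * (K.An + 1) with hq
  have hq0 : 0 ≤ q := by positivity
  have hl0 : 0 ≤ l := by positivity
  set D : ℝ := 10 ^ 10 * (l * ((K.Am : ℝ) + 1) ^ 2 * (K.An + 1)) with hD
  have hD0 : 0 ≤ D := by positivity
  let t : ℕ → ℕ → ℕ := fun b h => cap K.out b / 2 ^ h + 1
  let p : ℕ → ℕ → ℝ := fun b h => (1 / 2 : ℝ) ^ b * prof K.out (t b h)
  have hp0 : ∀ b h, 0 ≤ p b h := fun b h => mul_nonneg (by positivity) (prof_nonneg _ _)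
  have h1 : ∀ ω, ∑ b : Fin (K.a + 1), (1 / 2 : ℝ) ^ (b : ℕ) * K.out (fun ℓ =>
        ∑ e : Fin (4 * K.a + 8), K.xval (K.nTok w U ω) ((ℓ, b), e)) ≤
      ∑ b : Fin (K.a + 1), ∑ h ∈ Finset.range (3 * K.a + 8), (p b h * D
        + (p b h * ((∑ ℓ, K.bandVal w U b h ω ℓ) / ((K.capO b / 2 ^ h + 1 : ℕ) : ℝ))
        + ∑ ℓ, max 0 (K.bandVal w U b h ω ℓ - D))) := by
    intro ω
    refine Finset.sum_le_sum fun b _ => ?_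
    have e1 : (fun ℓ => ∑ e : Fin (4 * K.a + 8), K.xval (K.nTok w U ω) ((ℓ, b), e))
        = fun ℓ => ∑ h ∈ Finset.range (3 * K.a + 8), K.bandVal w U b h ω ℓ := by
      funext ℓ
      exact K.sum_band fun e => K.xval (K.nTok w U ω) ((ℓ, b), e)
    rw [e1]
    refine (mul_le_mul_of_nonneg_left (seminorm_sum_le K.out (Finset.range (3 * K.a + 8))
      fun h ℓ => K.bandVal w U b h ω ℓ) (by positivity)).trans ?_
    rw [Finset.mul_sum]
    refine Finset.sum_le_sum fun h _ => ?_
    -- Three contributions arise: the threshold `D`, the sum of the values, which needs only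
    -- expectations, and the overflow above `D`.
    have h2 := K.hout.excess_le (t := t b h) (Nat.le_add_left 1 _) hD0
      (V := fun ℓ => K.bandVal w U b h ω ℓ) fun ℓ => K.bandVal_nonneg b h ω ℓ
    have h3 : (1 / 2 : ℝ) ^ (b : ℕ) ≤ 1 := pow_le_one₀ (by norm_num) (by norm_num)
    have h4 : 0 ≤ ∑ ℓ, max 0 (K.bandVal w U b h ω ℓ - D) :=
      Finset.sum_nonneg fun ℓ _ => le_max_left _ _
    calc _ ≤ (1 / 2 : ℝ) ^ (b : ℕ) * (prof K.out (t b h) * (D + (∑ ℓ, K.bandVal w U b h ω ℓ)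
          / ((t b h : ℕ) : ℝ)) + ∑ ℓ, max 0 (K.bandVal w U b h ω ℓ - D)) := by gcongr
      _ = p b h * D + p b h * ((∑ ℓ, K.bandVal w U b h ω ℓ) / ((t b h : ℕ) : ℝ))
          + (1 / 2 : ℝ) ^ (b : ℕ) * ∑ ℓ, max 0 (K.bandVal w U b h ω ℓ - D) := by
          simp only [p]; ring
      _ ≤ p b h * D + p b h * ((∑ ℓ, K.bandVal w U b h ω ℓ) / ((t b h : ℕ) : ℝ))
          + 1 * ∑ ℓ, max 0 (K.bandVal w U b h ω ℓ - D) := by gcongr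
      _ = _ := by rw [one_mul, add_assoc]; rfl
  refine (bernE_mono K.prb_mem h1).trans ?_
  rw [bernE_sum]
  simp only [bernE_sum, bernE_add, bernE_const, bernE_const_mul]
  calc _ ≤ ∑ b : Fin (K.a + 1), ∑ h ∈ Finset.range (3 * K.a + 8), (p b h * D
        + (12 * 10 ^ 9 * q * (∑ ℓ, ∑ e ∈ K.band h, K.gval U ((ℓ, b), e)) + 10 ^ 9 * q)) := by
        refine Finset.sum_le_sum fun b _ => Finset.sum_le_sum fun h _ => ?_
        refine add_le_add le_rfl (add_le_add ?_ ?_)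
        · have h2 := K.bernE_sum_bandVal_le hU b h
          have h3 : p b h ≤ 3 := K.hout.level_term_le b h
          have h4 : 0 ≤ bernE K.prb (fun ω => (∑ ℓ, K.bandVal w U b h ω ℓ) /
              ((K.capO b / 2 ^ h + 1 : ℕ) : ℝ)) := bernE_nonneg K.prb_mem fun ω =>
            div_nonneg (Finset.sum_nonneg fun ℓ _ => K.bandVal_nonneg b h ω ℓ) (Nat.cast_nonneg _)
          calc _ ≤ 3 * (4 * 10 ^ 9 * q * ∑ ℓ, ∑ e ∈ K.band h, K.gval U ((ℓ, b), e)) :=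
                mul_le_mul h3 h2 h4 (by norm_num)
            _ = _ := by ring
        -- There are at most `2 ^ a` groups, and the expected overflow of each carries the factor `2
        -- ^ (-a)`.
        · calc _ ≤ ∑ _ℓ : ι, 10 ^ 9 * q * (1 / 2) ^ K.a := by
                refine Finset.sum_le_sum fun ℓ _ => ?_
                have h2 := K.bernE_excess_lump_le hU (K.card_bandToks_le ℓ b h)
                  (K.sum_vhat_bandToks_le ℓ b h)
                simp only [K.sum_bandToks] at h2
                exact h2
            _ = Fintype.card ι * (1 / 2) ^ K.a * (10 ^ 9 * q) := by
                rw [Finset.sum_const, nsmul_eq_mul, Finset.card_univ]; ring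
            _ ≤ 2 ^ K.a * (1 / 2) ^ K.a * (10 ^ 9 * q) := by
                have : (Fintype.card ι : ℝ) ≤ 2 ^ K.a := by exact_mod_cast K.card_out
                gcongr
            _ = _ := by rw [← mul_pow]; norm_num
    _ = (∑ b : Fin (K.a + 1), ∑ h ∈ Finset.range (3 * K.a + 8), p b h) * D
        + (12 * 10 ^ 9 * q * ∑ G, K.gval U G + (K.a + 1) * (3 * K.a + 8) * (10 ^ 9 * q)) := by
        simp only [Finset.sum_add_distrib, ← Finset.sum_mul, ← Finset.mul_sum, Finset.sum_const,
          Finset.card_univ, Finset.card_range, Fintype.card_fin, nsmul_eq_mul]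
        congr 2
        · congr 1
          rw [Fintype.sum_prod_type, Fintype.sum_prod_type, Finset.sum_comm (s := Finset.univ (α := ι))]
          refine Finset.sum_congr rfl fun b _ => ?_
          rw [Finset.sum_comm]
          exact Finset.sum_congr rfl fun ℓ _ => (K.sum_band fun e => K.gval U ((ℓ, b), e)).symm
        · push_cast; ring
    -- The double sum over levels and bands is linear in `l`. As `D` already contains one factor
    -- `l`, each of the three contributions is of order `l ^ 2 * q`.
    _ ≤ (24 * l) * D + (12 * 10 ^ 9 * q * (140 * l ^ 2) + l * (8 * l) * (10 ^ 9 * q)) := by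
        have h2 := K.hout.level_double_sum_le K.card_out (3 * K.a + 8)
        rw [← Fin.sum_univ_eq_sum_range (fun b => ∑ h ∈ Finset.range (3 * K.a + 8), p b h)] at h2
        push_cast at h2
        have h3 : ∑ G, K.gval U G ≤ 140 * l ^ 2 := by
          refine le_trans (le_of_eq ?_) hU.sum_vbar
          unfold gval
          rw [Finset.sum_ite_mem, Finset.univ_inter]
        have h4 : (0 : ℝ) ≤ K.a := Nat.cast_nonneg _
        have h5 : 3 * (K.a : ℝ) + 8 ≤ 8 * l := by rw [hl]; linarith
        have h6 : 2 * (3 * (K.a : ℝ) + 8) + 8 * (K.a + 1) ≤ 24 * l := by rw [hl]; linarith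
        have h7 := h2.trans h6
        gcongr
    _ = 1928 * 10 ^ 9 * (l ^ 2 * q) := by rw [hD, hq]; ring
    _ ≤ 2 * 10 ^ 12 * (l ^ 2 * q) := by
        refine mul_le_mul_of_nonneg_right (by norm_num) (by positivity)
    _ = _ := by rw [hq]; ring

/-- Missing all bundles has probability at most `2 ^ (-(2 ^ bundles - 1)) ≤ 2 ^ (-An) ≤ 1 / n`. -/
theorem bernE_fallback_le (hU : K.TokOK w U) :
    bernE K.prb (fun ω => ∑ j, if K.chosen ω (U j) = none then 1 else 0) ≤ 1 := by
  rw [bernE_sum]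
  calc _ ≤ ∑ _j : Fin n, (1 / 2 : ℝ) ^ K.An := by
        refine Finset.sum_le_sum fun j _ => ?_
        calc _ ≤ bernE K.prb (fun ω => K.reachInd ω (U j) K.bundles) := by
              refine bernE_mono K.prb_mem fun ω => ?_
              split_ifs with h
              · rw [K.reachInd_eq_one (K.chosen_none h)]
              · exact K.reachInd_nonneg _ _ _
          _ ≤ Real.exp (-8) ^ (2 ^ K.bundles - 1) := K.bernE_reachInd_le le_rfl (hU.cover j)
          _ ≤ (1 / 2) ^ (2 ^ K.bundles - 1) := by
              have h1 := two_mul_exp_le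
              refine pow_le_pow_left₀ (Real.exp_pos _).le (by linarith) _
          _ ≤ _ := by
              have := K.le_pow_bundles
              exact pow_le_pow_of_le_one (by norm_num) (by norm_num) (by omega)
    _ = n * (1 / 2) ^ K.An := by simp
    _ ≤ 2 ^ K.An * (1 / 2) ^ K.An := by
        have : (n : ℝ) ≤ 2 ^ K.An := by exact_mod_cast K.card_jobs
        gcongr
    _ = 1 := by rw [← mul_pow]; norm_num

/-- Expected cost of the rounded placement. -/
theorem bernE_agg_place_le (hU : K.TokOK w U) {fb : Fin n → Σ ℓ, σ ℓ} (hfb : ∀ j, w j (fb j) ≤ 1) :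
    bernE K.prb (fun ω => K.agg (K.cload w fun j => K.place ω (U j) (fb j)))
      ≤ 3 * 10 ^ 12 * (((K.a : ℝ) + 1) ^ 2 * (K.Am + 1) ^ 2 * (K.An + 1)) := by
  refine (bernE_mono K.prb_mem fun ω => K.agg_place_le hU hfb ω).trans ?_
  rw [bernE_add]
  have h1 := K.bernE_out_le hU
  have h2 := K.bernE_fallback_le hU
  have h3 : ∀ k : ℕ, (1 : ℝ) ≤ (k : ℝ) + 1 := fun k => by
    have : (0 : ℝ) ≤ k := Nat.cast_nonneg _
    linarith
  have h4 : (1 : ℝ) ≤ ((K.a : ℝ) + 1) ^ 2 * (K.Am + 1) ^ 2 * (K.An + 1) := by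
    have := one_le_mul_of_one_le_of_one_le (one_le_mul_of_one_le_of_one_le
      (one_le_pow₀ (h3 K.a) (n := 2)) (one_le_pow₀ (h3 K.Am) (n := 2))) (h3 K.An)
    exact this
  linarith

end Core

/-! ### Unknown optimum: phases by its binary scale -/

theorem sum_two_zpow_le (s : Finset ℤ) {X : ℝ} (hX : 0 ≤ X) (h : ∀ k ∈ s, (2 : ℝ) ^ (k - 1) ≤ X) :
    ∑ k ∈ s, (2 : ℝ) ^ k ≤ 4 * X := by
  rcases s.eq_empty_or_nonempty with rfl | hs
  · simpa using hX
  set M := s.max' hs with hM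
  have hle : ∀ k ∈ s, k ≤ M := fun k hk => Finset.le_max' s k hk
  have hinj : Set.InjOn (fun k : ℤ => (M - k).toNat) s := by
    intro k hk k' hk' heq
    have h1 := hle k hk
    have h2 := hle k' hk'
    simp only at heq
    omega
  have h1 : ∀ k ∈ s, (2 : ℝ) ^ k = 2 ^ M * (1 / 2) ^ (M - k).toNat := by
    intro k hk
    have h2 : ((M - k).toNat : ℤ) = M - k := Int.toNat_of_nonneg (by linarith [hle k hk])
    rw [one_div, inv_pow, ← zpow_natCast, h2, ← zpow_neg, ← zpow_add₀ (by norm_num)]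
    congr 1; ring
  have h3 : ∑ k ∈ s, (1 / 2 : ℝ) ^ (M - k).toNat ≤ 2 := by
    rw [← Finset.sum_image (f := fun j : ℕ => (1 / 2 : ℝ) ^ j) hinj]
    set T := s.image fun k : ℤ => (M - k).toNat with hT
    refine le_trans (Finset.sum_le_sum_of_subset_of_nonneg (t := Finset.Ico 0 (T.sup id + 1))
      (fun j hj => ?_) fun _ _ _ => by positivity) ((sum_half_pow_Ico_le 0 _).trans (by norm_num))
    have := Finset.le_sup (f := id) hj
    simp only [id] at this
    exact Finset.mem_Ico.mpr ⟨Nat.zero_le _, by omega⟩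
  rw [Finset.sum_congr rfl h1, ← Finset.mul_sum]
  have h4 := h M (Finset.max'_mem s hs)
  have h5 : (2 : ℝ) ^ M = 2 * 2 ^ (M - 1) := by
    rw [zpow_sub_one₀ (by norm_num)]; ring
  have h6 : (0 : ℝ) < 2 ^ M := by positivity
  nlinarith

namespace Core

variable {ι : Type} [Fintype ι] [DecidableEq ι] {σ : ι → Type} [∀ ℓ, Fintype (σ ℓ)]
  [∀ ℓ, DecidableEq (σ ℓ)] {n : ℕ} (K : Core ι σ n)

theorem agg_mono {x y : (Σ ℓ, σ ℓ) → ℝ} (h0 : ∀ i, 0 ≤ x i) (h : ∀ i, x i ≤ y i) :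
    K.agg x ≤ K.agg y :=
  K.hout.mono' (fun _ => apply_nonneg _ _) fun ℓ => (K.hinn ℓ).mono' (fun _ => h0 _) fun _ => h _

theorem agg_nonneg (x : (Σ ℓ, σ ℓ) → ℝ) : 0 ≤ K.agg x := apply_nonneg _ _

theorem agg_sum_mul_le {κ : Type*} (s : Finset κ) (c : κ → ℝ) (hc : ∀ k, 0 ≤ c k)
    (x : κ → (Σ ℓ, σ ℓ) → ℝ) : K.agg (fun i => ∑ k ∈ s, c k * x k i) ≤ ∑ k ∈ s, c k * K.agg (x k) := by
  unfold agg
  have h1 : ∀ ℓ, K.inn ℓ (fun i => ∑ k ∈ s, c k * x k ⟨ℓ, i⟩)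
      ≤ ∑ k ∈ s, c k * K.inn ℓ fun i => x k ⟨ℓ, i⟩ := by
    intro ℓ
    refine (seminorm_sum_le (K.inn ℓ) s fun k i => c k * x k ⟨ℓ, i⟩).trans (le_of_eq ?_)
    exact Finset.sum_congr rfl fun k _ => seminorm_mul _ (hc k) _
  refine (K.hout.mono' (fun _ => apply_nonneg _ _) h1).trans ?_
  refine (seminorm_sum_le K.out s fun k ℓ => c k * K.inn ℓ fun i => x k ⟨ℓ, i⟩).trans (le_of_eq ?_)
  exact Finset.sum_congr rfl fun k _ => seminorm_mul _ (hc k) _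

theorem toReal_le_agg (w : Fin n → (Σ ℓ, σ ℓ) → ℝ≥0∞) (y : Fin n → Σ ℓ, σ ℓ) (j : Fin n) :
    (w j (y j)).toReal ≤ K.agg (K.cload w y) := by
  have h1 : (w j (y j)).toReal ≤ K.cload w y (y j) := by
    have := (K.hmach (y j)).le_of_apply_le
      (y := fun j' => if y j' = y j then (w j' (y j)).toReal else 0)
      (fun j' => by split_ifs <;> simp) j
    simp only [if_true] at this
    exact this
  have h2 : K.cload w y (y j) ≤ K.inn (y j).1 fun i => K.cload w y ⟨(y j).1, i⟩ :=
    (K.hinn (y j).1).le_of_apply_le (y := fun i => K.cload w y ⟨(y j).1, i⟩)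
      (fun i => apply_nonneg _ _) (y j).2
  exact h1.trans (h2.trans (K.hout.le_of_apply_le (y := fun ℓ => K.inn ℓ fun i => K.cload w y ⟨ℓ, i⟩)
    (fun ℓ => apply_nonneg _ _) (y j).1))

open Classical in
/-- Cost of a placement. -/
noncomputable def ccost (w : Fin n → (Σ ℓ, σ ℓ) → ℝ≥0∞) (y : Fin n → Σ ℓ, σ ℓ) : ℝ≥0∞ :=
  if ∀ j, w j (y j) ≠ ∞ then ENNReal.ofReal (K.agg (K.cload w y)) else ∞

/-- Optimal cost. -/
noncomputable def copt (w : Fin n → (Σ ℓ, σ ℓ) → ℝ≥0∞) : ℝ≥0∞ := ⨅ y, K.ccost w y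

theorem cload_le_mul {w w' : Fin n → (Σ ℓ, σ ℓ) → ℝ≥0∞} {y : Fin n → Σ ℓ, σ ℓ} {c : ℝ} (hc : 0 ≤ c)
    (h : ∀ j, (w j (y j)).toReal ≤ c * (w' j (y j)).toReal) (i : Σ ℓ, σ ℓ) :
    K.cload w y i ≤ c * K.cload w' y i := by
  unfold cload
  rw [← seminorm_mul _ hc]
  refine (K.hmach i).mono' (fun j => by split_ifs <;> simp) fun j => ?_
  split_ifs with hj
  · subst hj; exact h j
  · simp

theorem agg_cload_le_mul {w w' : Fin n → (Σ ℓ, σ ℓ) → ℝ≥0∞} {y : Fin n → Σ ℓ, σ ℓ} {c : ℝ}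
    (hc : 0 ≤ c) (h : ∀ j, (w j (y j)).toReal ≤ c * (w' j (y j)).toReal) :
    K.agg (K.cload w y) ≤ c * K.agg (K.cload w' y) := by
  refine (K.agg_mono (fun i => apply_nonneg _ _) (K.cload_le_mul hc h)).trans ?_
  simpa using K.agg_sum_mul_le (Finset.univ : Finset Unit) (fun _ => c) (fun _ => hc)
    fun _ => K.cload w' y

theorem copt_mono {w w' : Fin n → (Σ ℓ, σ ℓ) → ℝ≥0∞} (h : ∀ j i, w j i ≤ w' j i) :
    K.copt w ≤ K.copt w' := by
  refine iInf_mono fun y => ?_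
  unfold ccost
  split_ifs with h1 h2 h2
  · refine ENNReal.ofReal_le_ofReal ?_
    have := K.agg_cload_le_mul (w := w) (w' := w') (y := y) zero_le_one fun j => by
      rw [one_mul]; exact ENNReal.toReal_mono (h2 j) (h j _)
    rwa [one_mul] at this
  · exact le_top
  · exact absurd (fun j => ne_top_of_le_ne_top (h2 j) (h j _)) h1
  · exact le_rfl

/-- The instance with the jobs after `t` made trivial. -/
def mask (w : Fin n → (Σ ℓ, σ ℓ) → ℝ≥0∞) (t : Fin n) : Fin n → (Σ ℓ, σ ℓ) → ℝ≥0∞ :=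
  fun j i => if j ≤ t then w j i else 0

/-- Optimal cost of the jobs up to `t`. -/
noncomputable def optTo (w : Fin n → (Σ ℓ, σ ℓ) → ℝ≥0∞) (t : Fin n) : ℝ≥0∞ := K.copt (mask w t)

theorem optTo_le (w : Fin n → (Σ ℓ, σ ℓ) → ℝ≥0∞) (t : Fin n) : K.optTo w t ≤ K.copt w :=
  K.copt_mono fun j i => by unfold mask; split_ifs <;> simp

/-- Binary scale of the optimal cost of the jobs up to `t`. -/
noncomputable def phase (w : Fin n → (Σ ℓ, σ ℓ) → ℝ≥0∞) (t : Fin n) : ℤ :=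
  Int.clog 2 (K.optTo w t).toReal

open Classical in
/-- The jobs of a phase, scaled to make the optimal cost at most one. -/
noncomputable def phaseInst (w : Fin n → (Σ ℓ, σ ℓ) → ℝ≥0∞) (k : ℤ) :
    Fin n → (Σ ℓ, σ ℓ) → ℝ≥0∞ :=
  fun j i => if K.optTo w j ≠ 0 ∧ K.phase w j = k then w j i * ENNReal.ofReal (2 ^ (-k)) else 0

section

variable [Nonempty ι] [∀ ℓ, Nonempty (σ ℓ)]

instance nonempty_machines : Nonempty (Σ ℓ, σ ℓ) :=
  ⟨⟨Classical.arbitrary ι, Classical.arbitrary _⟩⟩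

theorem exists_copt_eq (w : Fin n → (Σ ℓ, σ ℓ) → ℝ≥0∞) : ∃ y, K.ccost w y = K.copt w :=
  exists_eq_ciInf_of_finite

theorem exists_of_copt_ne_top {w : Fin n → (Σ ℓ, σ ℓ) → ℝ≥0∞} (h : K.copt w ≠ ∞) :
    ∃ y, (∀ j, w j (y j) ≠ ∞) ∧ K.agg (K.cload w y) = (K.copt w).toReal := by
  obtain ⟨y, hy⟩ := K.exists_copt_eq w
  have hf : ∀ j, w j (y j) ≠ ∞ := by
    by_contra hc
    unfold ccost at hy
    rw [if_neg hc] at hy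
    exact h hy.symm
  refine ⟨y, hf, ?_⟩
  rw [← hy]
  unfold ccost
  rw [if_pos hf, ENNReal.toReal_ofReal (K.agg_nonneg _)]

/-- A machine on which a job is smallest. -/
noncomputable def cheapest (v : (Σ ℓ, σ ℓ) → ℝ≥0∞) : Σ ℓ, σ ℓ := (Finite.exists_min v).choose

theorem cheapest_le (v : (Σ ℓ, σ ℓ) → ℝ≥0∞) (i : Σ ℓ, σ ℓ) : v (cheapest v) ≤ v i :=
  (Finite.exists_min v).choose_spec i

variable [NeZero n]

/-- The placement in a phase. -/
noncomputable def phasePlace (ω : K.Bit → Bool) (w : Fin n → (Σ ℓ, σ ℓ) → ℝ≥0∞) (k : ℤ)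
    (t : Fin n) : Σ ℓ, σ ℓ :=
  K.place ω (K.toks (K.phaseInst w k) t) (cheapest (w t))

open Classical in
/-- The online placement rule. -/
noncomputable def sched (ω : K.Bit → Bool) (w : Fin n → (Σ ℓ, σ ℓ) → ℝ≥0∞) (t : Fin n) : Σ ℓ, σ ℓ :=
  if K.optTo w t = 0 then cheapest (w t) else K.phasePlace ω w (K.phase w t) t

theorem optTo_congr {w w' : Fin n → (Σ ℓ, σ ℓ) → ℝ≥0∞} {t : Fin n} (h : ∀ j ≤ t, w j = w' j) :
    K.optTo w t = K.optTo w' t := by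
  unfold optTo
  congr 1
  funext j i
  unfold mask
  split_ifs with hj
  · rw [h j hj]
  · rfl

theorem sched_congr (ω : K.Bit → Bool) {w w' : Fin n → (Σ ℓ, σ ℓ) → ℝ≥0∞} {t : Fin n}
    (h : ∀ j ≤ t, w j = w' j) : K.sched ω w t = K.sched ω w' t := by
  have h1 : ∀ j ≤ t, K.optTo w j = K.optTo w' j := fun j hj =>
    K.optTo_congr fun j' hj' => h j' (hj'.trans hj)
  have h2 : ∀ j ≤ t, K.phase w j = K.phase w' j := fun j hj => by unfold phase; rw [h1 j hj]
  have h3 : ∀ k, K.toks (K.phaseInst w k) t = K.toks (K.phaseInst w' k) t := fun k =>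
    K.toks_congr fun j hj => by
      funext i
      unfold phaseInst
      rw [h1 j hj, h2 j hj, h j hj]
  unfold sched phasePlace
  rw [h1 t le_rfl, h2 t le_rfl, h3, h t le_rfl]

variable {w : Fin n → (Σ ℓ, σ ℓ) → ℝ≥0∞}

open Classical in
/-- The phases of an instance. -/
noncomputable def phases (w : Fin n → (Σ ℓ, σ ℓ) → ℝ≥0∞) : Finset ℤ :=
  (Finset.univ.filter fun j => K.optTo w j ≠ 0).image (K.phase w)

theorem mem_phases {j : Fin n} (h : K.optTo w j ≠ 0) : K.phase w j ∈ K.phases w :=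
  Finset.mem_image.mpr ⟨j, by simpa using h, rfl⟩

/-- All jobs of the phase come no later than its last job `t`, and an optimal schedule of the prefix
up to `t` costs at most `2 ^ k`. -/
theorem exists_phaseInst_agg_le (hw : K.copt w ≠ ∞) {k : ℤ} (hk : k ∈ K.phases w) :
    ∃ y, (∀ j, K.phaseInst w k j (y j) ≠ ∞) ∧ K.agg (K.cload (K.phaseInst w k) y) ≤ 1 := by
  classical
  set P := Finset.univ.filter fun j => K.optTo w j ≠ 0 ∧ K.phase w j = k with hP
  have hne : P.Nonempty := by
    obtain ⟨j, hj, hjk⟩ := Finset.mem_image.mp hk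
    exact ⟨j, by simpa [hP, hjk] using hj⟩
  set t := P.max' hne with ht
  have htP : K.optTo w t ≠ 0 ∧ K.phase w t = k := by
    simpa [hP] using Finset.max'_mem P hne
  obtain ⟨y, hy, hagg⟩ := K.exists_of_copt_ne_top
    (w := mask w t) (ne_top_of_le_ne_top hw (K.optTo_le w t))
  have hle : ∀ j, K.phaseInst w k j (y j) ≤ mask w t j (y j) * ENNReal.ofReal (2 ^ (-k)) := by
    intro j
    unfold phaseInst
    split_ifs with h
    · have : j ≤ t := Finset.le_max' P j (by simpa [hP] using h)
      unfold mask; rw [if_pos this]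
    · exact zero_le
  have hfin : ∀ j, mask w t j (y j) * ENNReal.ofReal (2 ^ (-k)) ≠ ∞ := fun j =>
    ENNReal.mul_ne_top (hy j) ENNReal.ofReal_ne_top
  refine ⟨y, fun j => ne_top_of_le_ne_top (hfin j) (hle j), ?_⟩
  have h2 : (0 : ℝ) < 2 ^ (-k) := by positivity
  refine (K.agg_cload_le_mul (w' := mask w t) h2.le fun j => ?_).trans ?_
  · refine (ENNReal.toReal_mono (hfin j) (hle j)).trans (le_of_eq ?_)
    rw [ENNReal.toReal_mul, ENNReal.toReal_ofReal h2.le, mul_comm]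
  · rw [hagg]
    have h3 : (K.optTo w t).toReal ≤ 2 ^ k := by
      rw [← htP.2]
      exact_mod_cast Int.self_le_zpow_clog (R := ℝ) (b := 2) (by norm_num) (K.optTo w t).toReal
    calc _ ≤ (2 : ℝ) ^ (-k) * 2 ^ k := mul_le_mul_of_nonneg_left h3 h2.le
      _ = 1 := by rw [← zpow_add₀ (by norm_num)]; simp

theorem cheapest_ne_top (hw : K.copt w ≠ ∞) (j : Fin n) : w j (cheapest (w j)) ≠ ∞ := by
  obtain ⟨y, hy, _⟩ := K.exists_of_copt_ne_top hw
  exact ne_top_of_le_ne_top (hy j) (cheapest_le _ _)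

/-- Single loads are bounded by the cost, so a prefix of optimum zero has a load-free machine for
each of its jobs. Such jobs belong to no phase. -/
theorem cheapest_eq_zero (hw : K.copt w ≠ ∞) {j : Fin n} (h : K.optTo w j = 0) :
    w j (cheapest (w j)) = 0 := by
  obtain ⟨y, hy, hagg⟩ := K.exists_of_copt_ne_top
    (w := mask w j) (ne_top_of_le_ne_top hw (K.optTo_le w j))
  have h1 := K.toReal_le_agg (mask w j) y j
  have h2 : (K.copt (mask w j)).toReal = 0 := by
    have : K.copt (mask w j) = 0 := h
    rw [this]; rfl
  rw [hagg, h2] at h1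
  have h3 : mask w j j (y j) = w j (y j) := if_pos le_rfl
  have h4 := hy j
  rw [h3] at h1 h4
  have h5 : w j (y j) = 0 := by
    rcases (ENNReal.toReal_eq_zero_iff _).mp (le_antisymm h1 ENNReal.toReal_nonneg) with h | h
    · exact h
    · exact absurd h h4
  exact le_antisymm (h5 ▸ cheapest_le _ _) (zero_le)

theorem phaseInst_cheapest_le (hw : K.copt w ≠ ∞) {k : ℤ} (hk : k ∈ K.phases w) (j : Fin n) :
    K.phaseInst w k j (cheapest (w j)) ≤ 1 := by
  obtain ⟨y, hy, hagg⟩ := K.exists_phaseInst_agg_le hw hk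
  have h1 : K.phaseInst w k j (cheapest (w j)) ≤ K.phaseInst w k j (y j) := by
    unfold phaseInst
    split_ifs
    · gcongr; exact cheapest_le _ _
    · exact le_rfl
  refine h1.trans ?_
  have h2 := (K.toReal_le_agg (K.phaseInst w k) y j).trans hagg
  rw [← ENNReal.ofReal_toReal (hy j)]
  exact ENNReal.ofReal_le_one.mpr h2

theorem phaseInst_tokOK (hw : K.copt w ≠ ∞) {k : ℤ} (hk : k ∈ K.phases w) :
    K.TokOK (K.phaseInst w k) (K.toks (K.phaseInst w k)) := by
  obtain ⟨y, hy, hagg⟩ := K.exists_phaseInst_agg_le hw hk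
  exact K.toks_ok hy hagg

theorem phaseInst_eq {j : Fin n} (h : K.optTo w j ≠ 0) (i : Σ ℓ, σ ℓ) :
    K.phaseInst w (K.phase w j) j i = w j i * ENNReal.ofReal (2 ^ (-K.phase w j)) := by
  unfold phaseInst
  rw [if_pos ⟨h, rfl⟩]

theorem sched_ne_top (hw : K.copt w ≠ ∞) (ω : K.Bit → Bool) (j : Fin n) :
    w j (K.sched ω w j) ≠ ∞ := by
  unfold sched
  split_ifs with h
  · exact K.cheapest_ne_top hw j
  · unfold phasePlace place
    rcases hc : K.chosen ω (K.toks (K.phaseInst w (K.phase w j)) j) with _ | x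
    · exact K.cheapest_ne_top hw j
    · have h1 := (K.phaseInst_tokOK hw (K.mem_phases h)).allowed j x.1 (K.chosen_some hc).1
      have h2 := ne_top_of_le_ne_top ENNReal.ofReal_ne_top h1
      rw [K.phaseInst_eq h] at h2
      intro h3
      have h4 : w j x.1.1.1 = ∞ := h3
      rw [h4] at h2
      refine h2 (ENNReal.top_mul ?_)
      have : (0 : ℝ) < 2 ^ (-K.phase w j) := by positivity
      exact (ENNReal.ofReal_pos.mpr this).ne'

theorem agg_sched_le (hw : K.copt w ≠ ∞) (ω : K.Bit → Bool) :
    K.agg (K.cload w (K.sched ω w)) ≤ ∑ k ∈ K.phases w, 2 ^ k *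
      K.agg (K.cload (K.phaseInst w k) fun j =>
        K.place ω (K.toks (K.phaseInst w k) j) (cheapest (w j))) := by
  refine le_trans (K.agg_mono (fun i => apply_nonneg _ _) fun i => ?_)
    (K.agg_sum_mul_le (K.phases w) (fun k => (2 : ℝ) ^ k) (fun k => by positivity)
      fun k => K.cload (K.phaseInst w k) fun j =>
        K.place ω (K.toks (K.phaseInst w k) j) (cheapest (w j)))
  unfold cload
  let f : ℤ → Fin n → ℝ := fun k j =>
    if K.place ω (K.toks (K.phaseInst w k) j) (cheapest (w j)) = i then
      (K.phaseInst w k j i).toReal else 0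
  have hf0 : ∀ k j, 0 ≤ f k j := fun k j => by simp only [f]; split_ifs <;> simp
  have hs0 : ∀ j, ∀ k, 0 ≤ (2 : ℝ) ^ k * f k j := fun j k => mul_nonneg (by positivity) (hf0 k j)
  have h1 : ∀ j, (if K.sched ω w j = i then (w j i).toReal else 0)
      ≤ ∑ k ∈ K.phases w, (2 : ℝ) ^ k * f k j := by
    intro j
    have hs := Finset.sum_nonneg fun k (_ : k ∈ K.phases w) => hs0 j k
    split_ifs with hi
    · by_cases h : K.optTo w j = 0
      · have : K.sched ω w j = cheapest (w j) := if_pos h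
        rw [← hi, this, K.cheapest_eq_zero hw h]
        simpa using hs
      · have h2 : K.place ω (K.toks (K.phaseInst w (K.phase w j)) j) (cheapest (w j)) = i := by
          rw [← hi]; exact (if_neg h).symm
        have h3 : (2 : ℝ) ^ K.phase w j * f (K.phase w j) j = (w j i).toReal := by
          simp only [f]
          rw [if_pos h2, K.phaseInst_eq h, ENNReal.toReal_mul,
            ENNReal.toReal_ofReal (by positivity)]
          calc _ = (w j i).toReal * ((2 : ℝ) ^ K.phase w j * 2 ^ (-K.phase w j)) := by ring
            _ = _ := by rw [← zpow_add₀ (by norm_num)]; simp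
        rw [← h3]
        exact Finset.single_le_sum (fun k _ => hs0 j k) (K.mem_phases h)
    · exact hs
  refine ((K.hmach i).mono' (fun j => by split_ifs <;> simp) h1).trans ?_
  refine (seminorm_sum_le (K.mach i) (K.phases w) fun k j => (2 : ℝ) ^ k * f k j).trans (le_of_eq ?_)
  exact Finset.sum_congr rfl fun k _ => seminorm_mul _ (by positivity) _

/-- Expected cost of the online placement. -/
theorem bernE_agg_sched_le (hw : K.copt w ≠ ∞) :
    bernE K.prb (fun ω => K.agg (K.cload w (K.sched ω w))) ≤
      12 * 10 ^ 12 * (((K.a : ℝ) + 1) ^ 2 * (K.Am + 1) ^ 2 * (K.An + 1)) * (K.copt w).toReal := by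
  set c : ℝ := ((K.a : ℝ) + 1) ^ 2 * (K.Am + 1) ^ 2 * (K.An + 1) with hc
  have hc0 : 0 ≤ c := by positivity
  refine (bernE_mono K.prb_mem fun ω => K.agg_sched_le hw ω).trans ?_
  rw [bernE_sum]
  -- A phase `k` occurs only if some prefix has optimum above `2 ^ (k - 1)`. All phases share one
  -- seed; linearity of expectation needs no independence between them.
  have h1 : ∑ k ∈ K.phases w, (2 : ℝ) ^ k ≤ 4 * (K.copt w).toReal := by
    refine sum_two_zpow_le _ ENNReal.toReal_nonneg fun k hk => ?_
    obtain ⟨j, hj, rfl⟩ := Finset.mem_image.mp hk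
    have hj0 : K.optTo w j ≠ 0 := by simpa using hj
    have hjt : K.optTo w j ≠ ∞ := ne_top_of_le_ne_top hw (K.optTo_le w j)
    have h2 := Int.zpow_pred_clog_lt_self (R := ℝ) (b := 2) (by norm_num)
      (ENNReal.toReal_pos hj0 hjt)
    refine le_trans ?_ (ENNReal.toReal_mono hw (K.optTo_le w j))
    exact_mod_cast h2.le
  calc _ ≤ ∑ k ∈ K.phases w, (2 : ℝ) ^ k * (3 * 10 ^ 12 * c) := by
        refine Finset.sum_le_sum fun k hk => ?_
        rw [bernE_const_mul]
        exact mul_le_mul_of_nonneg_left (K.bernE_agg_place_le (K.phaseInst_tokOK hw hk)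
          (K.phaseInst_cheapest_le hw hk)) (by positivity)
    _ = (∑ k ∈ K.phases w, (2 : ℝ) ^ k) * (3 * 10 ^ 12 * c) := by rw [Finset.sum_mul]
    _ ≤ 4 * (K.copt w).toReal * (3 * 10 ^ 12 * c) := by gcongr
    _ = _ := by ring

end

end Core

/-! ### From nested symmetric norms to the normalised problem -/

section

variable {ι η : Type*} [DecidableEq η]

theorem IsSymmetricNorm.unit_eq {N : Seminorm ℝ (η → ℝ)} (hN : IsSymmetricNorm N) (e e' : η) :
    N (Pi.single e 1) = N (Pi.single e' 1) := by
  have h : (Pi.single e 1 : η → ℝ) ∘ Equiv.swap e e' = Pi.single e' 1 := by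
    funext k
    simp only [Function.comp_apply, Pi.single_apply, Equiv.swap_apply_eq_iff, Equiv.swap_apply_left]
  rw [← h, hN.symmetric]

theorem IsSymmetricNorm.unit_pos {N : Seminorm ℝ (η → ℝ)} (hN : IsSymmetricNorm N) (e : η) :
    0 < N (Pi.single e 1) := by
  refine lt_of_le_of_ne (apply_nonneg _ _) fun h => ?_
  have := congrFun (hN.definite _ h.symm) e
  simp at this

/-- The restriction of a norm to some of the coordinates, with unit vectors of norm one. -/
noncomputable def restr (N : Seminorm ℝ (η → ℝ)) (s : ι → η) (e : η) : Seminorm ℝ (ι → ℝ) :=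
  (1 / N (Pi.single e 1)).toNNReal • N.comp (Function.ExtendByZero.linearMap ℝ s)

theorem restr_apply (N : Seminorm ℝ (η → ℝ)) (s : ι → η) (e : η) (x : ι → ℝ) :
    restr N s e x = 1 / N (Pi.single e 1) * N (Function.extend s x 0) := by
  have h : (0 : ℝ) ≤ 1 / N (Pi.single e 1) := div_nonneg zero_le_one (apply_nonneg _ _)
  show ((1 / N (Pi.single e 1)).toNNReal : ℝ) * N (Function.extend s x 0) = _
  rw [Real.coe_toNNReal _ h]

theorem IsSymmetricNorm.symMono_restr [DecidableEq ι] {N : Seminorm ℝ (η → ℝ)}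
    (hN : IsSymmetricNorm N) {s : ι → η} (hs : Function.Injective s) (e : η)
    (hmono : ∀ x y : ι → ℝ, (∀ i, 0 ≤ x i) → (∀ i, x i ≤ y i) →
      N (Function.extend s x 0) ≤ N (Function.extend s y 0)) : SymMono (restr N s e) where
  symm τ x := by
    classical
    rw [restr_apply, restr_apply]
    congr 1
    have hτ : ∀ i, τ.extendDomain (Equiv.ofInjective s hs) (s i) = s (τ i) := fun i =>
      τ.extendDomain_apply_image (Equiv.ofInjective s hs) i
    have h : Function.extend s (x ∘ τ) 0
        = Function.extend s x 0 ∘ τ.extendDomain (Equiv.ofInjective s hs) := by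
      funext k
      by_cases hk : ∃ i, s i = k
      · obtain ⟨i, rfl⟩ := hk
        rw [hs.extend_apply, Function.comp_apply, Function.comp_apply, hτ, hs.extend_apply]
      · rw [Function.extend_apply' _ _ _ hk, Function.comp_apply, Function.extend_apply']
        · rfl
        · rintro ⟨i, hi⟩
          refine hk ⟨τ.symm i, ?_⟩
          apply (τ.extendDomain (Equiv.ofInjective s hs)).injective
          rw [hτ, ← hi, Equiv.apply_symm_apply]
    rw [h, hN.symmetric]
  mono x hx y _ hxy := by
    rw [restr_apply, restr_apply]
    exact mul_le_mul_of_nonneg_left (hmono x y hx hxy) (div_nonneg zero_le_one (apply_nonneg _ _))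
  unit i := by
    have h : Function.extend s (Pi.single i 1) 0 = (Pi.single (s i) 1 : η → ℝ) := by
      funext k
      by_cases hk : ∃ i, s i = k
      · obtain ⟨i', rfl⟩ := hk
        rw [hs.extend_apply]
        simp only [Pi.single_apply, hs.eq_iff]
      · rw [Function.extend_apply' _ _ _ hk, Pi.single_eq_of_ne]
        · rfl
        · rintro rfl; exact hk ⟨i, rfl⟩
    rw [restr_apply, h, hN.unit_eq (s i) e]
    exact one_div_mul_cancel (hN.unit_pos e).ne'

/-- Each row has a single entry, and a swap within each row moves it to column `e`. Hence the load
depends only on the sizes of the jobs, not on the ways chosen. -/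
theorem IsSymmetricNorm.apply_ways {J : Type*} [DecidableEq ι] {N : Seminorm ℝ (J × ι → ℝ)}
    (hN : IsSymmetricNorm N) (e : ι) (κ : J → ι) (a : J → ℝ) :
    N (fun x => if x.2 = κ x.1 then a x.1 else 0)
      = N (Function.extend (fun j => (j, e)) a 0) := by
  have hs : Function.Injective fun j : J => (j, e) := fun j j' h => (Prod.mk.inj h).1
  have h : (fun x : J × ι => if x.2 = κ x.1 then a x.1 else 0)
      = Function.extend (fun j => (j, e)) a 0 ∘
        Equiv.prodShear (Equiv.refl J) fun j => Equiv.swap e (κ j) := by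
    funext ⟨j, k⟩
    simp only [Function.comp_apply, Equiv.prodShear_apply, Equiv.refl_apply]
    by_cases hk : k = κ j
    · rw [if_pos hk, hk, Equiv.swap_apply_right]
      exact (hs.extend_apply a 0 j).symm
    · rw [if_neg hk, Function.extend_apply']
      · rfl
      · rintro ⟨j', hj'⟩
        have h1 : e = Equiv.swap e (κ j) k := (Prod.mk.inj hj').2
        apply hk
        apply (Equiv.swap e (κ j)).injective
        rw [← h1, Equiv.swap_apply_right]
  rw [h, hN.symmetric]

end

/-- The data of the scheduling problem with a nested symmetric norm. -/
structure Nested (m n r L : ℕ) where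
  S : Fin L → Finset (Fin m)
  outer : Seminorm ℝ (Fin L → ℝ)
  inner : (ℓ : Fin L) → Seminorm ℝ (S ℓ → ℝ)
  N : Fin m → Seminorm ℝ (Fin n × Fin r → ℝ)
  disj : Pairwise fun ℓ ℓ' => Disjoint (S ℓ) (S ℓ')
  houter : IsSymmetricNorm outer
  hinner : ∀ ℓ, IsSymmetricNorm (inner ℓ)
  hmono : MonotoneOn (nestedNorm S outer inner) (Set.Ici 0)
  hN : ∀ i, IsSymmetricNorm (N i)
  hNmono : ∀ i, MonotoneOn (N i) (Set.Ici 0)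

namespace Nested

variable {m n r L : ℕ} (D : Nested m n r L)

/-- The nonempty groups. -/
abbrev Idx : Type := {ℓ : Fin L // (D.S ℓ).Nonempty}

/-- The machines of a group. -/
abbrev Mem (ℓ : D.Idx) : Type := {i : Fin m // i ∈ D.S ℓ.1}

/-- The first machine of a group. -/
noncomputable def fst (ℓ : D.Idx) : D.Mem ℓ := ⟨ℓ.2.choose, ℓ.2.choose_spec⟩

instance (ℓ : D.Idx) : Nonempty (D.Mem ℓ) := ⟨D.fst ℓ⟩

/-- The aggregation function. -/
noncomputable def f : (Fin m → ℝ) → ℝ := nestedNorm D.S D.outer D.inner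

theorem eq_of_mem {ℓ ℓ' : Fin L} {i : Fin m} (h : i ∈ D.S ℓ) (h' : i ∈ D.S ℓ') : ℓ = ℓ' := by
  by_contra hne
  exact Finset.disjoint_left.mp (D.disj hne) h h'

theorem machine_inj {a b : Σ ℓ, D.Mem ℓ} (h : (a.2 : Fin m) = b.2) : a = b := by
  obtain ⟨ℓ, i⟩ := a
  obtain ⟨ℓ', i'⟩ := b
  obtain rfl : ℓ = ℓ' := Subtype.ext (D.eq_of_mem i.2 (by rw [show (i : Fin m) = i' from h]; exact i'.2))
  obtain rfl : i = i' := Subtype.ext h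
  rfl

theorem inner_empty {ℓ : Fin L} (h : ¬ (D.S ℓ).Nonempty) (y : D.S ℓ → ℝ) : D.inner ℓ y = 0 := by
  have : y = 0 := by
    funext i
    exact absurd ⟨i.1, i.2⟩ h
  rw [this, map_zero]

/-- Only the aggregate is assumed monotone. On vectors supported in one group it is the inner norm
times a positive constant. -/
theorem inner_mono (ℓ : D.Idx) (x y : D.Mem ℓ → ℝ) (h0 : ∀ i, 0 ≤ x i) (h : ∀ i, x i ≤ y i) :
    D.inner ℓ.1 x ≤ D.inner ℓ.1 y := by
  classical
  let v : (D.Mem ℓ → ℝ) → Fin m → ℝ := fun x i => if h : i ∈ D.S ℓ.1 then x ⟨i, h⟩ else 0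
  have hv : ∀ x, D.f (v x) = D.inner ℓ.1 x * D.outer (Pi.single ℓ.1 1) := by
    intro x
    have h1 : (fun ℓ' => D.inner ℓ' fun i => v x i) = D.inner ℓ.1 x • Pi.single ℓ.1 (1 : ℝ) := by
      funext ℓ'
      by_cases hℓ : ℓ' = ℓ.1
      · subst hℓ
        have : (fun i : D.S ℓ.1 => v x i) = x := by
          funext i; simp only [v]; rw [dif_pos i.2]
        rw [this]; simp
      · have : (fun i : D.S ℓ' => v x i) = 0 := by
          funext i; simp only [v]
          rw [dif_neg fun hi => hℓ (D.eq_of_mem i.2 hi)]; rfl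
        rw [this, map_zero]; simp [hℓ]
    unfold f nestedNorm
    rw [h1, map_smul_eq_mul, Real.norm_of_nonneg (apply_nonneg _ _)]
  have h2 : D.f (v x) ≤ D.f (v y) := by
    refine D.hmono (fun i => ?_) (fun i => ?_) fun i => ?_
    · simp only [v]; split_ifs
      · exact h0 _
      · exact le_rfl
    · simp only [v]; split_ifs
      · exact (h0 _).trans (h _)
      · exact le_rfl
    · simp only [v]; split_ifs
      · exact h _
      · exact le_rfl
  rw [hv, hv] at h2
  exact le_of_mul_le_mul_right h2 (D.houter.unit_pos _)

/-- Placing a suitable load on one machine of each group realises every nonnegative vector indexed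
by the nonempty groups. Coordinates of empty groups cannot be reached, which is why `Idx` omits
them. -/
theorem outer_mono (x y : D.Idx → ℝ) (h0 : ∀ ℓ, 0 ≤ x ℓ) (h : ∀ ℓ, x ℓ ≤ y ℓ) :
    D.outer (Function.extend Subtype.val x 0) ≤ D.outer (Function.extend Subtype.val y 0) := by
  classical
  let u : D.Idx → ℝ := fun ℓ => D.inner ℓ.1 (Pi.single (D.fst ℓ) 1)
  have hu : ∀ ℓ, 0 < u ℓ := fun ℓ => (D.hinner ℓ.1).unit_pos _
  let v : (D.Idx → ℝ) → Fin m → ℝ := fun x i => ∑ ℓ, if i = D.fst ℓ then x ℓ / u ℓ else 0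
  have hv : ∀ x, (∀ ℓ, 0 ≤ x ℓ) → D.f (v x) = D.outer (Function.extend Subtype.val x 0) := by
    intro x hx
    unfold f nestedNorm
    congr 1
    funext ℓ
    by_cases hℓ : (D.S ℓ).Nonempty
    · have h1 : Function.extend Subtype.val x 0 ℓ = x ⟨ℓ, hℓ⟩ :=
        Subtype.val_injective.extend_apply x 0 (⟨ℓ, hℓ⟩ : D.Idx)
      have h2 : (fun i : D.S ℓ => v x i) = (x ⟨ℓ, hℓ⟩ / u ⟨ℓ, hℓ⟩) • Pi.single (D.fst ⟨ℓ, hℓ⟩) 1 := by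
        funext i
        simp only [v]
        rw [Finset.sum_eq_single (⟨ℓ, hℓ⟩ : D.Idx)]
        · simp only [Pi.smul_apply, Pi.single_apply, smul_eq_mul, mul_ite, mul_one, mul_zero]
          exact if_congr (by rw [Subtype.ext_iff]) rfl rfl
        · intro ℓ' _ hne
          refine if_neg fun hi => hne (Subtype.ext ?_)
          exact D.eq_of_mem (i := i) (by rw [hi]; exact (D.fst ℓ').2) i.2
        · exact fun h => absurd (Finset.mem_univ _) h
      rw [h1, h2, map_smul_eq_mul, Real.norm_of_nonneg (div_nonneg (hx _) (hu _).le)]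
      exact div_mul_cancel₀ _ (hu ⟨ℓ, hℓ⟩).ne'
    · rw [D.inner_empty hℓ, Function.extend_apply']
      · rfl
      · rintro ⟨ℓ', rfl⟩; exact hℓ ℓ'.2
  have hx0 : ∀ x : D.Idx → ℝ, (∀ ℓ, 0 ≤ x ℓ) → ∀ i, 0 ≤ v x i := fun x hx i =>
    Finset.sum_nonneg fun ℓ _ => by
      split_ifs
      · exact div_nonneg (hx ℓ) (hu ℓ).le
      · exact le_rfl
  have hy : ∀ ℓ, 0 ≤ y ℓ := fun ℓ => (h0 ℓ).trans (h ℓ)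
  rw [← hv x h0, ← hv y hy]
  refine D.hmono (hx0 x h0) (hx0 y hy) fun i => Finset.sum_le_sum fun ℓ _ => ?_
  split_ifs
  · exact div_le_div_of_nonneg_right (h ℓ) (hu ℓ).le
  · exact le_rfl

theorem card_idx_le : Fintype.card D.Idx ≤ m := by
  have h := Fintype.card_le_of_injective (fun ℓ : D.Idx => (D.fst ℓ : Fin m)) fun ℓ ℓ' h =>
    congrArg Sigma.fst (D.machine_inj (a := ⟨ℓ, D.fst ℓ⟩) (b := ⟨ℓ', D.fst ℓ'⟩) h)
  simpa using h

theorem card_idx_le' : Fintype.card D.Idx ≤ L := by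
  simpa using Fintype.card_subtype_le fun ℓ : Fin L => (D.S ℓ).Nonempty

theorem card_mem_le (ℓ : D.Idx) : Fintype.card (D.Mem ℓ) ≤ m := by
  simpa using Fintype.card_subtype_le fun i : Fin m => i ∈ D.S ℓ.1

variable [NeZero n] [NeZero r] [NeZero L]

/-- The normalised problem. -/
noncomputable def core : Core D.Idx D.Mem n where
  out := restr D.outer Subtype.val 0
  inn ℓ := restr (D.inner ℓ.1) id (D.fst ℓ)
  mach i := restr (D.N i.2) (fun j => (j, (0 : Fin r))) (0, 0)
  a := Nat.clog 2 (Fintype.card D.Idx)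
  Am := Nat.clog 2 m
  An := Nat.clog 2 n
  hout := D.houter.symMono_restr Subtype.val_injective _ D.outer_mono
  hinn ℓ := (D.hinner ℓ.1).symMono_restr Function.injective_id _ fun x y h0 h => by
    have e : ∀ z : D.Mem ℓ → ℝ, Function.extend id z 0 = z := fun z => by
      funext i; exact Function.injective_id.extend_apply z 0 i
    rw [e, e]; exact D.inner_mono ℓ x y h0 h
  hmach i := (D.hN i.2).symMono_restr (fun j j' h => (Prod.mk.inj h).1) _ fun x y h0 h => by
    have hs : Function.Injective fun j : Fin n => (j, (0 : Fin r)) := fun j j' h => (Prod.mk.inj h).1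
    have h1 : ∀ z : Fin n → ℝ, (∀ j, 0 ≤ z j) → ∀ k,
        0 ≤ Function.extend (fun j : Fin n => (j, (0 : Fin r))) z 0 k := by
      intro z hz k
      by_cases hk : ∃ j, (j, (0 : Fin r)) = k
      · obtain ⟨j, rfl⟩ := hk
        exact (hz j).trans_eq (hs.extend_apply z 0 j).symm
      · rw [Function.extend_apply' _ _ _ hk]; exact le_rfl
    refine D.hNmono i.2 (h1 x h0) (h1 y fun j => (h0 j).trans (h j)) fun k => ?_
    by_cases hk : ∃ j, (j, (0 : Fin r)) = k
    · obtain ⟨j, rfl⟩ := hk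
      refine (hs.extend_apply x 0 j).le.trans ((h j).trans (hs.extend_apply y 0 j).ge)
    · rw [Function.extend_apply' _ _ _ hk, Function.extend_apply' _ _ _ hk]
  card_out := Nat.le_pow_clog (by norm_num) _
  card_inn ℓ := (D.card_mem_le ℓ).trans (Nat.le_pow_clog (by norm_num) _)
  card_jobs := Nat.le_pow_clog (by norm_num) _
  a_le := Nat.clog_mono_right 2 D.card_idx_le

/-- Conversion factor of the loads of a machine. -/
noncomputable def scale (i : Σ ℓ, D.Mem ℓ) : ℝ :=
  D.outer (Pi.single 0 1) * D.inner i.1.1 (Pi.single (D.fst i.1) 1) * D.N i.2 (Pi.single (0, 0) 1)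

theorem scale_pos (i : Σ ℓ, D.Mem ℓ) : 0 < D.scale i :=
  mul_pos (mul_pos (D.houter.unit_pos _) ((D.hinner _).unit_pos _)) ((D.hN _).unit_pos _)

/-- The cost in terms of the normalised problem. -/
theorem f_load (p : Instance m n r) (x : Allocation m n r) : D.f (load D.N p x) =
    D.core.agg fun i => D.core.mach i fun j =>
      D.scale i * if (x j).1 = i.2 then (p j i.2 (x j).2).toReal else 0 := by
  have h1 : ∀ i : Σ ℓ, D.Mem ℓ, (D.core.mach i fun j =>
      D.scale i * if (x j).1 = i.2 then (p j i.2 (x j).2).toReal else 0)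
      = D.outer (Pi.single 0 1) * (D.inner i.1.1 (Pi.single (D.fst i.1) 1) * load D.N p x i.2) := by
    intro i
    rw [seminorm_mul _ (D.scale_pos i).le]
    have h2 : load D.N p x i.2 = D.N i.2 (Function.extend (fun j => (j, (0 : Fin r)))
        (fun j => if (x j).1 = i.2 then (p j i.2 (x j).2).toReal else 0) 0) := by
      rw [← (D.hN i.2).apply_ways 0 (fun j => (x j).2)]
      unfold load
      congr 1
      funext jk
      by_cases h3 : x jk.1 = ((i.2 : Fin m), jk.2)
      · simp [h3]
      · rw [if_neg h3]
        by_cases h4 : jk.2 = (x jk.1).2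
        · rw [if_pos h4, if_neg]
          exact fun h5 => h3 (Prod.ext h5 h4.symm)
        · rw [if_neg h4]
    have h3 : ∀ z, D.core.mach i z = 1 / D.N i.2 (Pi.single (0, 0) 1) *
        D.N i.2 (Function.extend (fun j => (j, (0 : Fin r))) z 0) := fun z => restr_apply _ _ _ _
    rw [h3, h2]
    have h4 := (D.hN i.2).unit_pos (0, 0)
    unfold scale
    field_simp
  simp only [h1]
  have h5 : ∀ ℓ : D.Idx, (D.core.inn ℓ fun i => D.outer (Pi.single 0 1) *
      (D.inner ℓ.1 (Pi.single (D.fst ℓ) 1) * load D.N p x i))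
      = D.outer (Pi.single 0 1) * D.inner ℓ.1 fun i => load D.N p x i := by
    intro ℓ
    have h6 := (D.hinner ℓ.1).unit_pos (D.fst ℓ)
    rw [seminorm_mul _ (D.houter.unit_pos _).le, seminorm_mul _ h6.le]
    have h7 : ∀ z, D.core.inn ℓ z = 1 / D.inner ℓ.1 (Pi.single (D.fst ℓ) 1) *
        D.inner ℓ.1 (Function.extend id z 0) := fun z => restr_apply _ _ _ _
    have h8 : ∀ z : D.Mem ℓ → ℝ, Function.extend id z 0 = z := fun z => by
      funext i; exact Function.injective_id.extend_apply z 0 i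
    rw [h7, h8]
    field_simp
  unfold Core.agg
  simp only [h5]
  have h9 := D.houter.unit_pos 0
  have h10 : ∀ z, D.core.out z = 1 / D.outer (Pi.single 0 1) *
      D.outer (Function.extend Subtype.val z 0) := fun z => restr_apply _ _ _ _
  rw [seminorm_mul _ h9.le, h10, ← mul_assoc, mul_one_div_cancel h9.ne', one_mul]
  unfold f nestedNorm
  congr 1
  funext ℓ
  by_cases hℓ : (D.S ℓ).Nonempty
  · exact (Subtype.val_injective.extend_apply
      (fun ℓ : D.Idx => D.inner ℓ.1 fun i => load D.N p x i) 0 (⟨ℓ, hℓ⟩ : D.Idx)).symm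
  · rw [D.inner_empty hℓ, Function.extend_apply']
    · rfl
    · rintro ⟨ℓ', rfl⟩; exact hℓ ℓ'.2

end Nested

/-! ### The online algorithm and its competitive ratio -/

theorem clog_add_one_le {x : ℕ} (hx : 1 ≤ x) : (Nat.clog 2 x : ℝ) + 1 ≤ 2 * (1 + Real.log x) := by
  rcases hx.eq_or_lt with rfl | h
  · simp
  · have h1 := Nat.pow_pred_clog_lt_self (b := 2) (by norm_num) h
    have h2 : 0 < Nat.clog 2 x := Nat.clog_pos (by norm_num) h
    have h3 : ((2 : ℝ) ^ (Nat.clog 2 x).pred) ≤ x := by exact_mod_cast h1.le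
    have h4 := Real.log_le_log (by positivity) h3
    rw [Real.log_pow] at h4
    have h5 : ((Nat.clog 2 x).pred : ℝ) = Nat.clog 2 x - 1 := by
      rw [Nat.pred_eq_sub_one, Nat.cast_sub h2]; simp
    rw [h5] at h4
    have h6 := Real.log_two_gt_d9
    have h7 : (1 : ℝ) ≤ Nat.clog 2 x := by exact_mod_cast h2
    nlinarith

theorem sum_ofReal_bernW {β : Type*} [Fintype β] [DecidableEq β] {p : β → ℝ}
    (hp : ∀ i, 0 ≤ p i ∧ p i ≤ 1) : ∑ ω, ENNReal.ofReal (bernW p ω) = 1 := by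
  rw [← ENNReal.ofReal_sum_of_nonneg fun ω _ => bernW_nonneg hp ω]
  have := bernE_const p 1
  simp only [bernE, mul_one] at this
  rw [this, ENNReal.ofReal_one]

namespace Nested

variable {m n r L : ℕ} (D : Nested m n r L) [NeZero n] [NeZero r] [NeZero L]

/-- A way of smallest load. -/
noncomputable def way (v : Fin r → ℝ≥0∞) : Fin r := (Finite.exists_min v).choose

theorem way_le (v : Fin r → ℝ≥0∞) (k : Fin r) : v (way v) ≤ v k :=
  (Finite.exists_min v).choose_spec k

/-- A job that can be placed outside all groups. -/
def Free (v : Job m r) : Prop := ∃ i, (∀ ℓ, i ∉ D.S ℓ) ∧ v i (way (v i)) ≠ ∞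

open Classical in
/-- The normalised loads. -/
noncomputable def weights (p : Instance m n r) (j : Fin n) (i : Σ ℓ, D.Mem ℓ) : ℝ≥0∞ :=
  if D.Free (p j) then 0 else p j i.2 (way (p j i.2)) * ENNReal.ofReal (D.scale i)

open Classical in
/-- The placement of a job given its machine in the normalised problem. -/
noncomputable def lift (v : Job m r) (i : Σ ℓ, D.Mem ℓ) : Fin m × Fin r :=
  if h : D.Free v then (h.choose, way (v h.choose)) else (i.2, way (v i.2))

theorem ofReal_scale_ne_zero (i : Σ ℓ, D.Mem ℓ) : ENNReal.ofReal (D.scale i) ≠ 0 :=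
  (ENNReal.ofReal_pos.mpr (D.scale_pos i)).ne'

/-- Free jobs go to machines outside all groups, where `f` does not see them; their zero weight in
the normalised problem is thus correct. -/
theorem cost_lift_le {p : Instance m n r} {y : Fin n → Σ ℓ, D.Mem ℓ}
    (hy : ∀ j, D.weights p j (y j) ≠ ∞) :
    cost D.f D.N p (fun j => D.lift (p j) (y j))
      ≤ ENNReal.ofReal (D.core.agg (D.core.cload (D.weights p) y)) := by
  have hfin : ∀ j, p j (D.lift (p j) (y j)).1 (D.lift (p j) (y j)).2 ≠ ∞ := by
    intro j
    unfold lift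
    split_ifs with h
    · exact h.choose_spec.2
    · have h1 := hy j
      unfold weights at h1
      rw [if_neg h] at h1
      intro h2
      exact h1 (by rw [show p j (y j).2 (way (p j (y j).2)) = ∞ from h2,
        ENNReal.top_mul (D.ofReal_scale_ne_zero _)])
  unfold cost
  rw [if_pos hfin, D.f_load]
  refine ENNReal.ofReal_le_ofReal (D.core.agg_mono (fun i => apply_nonneg _ _) fun i => ?_)
  have hs := (D.scale_pos i).le
  refine (D.core.hmach i).mono' (fun j => mul_nonneg hs (by split_ifs <;> simp)) fun j => ?_
  by_cases h : D.Free (p j)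
  · have h1 : (D.lift (p j) (y j)).1 ≠ i.2 := by
      unfold lift
      rw [dif_pos h]
      intro h2
      exact h.choose_spec.1 i.1 (by rw [show h.choose = (i.2 : Fin m) from h2]; exact i.2.2)
    rw [if_neg h1, mul_zero]
    split_ifs <;> simp
  · have h1 : D.lift (p j) (y j) = (((y j).2 : Fin m), way (p j (y j).2)) := dif_neg h
    rw [h1]
    by_cases h2 : ((y j).2 : Fin m) = i.2
    · obtain rfl := D.machine_inj h2
      rw [if_pos rfl, if_pos rfl]
      unfold weights
      rw [if_neg h, ENNReal.toReal_mul, ENNReal.toReal_ofReal hs, mul_comm]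
    · rw [if_neg h2, mul_zero]
      split_ifs <;> simp

/-- A job that is not free must sit in a group in any feasible allocation. It keeps its machine and
switches to the cheapest way, which only lowers loads. -/
theorem copt_le [Nonempty D.Idx] (p : Instance m n r) :
    D.core.copt (D.weights p) ≤ opt D.f D.N p := by
  classical
  refine le_iInf fun x => ?_
  unfold cost
  split_ifs with hx
  · let y : Fin n → Σ ℓ, D.Mem ℓ := fun j =>
      if h : ∃ a : Σ ℓ, D.Mem ℓ, (a.2 : Fin m) = (x j).1 then h.choose else Classical.arbitrary _
    have hy : ∀ j, ¬ D.Free (p j) → ((y j).2 : Fin m) = (x j).1 := by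
      intro j hj
      have h : ∃ a : Σ ℓ, D.Mem ℓ, (a.2 : Fin m) = (x j).1 := by
        by_contra hc
        refine hj ⟨(x j).1, fun ℓ hℓ => hc ⟨⟨⟨ℓ, ⟨_, hℓ⟩⟩, ⟨_, hℓ⟩⟩, rfl⟩, ?_⟩
        exact ne_top_of_le_ne_top (hx j) (way_le _ _)
      simp only [y]
      rw [dif_pos h]
      exact h.choose_spec
    have hle : ∀ j, ¬ D.Free (p j) → p j (y j).2 (way (p j (y j).2)) ≤ p j (x j).1 (x j).2 := by
      intro j hj
      rw [hy j hj]; exact way_le _ _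
    have hfin : ∀ j, D.weights p j (y j) ≠ ∞ := by
      intro j
      unfold weights
      split_ifs with h
      · exact ENNReal.zero_ne_top
      · exact ENNReal.mul_ne_top (ne_top_of_le_ne_top (hx j) (hle j h)) ENNReal.ofReal_ne_top
    refine (iInf_le _ y).trans ?_
    unfold Core.ccost
    rw [if_pos hfin, D.f_load]
    refine ENNReal.ofReal_le_ofReal (D.core.agg_mono (fun i => apply_nonneg _ _) fun i => ?_)
    have hs := (D.scale_pos i).le
    refine (D.core.hmach i).mono' (fun j => by split_ifs <;> simp) fun j => ?_
    have h0 : 0 ≤ D.scale i * if (x j).1 = i.2 then (p j i.2 (x j).2).toReal else 0 :=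
      mul_nonneg hs (by split_ifs <;> simp)
    by_cases h1 : y j = i
    · obtain rfl := h1
      rw [if_pos rfl]
      by_cases h : D.Free (p j)
      · have h2 : (D.weights p j (y j)).toReal = 0 := by
          unfold weights
          rw [if_pos h, ENNReal.toReal_zero]
        rw [h2]
        exact h0
      · have h2 := hle j h
        rw [if_pos (hy j h).symm]
        unfold weights
        rw [if_neg h, ENNReal.toReal_mul, ENNReal.toReal_ofReal hs, mul_comm]
        refine mul_le_mul_of_nonneg_left ?_ hs
        rw [hy j h] at h2 ⊢
        exact ENNReal.toReal_mono (hx j) h2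
    · rw [if_neg h1]
      exact h0
  · exact le_top

/-- The online algorithm. -/
noncomputable def algorithm [Nonempty D.Idx] : OnlineAlgorithm m n r where
  Seed := D.core.Bit → Bool
  law := PMF.ofFintype (fun ω => ENNReal.ofReal (bernW D.core.prb ω))
    (sum_ofReal_bernW D.core.prb_mem)
  schedule ω p t := D.lift (p t) (D.core.sched ω (D.weights p) t)
  online ω p q t h := by
    have h1 : D.core.sched ω (D.weights p) t = D.core.sched ω (D.weights q) t :=
      D.core.sched_congr ω fun j hj => by
        funext i
        unfold weights
        rw [h j hj]
    rw [h1, h t le_rfl]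

theorem expectedCost_algorithm_le [Nonempty D.Idx] {p : Instance m n r} (hp : opt D.f D.N p ≠ ∞) :
    D.algorithm.expectedCost D.f D.N p ≤ ENNReal.ofReal (12 * 10 ^ 12 *
      (((D.core.a : ℝ) + 1) ^ 2 * (D.core.Am + 1) ^ 2 * (D.core.An + 1))) * opt D.f D.N p := by
  have hc : D.core.copt (D.weights p) ≠ ∞ := ne_top_of_le_ne_top hp (D.copt_le p)
  have h0 : 0 ≤ 12 * 10 ^ 12 * (((D.core.a : ℝ) + 1) ^ 2 * (D.core.Am + 1) ^ 2 * (D.core.An + 1)) := by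
    positivity
  calc D.algorithm.expectedCost D.f D.N p
      = ∑ ω : D.core.Bit → Bool, ENNReal.ofReal (bernW D.core.prb ω) *
        cost D.f D.N p (fun t => D.lift (p t) (D.core.sched ω (D.weights p) t)) :=
        tsum_fintype (β := D.core.Bit → Bool) (L := .unconditional _) _
    _ ≤ ∑ ω : D.core.Bit → Bool, ENNReal.ofReal (bernW D.core.prb ω *
        D.core.agg (D.core.cload (D.weights p) (D.core.sched ω (D.weights p)))) := by
        refine Finset.sum_le_sum fun ω _ => ?_
        rw [ENNReal.ofReal_mul (bernW_nonneg D.core.prb_mem ω)]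
        gcongr
        exact D.cost_lift_le fun j => D.core.sched_ne_top hc ω j
    _ = ENNReal.ofReal (bernE D.core.prb fun ω =>
        D.core.agg (D.core.cload (D.weights p) (D.core.sched ω (D.weights p)))) :=
        (ENNReal.ofReal_sum_of_nonneg fun ω _ => mul_nonneg (bernW_nonneg D.core.prb_mem ω)
          (D.core.agg_nonneg _)).symm
    _ ≤ ENNReal.ofReal (12 * 10 ^ 12 *
        (((D.core.a : ℝ) + 1) ^ 2 * (D.core.Am + 1) ^ 2 * (D.core.An + 1)) *
        (D.core.copt (D.weights p)).toReal) :=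
        ENNReal.ofReal_le_ofReal (D.core.bernE_agg_sched_le hc)
    _ ≤ _ := by
        rw [ENNReal.ofReal_mul h0, ENNReal.ofReal_toReal hc]
        gcongr
        exact D.copt_le p

/-- The algorithm that places every job on its cheapest machine. -/
noncomputable def greedy [NeZero m] : OnlineAlgorithm m n r where
  Seed := Unit
  law := PMF.pure ()
  schedule _ p t := (Finite.exists_min fun x : Fin m × Fin r => p t x.1 x.2).choose
  online _ p q t h := by simp only [h t le_rfl]

/-- Without nonempty groups `f` vanishes and only feasibility matters, which a cheapest choice for
each job ensures. -/
theorem expectedCost_greedy_eq_zero [NeZero m] (hD : IsEmpty D.Idx) {p : Instance m n r}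
    (hp : opt D.f D.N p ≠ ∞) : (greedy : OnlineAlgorithm m n r).expectedCost D.f D.N p = 0 := by
  have h1 : ∀ z, D.f z = 0 := by
    intro z
    have h2 : (fun ℓ => D.inner ℓ fun i => z i) = 0 := by
      funext ℓ
      exact D.inner_empty (fun h => hD.elim ⟨ℓ, h⟩) _
    unfold f nestedNorm
    rw [h2, map_zero]
  obtain ⟨x, hx⟩ : ∃ x, cost D.f D.N p x ≠ ∞ := by
    by_contra hc
    push Not at hc
    exact hp (by unfold opt; simp [hc])
  have hx' : ∀ j, p j (x j).1 (x j).2 ≠ ∞ := by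
    by_contra hc
    unfold cost at hx
    rw [if_neg hc] at hx
    exact hx rfl
  unfold OnlineAlgorithm.expectedCost
  refine ENNReal.tsum_eq_zero.mpr fun ω => ?_
  have h3 : ∀ j, p j ((greedy : OnlineAlgorithm m n r).schedule ω p j).1
      ((greedy : OnlineAlgorithm m n r).schedule ω p j).2 ≠ ∞ := fun j =>
    ne_top_of_le_ne_top (hx' j)
      ((Finite.exists_min fun x : Fin m × Fin r => p j x.1 x.2).choose_spec (x j))
  unfold cost
  rw [if_pos h3, h1, ENNReal.ofReal_zero, mul_zero]

theorem one_le_factor (x : ℕ) : 1 ≤ 1 + Real.log x := by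
  linarith [Real.log_natCast_nonneg x]

theorem exists_competitive [NeZero m] : ∃ A : OnlineAlgorithm m n r, A.IsCompetitive D.f D.N
    (4 * 10 ^ 14 * (1 + Real.log m) ^ 2 * (1 + Real.log L) ^ 2 * (1 + Real.log n)) := by
  have hm := one_le_factor m
  have hL := one_le_factor L
  have hn := one_le_factor n
  set c := 4 * 10 ^ 14 * (1 + Real.log m) ^ 2 * (1 + Real.log L) ^ 2 * (1 + Real.log n) with hc
  have hc0 : 0 < c := by positivity
  have htop : ENNReal.ofReal c * ∞ = ∞ := ENNReal.mul_top (ENNReal.ofReal_pos.mpr hc0).ne'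
  rcases isEmpty_or_nonempty D.Idx with hD | hD
  · refine ⟨greedy, fun p => ?_⟩
    by_cases hp : opt D.f D.N p = ∞
    · rw [hp, htop]; exact le_top
    · rw [D.expectedCost_greedy_eq_zero hD hp]; exact zero_le
  · refine ⟨D.algorithm, fun p => ?_⟩
    by_cases hp : opt D.f D.N p = ∞
    · rw [hp, htop]; exact le_top
    · refine (D.expectedCost_algorithm_le hp).trans ?_
      gcongr
      have h1 : (D.core.Am : ℝ) + 1 ≤ 2 * (1 + Real.log m) :=
        clog_add_one_le (Nat.one_le_iff_ne_zero.mpr (NeZero.ne m))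
      have h2 : (D.core.An : ℝ) + 1 ≤ 2 * (1 + Real.log n) :=
        clog_add_one_le (Nat.one_le_iff_ne_zero.mpr (NeZero.ne n))
      have h3 : (D.core.a : ℝ) + 1 ≤ 2 * (1 + Real.log L) := by
        refine le_trans ?_ (clog_add_one_le (Nat.one_le_iff_ne_zero.mpr (NeZero.ne L)))
        have : D.core.a ≤ Nat.clog 2 L := Nat.clog_mono_right 2 D.card_idx_le'
        gcongr
      -- The change from rounded binary to natural logarithms costs a factor `2` five times, so the
      -- constant is `32 * 12 * 10 ^ 12 = 384 * 10 ^ 12`.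
      calc _ ≤ 12 * 10 ^ 12 * ((2 * (1 + Real.log L)) ^ 2 * (2 * (1 + Real.log m)) ^ 2 *
            (2 * (1 + Real.log n))) := by gcongr
        _ = 384 * 10 ^ 12 * ((1 + Real.log m) ^ 2 * (1 + Real.log L) ^ 2 * (1 + Real.log n)) := by
            ring
        _ ≤ 4 * 10 ^ 14 * ((1 + Real.log m) ^ 2 * (1 + Real.log L) ^ 2 * (1 + Real.log n)) := by
            gcongr ?_ * _
            norm_num
        _ = c := by rw [hc]; ring

end Nested

end GenSched

theorem theorem5 :
    ∃ C : ℝ, 0 < C ∧ ∀ (m n r L : ℕ), 1 ≤ m → 1 ≤ n → 1 ≤ r → 1 ≤ L →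
      ∀ (S : Fin L → Finset (Fin m)) (outer : Seminorm ℝ (Fin L → ℝ))
        (inner : (ℓ : Fin L) → Seminorm ℝ (S ℓ → ℝ))
        (N : Fin m → Seminorm ℝ (Fin n × Fin r → ℝ)),
        Pairwise (fun ℓ ℓ' => Disjoint (S ℓ) (S ℓ')) →
        GenSched.IsSymmetricNorm outer →
        (∀ ℓ, GenSched.IsSymmetricNorm (inner ℓ)) →
        MonotoneOn (GenSched.nestedNorm S outer inner) (Set.Ici 0) →
        (∀ i, GenSched.IsSymmetricNorm (N i)) →
        (∀ i, MonotoneOn (N i) (Set.Ici 0)) →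
        ∃ A : GenSched.OnlineAlgorithm m n r,
          A.IsCompetitive (GenSched.nestedNorm S outer inner) N
            (C * (1 + Real.log m) ^ 2 * (1 + Real.log L) ^ 2 * (1 + Real.log n)) := by
  refine ⟨4 * 10 ^ 14, by norm_num, ?_⟩
  intro m n r L hm hn hr hL S outer inner N hS hout hinn hmono hN hNmono
  have : NeZero m := ⟨by omega⟩
  have : NeZero n := ⟨by omega⟩
  have : NeZero r := ⟨by omega⟩
  have : NeZero L := ⟨by omega⟩
  exact (GenSched.Nested.mk S outer inner N hS hout hinn hmono hN hNmono).exists_competitive
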